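/- Let $X$ be a complex manifold of dimension $3$ (Hausdorff, second countable) with a nowhere vanishing holomorphic volume form $\Omega_X$. Let $\mathrm{PV}^{i,j}(X)=\Omega^{0,j}(X,\wedge^iT_X)$ with parity $i+j$, let $\partial:\mathrm{PV}^{i,\bullet}\to\mathrm{PV}^{i-1,\bullet}$ be the divergence operator of $\Omega_X$ (the holomorphic de Rham differential transported along $(-)\vee\Omega_X$), and let $\mathrm{Tr}\,a=\int_X(a\vee\Omega_X)\wedge\Omega_X$. Let $[a,b]_{SN}=(-1)^{|a|-1}\bigl(\partial(ab)-(\partial a)b-(-1)^{|a|}a\,\partial b\bigr)$, and let $\omega$ be the canonical symplectic form on $\mathbb C^2$. The $\mathbb Z/2$-graded theory $\widetilde{\mathcal E}=\widetilde{\mathcal E}^{\mathbb Z/2}_{\mathrm{mBCOV}}(X)$ has fields $\phi\in\mathrm{PV}^{0,\bullet}(X)\otimes\mathbb C^2$, $\mu\in\mathrm{PV}^{1,\bullet}(X)$, $t\nu\in t\,\mathrm{PV}^{0,\bullet}(X)$, which we take with compact support, and the differential $Q=\bar\partial+t\partial$, i.e. $Q(\phi,\mu,\nu)=(\bar\partial\phi,\bar\partial\mu,\bar\partial\nu+\partial\mu)$;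 its action functional is $$\widetilde I(\phi,\mu,t\nu)=\sum_{k\ge0}\mathrm{Tr}\Bigl(\tfrac12\,\omega(\phi,[\mu,\phi]_{SN})\,\nu^k\vee\Omega_X^{-1}+\tfrac16\,\mu\mu\mu\,\nu^k\Bigr).$$ Let $\mathcal O(\widetilde{\mathcal E})$ be the $\mathbb Z/2$-graded space of formal power series of functionals $F=(F_n)_{n\ge0}$ on the fields, where $F_n$ is a graded symmetric $n$-linear functional and the first derivative of $F$ is given by smooth compactly supported dual fields: $F_{n+1}(e_1,\dots,e_n,h)=\langle u,h\rangle$ with $u=u(e_1,\dots,e_n)\in(\mathrm{PV}_c^{0,\bullet}\otimes\mathbb C^2)\oplus\mathrm{PV}_c^{2,\bullet}\oplus\mathrm{PV}_c^{3,\bullet}$, where the first summand is paired with $\phi$ by $\int_X(-)\wedge\Omega_X$ and the two others with $\mu$ and $\nu$ by $\mathrm{Tr}$. Let $\{-,-\}$ be the odd Poisson bracket on $\mathcal O(\widetilde{\mathcal E})$ of the Poisson tensor that is inverse to $\int_X\omega(-,-)\wedge\Omega_X$ on $\mathrm{PV}^{0,\bullet}\otimes\mathbb C^2$, and is the kernel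 $(\partial\otimes1)\delta_{\mathrm{diag}}$ on $\mathrm{PV}^{1,\bullet}\to t\,\mathrm{PV}^{0,\bullet}$ (it vanishes on $t\,\mathrm{PV}^{0,\bullet}$). Let $d=Q+\{\widetilde I,-\}$, where $Q$ acts on functionals by the dual action $(QF)(e_1,\dots,e_n)=-\sum_i\pm F(e_1,\dots,Qe_i,\dots,e_n)$ with Koszul signs. Then $\bar\partial$ and $\partial$ preserve smooth compactly supported polyvector fields, $(\mathcal O(\widetilde{\mathcal E})[1],d,\{-,-\})$ is a $\mathbb Z/2$-graded dg Lie algebra over $\mathbb C$, and $$J:\ (\mathfrak{sl}_2(\mathbb C),\,0,\,[-,-])\longrightarrow(\mathcal O(\widetilde{\mathcal E})[1],\,d,\,\{-,-\}),\qquad x\longmapsto\tfrac12\int_X\omega(\phi,x\phi)\wedge\Omega_X,$$ is a map of dg Lie algebras: $J$ is linear, $J(x)$ is an odd functional (of degree $0$ in $\mathcal O(\widetilde{\mathcal E})[1]$), $dJ(x)=0$, and $J([x,y])=\{J(x),J(y)\}$. Moreover $\{\widetilde I,J(x)\}=0$ for all $x$. Thus $\mathfrak{sl}_2$ acts on the theory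 in a Hamiltonian way. -/

import Mathlib

open scoped Manifold ContDiff Topology

noncomputable section

namespace BCOV

/-! ### The Grassmann algebra on six generators

The generators `0, 1, 2` stand for `∂_{z₁}, ∂_{z₂}, ∂_{z₃}` when we speak of polyvector fields and for
`dz₁, dz₂, dz₃` when we speak of differential forms; the generators `3, 4, 5` stand for
`dz̄₁, dz̄₂, dz̄₃`.  An element is given by its coefficients in the basis of ordered monomials. -/

/-- The local model of `X`. -/
abbrev V : Type := Fin 3 → ℂ

/-- `a K` is the coefficient of the monomial whose factors are the generators in `K`, in
increasing order. -/
abbrev Grass : Type := Finset (Fin 6) → ℂ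

/-- The generator `∂_{z_i}` (or `dz_i`). -/
def xi (i : Fin 3) : Fin 6 := Fin.castAdd 3 i

/-- The generator `dz̄_j`. -/
def eta (j : Fin 3) : Fin 6 := Fin.natAdd 3 j

/-- The sign with which (monomial of `I`) times (monomial of `J`) is the monomial of `I ∪ J`. -/
def monoSign (I J : Finset (Fin 6)) : ℂ :=
  (-1) ^ ((I ×ˢ J).filter (fun p => p.2 < p.1)).card

/-- The graded commutative product. -/
def gmul (a b : Grass) : Grass := fun K =>
  ∑ I ∈ K.powerset, monoSign I (K \ I) * a I * b (K \ I)

/-- The unit. -/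
def gone : Grass := Pi.single ∅ 1

/-- Left multiplication by the `k`-th generator. -/
def gext (k : Fin 6) (a : Grass) : Grass := fun K =>
  if k ∈ K then (-1) ^ (K.filter (· < k)).card * a (K.erase k) else 0

/-- The left derivative along the `k`-th generator (contraction). -/
def gcontr (k : Fin 6) (a : Grass) : Grass := fun K =>
  if k ∈ K then 0 else (-1) ^ (K.filter (· < k)).card * a (insert k K)

/-- The coefficient at the monomial `K` of the image of the monomial `I` under the
algebra map that sends the generator `i` to `∑ k, M k i • (generator k)`. -/
def gminor (M : Matrix (Fin 6) (Fin 6) ℂ) (K I : Finset (Fin 6)) : ℂ :=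
  if h : I.card = K.card then
    Matrix.det (Matrix.of fun r s : Fin K.card =>
      M (K.orderEmbOfFin rfl r) (I.orderEmbOfFin h s))
  else 0

/-- The algebra map that sends the generator `i` to `∑ k, M k i • (generator k)`. -/
def gsubst (M : Matrix (Fin 6) (Fin 6) ℂ) (a : Grass) : Grass := fun K =>
  ∑ I, gminor M K I * a I

/-- The monomial `dz₁ dz₂ dz₃`. -/
def dzzz : Grass := Pi.single {0, 1, 2} 1

/-- The contraction `a ∨ (ρ dz₁ dz₂ dz₃)`: a factor `∂_{z_i}` of the polyvector `a` acts as the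
contraction with `∂_{z_i}`, and a factor `dz̄_j` as left multiplication by `dz̄_j`. -/
def gcontract (ρ : ℂ) (a : Grass) : Grass :=
  ∑ K : Finset (Fin 6), a K •
    (K.sort).foldr (fun (k : Fin 6) f => if (k : ℕ) < 3 then gcontr k f else gext k f) (ρ • dzzz)

/-! ### Wirtinger derivatives in `ℂ³` -/

/-- `∂f/∂z_i`. -/
def dz (i : Fin 3) (f : V → Grass) (z : V) : Grass :=
  (1 / 2 : ℂ) • (fderiv ℝ f z (Pi.single i 1) - Complex.I • fderiv ℝ f z (Pi.single i Complex.I))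

/-- `∂f/∂z̄_j`. -/
def dzbar (j : Fin 3) (f : V → Grass) (z : V) : Grass :=
  (1 / 2 : ℂ) • (fderiv ℝ f z (Pi.single j 1) + Complex.I • fderiv ℝ f z (Pi.single j Complex.I))

/-- The Jacobian matrix `(∂τ_k/∂z_i)` of a holomorphic map. -/
def jac (τ : V → V) (z : V) : Matrix (Fin 3) (Fin 3) ℂ :=
  Matrix.of fun k i => fderiv ℂ τ z (Pi.single i 1) k

/-- With `w = τ z` and `σ = τ⁻¹`, the matrix that expresses the frame `∂_{z_i}, dz̄_j` at `z` through
the frame `∂_{w_k}, dw̄_k` at `w`: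
`∂_{z_i} = ∑ k, (∂w_k/∂z_i) ∂_{w_k}` and `dz̄_j = ∑ k, conj (∂z_j/∂w_k) dw̄_k`. -/
def frameChange (τ σ : V → V) (z : V) : Matrix (Fin 6) (Fin 6) ℂ :=
  Matrix.reindex finSumFinEquiv finSumFinEquiv
    (Matrix.fromBlocks (jac τ z) 0 0 (jac σ (τ z)).conjTranspose)

/-! ### Polyvector fields on a complex threefold -/

section Geometry

variable (X : Type*) [TopologicalSpace X] [ChartedSpace V X]

/-- A family of Grassmann-valued functions, one in each chart of the atlas. -/
abbrev Sec : Type _ := atlas V X → V → Grass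

variable {X}

/-- The coordinate change from the chart `c` to the chart `c'`. -/
def transition (c c' : atlas V X) : V → V := fun z => c'.1 (c.1.symm z)

variable (X) in
/-- A holomorphic volume form `Ω`, given by `ρ_c dz₁ ∧ dz₂ ∧ dz₃` in the chart `c`. -/
structure HolVolForm where
  coeff : atlas V X → V → ℂ
  holomorphic : ∀ c : atlas V X, AnalyticOnNhd ℂ (coeff c) c.1.target
  ne_zero : ∀ c : atlas V X, ∀ z ∈ c.1.target, coeff c z ≠ 0
  transform : ∀ c c' : atlas V X, ∀ z ∈ c.1.target, c.1.symm z ∈ c'.1.source →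
    coeff c z = coeff c' (transition c c' z) * (jac (transition c c') z).det

/-- `a` is a smooth compactly supported section of `⨁_j Ω^{0,j}(∧^i T_X)`, that is, an element
of `PV^{i,•}` with compact support.  The coefficient functions vanish outside the image of the
chart, so that the family is determined by the section. -/
structure IsPV (i : ℕ) (a : Sec X) : Prop where
  smooth : ∀ c : atlas V X, ContDiffOn ℝ ∞ (a c) c.1.target
  off_target : ∀ c : atlas V X, ∀ z ∉ c.1.target, a c z = 0
  transform : ∀ c c' : atlas V X, ∀ z ∈ c.1.target, c.1.symm z ∈ c'.1.source →
    a c' (transition c c' z) =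
      gsubst (frameChange (transition c c') (transition c' c) z) (a c z)
  degree : ∀ (c : atlas V X) (z : V) (K : Finset (Fin 6)),
    a c z K ≠ 0 → (K.filter (fun k : Fin 6 => (k : ℕ) < 3)).card = i
  compact_support : ∃ S : Set X, IsCompact S ∧
    ∀ c : atlas V X, ∀ z ∈ c.1.target, c.1.symm z ∉ S → a c z = 0

theorem gsubst_add (M : Matrix (Fin 6) (Fin 6) ℂ) (a b : Grass) :
    gsubst M (a + b) = gsubst M a + gsubst M b := by
  funext K
  simp [gsubst, mul_add, Finset.sum_add_distrib]

theorem gsubst_smul (M : Matrix (Fin 6) (Fin 6) ℂ) (s : ℂ) (a : Grass) :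
    gsubst M (s • a) = s • gsubst M a := by
  funext K
  simp only [gsubst, Pi.smul_apply, smul_eq_mul, Finset.mul_sum]
  exact Finset.sum_congr rfl fun I _ => by ring

variable (X) in
/-- The space of compactly supported elements of `PV^{i,•}(X)`. -/
def PVc (i : ℕ) : Submodule ℂ (Sec X) where
  carrier := {a | IsPV i a}
  zero_mem' :=
    { smooth := fun c => contDiffOn_const
      off_target := fun _ _ _ => rfl
      transform := fun c c' z _ _ => by
        funext K
        simp [gsubst]
      degree := fun _ _ _ h => absurd rfl h
      compact_support := ⟨∅, isCompact_empty, fun _ _ _ _ => rfl⟩ }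
  add_mem' := by
    intro a b ha hb
    obtain ⟨S, hS, haS⟩ := ha.compact_support
    obtain ⟨T, hT, hbT⟩ := hb.compact_support
    refine ⟨fun c => (ha.smooth c).add (hb.smooth c), ?_, ?_, ?_, S ∪ T, hS.union hT, ?_⟩
    · intro c z hz
      simp [ha.off_target c z hz, hb.off_target c z hz]
    · intro c c' z hz hz'
      simp only [Pi.add_apply, gsubst_add, ha.transform c c' z hz hz', hb.transform c c' z hz hz']
    · intro c z K h
      by_cases h0 : a c z K = 0
      · refine hb.degree c z K fun h1 => h ?_
        simp [h0, h1]
      · exact ha.degree c z K h0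
    · intro c z hz h
      simp only [Set.mem_union, not_or] at h
      simp [haS c z hz h.1, hbT c z hz h.2]
  smul_mem' := by
    intro s a ha
    obtain ⟨S, hS, haS⟩ := ha.compact_support
    refine ⟨fun c => (ha.smooth c).const_smul s, ?_, ?_, ?_, S, hS, ?_⟩
    · intro c z hz
      simp [ha.off_target c z hz]
    · intro c c' z hz hz'
      simp only [Pi.smul_apply, gsubst_smul, ha.transform c c' z hz hz']
    · intro c z K h
      refine ha.degree c z K fun h1 => h ?_
      simp [h1]
    · intro c z hz h
      simp [haS c z hz h]

/-- The product of polyvector fields, and the wedge product of forms. -/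
def wedge (a b : Sec X) : Sec X := fun c z => gmul (a c z) (b c z)

/-- The product of a finite family. -/
def wedgeProd {k : ℕ} (a : Fin k → Sec X) : Sec X := fun c z =>
  (List.ofFn fun j => a j c z).foldr gmul gone

open Classical in
/-- The operator `∂̄ = ∑ j, dz̄_j ∂/∂z̄_j`. -/
def dbar (a : Sec X) : Sec X := fun c z =>
  if z ∈ c.1.target then ∑ j : Fin 3, gext (eta j) (dzbar j (a c) z) else 0

open Classical in
/-- The divergence operator `∂ : PV^{i,•} → PV^{i-1,•}` with respect to `Ω`.  In a chart
`∂ = ∑ i, ρ⁻¹ (∂/∂z_i) ρ ι_{dz_i}`, which is the holomorphic de Rham differential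
`∑ i, dz_i ∂/∂z_i` transported along the contraction `(-) ∨ Ω`. -/
def div (Ω : HolVolForm X) (a : Sec X) : Sec X := fun c z =>
  if z ∈ c.1.target then
    ∑ i : Fin 3, (Ω.coeff c z)⁻¹ • gcontr (xi i) (dz i (fun w => Ω.coeff c w • a c w) z)
  else 0

/-- `(-1)^p` for a parity `p`. -/
def psign (p : ZMod 2) : ℂ := if p = 0 then 1 else -1

/-- The Schouten–Nijenhuis bracket `[a, b]`, for `a` of parity `p`. -/
def snBracket (Ω : HolVolForm X) (p : ZMod 2) (a b : Sec X) : Sec X :=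
  psign (p + 1) • (div Ω (wedge a b) - wedge (div Ω a) b - psign p • wedge a (div Ω b))

/-- `Ω` as a family of forms. -/
def HolVolForm.form (Ω : HolVolForm X) : Sec X := fun c z => Ω.coeff c z • dzzz

/-- The contraction `a ∨ Ω`. -/
def contract (Ω : HolVolForm X) (a : Sec X) : Sec X := fun c z => gcontract (Ω.coeff c z) (a c z)

/-- The volume measure of `Ω`: in each chart it is `|ρ|²` times the Lebesgue measure of `ℂ³`. -/
def volMeasure [MeasurableSpace X] (Ω : HolVolForm X) : MeasureTheory.Measure X :=
  ⨆ c : atlas V X, MeasureTheory.Measure.map c.1.symm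
    ((MeasureTheory.volume.restrict c.1.target).withDensity
      fun z => ENNReal.ofReal (‖Ω.coeff c z‖ ^ 2))

/-- The integral over `X` of a form of type `(3,3)`.  If the form is `β dz₁ dz₂ dz₃ dz̄₁ dz̄₂ dz̄₃` in
a chart, then this is `-8i β` times the Lebesgue measure, since `dz ∧ dz̄ = -2i dx ∧ dy`; we write it
as `-8i β / |ρ|²` times the volume measure of `Ω`. -/
def integral [MeasurableSpace X] (Ω : HolVolForm X) (β : Sec X) : ℂ :=
  -8 * Complex.I * ∫ p : X,
    β ⟨chartAt V p, chart_mem_atlas V p⟩ (chartAt V p p) Finset.univ /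
      ((‖Ω.coeff ⟨chartAt V p, chart_mem_atlas V p⟩ (chartAt V p p)‖ ^ 2 : ℝ) : ℂ)
    ∂(volMeasure Ω)

/-- `∫_X η ∧ Ω`, for `η` of type `(0,•)`.  This is also `Tr (η ∨ Ω⁻¹)`, where `η ∨ Ω⁻¹` is the element
of `PV^{3,•}` whose contraction with `Ω` is `η`. -/
def intOmega [MeasurableSpace X] (Ω : HolVolForm X) (η : Sec X) : ℂ :=
  integral Ω (wedge η Ω.form)

/-- The trace `Tr a = ∫_X (a ∨ Ω) ∧ Ω`. -/
def tr [MeasurableSpace X] (Ω : HolVolForm X) (a : Sec X) : ℂ :=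
  integral Ω (wedge (contract Ω a) Ω.form)

/-! ### The fields -/

variable (X) in
/-- The fields `(φ, μ, ν)`: `φ ∈ PV^{0,•} ⊗ ℂ²`, `μ ∈ PV^{1,•}` and `tν ∈ t PV^{0,•}`, with compact
support. -/
abbrev Fields : Type _ := (Fin 2 → PVc X 0) × PVc X 1 × PVc X 0

/-- The component of `φ` along the `a`-th vector of the standard basis of `ℂ²`. -/
def phi (e : Fields X) (a : Fin 2) : Sec X := (e.1 a : Sec X)

/-- The component `μ`. -/
def mu (e : Fields X) : Sec X := (e.2.1 : Sec X)

/-- The component `ν`. -/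
def nu (e : Fields X) : Sec X := (e.2.2 : Sec X)

variable (X) in
/-- The smooth compactly supported dual fields: `PV^{0,•} ⊗ ℂ²` is dual to itself through
`∫ (-) ∧ Ω`, and `PV^{2,•}`, `PV^{3,•}` are dual to the summands `PV^{1,•}`, `t PV^{0,•}` through the
trace. -/
abbrev DualFields : Type _ := (Fin 2 → PVc X 0) × PVc X 2 × PVc X 3

/-- The pairing of a dual field (on the left) with a field. -/
def pairR [MeasurableSpace X] (Ω : HolVolForm X) (u : DualFields X) (h : Fields X) : ℂ :=
  ∑ a : Fin 2, intOmega Ω (wedge (u.1 a : Sec X) (phi h a))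
    + tr Ω (wedge (u.2.1 : Sec X) (mu h)) + tr Ω (wedge (u.2.2 : Sec X) (nu h))

/-- The pairing of a field with a dual field (on the right). -/
def pairL [MeasurableSpace X] (Ω : HolVolForm X) (h : Fields X) (v : DualFields X) : ℂ :=
  ∑ a : Fin 2, intOmega Ω (wedge (phi h a) (v.1 a : Sec X))
    + tr Ω (wedge (mu h) (v.2.1 : Sec X)) + tr Ω (wedge (nu h) (v.2.2 : Sec X))

/-- Only monomials whose number of factors has parity `p` occur in `a`. -/
def HasParity (p : ZMod 2) (a : Sec X) : Prop :=
  ∀ (c : atlas V X) (z : V) (K : Finset (Fin 6)), a c z K ≠ 0 → (K.card : ZMod 2) = p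

variable (X) in
/-- A homogeneous field together with its parity: components in `Ω^{0,j}(X)` have parity `j`, and
components in `Ω^{0,j}(X, T_X)` have parity `j + 1`. -/
structure HomField where
  par : ZMod 2
  val : Fields X
  phi_parity : ∀ a, HasParity par (phi val a)
  mu_parity : HasParity par (mu val)
  nu_parity : HasParity par (nu val)

open Classical in
/-- A family `a`, as an element of `PV^{i,•}`.  It is used only for families in that space. -/
def toPVc (i : ℕ) (a : Sec X) : PVc X i := if h : a ∈ PVc X i then ⟨a, h⟩ else 0

theorem HasParity.toPVc {p : ZMod 2} {a : Sec X} (h : HasParity p a) (i : ℕ) :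
    HasParity p (BCOV.toPVc i a : Sec X) := by
  unfold BCOV.toPVc
  split_ifs
  · exact h
  · exact fun _ _ _ h0 => absurd rfl h0

theorem HasParity.add {p : ZMod 2} {a b : Sec X} (ha : HasParity p a) (hb : HasParity p b) :
    HasParity p (a + b) := by
  intro c z K h
  by_cases h0 : a c z K = 0
  · refine hb c z K fun h1 => h ?_
    simp [h0, h1]
  · exact ha c z K h0

theorem fderiv_coeff_eq_zero {f : V → Grass} {K : Finset (Fin 6)} (h : ∀ z, f z K = 0) (z v : V) :
    fderiv ℝ f z v K = 0 := by
  by_cases hf : DifferentiableAt ℝ f z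
  · have h1 := fderiv_apply (𝕜 := ℝ) hf K
    have h2 : (fun x => f x K) = fun _ => (0 : ℂ) := funext h
    rw [h2] at h1
    have h3 := congrArg (fun L => L v) h1
    simpa using h3.symm
  · simp [fderiv_zero_of_not_differentiableAt hf]

theorem HasParity.dbar {p : ZMod 2} {a : Sec X} (ha : HasParity p a) :
    HasParity (p + 1) (BCOV.dbar a) := by
  intro c z K h
  by_contra hK
  refine h ?_
  unfold BCOV.dbar
  split_ifs with hz
  · rw [Finset.sum_apply]
    refine Finset.sum_eq_zero fun j _ => ?_
    unfold gext
    split_ifs with hj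
    · have hc : (K.card : ZMod 2) = ((K.erase (eta j)).card : ZMod 2) + 1 := by
        rw [← Finset.card_erase_add_one hj]
        push_cast
        rfl
      have h0 : ∀ w, a c w (K.erase (eta j)) = 0 := by
        intro w
        by_contra hw
        exact hK (by rw [hc, ha c w _ hw])
      simp [dzbar, fderiv_coeff_eq_zero h0]
    · rfl
  · rfl

theorem HasParity.div {p : ZMod 2} {a : Sec X} (Ω : HolVolForm X) (ha : HasParity p a) :
    HasParity (p + 1) (BCOV.div Ω a) := by
  intro c z K h
  by_contra hK
  refine h ?_
  unfold BCOV.div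
  split_ifs with hz
  · rw [Finset.sum_apply]
    refine Finset.sum_eq_zero fun j _ => ?_
    rw [Pi.smul_apply]
    unfold gcontr
    split_ifs with hj
    · simp
    · have hc : ((insert (xi j) K).card : ZMod 2) = (K.card : ZMod 2) + 1 := by
        rw [Finset.card_insert_of_notMem hj]
        push_cast
        rfl
      have h2 : (1 : ZMod 2) + 1 = 0 := rfl
      have h0 : ∀ w, (Ω.coeff c w • a c w) (insert (xi j) K) = 0 := by
        intro w
        rw [Pi.smul_apply]
        by_contra hw
        have hp := ha c w _ (fun h1 => hw (by rw [h1, smul_zero]))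
        refine hK ?_
        rw [← hp, hc, add_assoc, h2, add_zero]
      simp [dz, fderiv_coeff_eq_zero h0]
  · rfl

/-- The differential `Q = ∂̄ + t∂`, so that `Q (φ, μ, ν) = (∂̄φ, ∂̄μ, ∂̄ν + ∂μ)`. -/
def Q (Ω : HolVolForm X) (e : HomField X) : HomField X where
  par := e.par + 1
  val := (fun a => toPVc 0 (dbar (phi e.val a)), toPVc 1 (dbar (mu e.val)),
    toPVc 0 (dbar (nu e.val)) + toPVc 0 (div Ω (mu e.val)))
  phi_parity := fun a => (e.phi_parity a).dbar.toPVc 0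
  mu_parity := e.mu_parity.dbar.toPVc 1
  nu_parity := (e.nu_parity.dbar.toPVc 0).add ((e.mu_parity.div Ω).toPVc 0)

/-! ### Functionals -/

variable (X) in
/-- A formal power series of functionals on the fields, through its Taylor components; the
multilinear map `F n` is given by its values on homogeneous fields, and the power series is
`e ↦ ∑ n, F n (e, …, e) / n!`. -/
abbrev PreFunctional : Type _ := ∀ n : ℕ, (Fin n → HomField X) → ℂ

/-- The Koszul sign of the rearrangement of `e 0, e 1, …` into `e (σ 0), e (σ 1), …`. -/
def koszul {n : ℕ} (σ : Equiv.Perm (Fin n)) (e : Fin n → HomField X) : ℂ :=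
  ∏ q ∈ (Finset.univ : Finset (Fin n × Fin n)).filter (fun q => q.1 < q.2 ∧ σ q.2 < σ q.1),
    psign ((e (σ q.1)).par * (e (σ q.2)).par)

/-- The Koszul sign of moving the fields with index in `S` to the left of the others. -/
def shuffleSign {n : ℕ} (S : Finset (Fin n)) (e : Fin n → HomField X) : ℂ :=
  ∏ q ∈ (Finset.univ : Finset (Fin n × Fin n)).filter
      (fun q => q.1 ∉ S ∧ q.2 ∈ S ∧ q.1 < q.2),
    psign ((e q.1).par * (e q.2).par)

/-- The fields with index in `S`, in increasing order. -/
def subfamily {n : ℕ} (S : Finset (Fin n)) (e : Fin n → HomField X) : Fin S.card → HomField X :=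
  fun j => e (S.orderEmbOfFin rfl j)

/-- The functionals of parity `p`: graded symmetric multilinear Taylor components of parity `p`, and
first derivatives that are given by smooth compactly supported dual fields.  (The last condition
implies that the Taylor components are separately continuous.) -/
structure IsFunctional [MeasurableSpace X] (Ω : HolVolForm X) (p : ZMod 2)
    (F : PreFunctional X) : Prop where
  multilinear : ∀ (n : ℕ) (e : Fin n → HomField X) (i : Fin n) (s : ℂ) (a b c : HomField X),
    a.par = c.par → b.par = c.par → c.val = s • a.val + b.val →
      F n (Function.update e i c) = s * F n (Function.update e i a) + F n (Function.update e i b)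
  symmetric : ∀ (n : ℕ) (e : Fin n → HomField X) (σ : Equiv.Perm (Fin n)),
    F n (e ∘ σ) = koszul σ e * F n e
  parity : ∀ (n : ℕ) (e : Fin n → HomField X), F n e ≠ 0 → ∑ i, (e i).par = p
  smooth_derivative : ∀ (n : ℕ) (e : Fin n → HomField X), ∃ u : DualFields X, ∀ h : HomField X,
    F (n + 1) (Fin.snoc (α := fun _ => HomField X) e h) = pairR Ω u h.val

open Classical in
/-- The right derivative of `F`: the dual field `u` such that `F (e₁, …, e_m, h) = ⟨u, h⟩`. -/
def rightDeriv [MeasurableSpace X] (Ω : HolVolForm X) (F : PreFunctional X) {m : ℕ}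
    (e : Fin m → HomField X) : DualFields X :=
  if H : ∃ u : DualFields X, ∀ h : HomField X,
    F (m + 1) (Fin.snoc (α := fun _ => HomField X) e h) = pairR Ω u h.val then H.choose else 0

open Classical in
/-- The left derivative of `F`: the dual field `v` such that `F (h, e₁, …, e_m) = ⟨h, v⟩`. -/
def leftDeriv [MeasurableSpace X] (Ω : HolVolForm X) (F : PreFunctional X) {m : ℕ}
    (e : Fin m → HomField X) : DualFields X :=
  if H : ∃ v : DualFields X, ∀ h : HomField X,
    F (m + 1) (Fin.cons (α := fun _ => HomField X) h e) = pairL Ω h.val v then H.choose else 0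

/-- The canonical symplectic form of `ℂ²`. -/
def omega : Matrix (Fin 2) (Fin 2) ℂ := !![0, 1; -1, 0]

/-- The Poisson tensor, applied to two dual fields: on `PV^{0,•} ⊗ ℂ²` it is the inverse of the
symplectic structure `∫ ω(-, -) ∧ Ω`, on `PV^{1,•} → t PV^{0,•}` it is the kernel
`(∂ ⊗ 1) δ_diag`, which does not see the summand `t PV^{0,•}`. -/
def poissonTensor [MeasurableSpace X] (Ω : HolVolForm X) (u v : DualFields X) : ℂ :=
  ∑ a : Fin 2, ∑ b : Fin 2, omega⁻¹ a b * intOmega Ω (wedge (u.1 a : Sec X) (v.1 b : Sec X))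
    + tr Ω (wedge (div Ω (u.2.1 : Sec X)) (v.2.1 : Sec X))

/-- The Poisson bracket `{F, G}`. -/
def bracket [MeasurableSpace X] (Ω : HolVolForm X) (F G : PreFunctional X) : PreFunctional X :=
  fun _ e => ∑ S : Finset _, shuffleSign S e *
    poissonTensor Ω (rightDeriv Ω F (subfamily S e)) (leftDeriv Ω G (subfamily Sᶜ e))

/-- The action of `Q` on functionals, dual to the action on fields:
`(Q F)(e₁, …, e_n) = - ∑ i, ± F (e₁, …, Q e_i, …, e_n)`. -/
def Qdual (Ω : HolVolForm X) (F : PreFunctional X) : PreFunctional X := fun n e =>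
  -∑ i : Fin n, psign (∑ j ∈ Finset.univ.filter (· < i), (e j).par) *
    F n (Function.update e i (Q Ω (e i)))

/-- The functional `e ↦ ∑ n, T n (e, …, e)` of a sequence of multilinear expressions: its Taylor
components are the graded symmetrizations of the `T n`. -/
def ofExpr (T : PreFunctional X) : PreFunctional X := fun n e =>
  ∑ σ : Equiv.Perm (Fin n), koszul σ e * T n (e ∘ σ)

/-- The multilinear expressions of
`∑ k, Tr (½ ω(φ, [μ, φ]) ν^k ∨ Ω⁻¹ + ⅙ μ μ μ ν^k)`.
The sign in the first summand is the Koszul sign of moving the odd bracket `[-, -]`, written at the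
comma, to the left of the fields in front of it. -/
def actionExpr [MeasurableSpace X] (Ω : HolVolForm X) : PreFunctional X
  | 0, _ => 0
  | 1, _ => 0
  | 2, _ => 0
  | k + 3, e =>
    let e₀ := e 0
    let e₁ := e 1
    let e₂ := e 2
    let νk : Sec X := wedgeProd fun j : Fin k => nu (e j.succ.succ.succ).val
    (1 / 2) * (psign (e₀.par + e₁.par) *
      intOmega Ω (wedge
        (∑ a : Fin 2, ∑ b : Fin 2, omega a b •
          wedge (phi e₀.val a) (snBracket Ω e₁.par (mu e₁.val) (phi e₂.val b))) νk))
    + (1 / 6) * tr Ω (wedge (wedge (wedge (mu e₀.val) (mu e₁.val)) (mu e₂.val)) νk)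

/-- The interaction functional `Ĩ`. -/
def action [MeasurableSpace X] (Ω : HolVolForm X) : PreFunctional X := ofExpr (actionExpr Ω)

/-- The differential on functionals: `Q` together with `{Ĩ, -}`. -/
def differential [MeasurableSpace X] (Ω : HolVolForm X) (F : PreFunctional X) : PreFunctional X :=
  Qdual Ω F + bracket Ω (action Ω) F

/-- The Lie algebra `sl₂`. -/
abbrev sl2 : Type := LieAlgebra.SpecialLinear.sl (Fin 2) ℂ

/-- The bilinear expression of `½ ∫ ω(φ, x φ) ∧ Ω`. -/
def hamiltonianExpr [MeasurableSpace X] (Ω : HolVolForm X) (x : sl2) : PreFunctional X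
  | 2, e => (1 / 2) * intOmega Ω (∑ a : Fin 2, ∑ b : Fin 2, omega a b •
      wedge (phi (e 0).val a) (∑ c : Fin 2, x.1 b c • phi (e 1).val c))
  | _, _ => 0

/-- The Hamiltonian `J x = ½ ∫ ω(φ, x φ) ∧ Ω`. -/
def J [MeasurableSpace X] (Ω : HolVolForm X) (x : sl2) : PreFunctional X :=
  ofExpr (hamiltonianExpr Ω x)

/-- The `ℤ/2`-graded space `𝒪[1]`: its elements of degree `i` are the functionals of parity
`i + 1`. -/
def shiftedFunctionals [MeasurableSpace X] (Ω : HolVolForm X) (i : ZMod 2) :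
    Set (PreFunctional X) := {F | IsFunctional Ω (i + 1) F}

end Geometry

/-! ### `ℤ/2`-graded dg Lie algebras -/

/-- `⨁ i, L i`, with the bracket `br` and the differential `d`, is a `ℤ/2`-graded dg Lie algebra
over `ℂ`. -/
structure IsDGLie {M : Type*} [AddCommGroup M] [Module ℂ M] (L : ZMod 2 → Set M)
    (br : M → M → M) (d : M → M) : Prop where
  zero_mem : ∀ i, 0 ∈ L i
  add_mem : ∀ i, ∀ F ∈ L i, ∀ G ∈ L i, F + G ∈ L i
  smul_mem : ∀ i, ∀ s : ℂ, ∀ F ∈ L i, s • F ∈ L i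
  br_mem : ∀ i j, ∀ F ∈ L i, ∀ G ∈ L j, br F G ∈ L (i + j)
  br_add_left : ∀ i j, ∀ F ∈ L i, ∀ F' ∈ L i, ∀ G ∈ L j, br (F + F') G = br F G + br F' G
  br_smul_left : ∀ i j, ∀ s : ℂ, ∀ F ∈ L i, ∀ G ∈ L j, br (s • F) G = s • br F G
  br_skew : ∀ i j, ∀ F ∈ L i, ∀ G ∈ L j, br F G = -(psign (i * j) • br G F)
  br_jacobi : ∀ i j k, ∀ F ∈ L i, ∀ G ∈ L j, ∀ H ∈ L k,
    br F (br G H) = br (br F G) H + psign (i * j) • br G (br F H)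
  d_mem : ∀ i, ∀ F ∈ L i, d F ∈ L (i + 1)
  d_add : ∀ i, ∀ F ∈ L i, ∀ G ∈ L i, d (F + G) = d F + d G
  d_smul : ∀ i, ∀ s : ℂ, ∀ F ∈ L i, d (s • F) = s • d F
  d_d : ∀ i, ∀ F ∈ L i, d (d F) = 0
  d_br : ∀ i j, ∀ F ∈ L i, ∀ G ∈ L j, d (br F G) = br (d F) G + psign i • br F (d G)

/-- `f` is a map of dg Lie algebras from a Lie algebra, in degree `0` and with differential `0`, to
`(⨁ i, L i, br, d)`. -/
structure IsDGLieHom {𝔤 : Type*} [LieRing 𝔤] [LieAlgebra ℂ 𝔤] {M : Type*} [AddCommGroup M]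
    [Module ℂ M] (L : ZMod 2 → Set M) (br : M → M → M) (d : M → M) (f : 𝔤 → M) : Prop where
  map_mem : ∀ x, f x ∈ L 0
  map_add : ∀ x y, f (x + y) = f x + f y
  map_smul : ∀ (s : ℂ) (x), f (s • x) = s • f x
  map_d : ∀ x, d (f x) = 0
  map_lie : ∀ x y, f ⁅x, y⁆ = br (f x) (f y)

end BCOV

end

/-!
Everything is reduced to algebra in the ring `FunR X` of families of Taylor components with values in
smooth polyvector fields, with the Koszul-signed shuffle product.  The fields themselves are elements
`phiF a`, `muF` of this ring, `geo` is `1 / (1 - ν) = ∑ ν ^ k`, and the operators `∂` and `∂̄` act on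
values (`FunR.del`, `FunR.delbar`).  The insertion `ins h` of a field `h` as the first argument is a
derivation up to signs (`FunR.ins_mul`), so an identity that is compatible with insertions holds as
soon as it holds for the components of order zero; there it is an identity of polyvector fields.

*Geometry.*  `dbar` and `div Ω` are compatible with the changes of frame (`IsCoordChange.dz_transform`,
`IsCoordChange.dzbar_transform` and Jacobi's formula), hence act on smooth sections as `dbarL` and
`divL Ω`.  The divergence is an operator of second order: the bracket that measures its failure to be
a derivation is itself a derivation (`br_mul`).  A partition of unity and integration in charts give
Stokes' theorem in the forms `traceL_dbarL` and `traceL_divL_mul`.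

*The Lie algebra.*  A functional determines a Hamiltonian field through its first derivative, up to
the kernel of the Poisson tensor.  The insertion of a field is a derivation of the bracket
(`ins_bracket`), which reduces the Jacobi identity to the graded symmetry of second derivatives
(`bracket_jacobi`).  By Stokes' theorem the Poisson tensor is compatible with `Q`, so the dual action
of `Q` is a derivation of the bracket (`qdual_bracket`).  Hence `Q + {I, -}` is a differential as soon
as `I` is even and `2 Q I + {I, I} = 0` (`isDGLie_of_masterEquation`).

*The master equation.*  With `D α = {μ, α}` and `E α = ∂ (Ω⁻¹ α)`, the action is the trace of
`-½ Ω⁻¹ (φ₀ D φ₁ - φ₁ D φ₀) / (1 - ν) + ⅙ μ³ / (1 - ν)` (`action_eq`), with the derivatives given in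
`hasGrad_action`.  Sorted by the order in `φ`, the bracket of the action with itself has three parts.
The part without `φ` cancels against the variation of `μ³ / (1 - ν)` under `ν ↦ ν + ∂μ`, because
`μ⁴ = 0` for reasons of degree (`del_cubic_mul`).  In second order, the contribution of the
`φ`-`φ`-component (`gradF_mul_gradF`) and twice the cross term of the `μ`-`μ`-component
(`traceF_cross`) leave the variation of `1 / (1 - ν)` in the quadratic part, after integration by
parts.  The part of fourth order vanishes because `E α E β` lies in `PV^{4,•} = 0`
(`del_quadratic_mul`).

*The Hamiltonians.*  `J x` is the integral of a quadratic form in `φ₀`, `φ₁` with constant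
coefficients (`J_eq`).  It is closed by Stokes' theorem, the bracket of two of them is the commutator
of matrices (`bracket_hamF`), and the bracket with the action is the integral of a total divergence
(`bracket_action_hamF`).
-/

noncomputable section

namespace BCOV


/-! ### The Grassmann algebra -/

/-- The number of factors that precede the generator `k` in the monomial `K`, as a sign. -/
def gsign (k : Fin 6) (K : Finset (Fin 6)) : ℂ := (-1) ^ (K.filter (· < k)).card

theorem gsign_mul_self (k : Fin 6) (K : Finset (Fin 6)) : gsign k K * gsign k K = 1 := by
  unfold gsign
  rw [← mul_pow]
  simp

theorem gsign_insert (k l : Fin 6) (K : Finset (Fin 6)) (hl : l ∉ K) :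
    gsign k (insert l K) = (if l < k then -1 else 1) * gsign k K := by
  unfold gsign
  rw [Finset.filter_insert]
  split_ifs with h
  · rw [Finset.card_insert_of_notMem (by simp [hl]), pow_succ]
    ring
  · simp

theorem gsign_erase (k l : Fin 6) (K : Finset (Fin 6)) (hl : l ∈ K) :
    gsign k (K.erase l) = (if l < k then -1 else 1) * gsign k K := by
  conv_rhs => rw [← Finset.insert_erase hl, gsign_insert k l _ (Finset.notMem_erase l K)]
  split_ifs <;> ring

theorem gext_apply (k : Fin 6) (a : Grass) (K : Finset (Fin 6)) :
    gext k a K = if k ∈ K then gsign k K * a (K.erase k) else 0 := rfl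

theorem gcontr_apply (k : Fin 6) (a : Grass) (K : Finset (Fin 6)) :
    gcontr k a K = if k ∈ K then 0 else gsign k K * a (insert k K) := rfl

theorem gext_add (k : Fin 6) (a b : Grass) : gext k (a + b) = gext k a + gext k b := by
  funext K
  simp only [gext_apply, Pi.add_apply]
  split_ifs <;> ring

theorem gext_smul (k : Fin 6) (s : ℂ) (a : Grass) : gext k (s • a) = s • gext k a := by
  funext K
  simp only [gext_apply, Pi.smul_apply, smul_eq_mul]
  split_ifs <;> ring

theorem gcontr_add (k : Fin 6) (a b : Grass) : gcontr k (a + b) = gcontr k a + gcontr k b := by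
  funext K
  simp only [gcontr_apply, Pi.add_apply]
  split_ifs <;> ring

theorem gcontr_smul (k : Fin 6) (s : ℂ) (a : Grass) : gcontr k (s • a) = s • gcontr k a := by
  funext K
  simp only [gcontr_apply, Pi.smul_apply, smul_eq_mul]
  split_ifs <;> ring

/-- Exterior multiplication by a generator as a linear map. -/
def gextL (k : Fin 6) : Grass →ₗ[ℂ] Grass := ⟨⟨gext k, gext_add k⟩, gext_smul k⟩

/-- Contraction with a generator as a linear map. -/
def gcontrL (k : Fin 6) : Grass →ₗ[ℂ] Grass := ⟨⟨gcontr k, gcontr_add k⟩, gcontr_smul k⟩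

@[simp] theorem gextL_apply (k : Fin 6) (a : Grass) : gextL k a = gext k a := rfl

theorem gext_gext (k l : Fin 6) (a : Grass) : gext k (gext l a) = -gext l (gext k a) := by
  funext K
  simp only [gext_apply, Pi.neg_apply, Finset.mem_erase]
  rcases eq_or_ne k l with rfl | hkl
  · simp
  · by_cases hk : k ∈ K <;> by_cases hl : l ∈ K <;> simp only [hk, hl, hkl, hkl.symm, if_true,
      if_false, ne_eq, not_false_eq_true, and_self, and_false, true_and, neg_zero, mul_zero,
      reduceIte]
    rw [gsign_erase _ _ _ hk, gsign_erase _ _ _ hl, Finset.erase_right_comm]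
    rcases lt_or_gt_of_ne hkl with h | h
    · simp only [h, not_lt_of_gt h, if_true, if_false]
      ring
    · simp only [h, not_lt_of_gt h, if_true, if_false]
      ring

theorem gcontr_gcontr (k l : Fin 6) (a : Grass) :
    gcontr k (gcontr l a) = -gcontr l (gcontr k a) := by
  funext K
  simp only [gcontr_apply, Pi.neg_apply, Finset.mem_insert]
  rcases eq_or_ne k l with rfl | hkl
  · simp
  · by_cases hk : k ∈ K <;> by_cases hl : l ∈ K <;> simp only [hk, hl, hkl, hkl.symm, if_true,
      if_false, or_false, or_true, neg_zero, mul_zero, or_self, reduceIte]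
    rw [gsign_insert _ _ _ hk, gsign_insert _ _ _ hl, Finset.insert_comm]
    rcases lt_or_gt_of_ne hkl with h | h
    · simp only [h, not_lt_of_gt h, if_true, if_false]
      ring
    · simp only [h, not_lt_of_gt h, if_true, if_false]
      ring

theorem gext_self (k : Fin 6) (a : Grass) : gext k (gext k a) = 0 := by
  have h := gext_gext k k a
  funext K
  exact CharZero.eq_neg_self_iff.mp (congrFun h K)

/-- The relation of the Clifford algebra between contractions and exterior multiplications. -/
theorem gcontr_gext (k l : Fin 6) (a : Grass) :
    gcontr k (gext l a) = (if k = l then a else 0) - gext l (gcontr k a) := by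
  funext K
  simp only [gext_apply, gcontr_apply, Pi.sub_apply, Finset.mem_insert, Finset.mem_erase]
  rcases eq_or_ne k l with rfl | hkl
  · by_cases hk : k ∈ K
    · simp only [hk, if_true, gsign_erase _ _ _ hk, lt_irrefl, if_false, Finset.insert_erase hk,
        ne_eq, not_true_eq_false, false_and]
      linear_combination (a K) * gsign_mul_self k K
    · simp only [hk, if_true, if_false, true_or, gsign_insert _ _ _ hk, lt_irrefl,
        Finset.erase_insert hk]
      linear_combination (a K) * gsign_mul_self k K
  · by_cases hk : k ∈ K <;> by_cases hl : l ∈ K <;> simp only [hk, hl, hkl, hkl.symm, if_true,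
      if_false, or_false, or_true, neg_zero, mul_zero, or_self, reduceIte, ne_eq,
      not_false_eq_true, and_self, and_false, Pi.zero_apply, sub_zero]
    rw [gsign_insert _ _ _ hk, gsign_erase _ _ _ hl, Finset.erase_insert_of_ne hkl]
    rcases lt_or_gt_of_ne hkl with h | h
    · simp only [h, not_lt_of_gt h, if_true, if_false]
      ring
    · simp only [h, not_lt_of_gt h, if_true, if_false]
      ring

theorem gext_single (k : Fin 6) (I : Finset (Fin 6)) (hk : k ∉ I) (s : ℂ) :
    gext k (Pi.single I s) = Pi.single (insert k I) (gsign k I * s) := by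
  funext K
  rw [gext_apply]
  by_cases h : K = insert k I
  · subst h
    simp [gsign_insert _ _ _ hk, Finset.erase_insert hk]
  · rw [Pi.single_eq_of_ne h]
    split_ifs with hK
    · rw [Pi.single_eq_of_ne, mul_zero]
      rintro rfl
      exact h (Finset.insert_erase hK).symm
    · rfl

/-- The generators generate the algebra. -/
theorem grass_induction {P : Grass → Prop} (one : P gone) (add : ∀ a b, P a → P b → P (a + b))
    (smul : ∀ (s : ℂ) a, P a → P (s • a)) (ext : ∀ k a, P a → P (gext k a)) (a : Grass) : P a := by
  have key : ∀ I : Finset (Fin 6), P (Pi.single I 1) := by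
    intro I
    induction I using Finset.induction_on with
    | empty => exact one
    | insert k I hk ih =>
      have h := smul (gsign k I) _ (ext k _ ih)
      rw [gext_single k I hk, ← Pi.single_smul, smul_eq_mul, mul_one, gsign_mul_self] at h
      exact h
  have zero : P 0 := by simpa using smul 0 gone one
  have h : a = ∑ I, a I • (Pi.single I 1 : Grass) := by
    funext K
    simp [Finset.sum_apply, Pi.single_apply]
  rw [h]
  exact Finset.sum_induction _ P add zero fun I _ => smul _ _ (key I)

theorem gmul_add (a b b' : Grass) : gmul a (b + b') = gmul a b + gmul a b' := by
  funext K
  simp [gmul, mul_add, Finset.sum_add_distrib]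

theorem add_gmul (a a' b : Grass) : gmul (a + a') b = gmul a b + gmul a' b := by
  funext K
  simp [gmul, mul_add, add_mul, Finset.sum_add_distrib]

theorem gmul_smul (s : ℂ) (a b : Grass) : gmul a (s • b) = s • gmul a b := by
  funext K
  simp only [gmul, Pi.smul_apply, smul_eq_mul, Finset.mul_sum]
  exact Finset.sum_congr rfl fun I _ => by ring

theorem smul_gmul (s : ℂ) (a b : Grass) : gmul (s • a) b = s • gmul a b := by
  funext K
  simp only [gmul, Pi.smul_apply, smul_eq_mul, Finset.mul_sum]
  exact Finset.sum_congr rfl fun I _ => by ring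

/-- The product as a bilinear map. -/
def gmulL : Grass →ₗ[ℂ] Grass →ₗ[ℂ] Grass :=
  LinearMap.mk₂ ℂ gmul add_gmul smul_gmul gmul_add gmul_smul

theorem zero_gmul (b : Grass) : gmul 0 b = 0 := by simpa using smul_gmul 0 0 b

theorem gmul_zero (a : Grass) : gmul a 0 = 0 := by simpa using gmul_smul 0 a 0

theorem gone_gmul (b : Grass) : gmul gone b = b := by
  funext K
  unfold gmul gone
  rw [Finset.sum_eq_single ∅]
  · simp [monoSign]
  · intro I _ hI
    simp [Pi.single_eq_of_ne hI]
  · simp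

theorem monoSign_insert (k : Fin 6) (I J : Finset (Fin 6)) (hk : k ∉ I) :
    monoSign (insert k I) J = gsign k J * monoSign I J := by
  unfold monoSign gsign
  rw [← pow_add]
  congr 1
  have h : ((insert k I) ×ˢ J).filter (fun p => p.2 < p.1) =
      ((J.filter (· < k)).map ⟨fun j => (k, j), fun _ _ h => (Prod.ext_iff.mp h).2⟩) ∪
        ((I ×ˢ J).filter (fun p => p.2 < p.1)) := by
    ext ⟨x, y⟩
    simp only [Finset.mem_filter, Finset.mem_product, Finset.mem_insert, Finset.mem_union,
      Finset.mem_map, Function.Embedding.coeFn_mk, Prod.mk.injEq]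
    constructor
    · rintro ⟨⟨rfl | h, h2⟩, h3⟩
      · exact Or.inl ⟨y, ⟨h2, h3⟩, rfl⟩
      · exact Or.inr ⟨⟨h, h2⟩, h3⟩
    · rintro (⟨j, ⟨h2, h3⟩, hj⟩ | ⟨⟨h, h2⟩, h3⟩)
      · obtain ⟨rfl, rfl⟩ := Prod.ext_iff.mp hj
        exact ⟨⟨Or.inl rfl, h2⟩, h3⟩
      · exact ⟨⟨Or.inr h, h2⟩, h3⟩
  rw [h, Finset.card_union_of_disjoint, Finset.card_map]
  rw [Finset.disjoint_left]
  rintro ⟨x, y⟩ hx hy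
  simp only [Finset.mem_map, Function.Embedding.coeFn_mk, Prod.mk.injEq] at hx
  obtain ⟨j, _, hj⟩ := hx
  obtain ⟨rfl, rfl⟩ := Prod.ext_iff.mp hj
  simp only [Finset.mem_filter, Finset.mem_product] at hy
  exact hk hy.1.1

theorem gsign_union (k : Fin 6) (I J : Finset (Fin 6)) (h : Disjoint I J) :
    gsign k (I ∪ J) = gsign k I * gsign k J := by
  unfold gsign
  rw [← pow_add, Finset.filter_union, Finset.card_union_of_disjoint]
  exact Finset.disjoint_filter_filter h

theorem gmul_gext_left (k : Fin 6) (a b : Grass) : gmul (gext k a) b = gext k (gmul a b) := by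
  funext K
  rw [gext_apply]
  split_ifs with hk
  · have hK : K = insert k (K.erase k) := (Finset.insert_erase hk).symm
    unfold gmul
    rw [hK, Finset.sum_powerset_insert (Finset.notMem_erase k K), ← hK, Finset.mul_sum]
    have h0 : ∑ t ∈ (K.erase k).powerset, monoSign t (K \ t) * gext k a t * b (K \ t) = 0 := by
      refine Finset.sum_eq_zero fun t ht => ?_
      have : k ∉ t := fun h => by simpa using Finset.mem_powerset.mp ht h
      simp [gext_apply, this]
    rw [h0, zero_add]
    refine Finset.sum_congr rfl fun t ht => ?_
    have hkt : k ∉ t := fun h => by simpa using Finset.mem_powerset.mp ht h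
    have hsub : t ⊆ K.erase k := Finset.mem_powerset.mp ht
    have hd : K \ insert k t = K.erase k \ t := by
      ext x
      simp only [Finset.mem_sdiff, Finset.mem_insert, Finset.mem_erase]
      tauto
    have hs : gsign k K = gsign k t * gsign k (K.erase k \ t) := by
      rw [← gsign_union _ _ _ Finset.disjoint_sdiff, Finset.union_sdiff_of_subset hsub,
        gsign_erase _ _ _ hk]
      simp
    rw [hd, monoSign_insert _ _ _ hkt, gext_apply, if_pos (Finset.mem_insert_self k t),
      Finset.erase_insert hkt, gsign_insert _ _ _ hkt, hs]
    simp only [lt_irrefl, if_false]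
    ring
  · unfold gmul
    refine Finset.sum_eq_zero fun t ht => ?_
    have : k ∉ t := fun h => hk (Finset.mem_powerset.mp ht h)
    simp [gext_apply, this]

theorem gmul_assoc (a b c : Grass) : gmul (gmul a b) c = gmul a (gmul b c) := by
  induction a using grass_induction with
  | one => simp only [gone_gmul]
  | add a a' h h' => simp only [add_gmul, h, h']
  | smul s a h => simp only [smul_gmul, h]
  | ext k a h => simp only [gmul_gext_left, h]

theorem gmul_gone (a : Grass) : gmul a gone = a := by
  induction a using grass_induction with
  | one => simp only [gone_gmul]
  | add a a' h h' => simp only [add_gmul, h, h']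
  | smul s a h => simp only [smul_gmul, h]
  | ext k a h => simp only [gmul_gext_left, h]

/-- The parity involution of the Grassmann algebra. -/
def ginv : Grass →ₗ[ℂ] Grass where
  toFun a := fun K => (-1) ^ K.card * a K
  map_add' a b := by
    funext K
    simp only [Pi.add_apply]
    ring
  map_smul' s a := by
    funext K
    simp only [Pi.smul_apply, smul_eq_mul, RingHom.id_apply]
    ring

theorem ginv_apply (a : Grass) (K : Finset (Fin 6)) : ginv a K = (-1) ^ K.card * a K := rfl

theorem ginv_ginv (a : Grass) : ginv (ginv a) = a := by
  funext K
  rw [ginv_apply, ginv_apply, ← mul_assoc, ← mul_pow]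
  simp

theorem ginv_gone : ginv gone = gone := by
  funext K
  rw [ginv_apply]
  by_cases h : K = ∅
  · simp [h]
  · simp [gone, Pi.single_eq_of_ne h]

theorem ginv_gext (k : Fin 6) (a : Grass) : ginv (gext k a) = -gext k (ginv a) := by
  funext K
  simp only [ginv_apply, gext_apply, Pi.neg_apply]
  split_ifs with h
  · rw [← Finset.card_erase_add_one h, pow_succ]
    ring
  · simp

theorem ginv_gcontr (k : Fin 6) (a : Grass) : ginv (gcontr k a) = -gcontr k (ginv a) := by
  funext K
  simp only [ginv_apply, gcontr_apply, Pi.neg_apply]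
  split_ifs with h
  · simp
  · rw [Finset.card_insert_of_notMem h, pow_succ]
    ring

theorem ginv_gmul (a b : Grass) : ginv (gmul a b) = gmul (ginv a) (ginv b) := by
  induction a using grass_induction with
  | one => simp only [gone_gmul, ginv_gone]
  | add a a' h h' => simp only [add_gmul, map_add, h, h']
  | smul s a h => simp only [smul_gmul, map_smul, h]
  | ext k a h =>
    rw [gmul_gext_left, ginv_gext, h, ginv_gext, ← gmul_gext_left, ← neg_one_smul ℂ,
      ← neg_one_smul ℂ (gext k (ginv a)), smul_gmul]

theorem neg_gmul (a b : Grass) : gmul (-a) b = -gmul a b := by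
  rw [← neg_one_smul ℂ, smul_gmul, neg_one_smul]

theorem gext_neg (k : Fin 6) (b : Grass) : gext k (-b) = -gext k b := map_neg (gextL k) b

theorem gcontr_neg (k : Fin 6) (b : Grass) : gcontr k (-b) = -gcontr k b := map_neg (gcontrL k) b

theorem gmul_gext_right (k : Fin 6) (a b : Grass) :
    gmul a (gext k b) = gext k (gmul (ginv a) b) := by
  induction a using grass_induction with
  | one => simp only [gone_gmul, ginv_gone]
  | add a a' h h' => simp only [add_gmul, map_add, h, h', gext_add]
  | smul s a h => simp only [smul_gmul, map_smul, h, gext_smul]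
  | ext l a h =>
    rw [gmul_gext_left, h, gext_gext, ginv_gext, neg_gmul, gmul_gext_left, gext_neg]

/-- Contractions are graded derivations. -/
theorem gcontr_gmul (k : Fin 6) (a b : Grass) :
    gcontr k (gmul a b) = gmul (gcontr k a) b + gmul (ginv a) (gcontr k b) := by
  induction a using grass_induction with
  | one =>
    have : gcontr k gone = 0 := by
      funext K
      rw [gcontr_apply]
      split_ifs <;> simp [gone]
    simp only [gone_gmul, ginv_gone, this, zero_gmul, zero_add]
  | add a a' h h' =>
    simp only [add_gmul, map_add, h, h', gcontr_add]
    abel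
  | smul s a h => simp only [smul_gmul, map_smul, h, gcontr_smul, smul_add]
  | ext l a h =>
    rw [gmul_gext_left, gcontr_gext, h, gcontr_gext, ginv_gext, sub_eq_add_neg, sub_eq_add_neg,
      add_gmul, neg_gmul, neg_gmul, gmul_gext_left, gmul_gext_left, gext_add]
    split_ifs
    · abel
    · rw [zero_gmul]
      abel

/-- The power of the parity involution. -/
def gpow (p : ZMod 2) (a : Grass) : Grass := if p = 0 then a else ginv a

theorem psign_zero : psign 0 = 1 := rfl

theorem psign_one : psign 1 = -1 := rfl

theorem zmod_two_cases (p : ZMod 2) : p = 0 ∨ p = 1 := by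
  revert p
  decide

theorem psign_add (p q : ZMod 2) : psign (p + q) = psign p * psign q := by
  rcases zmod_two_cases p with rfl | rfl <;> rcases zmod_two_cases q with rfl | rfl <;>
    simp [psign, show (1 : ZMod 2) + 1 = 0 from rfl]

theorem psign_mul_self (p : ZMod 2) : psign p * psign p = 1 := by
  rcases zmod_two_cases p with rfl | rfl <;> simp [psign]

/-- A homogeneous element commutes with every element up to the parity involution. -/
theorem gmul_comm_of_parity (p : ZMod 2) (a b : Grass) (ha : ginv a = psign p • a) :
    gmul a b = gmul (gpow p b) a := by
  have key : ∀ b, (p = 0 → gmul a b = gmul b a) ∧ (p = 1 → gmul a b = gmul (ginv b) a) := by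
    intro b
    induction b using grass_induction with
    | one => simp only [gone_gmul, gmul_gone, ginv_gone, implies_true, and_self]
    | add b b' h h' =>
      exact ⟨fun h0 => by rw [gmul_add, add_gmul, h.1 h0, h'.1 h0],
        fun h0 => by rw [gmul_add, map_add, add_gmul, h.2 h0, h'.2 h0]⟩
    | smul s b h =>
      exact ⟨fun h0 => by rw [gmul_smul, smul_gmul, h.1 h0],
        fun h0 => by rw [gmul_smul, map_smul, smul_gmul, h.2 h0]⟩
    | ext k b h =>
      constructor
      · rintro rfl
        rw [gmul_gext_right, ha, psign_zero, one_smul, h.1 rfl, gmul_gext_left]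
      · rintro rfl
        rw [gmul_gext_right, ha, psign_one, neg_one_smul, neg_gmul, h.2 rfl, ginv_gext, neg_gmul,
          gmul_gext_left, gext_neg]
  unfold gpow
  split_ifs with hp
  · exact (key b).1 hp
  · exact (key b).2 ((zmod_two_cases p).resolve_left hp)


/-! ### Algebra maps induced by matrices -/

theorem card_filter_lt_orderEmbOfFin {K : Finset (Fin 6)} {n : ℕ} (hK : K.card = n) (r : Fin n) :
    (K.filter (· < K.orderEmbOfFin hK r)).card = r := by
  have h : K.filter (· < K.orderEmbOfFin hK r) =
      (Finset.univ.filter (· < r)).map (K.orderEmbOfFin hK).toEmbedding := by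
    ext x
    simp only [Finset.mem_filter, Finset.mem_map, Finset.mem_univ, true_and,
      RelEmbedding.coe_toEmbedding]
    constructor
    · rintro ⟨hx, hlt⟩
      have hx' : x ∈ Set.range (K.orderEmbOfFin hK) := by
        rw [Finset.range_orderEmbOfFin]
        exact hx
      obtain ⟨i, rfl⟩ := hx'
      exact ⟨i, (K.orderEmbOfFin hK).lt_iff_lt.mp hlt, rfl⟩
    · rintro ⟨i, hi, rfl⟩
      exact ⟨Finset.orderEmbOfFin_mem _ _ _, (K.orderEmbOfFin hK).lt_iff_lt.mpr hi⟩
  rw [h, Finset.card_map]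
  have : (Finset.univ.filter (· < r)) = Finset.Iio r := by
    ext x
    simp
  rw [this, Fin.card_Iio]

theorem gsign_orderEmbOfFin {K : Finset (Fin 6)} {n : ℕ} (hK : K.card = n) (r : Fin n) :
    gsign (K.orderEmbOfFin hK r) K = (-1) ^ (r : ℕ) := by
  unfold gsign
  rw [card_filter_lt_orderEmbOfFin]

theorem orderEmbOfFin_erase {K : Finset (Fin 6)} {n : ℕ} (hK : K.card = n + 1) (r : Fin (n + 1))
    (hE : (K.erase (K.orderEmbOfFin hK r)).card = n) (s : Fin n) :
    (K.erase (K.orderEmbOfFin hK r)).orderEmbOfFin hE s = K.orderEmbOfFin hK (r.succAbove s) := by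
  have := Finset.orderEmbOfFin_unique hE (f := fun s => K.orderEmbOfFin hK (r.succAbove s))
    (fun x => by
      rw [Finset.mem_erase]
      refine ⟨fun h => ?_, Finset.orderEmbOfFin_mem _ _ _⟩
      exact Fin.succAbove_ne r x ((K.orderEmbOfFin hK).injective h))
    ((K.orderEmbOfFin hK).strictMono.comp (Fin.strictMono_succAbove r))
  exact (congrFun this s).symm

theorem gminor_eq_det (M : Matrix (Fin 6) (Fin 6) ℂ) {K I : Finset (Fin 6)} {n : ℕ}
    (hK : K.card = n) (hI : I.card = n) :
    gminor M K I = Matrix.det (Matrix.of fun r s : Fin n =>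
      M (K.orderEmbOfFin hK r) (I.orderEmbOfFin hI s)) := by
  subst hK
  unfold gminor
  rw [dif_pos hI]

theorem gminor_of_card_ne (M : Matrix (Fin 6) (Fin 6) ℂ) {K I : Finset (Fin 6)}
    (h : I.card ≠ K.card) : gminor M K I = 0 := by
  unfold gminor
  rw [dif_neg h]

/-- Expansion of a minor along an additional first column, as a sum over the rows. -/
theorem sum_gminor_erase (M : Matrix (Fin 6) (Fin 6) ℂ) (v : Fin 6 → ℂ) {K I : Finset (Fin 6)}
    {n : ℕ} (hK : K.card = n + 1) (hI : I.card = n) :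
    ∑ j ∈ K, v j * (gsign j K * gminor M (K.erase j) I) =
      ∑ r : Fin (n + 1), (-1) ^ (r : ℕ) * v (K.orderEmbOfFin hK r) *
        Matrix.det (Matrix.of fun r' s : Fin n =>
          M (K.orderEmbOfFin hK (r.succAbove r')) (I.orderEmbOfFin hI s)) := by
  have h : K = Finset.univ.map (K.orderEmbOfFin hK).toEmbedding := by
    rw [Finset.map_orderEmbOfFin_univ]
  conv_lhs => rw [h, Finset.sum_map]
  refine Finset.sum_congr rfl fun r _ => ?_
  rw [RelEmbedding.coe_toEmbedding, ← h, gsign_orderEmbOfFin]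
  have hE : (K.erase (K.orderEmbOfFin hK r)).card = n := by
    rw [Finset.card_erase_of_mem (Finset.orderEmbOfFin_mem _ _ _), hK]
    rfl
  rw [gminor_eq_det M hE hI]
  simp only [orderEmbOfFin_erase]
  ring

theorem gsubst_single (M : Matrix (Fin 6) (Fin 6) ℂ) (I : Finset (Fin 6)) (s : ℂ)
    (K : Finset (Fin 6)) : gsubst M (Pi.single I s) K = gminor M K I * s := by
  unfold gsubst
  rw [Finset.sum_eq_single I]
  · simp
  · intro J _ hJ
    simp [Pi.single_eq_of_ne hJ]
  · simp

/-- `gsubst` as a linear map. -/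
def gsubstL (M : Matrix (Fin 6) (Fin 6) ℂ) : Grass →ₗ[ℂ] Grass :=
  ⟨⟨gsubst M, gsubst_add M⟩, gsubst_smul M⟩

@[simp] theorem gsubstL_apply (M : Matrix (Fin 6) (Fin 6) ℂ) (a : Grass) :
    gsubstL M a = gsubst M a := rfl

theorem gext_single_of_mem (k : Fin 6) (I : Finset (Fin 6)) (hk : k ∈ I) (s : ℂ) :
    gext k (Pi.single I s) = 0 := by
  funext K
  rw [gext_apply]
  split_ifs with hK
  · rw [Pi.single_eq_of_ne, mul_zero]
    · rfl
    · rintro rfl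
      simp at hk
  · rfl

/-- Laplace expansion: `gsubst M` sends the generator `k` to `∑ j, M j k • (generator j)` and is
compatible with the multiplication by generators. -/
theorem gsubst_gext (M : Matrix (Fin 6) (Fin 6) ℂ) (k : Fin 6) (a : Grass) :
    gsubst M (gext k a) = ∑ j, M j k • gext j (gsubst M a) := by
  have h : a = ∑ I, a I • (Pi.single I 1 : Grass) := by
    funext K
    simp [Finset.sum_apply, Pi.single_apply]
  suffices H : ∀ I : Finset (Fin 6), gsubst M (gext k (Pi.single I 1)) =
      ∑ j, M j k • gext j (gsubst M (Pi.single I 1)) by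
    have H' : (gsubstL M) ∘ₗ (gextL k) = ∑ j, M j k • (gextL j ∘ₗ gsubstL M) := by
      refine LinearMap.pi_ext' fun I => LinearMap.ext_ring ?_
      simpa [LinearMap.sum_apply] using H I
    simpa [LinearMap.sum_apply] using congrArg (fun L => L a) H'
  intro I
  funext K
  have hR : (∑ j, M j k • gext j (gsubst M (Pi.single I 1))) K =
      ∑ j ∈ K, M j k * (gsign j K * gminor M (K.erase j) I) := by
    rw [Finset.sum_apply, ← Finset.sum_filter_add_sum_filter_not Finset.univ (· ∈ K)]
    rw [Finset.sum_eq_zero (s := Finset.univ.filter (fun j => ¬ j ∈ K)), add_zero,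
      Finset.filter_univ_mem]
    · refine Finset.sum_congr rfl fun j hj => ?_
      simp [gext_apply, hj, gsubst_single]
    · intro j hj
      simp only [Finset.mem_filter, Finset.mem_univ, true_and] at hj
      simp [gext_apply, hj]
  rw [hR]
  by_cases hc : I.card + 1 = K.card
  · rw [sum_gminor_erase M (fun j => M j k) hc.symm rfl]
    by_cases hk : k ∈ I
    · rw [gext_single_of_mem _ _ hk, ← gsubstL_apply, map_zero, Pi.zero_apply]
      obtain ⟨s, hs⟩ : k ∈ Set.range (I.orderEmbOfFin rfl) := by
        rw [Finset.range_orderEmbOfFin]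
        exact hk
      -- the expansion along the first column of a matrix with two equal columns
      let B : Matrix (Fin (I.card + 1)) (Fin (I.card + 1)) ℂ := Matrix.of fun r =>
        Fin.cons (M (K.orderEmbOfFin hc.symm r) k)
          (fun s => M (K.orderEmbOfFin hc.symm r) (I.orderEmbOfFin rfl s))
      have hB : B.det = 0 := Matrix.det_zero_of_column_eq (Fin.succ_ne_zero s).symm fun r => by
        simp [B, hs]
      rw [Matrix.det_succ_column_zero] at hB
      exact hB.symm
    · rw [gext_single _ _ hk, gsubst_single]
      have hcard : (insert k I).card = I.card + 1 := Finset.card_insert_of_notMem hk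
      obtain ⟨s, hs⟩ : k ∈ Set.range ((insert k I).orderEmbOfFin hcard) := by
        rw [Finset.range_orderEmbOfFin]
        simp
      have hE : ((insert k I).erase ((insert k I).orderEmbOfFin hcard s)).card = I.card := by
        rw [hs, Finset.erase_insert hk]
      have hI : ∀ t : Fin I.card, (insert k I).orderEmbOfFin hcard (s.succAbove t) =
          I.orderEmbOfFin rfl t := by
        intro t
        rw [← orderEmbOfFin_erase hcard s hE t]
        congr 1
        · congr 1
          rw [hs, Finset.erase_insert hk]
      have hsign : gsign k I = (-1) ^ (s : ℕ) := by
        rw [← gsign_orderEmbOfFin hcard s, hs, gsign_insert _ _ _ hk]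
        simp
      rw [gminor_eq_det M hc.symm hcard, Matrix.det_succ_column _ s, hsign, mul_one,
        Finset.sum_mul]
      refine Finset.sum_congr rfl fun r _ => ?_
      simp only [Matrix.of_apply, hs, Matrix.submatrix]
      simp only [hI]
      rw [pow_add]
      have : ((-1 : ℂ) ^ (s : ℕ)) * (-1) ^ (s : ℕ) = 1 := by
        rw [← mul_pow]
        simp
      linear_combination ((-1) ^ (r : ℕ) * M (K.orderEmbOfFin hc.symm r) k *
        Matrix.det (Matrix.of fun r' s : Fin I.card =>
          M (K.orderEmbOfFin hc.symm (r.succAbove r')) (I.orderEmbOfFin rfl s))) * this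
  · rw [Finset.sum_eq_zero]
    · by_cases hk : k ∈ I
      · rw [gext_single_of_mem _ _ hk, ← gsubstL_apply, map_zero, Pi.zero_apply]
      · rw [gext_single _ _ hk, gsubst_single, gminor_of_card_ne, zero_mul]
        rwa [Finset.card_insert_of_notMem hk]
    · intro j hj
      rw [gminor_of_card_ne, mul_zero, mul_zero]
      rw [Finset.card_erase_of_mem hj]
      have := Finset.card_pos.mpr ⟨j, hj⟩
      omega

theorem gsubst_gone (M : Matrix (Fin 6) (Fin 6) ℂ) : gsubst M gone = gone := by
  funext K
  rw [gone, gsubst_single]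
  by_cases hK : K = ∅
  · subst hK
    rw [gminor_eq_det M (n := 0) rfl rfl]
    simp
  · rw [gminor_of_card_ne, Pi.single_eq_of_ne hK, zero_mul]
    simpa using fun h : 0 = K.card => hK (Finset.card_eq_zero.mp h.symm)

theorem gsubst_neg (M : Matrix (Fin 6) (Fin 6) ℂ) (a : Grass) : gsubst M (-a) = -gsubst M a :=
  map_neg (gsubstL M) a

theorem gsubst_sum {ι : Type*} (M : Matrix (Fin 6) (Fin 6) ℂ) (s : Finset ι) (a : ι → Grass) :
    gsubst M (∑ i ∈ s, a i) = ∑ i ∈ s, gsubst M (a i) := map_sum (gsubstL M) a s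

theorem gext_sum {ι : Type*} (k : Fin 6) (s : Finset ι) (a : ι → Grass) :
    gext k (∑ i ∈ s, a i) = ∑ i ∈ s, gext k (a i) := map_sum (gextL k) a s

theorem gcontr_sum {ι : Type*} (k : Fin 6) (s : Finset ι) (a : ι → Grass) :
    gcontr k (∑ i ∈ s, a i) = ∑ i ∈ s, gcontr k (a i) := map_sum (gcontrL k) a s

theorem sum_gmul {ι : Type*} (s : Finset ι) (a : ι → Grass) (b : Grass) :
    gmul (∑ i ∈ s, a i) b = ∑ i ∈ s, gmul (a i) b := by
  have h := congrArg (fun L : Grass →ₗ[ℂ] Grass => L b) (map_sum gmulL a s)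
  rwa [LinearMap.sum_apply] at h

theorem gmul_sum {ι : Type*} (s : Finset ι) (a : ι → Grass) (b : Grass) :
    gmul b (∑ i ∈ s, a i) = ∑ i ∈ s, gmul b (a i) := map_sum (gmulL b) a s

theorem gsubst_gmul (M : Matrix (Fin 6) (Fin 6) ℂ) (a b : Grass) :
    gsubst M (gmul a b) = gmul (gsubst M a) (gsubst M b) := by
  induction a using grass_induction with
  | one => simp only [gone_gmul, gsubst_gone]
  | add a a' h h' => simp only [add_gmul, gsubst_add, h, h']
  | smul s a h => simp only [smul_gmul, gsubst_smul, h]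
  | ext k a h =>
    rw [gmul_gext_left, gsubst_gext, gsubst_gext, h, sum_gmul]
    simp only [smul_gmul, gmul_gext_left]

theorem ginv_gsubst (M : Matrix (Fin 6) (Fin 6) ℂ) (a : Grass) :
    ginv (gsubst M a) = gsubst M (ginv a) := by
  induction a using grass_induction with
  | one => simp only [ginv_gone, gsubst_gone]
  | add a a' h h' => simp only [gsubst_add, map_add, h, h']
  | smul s a h => simp only [gsubst_smul, map_smul, h]
  | ext k a h =>
    rw [gsubst_gext, ginv_gext, gsubst_neg, gsubst_gext, map_sum]
    simp only [map_smul, ginv_gext, h, smul_neg, Finset.sum_neg_distrib]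

theorem gcontr_gone (k : Fin 6) : gcontr k gone = 0 := by
  funext K
  rw [gcontr_apply]
  split_ifs <;> simp [gone]

/-- Contractions transform under `gsubst` by the transposed matrix. -/
theorem gcontr_gsubst (M : Matrix (Fin 6) (Fin 6) ℂ) (l : Fin 6) (a : Grass) :
    gcontr l (gsubst M a) = ∑ k, M l k • gsubst M (gcontr k a) := by
  induction a using grass_induction with
  | one =>
    have h0 : gsubst M 0 = 0 := map_zero (gsubstL M)
    simp [gsubst_gone, gcontr_gone, h0]
  | add a a' h h' => simp only [gsubst_add, gcontr_add, h, h', smul_add, Finset.sum_add_distrib]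
  | smul s a h =>
    simp only [gsubst_smul, gcontr_smul, h, Finset.smul_sum]
    exact Finset.sum_congr rfl fun k _ => smul_comm _ _ _
  | ext m a h =>
    have e1 : ∀ k, gsubst M (gcontr k (gext m a)) =
        (if k = m then gsubst M a else 0) - ∑ j, M j m • gext j (gsubst M (gcontr k a)) := by
      intro k
      rw [gcontr_gext, sub_eq_add_neg, gsubst_add, gsubst_neg, gsubst_gext, sub_eq_add_neg]
      congr 1
      split_ifs
      · rfl
      · exact map_zero (gsubstL M)
    have e2 : ∀ j, gcontr l (M j m • gext j (gsubst M a)) =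
        (if l = j then M j m • gsubst M a else 0) -
          M j m • gext j (∑ k, M l k • gsubst M (gcontr k a)) := by
      intro j
      rw [gcontr_smul, gcontr_gext, h, smul_sub]
      split_ifs <;> simp
    simp only [gsubst_gext, gcontr_sum, e1, e2, Finset.sum_sub_distrib, smul_sub,
      Finset.sum_ite_eq, Finset.sum_ite_eq', Finset.mem_univ, if_true, smul_ite, smul_zero]
    congr 1
    simp only [gext_sum, gext_smul, Finset.smul_sum]
    rw [Finset.sum_comm]
    exact Finset.sum_congr rfl fun k _ => Finset.sum_congr rfl fun j _ => smul_comm _ _ _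

/-- The even derivation of the Grassmann algebra that sends the generator `j` to
`∑ i, N i j • (generator i)`. -/
def ghat (N : Matrix (Fin 6) (Fin 6) ℂ) (a : Grass) : Grass :=
  ∑ i, ∑ j, N i j • gext i (gcontr j a)

theorem ghat_add (N : Matrix (Fin 6) (Fin 6) ℂ) (a b : Grass) :
    ghat N (a + b) = ghat N a + ghat N b := by
  simp only [ghat, gcontr_add, gext_add, smul_add, Finset.sum_add_distrib]

theorem ghat_smul (N : Matrix (Fin 6) (Fin 6) ℂ) (s : ℂ) (a : Grass) :
    ghat N (s • a) = s • ghat N a := by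
  simp only [ghat, gcontr_smul, gext_smul, Finset.smul_sum]
  exact Finset.sum_congr rfl fun i _ => Finset.sum_congr rfl fun j _ => smul_comm _ _ _

theorem ghat_gext (N : Matrix (Fin 6) (Fin 6) ℂ) (k : Fin 6) (a : Grass) :
    ghat N (gext k a) = ∑ i, N i k • gext i a + gext k (ghat N a) := by
  have e : ∀ i j, N i j • gext i (gcontr j (gext k a)) =
      (if j = k then N i j • gext i a else 0) + gext k (N i j • gext i (gcontr j a)) := by
    intro i j
    rw [gcontr_gext, sub_eq_add_neg, gext_add, gext_neg, gext_gext i k, neg_neg, smul_add,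
      gext_smul]
    congr 1
    split_ifs
    · rfl
    · rw [← gextL_apply, map_zero, smul_zero]
  unfold ghat
  simp only [e, Finset.sum_add_distrib, Finset.sum_ite_eq', Finset.mem_univ, if_true, gext_sum]

theorem ghat_gone (N : Matrix (Fin 6) (Fin 6) ℂ) : ghat N gone = 0 := by
  unfold ghat
  refine Finset.sum_eq_zero fun i _ => Finset.sum_eq_zero fun j _ => ?_
  rw [gcontr_gone, ← gextL_apply, map_zero, smul_zero]

theorem HasDerivAt.gextc {f : ℝ → Grass} {f' : Grass} {t : ℝ} (k : Fin 6)
    (h : HasDerivAt f f' t) : HasDerivAt (fun s => gext k (f s)) (gext k f') t := by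
  rw [hasDerivAt_pi] at h ⊢
  intro K
  simp only [gext_apply]
  split_ifs
  · exact (h (K.erase k)).const_mul _
  · exact hasDerivAt_const _ _

/-- The derivative of `gsubst (F t) a` along a curve of matrices. -/
theorem hasDerivAt_gsubst_const {F : ℝ → Matrix (Fin 6) (Fin 6) ℂ}
    {F' N : Matrix (Fin 6) (Fin 6) ℂ} {t : ℝ}
    (hF : ∀ i j, HasDerivAt (fun s => F s i j) (F' i j) t) (hN : F' = F t * N) (a : Grass) :
    HasDerivAt (fun s => gsubst (F s) a) (gsubst (F t) (ghat N a)) t := by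
  induction a using grass_induction with
  | one =>
    have h0 : gsubst (F t) 0 = 0 := map_zero (gsubstL (F t))
    simp only [gsubst_gone, ghat_gone, h0]
    exact hasDerivAt_const _ _
  | add a a' h h' =>
    simp only [gsubst_add, ghat_add]
    exact h.add h'
  | smul s a h =>
    simp only [gsubst_smul, ghat_smul]
    exact h.const_smul s
  | ext k a h =>
    simp only [gsubst_gext, ghat_gext, gsubst_add, gsubst_sum, gsubst_smul]
    have h1 := HasDerivAt.fun_sum (u := Finset.univ) fun j _ =>
      (hF j k).smul (HasDerivAt.gextc j h)
    refine h1.congr_deriv ?_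
    simp only [Finset.sum_add_distrib, hN, Matrix.mul_apply, Finset.sum_smul, Finset.smul_sum]
    rw [add_comm, Finset.sum_comm (γ := Fin 6)]
    congr 1
    refine Finset.sum_congr rfl fun j _ => Finset.sum_congr rfl fun i _ => ?_
    rw [smul_smul, mul_comm]

theorem hasDerivAt_gsubst {F : ℝ → Matrix (Fin 6) (Fin 6) ℂ}
    {F' N : Matrix (Fin 6) (Fin 6) ℂ} {t : ℝ}
    (hF : ∀ i j, HasDerivAt (fun s => F s i j) (F' i j) t) (hN : F' = F t * N)
    {b : ℝ → Grass} {b' : Grass} (hb : HasDerivAt b b' t) :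
    HasDerivAt (fun s => gsubst (F s) (b s))
      (gsubst (F t) b' + gsubst (F t) (ghat N (b t))) t := by
  have h : ∀ a : Grass, a = ∑ I, a I • (Pi.single I 1 : Grass) := by
    intro a
    funext K
    simp [Finset.sum_apply, Pi.single_apply]
  have e : ∀ (M : Matrix (Fin 6) (Fin 6) ℂ) (a : Grass),
      gsubst M a = ∑ I, a I • gsubst M (Pi.single I 1) := by
    intro M a
    conv_lhs => rw [h a]
    simp only [gsubst_sum, gsubst_smul]
  have e' : ghat N (b t) = ∑ I, b t I • ghat N (Pi.single I 1) := by
    conv_lhs => rw [h (b t)]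
    let L : Grass →ₗ[ℂ] Grass := ⟨⟨ghat N, ghat_add N⟩, ghat_smul N⟩
    exact (map_sum L _ _).trans (Finset.sum_congr rfl fun I _ => map_smul L _ _)
  rw [hasDerivAt_pi] at hb
  have h1 := HasDerivAt.fun_sum (u := Finset.univ) fun I _ =>
    (hb I).smul (hasDerivAt_gsubst_const hF hN (Pi.single I 1))
  have hf : (fun s => gsubst (F s) (b s)) =
      fun s => ∑ I, b s I • gsubst (F s) (Pi.single I 1) := funext fun s => e _ _
  rw [hf]
  refine h1.congr_deriv ?_
  · rw [e', e (F t) b', gsubst_sum, ← Finset.sum_add_distrib]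
    exact Finset.sum_congr rfl fun I _ => by rw [gsubst_smul, add_comm]


/-! ### Calculus of the Wirtinger derivatives -/

/-- The common form of the two Wirtinger derivatives: `s = -i` gives `∂/∂z_i` and `s = i` gives
`∂/∂z̄_i`. -/
def wirt (s : ℂ) (i : Fin 3) (f : V → Grass) (z : V) : Grass :=
  (1 / 2 : ℂ) • (fderiv ℝ f z (Pi.single i 1) + s • fderiv ℝ f z (Pi.single i Complex.I))

theorem dz_eq_wirt (i : Fin 3) : dz i = wirt (-Complex.I) i := by
  funext f z
  simp only [dz, wirt, neg_smul, sub_eq_add_neg]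

theorem dzbar_eq_wirt (i : Fin 3) : dzbar i = wirt Complex.I i := rfl

theorem _root_.ContDiffAt.differentiable {E F : Type*} [NormedAddCommGroup E] [NormedSpace ℝ E]
    [NormedAddCommGroup F] [NormedSpace ℝ F] {f : E → F} {z : E} (h : ContDiffAt ℝ ∞ f z) :
    DifferentiableAt ℝ f z := h.differentiableAt (by simp)

theorem wirt_congr {s : ℂ} {i : Fin 3} {f g : V → Grass} {z : V} (h : f =ᶠ[𝓝 z] g) :
    wirt s i f z = wirt s i g z := by
  simp only [wirt, h.fderiv_eq]

theorem wirt_add {s : ℂ} {i : Fin 3} {f g : V → Grass} {z : V} (hf : ContDiffAt ℝ ∞ f z)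
    (hg : ContDiffAt ℝ ∞ g z) : wirt s i (fun w => f w + g w) z = wirt s i f z + wirt s i g z := by
  simp only [wirt, fderiv_fun_add hf.differentiable hg.differentiable,
    ContinuousLinearMap.add_apply]
  module

/-- A linear endomorphism of the Grassmann algebra as a continuous real linear map. -/
def toCLM (L : Grass →ₗ[ℂ] Grass) : Grass →L[ℝ] Grass :=
  (L.restrictScalars ℝ).toContinuousLinearMap

@[simp] theorem toCLM_apply (L : Grass →ₗ[ℂ] Grass) (a : Grass) : toCLM L a = L a := rfl

theorem _root_.ContDiffAt.linear {f : V → Grass} {z : V} (hf : ContDiffAt ℝ ∞ f z)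
    (L : Grass →ₗ[ℂ] Grass) : ContDiffAt ℝ ∞ (fun w => L (f w)) z :=
  (toCLM L).contDiff.contDiffAt.comp z hf

theorem wirt_linear {s : ℂ} {i : Fin 3} {f : V → Grass} {z : V} (hf : ContDiffAt ℝ ∞ f z)
    (L : Grass →ₗ[ℂ] Grass) : wirt s i (fun w => L (f w)) z = L (wirt s i f z) := by
  have h : fderiv ℝ (fun w => L (f w)) z = (toCLM L).comp (fderiv ℝ f z) :=
    ((toCLM L).hasFDerivAt.comp z hf.differentiable.hasFDerivAt).fderiv
  simp only [wirt, h, ContinuousLinearMap.comp_apply, toCLM_apply, map_smul, map_add]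

theorem wirt_gext {s : ℂ} {i : Fin 3} {f : V → Grass} {z : V} (hf : ContDiffAt ℝ ∞ f z)
    (k : Fin 6) : wirt s i (fun w => gext k (f w)) z = gext k (wirt s i f z) :=
  wirt_linear hf (gextL k)

theorem wirt_gcontr {s : ℂ} {i : Fin 3} {f : V → Grass} {z : V} (hf : ContDiffAt ℝ ∞ f z)
    (k : Fin 6) : wirt s i (fun w => gcontr k (f w)) z = gcontr k (wirt s i f z) :=
  wirt_linear hf (gcontrL k)

theorem wirt_smul {s : ℂ} {i : Fin 3} {f : V → Grass} {z : V} (hf : ContDiffAt ℝ ∞ f z)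
    (t : ℂ) : wirt s i (fun w => t • f w) z = t • wirt s i f z := by
  exact wirt_linear hf (t • LinearMap.id)

theorem wirt_sum {ι : Type*} {s : ℂ} {i : Fin 3} (u : Finset ι) {f : ι → V → Grass} {z : V}
    (hf : ∀ j, ContDiffAt ℝ ∞ (f j) z) :
    wirt s i (fun w => ∑ j ∈ u, f j w) z = ∑ j ∈ u, wirt s i (f j) z := by
  simp only [wirt, fderiv_fun_sum (fun j _ => (hf j).differentiable),
    ContinuousLinearMap.sum_apply, Finset.smul_sum, ← Finset.sum_add_distrib]

theorem _root_.ContDiffAt.fderiv_const {f : V → Grass} {z : V} (hf : ContDiffAt ℝ ∞ f z) (v : V) :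
    ContDiffAt ℝ ∞ (fun w => fderiv ℝ f w v) z :=
  (hf.fderiv_right (m := ∞) (by simp)).clm_apply contDiffAt_const

theorem _root_.ContDiffAt.wirt {f : V → Grass} {z : V} (hf : ContDiffAt ℝ ∞ f z) (s : ℂ) (i : Fin 3) :
    ContDiffAt ℝ ∞ (BCOV.wirt s i f) z :=
  ((hf.fderiv_const _).add ((hf.fderiv_const _).linear (s • LinearMap.id))).linear
    ((1 / 2 : ℂ) • LinearMap.id)

theorem fderiv_fderiv_comm {f : V → Grass} {z : V} (hf : ContDiffAt ℝ ∞ f z) (u v : V) :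
    fderiv ℝ (fun w => fderiv ℝ f w v) z u = fderiv ℝ (fun w => fderiv ℝ f w u) z v := by
  have h : DifferentiableAt ℝ (fderiv ℝ f) z :=
    (hf.fderiv_right (m := ∞) (by simp)).differentiable
  have e : ∀ u v, fderiv ℝ (fun w => fderiv ℝ f w v) z u = fderiv ℝ (fderiv ℝ f) z u v := by
    intro u v
    rw [fderiv_clm_apply h (differentiableAt_const v)]
    simp
  rw [e, e]
  have := hf.isSymmSndFDerivAt (by
    rw [minSmoothness_of_isRCLikeNormedField]
    exact WithTop.coe_le_coe.mpr le_top)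
  exact this.eq u v

theorem wirt_comm {f : V → Grass} {z : V} (hf : ContDiffAt ℝ ∞ f z) (s t : ℂ) (i j : Fin 3) :
    wirt s i (wirt t j f) z = wirt t j (wirt s i f) z := by
  have e : ∀ (s t : ℂ) (i j : Fin 3), wirt s i (wirt t j f) z = (1 / 2 : ℂ) • ((1 / 2 : ℂ) •
      (fderiv ℝ (fun w => fderiv ℝ f w (Pi.single j 1)) z (Pi.single i 1) +
        t • fderiv ℝ (fun w => fderiv ℝ f w (Pi.single j Complex.I)) z (Pi.single i 1) +
        s • (fderiv ℝ (fun w => fderiv ℝ f w (Pi.single j 1)) z (Pi.single i Complex.I) +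
        t • fderiv ℝ (fun w => fderiv ℝ f w (Pi.single j Complex.I)) z
          (Pi.single i Complex.I)))) := by
    intro s t i j
    have h : ∀ u, fderiv ℝ (wirt t j f) z u = (1 / 2 : ℂ) •
      (fderiv ℝ (fun w => fderiv ℝ f w (Pi.single j 1)) z u +
        t • fderiv ℝ (fun w => fderiv ℝ f w (Pi.single j Complex.I)) z u) := by
      intro u
      have h1 := (hf.fderiv_const (Pi.single j 1)).differentiable.hasFDerivAt
      have h2 := ((toCLM (t • LinearMap.id)).hasFDerivAt.comp z
        (hf.fderiv_const (Pi.single j Complex.I)).differentiable.hasFDerivAt)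
      have h3 := (toCLM ((1 / 2 : ℂ) • LinearMap.id)).hasFDerivAt.comp z (h1.add h2)
      exact congrArg (fun L : V →L[ℝ] Grass => L u) h3.fderiv
    conv_lhs => rw [wirt]
    rw [h, h]
    module
  rw [e, e, fderiv_fderiv_comm hf (Pi.single i 1) (Pi.single j 1),
    fderiv_fderiv_comm hf (Pi.single i 1) (Pi.single j Complex.I),
    fderiv_fderiv_comm hf (Pi.single i Complex.I) (Pi.single j 1),
    fderiv_fderiv_comm hf (Pi.single i Complex.I) (Pi.single j Complex.I)]
  module

theorem _root_.ContDiffAt.gmul {f g : V → Grass} {z : V} (hf : ContDiffAt ℝ ∞ f z)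
    (hg : ContDiffAt ℝ ∞ g z) : ContDiffAt ℝ ∞ (fun w => BCOV.gmul (f w) (g w)) z := by
  rw [contDiffAt_pi] at hf hg ⊢
  intro K
  exact ContDiffAt.sum fun I _ => (contDiffAt_const.mul (hf I)).mul (hg (K \ I))

theorem fderiv_gmul {f g : V → Grass} {z : V} (hf : DifferentiableAt ℝ f z)
    (hg : DifferentiableAt ℝ g z) (v : V) :
    fderiv ℝ (fun w => gmul (f w) (g w)) z v =
      gmul (fderiv ℝ f z v) (g z) + gmul (f z) (fderiv ℝ g z v) := by
  have hf' := hasFDerivAt_pi'.mp hf.hasFDerivAt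
  have hg' := hasFDerivAt_pi'.mp hg.hasFDerivAt
  have h : HasFDerivAt (fun w => gmul (f w) (g w))
      (ContinuousLinearMap.pi fun K => ∑ I ∈ K.powerset,
        (((monoSign I (K \ I) * f z I) • ((ContinuousLinearMap.proj (K \ I)).comp (fderiv ℝ g z)) +
          (g z (K \ I)) • (monoSign I (K \ I) •
            ((ContinuousLinearMap.proj I).comp (fderiv ℝ f z)))) : V →L[ℝ] ℂ)) z := by
    rw [hasFDerivAt_pi]
    intro K
    exact HasFDerivAt.fun_sum fun I _ => (((hf' I).const_mul (monoSign I (K \ I))).mul (hg' (K \ I)))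
  rw [h.fderiv]
  funext K
  simp only [ContinuousLinearMap.coe_pi', ContinuousLinearMap.sum_apply,
    ContinuousLinearMap.add_apply, ContinuousLinearMap.smul_apply, ContinuousLinearMap.comp_apply,
    ContinuousLinearMap.proj_apply, smul_eq_mul, Pi.add_apply, gmul, ← Finset.sum_add_distrib]
  exact Finset.sum_congr rfl fun I _ => by ring

theorem wirt_gmul {s : ℂ} {i : Fin 3} {f g : V → Grass} {z : V} (hf : ContDiffAt ℝ ∞ f z)
    (hg : ContDiffAt ℝ ∞ g z) : wirt s i (fun w => gmul (f w) (g w)) z =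
      gmul (wirt s i f z) (g z) + gmul (f z) (wirt s i g z) := by
  simp only [wirt, fderiv_gmul hf.differentiable hg.differentiable, smul_gmul, gmul_smul, add_gmul,
    gmul_add]
  module

/-- The Wirtinger derivatives of a scalar function, as scalars. -/
def wirtS (s : ℂ) (i : Fin 3) (r : V → ℂ) (z : V) : ℂ :=
  (1 / 2 : ℂ) * (fderiv ℝ r z (Pi.single i 1) + s * fderiv ℝ r z (Pi.single i Complex.I))

theorem wirt_fsmul {s : ℂ} {i : Fin 3} {r : V → ℂ} {f : V → Grass} {z : V}
    (hr : ContDiffAt ℝ ∞ r z) (hf : ContDiffAt ℝ ∞ f z) :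
    wirt s i (fun w => r w • f w) z = wirtS s i r z • f z + r z • wirt s i f z := by
  have h : ∀ v, fderiv ℝ (fun w => r w • f w) z v = fderiv ℝ r z v • f z + r z • fderiv ℝ f z v := by
    intro v
    have hf' := hasFDerivAt_pi'.mp hf.differentiable.hasFDerivAt
    have hr' := hr.differentiable.hasFDerivAt
    have h1 : HasFDerivAt (fun w => r w • f w) (ContinuousLinearMap.pi fun K =>
        ((r z • ((ContinuousLinearMap.proj K).comp (fderiv ℝ f z)) +
          f z K • fderiv ℝ r z) : V →L[ℝ] ℂ)) z := by
      rw [hasFDerivAt_pi]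
      intro K
      exact hr'.mul (hf' K)
    rw [h1.fderiv]
    funext K
    simp only [ContinuousLinearMap.coe_pi', ContinuousLinearMap.add_apply,
      ContinuousLinearMap.smul_apply, ContinuousLinearMap.comp_apply,
      ContinuousLinearMap.proj_apply, smul_eq_mul, Pi.add_apply, Pi.smul_apply]
    ring
  simp only [wirt, wirtS, h]
  module

theorem fderiv_real_eq_of_analyticAt {r : V → ℂ} {z : V} (hr : AnalyticAt ℂ r z) :
    fderiv ℝ r z = (fderiv ℂ r z).restrictScalars ℝ :=
  (hr.differentiableAt.hasFDerivAt.restrictScalars ℝ).fderiv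

theorem single_I_eq (i : Fin 3) : (Pi.single i Complex.I : V) = Complex.I • Pi.single i 1 := by
  rw [← Pi.single_smul]
  simp

/-- Cauchy–Riemann equations. -/
theorem wirtS_dzbar_eq_zero {r : V → ℂ} {z : V} (hr : AnalyticAt ℂ r z) (i : Fin 3) :
    wirtS Complex.I i r z = 0 := by
  simp only [wirtS, fderiv_real_eq_of_analyticAt hr, ContinuousLinearMap.coe_restrictScalars',
    single_I_eq, map_smul, smul_eq_mul]
  linear_combination (1 / 2 * fderiv ℂ r z (Pi.single i 1)) * Complex.I_mul_I

theorem wirtS_dz_eq {r : V → ℂ} {z : V} (hr : AnalyticAt ℂ r z) (i : Fin 3) :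
    wirtS (-Complex.I) i r z = fderiv ℂ r z (Pi.single i 1) := by
  simp only [wirtS, fderiv_real_eq_of_analyticAt hr, ContinuousLinearMap.coe_restrictScalars',
    single_I_eq, map_smul, smul_eq_mul]
  linear_combination (-1 / 2 * fderiv ℂ r z (Pi.single i 1)) * Complex.I_mul_I

theorem _root_.AnalyticAt.contDiffAt_real {r : V → ℂ} {z : V} (hr : AnalyticAt ℂ r z) :
    ContDiffAt ℝ ∞ r z := (hr.contDiffAt (n := ∞)).restrict_scalars ℝ

theorem _root_.ContDiffAt.fsmul {r : V → ℂ} {f : V → Grass} {z : V}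
    (hr : ContDiffAt ℝ ∞ r z) (hf : ContDiffAt ℝ ∞ f z) :
    ContDiffAt ℝ ∞ (fun w => r w • f w) z := by
  rw [contDiffAt_pi] at hf ⊢
  exact fun K => hr.mul (hf K)


/-! ### Transformation of derivatives under holomorphic coordinate changes -/

/-- The block diagonal matrix with blocks `A`, acting on the generators `∂_{z_i}`, and `D`, acting on
the generators `dz̄_j`. -/
def blk (A D : Matrix (Fin 3) (Fin 3) ℂ) : Matrix (Fin 6) (Fin 6) ℂ :=
  Matrix.reindex finSumFinEquiv finSumFinEquiv (Matrix.fromBlocks A 0 0 D)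

theorem frameChange_eq_blk (τ σ : V → V) (z : V) :
    frameChange τ σ z = blk (jac τ z) (jac σ (τ z)).conjTranspose := rfl

theorem blk_mul (A D A' D' : Matrix (Fin 3) (Fin 3) ℂ) :
    blk A D * blk A' D' = blk (A * A') (D * D') := by
  unfold blk
  simp [Matrix.reindex_apply, Matrix.submatrix_mul_equiv, Matrix.fromBlocks_multiply]

theorem finSumFinEquiv_symm_xi (i : Fin 3) :
    (finSumFinEquiv (m := 3) (n := 3)).symm (xi i) = Sum.inl i :=
  finSumFinEquiv_symm_apply_castAdd (m := 3) (n := 3) i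

theorem finSumFinEquiv_symm_eta (i : Fin 3) :
    (finSumFinEquiv (m := 3) (n := 3)).symm (eta i) = Sum.inr i :=
  finSumFinEquiv_symm_apply_natAdd (m := 3) (n := 3) i

@[simp] theorem blk_xi_xi (A D : Matrix (Fin 3) (Fin 3) ℂ) (i j : Fin 3) :
    blk A D (xi i) (xi j) = A i j := by
  rw [blk, Matrix.reindex_apply, Matrix.submatrix_apply, finSumFinEquiv_symm_xi,
    finSumFinEquiv_symm_xi]
  rfl

@[simp] theorem blk_eta_eta (A D : Matrix (Fin 3) (Fin 3) ℂ) (i j : Fin 3) :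
    blk A D (eta i) (eta j) = D i j := by
  rw [blk, Matrix.reindex_apply, Matrix.submatrix_apply, finSumFinEquiv_symm_eta,
    finSumFinEquiv_symm_eta]
  rfl

@[simp] theorem blk_xi_eta (A D : Matrix (Fin 3) (Fin 3) ℂ) (i j : Fin 3) :
    blk A D (xi i) (eta j) = 0 := by
  rw [blk, Matrix.reindex_apply, Matrix.submatrix_apply, finSumFinEquiv_symm_xi,
    finSumFinEquiv_symm_eta]
  rfl

@[simp] theorem blk_eta_xi (A D : Matrix (Fin 3) (Fin 3) ℂ) (i j : Fin 3) :
    blk A D (eta i) (xi j) = 0 := by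
  rw [blk, Matrix.reindex_apply, Matrix.submatrix_apply, finSumFinEquiv_symm_eta,
    finSumFinEquiv_symm_xi]
  rfl

theorem sum_generators {M : Type*} [AddCommMonoid M] (f : Fin 6 → M) :
    ∑ k, f k = ∑ i, f (xi i) + ∑ j, f (eta j) := Fin.sum_univ_add (a := 3) (b := 3) f

theorem blk_add (A D A' D' : Matrix (Fin 3) (Fin 3) ℂ) :
    blk A D + blk A' D' = blk (A + A') (D + D') := by
  unfold blk
  ext i j
  simp only [Matrix.reindex_apply, Matrix.add_apply, Matrix.submatrix_apply]
  rw [← Matrix.add_apply, Matrix.fromBlocks_add, add_zero]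

theorem blk_smul (s : ℂ) (A D : Matrix (Fin 3) (Fin 3) ℂ) : s • blk A D = blk (s • A) (s • D) := by
  unfold blk
  ext i j
  simp only [Matrix.reindex_apply, Matrix.smul_apply, Matrix.submatrix_apply]
  rw [← Matrix.smul_apply, Matrix.fromBlocks_smul, smul_zero]

theorem ghat_add_left (M N : Matrix (Fin 6) (Fin 6) ℂ) (a : Grass) :
    ghat (M + N) a = ghat M a + ghat N a := by
  simp only [ghat, Matrix.add_apply, add_smul, Finset.sum_add_distrib]

theorem ghat_smul_left (s : ℂ) (N : Matrix (Fin 6) (Fin 6) ℂ) (a : Grass) :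
    ghat (s • N) a = s • ghat N a := by
  simp only [ghat, Matrix.smul_apply, smul_eq_mul, mul_smul, Finset.smul_sum]

theorem ghat_blk (P R : Matrix (Fin 3) (Fin 3) ℂ) (a : Grass) :
    ghat (blk P R) a = ∑ i, ∑ j, P i j • gext (xi i) (gcontr (xi j) a) +
      ∑ i, ∑ j, R i j • gext (eta i) (gcontr (eta j) a) := by
  unfold ghat
  simp [sum_generators]

theorem eq_sum_basis (w : V) :
    w = ∑ l, ((w l).re • (Pi.single l 1 : V) + (w l).im • (Pi.single l Complex.I : V)) := by
  have h : ∀ l, (w l).re • (Pi.single l 1 : V) + (w l).im • (Pi.single l Complex.I : V) =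
      Pi.single l (w l) := by
    intro l
    rw [← Pi.single_smul, ← Pi.single_smul, ← Pi.single_add]
    congr 1
    simp [Complex.re_add_im]
  simp only [h]
  exact (Finset.univ_sum_single w).symm

theorem clm_apply_eq (L : V →L[ℝ] Grass) (w : V) :
    L w = ∑ l, (((w l).re : ℂ) • L (Pi.single l 1) + ((w l).im : ℂ) • L (Pi.single l Complex.I)) := by
  conv_lhs => rw [eq_sum_basis w]
  simp only [map_sum, map_add, map_smul, Complex.coe_smul]

/-- A complex linear combination of `∂_{z_l}` as the `(1, 0)`-part of a directional derivative. -/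
theorem clm_dz (L : V →L[ℝ] Grass) (w : V) :
    (1 / 2 : ℂ) • (L w + (-Complex.I) • L (Complex.I • w)) =
      ∑ l, w l • ((1 / 2 : ℂ) • (L (Pi.single l 1) + (-Complex.I) • L (Pi.single l Complex.I))) := by
  rw [clm_apply_eq L w, clm_apply_eq L (Complex.I • w), Finset.smul_sum, ← Finset.sum_add_distrib,
    Finset.smul_sum]
  refine Finset.sum_congr rfl fun l _ => ?_
  have h1 : ((Complex.I • w) l).re = -(w l).im := by simp
  have h2 : ((Complex.I • w) l).im = (w l).re := by simp
  have h3 : w l = (w l).re + (w l).im * Complex.I := (Complex.re_add_im _).symm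
  rw [h1, h2]
  conv_rhs => rw [h3]
  have hI : Complex.I * Complex.I = -1 := Complex.I_mul_I
  match_scalars
  · push_cast
    linear_combination 0 * hI
  · push_cast
    linear_combination (1 / 2 * (w l).im : ℂ) * hI

theorem clm_dzbar (L : V →L[ℝ] Grass) (w : V) :
    (1 / 2 : ℂ) • (L w + Complex.I • L (Complex.I • w)) =
      ∑ l, (starRingEnd ℂ (w l)) •
        ((1 / 2 : ℂ) • (L (Pi.single l 1) + Complex.I • L (Pi.single l Complex.I))) := by
  rw [clm_apply_eq L w, clm_apply_eq L (Complex.I • w), Finset.smul_sum, ← Finset.sum_add_distrib,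
    Finset.smul_sum]
  refine Finset.sum_congr rfl fun l _ => ?_
  have h1 : ((Complex.I • w) l).re = -(w l).im := by simp
  have h2 : ((Complex.I • w) l).im = (w l).re := by simp
  have h3 : (starRingEnd ℂ) (w l) = (w l).re - (w l).im * Complex.I := by
    apply Complex.ext <;> simp
  rw [h1, h2, h3]
  have hI : Complex.I * Complex.I = -1 := Complex.I_mul_I
  match_scalars
  · push_cast
    linear_combination 0 * hI
  · push_cast
    linear_combination (1 / 2 * (w l).im : ℂ) * hI

/-- The derivative of the Jacobian matrix in the direction `v`. -/
def jacDeriv (τ : V → V) (z v : V) : Matrix (Fin 3) (Fin 3) ℂ :=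
  Matrix.of fun k l => fderiv ℂ (fun w => jac τ w k l) z v

theorem analyticAt_jac {τ : V → V} {z : V} (hτ : AnalyticAt ℂ τ z) (k l : Fin 3) :
    AnalyticAt ℂ (fun w => jac τ w k l) z := by
  have h1 : AnalyticAt ℂ (fun w => fderiv ℂ τ w) z := hτ.fderiv
  let L : (V →L[ℂ] V) →L[ℂ] ℂ := (ContinuousLinearMap.proj (R := ℂ) (φ := fun _ : Fin 3 => ℂ) k).comp
    (ContinuousLinearMap.apply ℂ V (Pi.single l 1 : V))
  exact AnalyticAt.comp' (L.analyticAt (fderiv ℂ τ z)) h1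

theorem jacDeriv_smul (τ : V → V) (z v : V) (s : ℂ) :
    jacDeriv τ z (s • v) = s • jacDeriv τ z v := by
  ext k l
  simp [jacDeriv]

/-- Symmetry of the second derivatives of the coordinate change. -/
theorem jacDeriv_symm {τ : V → V} {z : V} (hτ : AnalyticAt ℂ τ z) (i l k : Fin 3) :
    jacDeriv τ z (Pi.single i 1) k l = jacDeriv τ z (Pi.single l 1) k i := by
  have hd : DifferentiableAt ℂ (fderiv ℂ τ) z := hτ.fderiv.differentiableAt
  have e : ∀ u l, fderiv ℂ (fun w => jac τ w k l) z u =
      fderiv ℂ (fderiv ℂ τ) z u (Pi.single l 1) k := by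
    intro u l
    have h1 : HasFDerivAt (fun w => fderiv ℂ τ w (Pi.single l 1)) _ z :=
      hd.hasFDerivAt.clm_apply (hasFDerivAt_const (Pi.single l 1 : V) z)
    have h2 := (ContinuousLinearMap.proj (R := ℂ) (φ := fun _ : Fin 3 => ℂ) k).hasFDerivAt.comp z h1
    have h3 := congrArg (fun L : V →L[ℂ] ℂ => L u) h2.fderiv
    refine Eq.trans ?_ (h3.trans ?_)
    · rfl
    · simp
  simp only [jacDeriv, Matrix.of_apply, e]
  have hs : IsSymmSndFDerivAt ℂ τ z := (hτ.contDiffAt (n := 2)).isSymmSndFDerivAt (by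
    rw [minSmoothness_of_isRCLikeNormedField])
  rw [hs.eq]

/-- `τ` is a holomorphic coordinate change near `z`, with inverse `σ`. -/
structure IsCoordChange (τ σ : V → V) (z : V) : Prop where
  analytic : AnalyticAt ℂ τ z
  analytic_inv : AnalyticAt ℂ σ (τ z)
  left_inv : ∀ᶠ w in 𝓝 z, σ (τ w) = w

namespace IsCoordChange

variable {τ σ : V → V} {z : V}

theorem jac_mul_jac_of_analytic (hτ : AnalyticAt ℂ τ z) (hσ : AnalyticAt ℂ σ (τ z))
    (hi : ∀ᶠ w in 𝓝 z, σ (τ w) = w) : jac σ (τ z) * jac τ z = 1 := by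
  have h1 : HasFDerivAt (σ ∘ τ) ((fderiv ℂ σ (τ z)).comp (fderiv ℂ τ z)) z :=
    hσ.differentiableAt.hasFDerivAt.comp z hτ.differentiableAt.hasFDerivAt
  have h2 : HasFDerivAt (σ ∘ τ) (ContinuousLinearMap.id ℂ V) z :=
    (hasFDerivAt_id z).congr_of_eventuallyEq hi
  have h3 := h1.unique h2
  ext i j
  have h4 := congrFun (congrArg (fun L : V →L[ℂ] V => L (Pi.single j 1)) h3) i
  simp only [ContinuousLinearMap.comp_apply, ContinuousLinearMap.id_apply] at h4
  rw [Matrix.mul_apply, Matrix.one_apply]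
  have h5 : fderiv ℂ τ z (Pi.single j 1) =
      ∑ l, (fderiv ℂ τ z (Pi.single j 1) l) • (Pi.single l 1 : V) := by
    have := (Finset.univ_sum_single (fderiv ℂ τ z (Pi.single j 1))).symm
    convert this using 2 with l
    rw [← Pi.single_smul]
    simp
  rw [h5, map_sum, Finset.sum_apply] at h4
  simp only [map_smul, Pi.smul_apply, smul_eq_mul] at h4
  simp only [jac, Matrix.of_apply]
  rw [Finset.sum_congr rfl fun l _ => mul_comm _ _, h4, Pi.single_apply]

theorem inv_mul (h : IsCoordChange τ σ z) : jac σ (τ z) * jac τ z = 1 :=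
  jac_mul_jac_of_analytic h.analytic h.analytic_inv h.left_inv

theorem mul_inv (h : IsCoordChange τ σ z) : jac τ z * jac σ (τ z) = 1 :=
  mul_eq_one_comm.mp h.inv_mul

theorem eventually (h : IsCoordChange τ σ z) :
    ∀ᶠ w in 𝓝 z, jac σ (τ w) * jac τ w = 1 := by
  filter_upwards [h.analytic.eventually_analyticAt,
    h.analytic.continuousAt.eventually h.analytic_inv.eventually_analyticAt,
    h.left_inv.eventually_nhds] with w h1 h2 h3
  exact jac_mul_jac_of_analytic h1 h2 h3

/-- The logarithmic derivative of the Jacobian matrix. -/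
def logJac (τ σ : V → V) (z v : V) : Matrix (Fin 3) (Fin 3) ℂ := jac σ (τ z) * jacDeriv τ z v

theorem hasDerivAt_line (z v : V) : HasDerivAt (fun t : ℝ => z + t • v) v 0 := by
  simpa using ((hasDerivAt_id (0 : ℝ)).smul_const v).const_add z

theorem hasDerivAt_jac (hτ : AnalyticAt ℂ τ z) (v : V) (k l : Fin 3) :
    HasDerivAt (fun t : ℝ => jac τ (z + t • v) k l) (jacDeriv τ z v k l) 0 := by
  have h1 := ((analyticAt_jac hτ k l).differentiableAt.hasFDerivAt.restrictScalars ℝ)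
  have h2 := HasFDerivAt.comp_hasDerivAt (0 : ℝ) (f := fun t : ℝ => z + t • v)
    (by simpa using h1) (hasDerivAt_line z v)
  exact h2

theorem hasDerivAt_jac_inv (h : IsCoordChange τ σ z) (v : V) (k l : Fin 3) :
    HasDerivAt (fun t : ℝ => jac σ (τ (z + t • v)) k l)
      ((-(logJac τ σ z v * jac σ (τ z))) k l) 0 := by
  -- the inverse matrix is differentiable, so its derivative follows from that of the product
  have hd : ∀ k l, ∃ d : ℂ, HasDerivAt (fun t : ℝ => jac σ (τ (z + t • v)) k l) d 0 := by
    intro k l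
    have h0 : AnalyticAt ℂ (fun w => jac σ (τ w) k l) z :=
      AnalyticAt.comp' (analyticAt_jac h.analytic_inv k l) h.analytic
    have h1 := (h0.differentiableAt.hasFDerivAt.restrictScalars ℝ)
    exact ⟨_, HasFDerivAt.comp_hasDerivAt (0 : ℝ) (f := fun t : ℝ => z + t • v)
      (l := fun w => jac σ (τ w) k l) (by simpa using h1) (hasDerivAt_line z v)⟩
  choose D hD using hd
  have hc : Filter.Tendsto (fun t : ℝ => z + t • v) (𝓝 0) (𝓝 z) := by
    have := (hasDerivAt_line z v).continuousAt
    simpa [ContinuousAt] using this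
  have hprod : ∀ k m, ∑ l, (D k l * jac τ z l m + jac σ (τ z) k l * jacDeriv τ z v l m) = 0 := by
    intro k m
    have h1 : HasDerivAt (fun t : ℝ => ∑ l, jac σ (τ (z + t • v)) k l * jac τ (z + t • v) l m) _ 0 :=
      HasDerivAt.fun_sum (u := Finset.univ) fun l _ =>
        (hD k l).mul (hasDerivAt_jac h.analytic v l m)
    have h2 : HasDerivAt (fun t : ℝ => ∑ l, jac σ (τ (z + t • v)) k l * jac τ (z + t • v) l m)
        0 0 := by
      refine (hasDerivAt_const (0 : ℝ) ((1 : Matrix (Fin 3) (Fin 3) ℂ) k m)).congr_of_eventuallyEq ?_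
      filter_upwards [hc.eventually h.eventually] with t ht
      rw [← ht, Matrix.mul_apply]
    have h3 := h1.unique h2
    simpa using h3
  have hm : Matrix.of D * jac τ z = -(logJac τ σ z v) := by
    ext k m
    have := hprod k m
    rw [Finset.sum_add_distrib] at this
    rw [Matrix.mul_apply, Matrix.neg_apply, logJac, Matrix.mul_apply]
    exact eq_neg_of_add_eq_zero_left this
  have hD' : Matrix.of D = -(logJac τ σ z v * jac σ (τ z)) := by
    rw [← Matrix.neg_mul, ← hm, Matrix.mul_assoc, h.mul_inv, Matrix.mul_one]
  rw [← hD']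
  exact hD k l

/-- How directional derivatives of a polyvector field transform. -/
theorem fderiv_transform (h : IsCoordChange τ σ z) {b b' : V → Grass}
    (hb : DifferentiableAt ℝ b z) (hb' : DifferentiableAt ℝ b' (τ z))
    (hbb : ∀ᶠ w in 𝓝 z, b' (τ w) = gsubst (frameChange τ σ w) (b w)) (v : V) :
    fderiv ℝ b' (τ z) (fderiv ℂ τ z v) =
      gsubst (frameChange τ σ z) (fderiv ℝ b z v) +
        gsubst (frameChange τ σ z)
          (ghat (blk (logJac τ σ z v) (-(logJac τ σ z v).conjTranspose)) (b z)) := by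
  have hline := hasDerivAt_line z v
  have hc : Filter.Tendsto (fun t : ℝ => z + t • v) (𝓝 0) (𝓝 z) := by
    simpa [ContinuousAt] using hline.continuousAt
  have hb1 : HasDerivAt (fun t : ℝ => b (z + t • v)) (fderiv ℝ b z v) 0 :=
    HasFDerivAt.comp_hasDerivAt (0 : ℝ) (f := fun t : ℝ => z + t • v)
      (by simpa using hb.hasFDerivAt) hline
  have hτ1 : HasDerivAt (fun t : ℝ => τ (z + t • v)) (fderiv ℂ τ z v) 0 :=
    HasFDerivAt.comp_hasDerivAt (0 : ℝ) (f := fun t : ℝ => z + t • v) (l := τ)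
      (l' := (fderiv ℂ τ z).restrictScalars ℝ)
      (by
        rw [show z + (0 : ℝ) • v = z by simp]
        exact h.analytic.differentiableAt.hasFDerivAt.restrictScalars ℝ) hline
  have hb2 : HasDerivAt (fun t : ℝ => b' (τ (z + t • v))) (fderiv ℝ b' (τ z) (fderiv ℂ τ z v)) 0 :=
    HasFDerivAt.comp_hasDerivAt (0 : ℝ) (f := fun t : ℝ => τ (z + t • v))
      (by simpa using hb'.hasFDerivAt) hτ1
  set N := blk (logJac τ σ z v) (-(logJac τ σ z v).conjTranspose) with hN
  set F' := frameChange τ σ z * N with hF'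
  have hF'eq : F' = blk (jacDeriv τ z v) (-(logJac τ σ z v * jac σ (τ z))).conjTranspose := by
    rw [hF', hN, frameChange_eq_blk, blk_mul]
    congr 1
    · rw [logJac, ← Matrix.mul_assoc, h.mul_inv, Matrix.one_mul]
    · rw [Matrix.conjTranspose_neg, Matrix.conjTranspose_mul, Matrix.mul_neg]
  have hF : ∀ i j, HasDerivAt (fun t : ℝ => frameChange τ σ (z + t • v) i j) (F' i j) 0 := by
    have key : ∀ i j : Fin 3,
        HasDerivAt (fun t : ℝ => frameChange τ σ (z + t • v) (xi i) (xi j)) (F' (xi i) (xi j)) 0 ∧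
        HasDerivAt (fun t : ℝ => frameChange τ σ (z + t • v) (xi i) (eta j)) (F' (xi i) (eta j)) 0 ∧
        HasDerivAt (fun t : ℝ => frameChange τ σ (z + t • v) (eta i) (xi j)) (F' (eta i) (xi j)) 0 ∧
        HasDerivAt (fun t : ℝ => frameChange τ σ (z + t • v) (eta i) (eta j))
          (F' (eta i) (eta j)) 0 := by
      intro i j
      simp only [frameChange_eq_blk, hF'eq, blk_xi_xi, blk_xi_eta, blk_eta_xi, blk_eta_eta,
        Matrix.conjTranspose_apply]
      refine ⟨hasDerivAt_jac h.analytic v i j, hasDerivAt_const _ _, hasDerivAt_const _ _, ?_⟩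
      exact (hasDerivAt_jac_inv h v j i).star
    intro i j
    induction i using Fin.addCases (m := 3) (n := 3) with
    | left i =>
      induction j using Fin.addCases (m := 3) (n := 3) with
      | left j => exact (key i j).1
      | right j => exact (key i j).2.1
    | right i =>
      induction j using Fin.addCases (m := 3) (n := 3) with
      | left j => exact (key i j).2.2.1
      | right j => exact (key i j).2.2.2
  have hz : z + (0 : ℝ) • v = z := by simp
  have h3 := hasDerivAt_gsubst (t := 0) (F := fun t : ℝ => frameChange τ σ (z + t • v)) (N := N) hF
    (by simp only [hz, hF']) hb1
  have h4 := h3.congr_of_eventuallyEq (f₁ := fun t : ℝ => b' (τ (z + t • v)))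
    (by filter_upwards [hc.eventually hbb] with t ht using ht)
  have h5 := hb2.unique h4
  simpa only [hz] using h5

theorem logJac_smul (τ σ : V → V) (z v : V) (s : ℂ) :
    logJac τ σ z (s • v) = s • logJac τ σ z v := by
  simp [logJac, jacDeriv_smul]

theorem logJac_symm (h : IsCoordChange τ σ z) (i l k : Fin 3) :
    logJac τ σ z (Pi.single i 1) k l = logJac τ σ z (Pi.single l 1) k i := by
  simp only [logJac, Matrix.mul_apply, jacDeriv_symm h.analytic i l]

theorem fderiv_single (τ : V → V) (z : V) (i l : Fin 3) :
    fderiv ℂ τ z (Pi.single i 1) l = jac τ z l i := rfl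

theorem dz_transform (h : IsCoordChange τ σ z) {b b' : V → Grass}
    (hb : DifferentiableAt ℝ b z) (hb' : DifferentiableAt ℝ b' (τ z))
    (hbb : ∀ᶠ w in 𝓝 z, b' (τ w) = gsubst (frameChange τ σ w) (b w)) (i : Fin 3) :
    ∑ l, jac τ z l i • dz l b' (τ z) = gsubst (frameChange τ σ z)
      (dz i b z + ghat (blk (logJac τ σ z (Pi.single i 1)) 0) (b z)) := by
  have e := clm_dz (fderiv ℝ b' (τ z)) (fderiv ℂ τ z (Pi.single i 1))
  simp only [fderiv_single] at e
  simp only [dz_eq_wirt, wirt]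
  have hI : fderiv ℂ τ z (Pi.single i Complex.I) = Complex.I • fderiv ℂ τ z (Pi.single i 1) := by
    rw [single_I_eq, map_smul]
  rw [← e, ← hI, fderiv_transform h hb hb' hbb, fderiv_transform h hb hb' hbb,
    single_I_eq, logJac_smul]
  set P := logJac τ σ z (Pi.single i 1)
  have hN : blk P 0 = (1 / 2 : ℂ) • (blk P (-P.conjTranspose) + (-Complex.I) •
      blk (Complex.I • P) (-(Complex.I • P).conjTranspose)) := by
    rw [blk_smul, blk_add, blk_smul]
    congr 1
    · rw [smul_smul, neg_mul, Complex.I_mul_I, neg_neg, one_smul]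
      module
    · rw [Matrix.conjTranspose_smul, ← smul_neg, smul_smul]
      simp
  rw [hN, ghat_smul_left, ghat_add_left, ghat_smul_left]
  simp only [gsubst_add, gsubst_smul]
  module

theorem dzbar_transform (h : IsCoordChange τ σ z) {b b' : V → Grass}
    (hb : DifferentiableAt ℝ b z) (hb' : DifferentiableAt ℝ b' (τ z))
    (hbb : ∀ᶠ w in 𝓝 z, b' (τ w) = gsubst (frameChange τ σ w) (b w)) (i : Fin 3) :
    ∑ l, (starRingEnd ℂ (jac τ z l i)) • dzbar l b' (τ z) = gsubst (frameChange τ σ z)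
      (dzbar i b z + ghat (blk 0 (-(logJac τ σ z (Pi.single i 1)).conjTranspose)) (b z)) := by
  have e := clm_dzbar (fderiv ℝ b' (τ z)) (fderiv ℂ τ z (Pi.single i 1))
  simp only [fderiv_single] at e
  simp only [dzbar_eq_wirt, wirt]
  have hI : fderiv ℂ τ z (Pi.single i Complex.I) = Complex.I • fderiv ℂ τ z (Pi.single i 1) := by
    rw [single_I_eq, map_smul]
  rw [← e, ← hI, fderiv_transform h hb hb' hbb, fderiv_transform h hb hb' hbb,
    single_I_eq, logJac_smul]
  set P := logJac τ σ z (Pi.single i 1)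
  have hN : blk 0 (-P.conjTranspose) = (1 / 2 : ℂ) • (blk P (-P.conjTranspose) + Complex.I •
      blk (Complex.I • P) (-(Complex.I • P).conjTranspose)) := by
    rw [blk_smul, blk_add, blk_smul]
    congr 1
    · rw [smul_smul, Complex.I_mul_I]
      simp
    · rw [Matrix.conjTranspose_smul, ← smul_neg, smul_smul]
      have : Complex.I * -star Complex.I = -1 := by simp
      simp
      module
  rw [hN, ghat_smul_left, ghat_add_left, ghat_smul_left]
  simp only [gsubst_add, gsubst_smul]
  module

end IsCoordChange


namespace IsCoordChange

variable {τ σ : V → V} {z : V}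

/-- Jacobi's formula for the derivative of the Jacobian determinant. -/
theorem fderiv_det_jac (h : IsCoordChange τ σ z) (v : V) :
    fderiv ℂ (fun w => (jac τ w).det) z v = (jac τ z).det * (logJac τ σ z v).trace := by
  have hJ : ∀ k l, jacDeriv τ z v k l = ∑ m, jac τ z k m * logJac τ σ z v m l := by
    intro k l
    rw [← Matrix.mul_apply, logJac, ← Matrix.mul_assoc, h.mul_inv, Matrix.one_mul]
  have e : ∀ k l, HasDerivAt (fun t : ℝ => jac τ (z + t • v) k l)
      (∑ m, jac τ z k m * logJac τ σ z v m l) 0 := by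
    intro k l
    rw [← hJ]
    exact hasDerivAt_jac h.analytic v k l
  have han : AnalyticAt ℂ (fun w => (jac τ w).det) z := by
    simp only [Matrix.det_fin_three]
    have a := fun k l => analyticAt_jac h.analytic k l
    fun_prop
  have h1 : HasDerivAt (fun t : ℝ => (jac τ (z + t • v)).det)
      (fderiv ℂ (fun w => (jac τ w).det) z v) 0 :=
    HasFDerivAt.comp_hasDerivAt (0 : ℝ) (f := fun t : ℝ => z + t • v)
      (l := fun w => (jac τ w).det)
      (l' := (fderiv ℂ (fun w => (jac τ w).det) z).restrictScalars ℝ)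
      (by
        rw [show z + (0 : ℝ) • v = z by simp]
        exact han.differentiableAt.hasFDerivAt.restrictScalars ℝ) (hasDerivAt_line z v)
  have h2 := (((((((e 0 0).mul (e 1 1)).mul (e 2 2)).sub (((e 0 0).mul (e 1 2)).mul (e 2 1))).sub
    (((e 0 1).mul (e 1 0)).mul (e 2 2))).add (((e 0 1).mul (e 1 2)).mul (e 2 0))).add
    (((e 0 2).mul (e 1 0)).mul (e 2 1))).sub (((e 0 2).mul (e 1 1)).mul (e 2 0))
  have h3 : (fun t : ℝ => (jac τ (z + t • v)).det) = _ :=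
    funext fun t => Matrix.det_fin_three (jac τ (z + t • v))
  rw [h3] at h1
  refine (h1.unique h2).trans ?_
  simp only [Pi.mul_apply, zero_smul, add_zero, Matrix.det_fin_three, Matrix.trace, Matrix.diag,
    Fin.sum_univ_three]
  ring

theorem analyticAt_det_jac (h : IsCoordChange τ σ z) :
    AnalyticAt ℂ (fun w => (jac τ w).det) z := by
  simp only [Matrix.det_fin_three]
  have a := fun k l => analyticAt_jac h.analytic k l
  fun_prop

theorem det_jac_ne_zero (h : IsCoordChange τ σ z) : (jac τ z).det ≠ 0 := by
  intro h0
  have := congrArg Matrix.det h.mul_inv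
  rw [Matrix.det_mul, h0, zero_mul, Matrix.det_one] at this
  exact zero_ne_one this

theorem sum_antisymm {M : Type*} [AddCommGroup M] [Module ℂ M] (f : Fin 3 → Fin 3 → M)
    (h : ∀ i j, f i j = -f j i) : ∑ i, ∑ j, f i j = 0 := by
  have e : ∑ i, ∑ j, f i j = -∑ i, ∑ j, f i j := by
    conv_lhs => rw [Finset.sum_comm]
    rw [← Finset.sum_neg_distrib]
    refine Finset.sum_congr rfl fun i _ => ?_
    rw [← Finset.sum_neg_distrib]
    exact Finset.sum_congr rfl fun j _ => h j i
  have e2 : (2 : ℂ) • ∑ i, ∑ j, f i j = 0 := by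
    rw [two_smul]
    nth_rewrite 1 [e]
    exact neg_add_cancel _
  exact (smul_eq_zero.mp e2).resolve_left two_ne_zero

theorem sum_gext_ghat (P : Fin 3 → Matrix (Fin 3) (Fin 3) ℂ)
    (hP : ∀ i l k, P i k l = P l k i) (a : Grass) :
    ∑ i, gext (eta i) (ghat (blk 0 (-(P i).conjTranspose)) a) = 0 := by
  have e : ∀ i, gext (eta i) (ghat (blk 0 (-(P i).conjTranspose)) a) =
      ∑ p, ∑ q, (-(starRingEnd ℂ (P i q p))) • gext (eta i) (gext (eta p) (gcontr (eta q) a)) := by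
    intro i
    rw [ghat_blk]
    simp [gext_sum, gext_smul, gext_neg]
  rw [Finset.sum_congr rfl fun i _ => e i]
  refine sum_antisymm _ fun i p => ?_
  rw [← Finset.sum_neg_distrib]
  refine Finset.sum_congr rfl fun q _ => ?_
  rw [gext_gext, hP i p q, smul_neg]

theorem sum_gcontr_ghat (P : Fin 3 → Matrix (Fin 3) (Fin 3) ℂ)
    (hP : ∀ i l k, P i k l = P l k i) (a : Grass) :
    ∑ i, gcontr (xi i) (ghat (blk (P i) 0) a) = ∑ i, (P i).trace • gcontr (xi i) a := by
  have hx : ∀ i j : Fin 3, (xi i = xi j) ↔ i = j := fun i j =>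
    (Fin.castAdd_injective 3 3).eq_iff
  have e : ∀ i, gcontr (xi i) (ghat (blk (P i) 0) a) = ∑ q, P i i q • gcontr (xi q) a -
      ∑ q, ∑ p, P i p q • gext (xi p) (gcontr (xi i) (gcontr (xi q) a)) := by
    intro i
    rw [ghat_blk]
    simp only [gcontr_add, gcontr_sum, gcontr_smul, gcontr_gext, hx, smul_sub,
      Finset.sum_sub_distrib, Matrix.zero_apply, zero_smul, Finset.sum_const_zero, add_zero,
      smul_ite, smul_zero]
    congr 1
    · rw [Finset.sum_comm]
      simp
    · exact Finset.sum_comm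
  rw [Finset.sum_congr rfl fun i _ => e i, Finset.sum_sub_distrib]
  rw [sum_antisymm (fun i q => ∑ p, P i p q • gext (xi p) (gcontr (xi i) (gcontr (xi q) a)))]
  · rw [sub_zero, Finset.sum_comm]
    refine Finset.sum_congr rfl fun q _ => ?_
    rw [Matrix.trace, Finset.sum_smul]
    refine Finset.sum_congr rfl fun i _ => ?_
    rw [Matrix.diag, hP i q i]
  · intro i q
    rw [← Finset.sum_neg_distrib]
    refine Finset.sum_congr rfl fun p _ => ?_
    rw [gcontr_gcontr, hP i q p, gext_neg, smul_neg]

theorem gsubst_gext_eta (h : IsCoordChange τ σ z) (i : Fin 3) (a : Grass) :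
    gsubst (frameChange τ σ z) (gext (eta i) a) =
      ∑ p, starRingEnd ℂ (jac σ (τ z) i p) • gext (eta p) (gsubst (frameChange τ σ z) a) := by
  rw [gsubst_gext, sum_generators]
  simp [frameChange_eq_blk]

theorem gsubst_gcontr_xi (h : IsCoordChange τ σ z) (i : Fin 3) (a : Grass) :
    gsubst (frameChange τ σ z) (gcontr (xi i) a) =
      ∑ m, jac σ (τ z) i m • gcontr (xi m) (gsubst (frameChange τ σ z) a) := by
  simp only [gcontr_gsubst, sum_generators, frameChange_eq_blk, blk_xi_xi, blk_xi_eta, zero_smul,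
    Finset.sum_const_zero, add_zero, Finset.smul_sum, smul_smul]
  rw [Finset.sum_comm]
  simp only [← Finset.sum_smul, ← Matrix.mul_apply, h.inv_mul, Matrix.one_apply, ite_smul, one_smul,
    zero_smul, Finset.sum_ite_eq, Finset.mem_univ, if_true]

/-- The operator `∂̄` is compatible with coordinate changes. -/
theorem dbar_transform (h : IsCoordChange τ σ z) {b b' : V → Grass}
    (hb : DifferentiableAt ℝ b z) (hb' : DifferentiableAt ℝ b' (τ z))
    (hbb : ∀ᶠ w in 𝓝 z, b' (τ w) = gsubst (frameChange τ σ w) (b w)) :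
    ∑ j, gext (eta j) (dzbar j b' (τ z)) =
      gsubst (frameChange τ σ z) (∑ j, gext (eta j) (dzbar j b z)) := by
  have h0 := sum_gext_ghat (fun i => logJac τ σ z (Pi.single i 1))
    (fun i l k => h.logJac_symm i l k) (b z)
  have h1 : ∑ j, gext (eta j) (dzbar j b z) = ∑ j, gext (eta j) (dzbar j b z +
      ghat (blk 0 (-(logJac τ σ z (Pi.single j 1)).conjTranspose)) (b z)) := by
    simp only [gext_add, Finset.sum_add_distrib, h0, add_zero]
  rw [h1, gsubst_sum]
  simp only [h.gsubst_gext_eta, ← h.dzbar_transform hb hb' hbb, gext_sum, gext_smul,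
    Finset.smul_sum, smul_smul]
  rw [Finset.sum_comm]
  refine Finset.sum_congr rfl fun p _ => ?_
  rw [Finset.sum_comm]
  have h2 : ∀ l, ∑ i, starRingEnd ℂ (jac σ (τ z) i p) * starRingEnd ℂ (jac τ z l i) =
      if l = p then 1 else 0 := by
    intro l
    have := congrFun (congrFun h.mul_inv l) p
    rw [Matrix.mul_apply, Matrix.one_apply] at this
    have := congrArg (starRingEnd ℂ) this
    rw [map_sum] at this
    simp only [map_mul, apply_ite (starRingEnd ℂ), map_one, map_zero] at this
    rw [← this]
    exact Finset.sum_congr rfl fun i _ => mul_comm _ _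
  simp only [← Finset.sum_smul, h2, ite_smul, one_smul, zero_smul, Finset.sum_ite_eq',
    Finset.mem_univ, if_true]

theorem sum_gcontr_dz_transform (h : IsCoordChange τ σ z) {b b' : V → Grass}
    (hb : DifferentiableAt ℝ b z) (hb' : DifferentiableAt ℝ b' (τ z))
    (hbb : ∀ᶠ w in 𝓝 z, b' (τ w) = gsubst (frameChange τ σ w) (b w)) :
    ∑ j, gcontr (xi j) (dz j b' (τ z)) = gsubst (frameChange τ σ z)
      (∑ j, (gcontr (xi j) (dz j b z) +
        (logJac τ σ z (Pi.single j 1)).trace • gcontr (xi j) (b z))) := by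
  have h0 := sum_gcontr_ghat (fun i => logJac τ σ z (Pi.single i 1))
    (fun i l k => h.logJac_symm i l k) (b z)
  rw [Finset.sum_add_distrib, ← h0, ← Finset.sum_add_distrib]
  simp only [← gcontr_add]
  rw [gsubst_sum]
  simp only [h.gsubst_gcontr_xi, ← h.dz_transform hb hb' hbb, gcontr_sum, gcontr_smul,
    Finset.smul_sum, smul_smul]
  rw [Finset.sum_comm]
  refine Finset.sum_congr rfl fun p _ => ?_
  rw [Finset.sum_comm]
  have h2 : ∀ l, ∑ i, jac σ (τ z) i p * jac τ z l i = if l = p then 1 else 0 := by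
    intro l
    have := congrFun (congrFun h.mul_inv l) p
    rw [Matrix.mul_apply, Matrix.one_apply] at this
    rw [← this]
    exact Finset.sum_congr rfl fun i _ => mul_comm _ _
  simp only [← Finset.sum_smul, h2, ite_smul, one_smul, zero_smul, Finset.sum_ite_eq',
    Finset.mem_univ, if_true]

/-- The divergence operator is compatible with coordinate changes: by Jacobi's formula, the change
of the density compensates the trace terms. -/
theorem div_transform (h : IsCoordChange τ σ z) {b b' : V → Grass} {ρ ρ' : V → ℂ}
    (hb : ContDiffAt ℝ ∞ b z) (hb' : ContDiffAt ℝ ∞ b' (τ z))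
    (hbb : ∀ᶠ w in 𝓝 z, b' (τ w) = gsubst (frameChange τ σ w) (b w))
    (hρ' : AnalyticAt ℂ ρ' (τ z)) (hρ0 : ρ z ≠ 0)
    (hρρ : ∀ᶠ w in 𝓝 z, ρ w = ρ' (τ w) * (jac τ w).det) :
    ∑ j, (ρ' (τ z))⁻¹ • gcontr (xi j) (dz j (fun w => ρ' w • b' w) (τ z)) =
      gsubst (frameChange τ σ z)
        (∑ j, (ρ z)⁻¹ • gcontr (xi j) (dz j (fun w => ρ w • b w) z)) := by
  have hρτ : AnalyticAt ℂ (fun w => ρ' (τ w)) z := AnalyticAt.comp' hρ' h.analytic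
  have hbt : ContDiffAt ℝ ∞ (fun w => ρ' (τ w) • b w) z := hρτ.contDiffAt_real.fsmul hb
  have hbt' : ContDiffAt ℝ ∞ (fun w => ρ' w • b' w) (τ z) := hρ'.contDiffAt_real.fsmul hb'
  have h1 := h.sum_gcontr_dz_transform (b := fun w => ρ' (τ w) • b w) (b' := fun w => ρ' w • b' w)
    hbt.differentiable hbt'.differentiable (by
      filter_upwards [hbb] with w hw
      rw [hw, gsubst_smul])
  rw [← Finset.smul_sum, h1, ← gsubst_smul, ← Finset.smul_sum]
  congr 1
  have h2 : ∀ j, dz j (fun w => ρ w • b w) z =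
      ((jac τ z).det * (logJac τ σ z (Pi.single j 1)).trace) • ρ' (τ z) • b z +
        (jac τ z).det • dz j (fun w => ρ' (τ w) • b w) z := by
    intro j
    have e : (fun w => ρ w • b w) =ᶠ[𝓝 z] fun w => (jac τ w).det • (ρ' (τ w) • b w) := by
      filter_upwards [hρρ] with w hw
      rw [hw, smul_smul, mul_comm]
    rw [dz_eq_wirt, wirt_congr e, wirt_fsmul h.analyticAt_det_jac.contDiffAt_real hbt,
      wirtS_dz_eq h.analyticAt_det_jac, h.fderiv_det_jac]
  have hz := hρρ.self_of_nhds
  have hd := h.det_jac_ne_zero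
  have hρ'0 : ρ' (τ z) ≠ 0 := fun h0 => hρ0 (by rw [hz, h0, zero_mul])
  simp only [h2, gcontr_add, gcontr_smul, Finset.smul_sum]
  refine Finset.sum_congr rfl fun j _ => ?_
  rw [hz]
  match_scalars <;> field_simp

end IsCoordChange


/-! ### The algebra of smooth polyvector fields -/

/-- The elements of the Grassmann algebra of polyvector degree `i`. -/
def gdeg (i : ℕ) : Submodule ℂ Grass where
  carrier := {a | ∀ K, a K ≠ 0 → (K.filter (fun k : Fin 6 => (k : ℕ) < 3)).card = i}
  zero_mem' := fun _ h => absurd rfl h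
  add_mem' := by
    intro a b ha hb K h
    by_cases h0 : a K = 0
    · exact hb K fun h1 => h (by simp [h0, h1])
    · exact ha K h0
  smul_mem' := by
    intro s a ha K h
    exact ha K fun h1 => h (by simp [h1])

theorem gext_eta_mem_gdeg {i : ℕ} {a : Grass} (ha : a ∈ gdeg i) (j : Fin 3) :
    gext (eta j) a ∈ gdeg i := by
  intro K h
  rw [gext] at h
  split_ifs at h with hj
  · have h1 := ha (K.erase (eta j)) fun h0 => h (by rw [h0, mul_zero])
    rw [← h1, Finset.filter_erase, Finset.erase_eq_of_notMem]
    simp [eta]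
  · exact absurd rfl h

theorem gcontr_xi_mem_gdeg {i : ℕ} {a : Grass} (ha : a ∈ gdeg (i + 1)) (j : Fin 3) :
    gcontr (xi j) a ∈ gdeg i := by
  intro K h
  rw [gcontr] at h
  split_ifs at h with hj
  · exact absurd rfl h
  · have h1 := ha (insert (xi j) K) fun h0 => h (by rw [h0, mul_zero])
    rw [Finset.filter_insert, if_pos (by simp [xi]), Finset.card_insert_of_notMem] at h1
    · omega
    · simp [hj]

theorem gcontr_xi_of_mem_gdeg_zero {a : Grass} (ha : a ∈ gdeg 0) (j : Fin 3) :
    gcontr (xi j) a = 0 := by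
  funext K
  rw [gcontr]
  split_ifs with hj
  · rfl
  · by_contra h
    have h1 := ha (insert (xi j) K) fun h0 => h (by rw [h0, mul_zero]; rfl)
    rw [Finset.filter_insert, if_pos (by simp [xi]), Finset.card_insert_of_notMem] at h1
    · omega
    · simp [hj]

theorem gmul_mem_gdeg {i j : ℕ} {a b : Grass} (ha : a ∈ gdeg i) (hb : b ∈ gdeg j) :
    gmul a b ∈ gdeg (i + j) := by
  intro K h
  obtain ⟨I, hI, hne⟩ := Finset.exists_ne_zero_of_sum_ne_zero h
  have h1 := ha I fun h0 => hne (by rw [h0]; ring)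
  have h2 := hb (K \ I) fun h0 => hne (by rw [h0]; ring)
  rw [Finset.mem_powerset] at hI
  rw [← h1, ← h2, ← Finset.card_union_of_disjoint]
  · rw [← Finset.filter_union, Finset.union_sdiff_of_subset hI]
  · exact Finset.disjoint_filter_filter Finset.disjoint_sdiff

theorem gone_mem_gdeg : gone ∈ gdeg 0 := by
  intro K h
  have : K = ∅ := by
    by_contra h0
    exact h (by simp [gone, h0])
  simp [this]

theorem eq_zero_of_mem_gdeg {i : ℕ} (hi : 4 ≤ i) {a : Grass} (ha : a ∈ gdeg i) : a = 0 := by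
  funext K
  by_contra h
  have h1 := ha K h
  have h2 : (K.filter (fun k : Fin 6 => (k : ℕ) < 3)).card ≤ 3 :=
    (Finset.card_le_card (Finset.filter_subset_filter _ (Finset.subset_univ K))).trans (by decide)
  omega

theorem ginv_mem_gdeg {i : ℕ} {a : Grass} (ha : a ∈ gdeg i) : ginv a ∈ gdeg i := by
  intro K h
  refine ha K fun h0 => h ?_
  rw [ginv_apply, h0]
  simp

theorem wirt_mem_gdeg {i : ℕ} {f : V → Grass} (hf : ∀ z, f z ∈ gdeg i) (s : ℂ) (j : Fin 3) (z : V) :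
    wirt s j f z ∈ gdeg i := by
  intro K h
  by_contra hK
  refine h ?_
  have h0 : ∀ w, f w K = 0 := fun w => by
    by_contra hw
    exact hK (hf w K hw)
  simp [wirt, fderiv_coeff_eq_zero h0]

theorem ginv_of_parity {p : ZMod 2} {a : Grass} (ha : ∀ K, a K ≠ 0 → (K.card : ZMod 2) = p) :
    ginv a = psign p • a := by
  funext K
  rw [ginv_apply, Pi.smul_apply, smul_eq_mul]
  by_cases h : a K = 0
  · rw [h, mul_zero, mul_zero]
  · congr 1
    rw [← ha K h, psign]
    rcases Nat.even_or_odd K.card with h1 | h1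
    · rw [if_pos ((ZMod.natCast_eq_zero_iff_even).mpr h1), h1.neg_one_pow]
    · rw [if_neg, h1.neg_one_pow]
      rw [ZMod.natCast_eq_zero_iff_even, Nat.not_even_iff_odd]
      exact h1

theorem parity_of_ginv {p : ZMod 2} {a : Grass} (ha : ginv a = psign p • a) (K : Finset (Fin 6))
    (h : a K ≠ 0) : (K.card : ZMod 2) = p := by
  have h1 := congrFun ha K
  rw [ginv_apply, Pi.smul_apply, smul_eq_mul] at h1
  have h2 := mul_right_cancel₀ h h1
  rcases zmod_two_cases p with rfl | rfl <;> rcases Nat.even_or_odd K.card with h3 | h3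
  · exact (ZMod.natCast_eq_zero_iff_even).mpr h3
  · rw [h3.neg_one_pow, psign_zero] at h2
    norm_num at h2
  · rw [h3.neg_one_pow, psign_one] at h2
    norm_num at h2
  · exact (ZMod.natCast_eq_one_iff_odd).mpr h3

section Geometry

variable {X : Type*} [TopologicalSpace X] [ChartedSpace V X]

theorem transition_mem {c c' : atlas V X} {z : V} (hz' : c.1.symm z ∈ c'.1.source) :
    transition c c' z ∈ c'.1.target := c'.1.map_source hz'

theorem symm_transition {c c' : atlas V X} {z : V}
    (hz' : c.1.symm z ∈ c'.1.source) : c'.1.symm (transition c c' z) = c.1.symm z :=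
  c'.1.left_inv hz'

theorem eventually_overlap {c c' : atlas V X} {z : V} (hz : z ∈ c.1.target)
    (hz' : c.1.symm z ∈ c'.1.source) :
    ∀ᶠ w in 𝓝 z, w ∈ c.1.target ∧ c.1.symm w ∈ c'.1.source :=
  (c.1.open_target.eventually_mem hz).and
    ((c.1.continuousAt_symm hz).eventually (c'.1.open_source.eventually_mem hz'))

theorem analyticAt_transition [IsManifold 𝓘(ℂ, V) ω X] {c c' : atlas V X} {z : V}
    (hz : z ∈ c.1.target) (hz' : c.1.symm z ∈ c'.1.source) :
    AnalyticAt ℂ (transition c c') z := by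
  have h := (contDiffGroupoid ω 𝓘(ℂ, V)).compatible c.2 c'.2
  rw [contDiffGroupoid, mem_groupoid_of_pregroupoid] at h
  have h1 : ContDiffOn ℂ ω _ _ := h.1
  have h2 := h1.contDiffAt (x := z) (by
    filter_upwards [eventually_overlap hz hz'] with w hw
    simp [hw.1, hw.2])
  exact h2.analyticAt

theorem isCoordChange [IsManifold 𝓘(ℂ, V) ω X] {c c' : atlas V X} {z : V}
    (hz : z ∈ c.1.target) (hz' : c.1.symm z ∈ c'.1.source) :
    IsCoordChange (transition c c') (transition c' c) z where
  analytic := analyticAt_transition hz hz'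
  analytic_inv := by
    refine analyticAt_transition (transition_mem hz') ?_
    rw [symm_transition hz']
    exact c.1.map_target hz
  left_inv := by
    filter_upwards [eventually_overlap hz hz'] with w hw
    rw [transition, symm_transition hw.2]
    exact c.1.right_inv hw.1

variable (X) in
/-- The space of smooth sections of `⨁_{i,j} Ω^{0,j}(∧^i T_X)`, as families of local
expressions that vanish outside the images of the charts. -/
def PV : Submodule ℂ (Sec X) where
  carrier := {a | (∀ c : atlas V X, ContDiffOn ℝ ∞ (a c) c.1.target) ∧
    (∀ c : atlas V X, ∀ z ∉ c.1.target, a c z = 0) ∧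
    (∀ c c' : atlas V X, ∀ z ∈ c.1.target, c.1.symm z ∈ c'.1.source →
      a c' (transition c c' z) =
        gsubst (frameChange (transition c c') (transition c' c) z) (a c z))}
  zero_mem' := ⟨fun _ => contDiffOn_const, fun _ _ _ => rfl, fun c c' z _ _ => by
    funext K
    simp [gsubst]⟩
  add_mem' := by
    intro a b ha hb
    refine ⟨fun c => (ha.1 c).add (hb.1 c), fun c z hz => ?_, fun c c' z hz hz' => ?_⟩
    · simp [ha.2.1 c z hz, hb.2.1 c z hz]
    · simp only [Pi.add_apply, gsubst_add, ha.2.2 c c' z hz hz', hb.2.2 c c' z hz hz']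
  smul_mem' := by
    intro s a ha
    refine ⟨fun c => (ha.1 c).const_smul s, fun c z hz => ?_, fun c c' z hz hz' => ?_⟩
    · simp [ha.2.1 c z hz]
    · simp only [Pi.smul_apply, gsubst_smul, ha.2.2 c c' z hz hz']

theorem PV.contDiffAt {a : Sec X} (ha : a ∈ PV X) {c : atlas V X} {z : V} (hz : z ∈ c.1.target) :
    ContDiffAt ℝ ∞ (a c) z :=
  (ha.1 c).contDiffAt (c.1.open_target.mem_nhds hz)

theorem wedge_mem {a b : Sec X} (ha : a ∈ PV X) (hb : b ∈ PV X) : wedge a b ∈ PV X := by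
  refine ⟨fun c z hz => ?_, fun c z hz => ?_, fun c c' z hz hz' => ?_⟩
  · exact ((PV.contDiffAt ha hz).gmul (PV.contDiffAt hb hz)).contDiffWithinAt
  · rw [wedge, ha.2.1 c z hz, zero_gmul]
  · rw [wedge, wedge, ha.2.2 c c' z hz hz', hb.2.2 c c' z hz hz', gsubst_gmul]

open Classical in
variable (X) in
/-- The constant section `1`. -/
def oneSec : Sec X := fun c z => if z ∈ c.1.target then gone else 0

theorem oneSec_mem : oneSec X ∈ PV X := by
  refine ⟨fun c => ?_, fun c z hz => if_neg hz, fun c c' z hz hz' => ?_⟩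
  · exact (contDiffOn_const (c := gone)).congr fun z hz => if_pos hz
  · rw [oneSec, oneSec, if_pos hz, if_pos (transition_mem hz'), gsubst_gone]

open Classical in
/-- The exterior algebra structure on polyvector fields. -/
instance : Ring (PV X) :=
  { (inferInstance : AddCommGroup (PV X)) with
  mul a b := ⟨wedge a.1 b.1, wedge_mem a.2 b.2⟩
  one := ⟨oneSec X, oneSec_mem⟩
  mul_assoc a b c := Subtype.ext (funext fun _ => funext fun _ => gmul_assoc _ _ _)
  one_mul a := Subtype.ext <| funext fun c => funext fun z => by
    change gmul (oneSec X c z) (a.1 c z) = a.1 c z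
    by_cases hz : z ∈ c.1.target
    · rw [oneSec, if_pos hz, gone_gmul]
    · rw [a.2.2.1 c z hz, gmul_zero]
  mul_one a := Subtype.ext <| funext fun c => funext fun z => by
    change gmul (a.1 c z) (oneSec X c z) = a.1 c z
    by_cases hz : z ∈ c.1.target
    · rw [oneSec, if_pos hz, gmul_gone]
    · rw [a.2.2.1 c z hz, zero_gmul]
  left_distrib a b c := Subtype.ext (funext fun _ => funext fun _ => gmul_add _ _ _)
  right_distrib a b c := Subtype.ext (funext fun _ => funext fun _ => add_gmul _ _ _)
  zero_mul a := Subtype.ext (funext fun _ => funext fun _ => zero_gmul _)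
  mul_zero a := Subtype.ext (funext fun _ => funext fun _ => gmul_zero _)
  }

theorem PV.coe_mul (a b : PV X) : ((a * b : PV X) : Sec X) = wedge a.1 b.1 := rfl

theorem PV.coe_one : ((1 : PV X) : Sec X) = oneSec X := rfl

instance : Algebra ℂ (PV X) :=
  Algebra.ofModule
    (fun _ _ _ => Subtype.ext (funext fun _ => funext fun _ => smul_gmul _ _ _))
    (fun _ _ _ => Subtype.ext (funext fun _ => funext fun _ => gmul_smul _ _ _))

theorem PV.ext {a b : PV X} (h : ∀ c : atlas V X, ∀ z ∈ c.1.target, a.1 c z = b.1 c z) : a = b := by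
  refine Subtype.ext (funext fun c => funext fun z => ?_)
  by_cases hz : z ∈ c.1.target
  · exact h c z hz
  · rw [a.2.2.1 c z hz, b.2.2.1 c z hz]

/-- The parity involution, the sign `(-1)^{i+j}` on `PV^{i,j}`. -/
def parityInv : PV X →ₗ[ℂ] PV X where
  toFun a := ⟨fun c z => ginv (a.1 c z), fun c z hz =>
      ((PV.contDiffAt a.2 hz).linear ginv).contDiffWithinAt,
    fun c z hz => by simp only [a.2.2.1 c z hz, map_zero],
    fun c c' z hz hz' => by simp only [a.2.2.2 c c' z hz hz', ginv_gsubst]⟩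
  map_add' a b := Subtype.ext (funext fun _ => funext fun _ => map_add _ _ _)
  map_smul' s a := Subtype.ext (funext fun c => funext fun z => map_smul ginv s (a.1 c z))

theorem parityInv_coe (a : PV X) (c : atlas V X) (z : V) :
    (parityInv a).1 c z = ginv (a.1 c z) := rfl

theorem parityInv_parityInv (a : PV X) : parityInv (parityInv a) = a :=
  Subtype.ext (funext fun _ => funext fun _ => ginv_ginv _)

theorem parityInv_mul (a b : PV X) : parityInv (a * b) = parityInv a * parityInv b :=
  Subtype.ext (funext fun _ => funext fun _ => ginv_gmul _ _)

theorem parityInv_one : parityInv (1 : PV X) = 1 := PV.ext fun c z hz => by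
  rw [parityInv_coe, PV.coe_one, oneSec, if_pos hz, ginv_gone]

theorem dbar_apply {a : Sec X} {c : atlas V X} {z : V} (hz : z ∈ c.1.target) :
    dbar a c z = ∑ j : Fin 3, gext (eta j) (dzbar j (a c) z) := if_pos hz

theorem dbar_eventuallyEq {a : Sec X} {c : atlas V X} {z : V} (hz : z ∈ c.1.target) :
    dbar a c =ᶠ[𝓝 z] fun w => ∑ j : Fin 3, gext (eta j) (dzbar j (a c) w) := by
  filter_upwards [c.1.open_target.mem_nhds hz] with w hw
  exact dbar_apply hw

theorem div_apply {Ω : HolVolForm X} {a : Sec X} {c : atlas V X} {z : V} (hz : z ∈ c.1.target) :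
    div Ω a c z =
      ∑ i : Fin 3, (Ω.coeff c z)⁻¹ • gcontr (xi i) (dz i (fun w => Ω.coeff c w • a c w) z) :=
  if_pos hz

theorem div_eventuallyEq {Ω : HolVolForm X} {a : Sec X} {c : atlas V X} {z : V}
    (hz : z ∈ c.1.target) : div Ω a c =ᶠ[𝓝 z] fun z =>
      ∑ i : Fin 3, (Ω.coeff c z)⁻¹ • gcontr (xi i) (dz i (fun w => Ω.coeff c w • a c w) z) := by
  filter_upwards [c.1.open_target.mem_nhds hz] with w hw
  exact div_apply hw

section Operators

variable [IsManifold 𝓘(ℂ, V) ω X]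

theorem dbar_mem {a : Sec X} (ha : a ∈ PV X) : dbar a ∈ PV X := by
  refine ⟨fun c z hz => ?_, fun c z hz => if_neg hz, fun c c' z hz hz' => ?_⟩
  · refine ContDiffAt.contDiffWithinAt ?_
    refine ContDiffAt.congr_of_eventuallyEq ?_ (dbar_eventuallyEq hz)
    exact ContDiffAt.sum fun j _ => ((PV.contDiffAt ha hz).wirt _ j).linear (gextL (eta j))
  · rw [dbar_apply hz, dbar_apply (transition_mem hz')]
    refine (isCoordChange hz hz').dbar_transform (PV.contDiffAt ha hz).differentiable
      (PV.contDiffAt ha (transition_mem hz')).differentiable ?_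
    filter_upwards [eventually_overlap hz hz'] with w hw
    exact ha.2.2 c c' w hw.1 hw.2

theorem div_mem (Ω : HolVolForm X) {a : Sec X} (ha : a ∈ PV X) : div Ω a ∈ PV X := by
  refine ⟨fun c z hz => ?_, fun c z hz => if_neg hz, fun c c' z hz hz' => ?_⟩
  · refine ContDiffAt.contDiffWithinAt ?_
    refine ContDiffAt.congr_of_eventuallyEq ?_ (div_eventuallyEq hz)
    have hρ := Ω.holomorphic c z hz
    refine ContDiffAt.sum fun j _ => (hρ.inv (Ω.ne_zero c z hz)).contDiffAt_real.fsmul ?_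
    have h1 := (hρ.contDiffAt_real.fsmul (PV.contDiffAt ha hz)).wirt (-Complex.I) j
    rw [dz_eq_wirt]
    exact h1.linear (gcontrL (xi j))
  · rw [div_apply hz, div_apply (transition_mem hz')]
    refine (isCoordChange hz hz').div_transform (PV.contDiffAt ha hz)
      (PV.contDiffAt ha (transition_mem hz')) ?_ (Ω.holomorphic c' _ (transition_mem hz'))
      (Ω.ne_zero c z hz) ?_
    · filter_upwards [eventually_overlap hz hz'] with w hw
      exact ha.2.2 c c' w hw.1 hw.2
    · filter_upwards [eventually_overlap hz hz'] with w hw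
      exact Ω.transform c c' w hw.1 hw.2

/-- The operator `∂̄` on polyvector fields. -/
def dbarL : PV X →ₗ[ℂ] PV X where
  toFun a := ⟨dbar a.1, dbar_mem a.2⟩
  map_add' a b := PV.ext fun c z hz => by
    change dbar (a.1 + b.1) c z = dbar a.1 c z + dbar b.1 c z
    simp only [dbar_apply hz, dzbar_eq_wirt, ← Finset.sum_add_distrib, ← gext_add]
    exact Finset.sum_congr rfl fun j _ => congrArg _
      (wirt_add (PV.contDiffAt a.2 hz) (PV.contDiffAt b.2 hz))
  map_smul' s a := PV.ext fun c z hz => by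
    change dbar (s • a.1) c z = s • dbar a.1 c z
    simp only [dbar_apply hz, dzbar_eq_wirt, Finset.smul_sum, ← gext_smul]
    exact Finset.sum_congr rfl fun j _ => congrArg _ (wirt_smul (PV.contDiffAt a.2 hz) s)

/-- The divergence operator on polyvector fields. -/
def divL (Ω : HolVolForm X) : PV X →ₗ[ℂ] PV X where
  toFun a := ⟨div Ω a.1, div_mem Ω a.2⟩
  map_add' a b := PV.ext fun c z hz => by
    change div Ω (a.1 + b.1) c z = div Ω a.1 c z + div Ω b.1 c z
    have hρ := (Ω.holomorphic c z hz).contDiffAt_real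
    simp only [div_apply hz, dz_eq_wirt, ← Finset.sum_add_distrib, ← smul_add, ← gcontr_add]
    refine Finset.sum_congr rfl fun j _ => congrArg _ (congrArg _ ?_)
    rw [← wirt_add (hρ.fsmul (PV.contDiffAt a.2 hz)) (hρ.fsmul (PV.contDiffAt b.2 hz))]
    simp only [Pi.add_apply, smul_add]
  map_smul' s a := PV.ext fun c z hz => by
    change div Ω (s • a.1) c z = s • div Ω a.1 c z
    have hρ := (Ω.holomorphic c z hz).contDiffAt_real
    simp only [div_apply hz, dz_eq_wirt, Finset.smul_sum]
    refine Finset.sum_congr rfl fun j _ => ?_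
    rw [smul_comm s, ← gcontr_smul _ s, ← wirt_smul (hρ.fsmul (PV.contDiffAt a.2 hz))]
    simp only [Pi.smul_apply, smul_comm s]

theorem dbarL_coe (a : PV X) : (dbarL a).1 = dbar a.1 := rfl

theorem divL_coe (Ω : HolVolForm X) (a : PV X) : (divL Ω a).1 = div Ω a.1 := rfl

end Operators

end Geometry


theorem wirt_sum_gext {s : ℂ} {i : Fin 3} {f : Fin 3 → V → Grass} {z : V} (k : Fin 3 → Fin 6)
    (hf : ∀ j, ContDiffAt ℝ ∞ (f j) z) :
    wirt s i (fun w => ∑ j, gext (k j) (f j w)) z = ∑ j, gext (k j) (wirt s i (f j) z) := by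
  have := wirt_sum (s := s) (i := i) Finset.univ (f := fun j w => gext (k j) (f j w)) (z := z)
    fun j => (hf j).linear (gextL (k j))
  rw [this]
  exact Finset.sum_congr rfl fun j _ => wirt_gext (hf j) _

theorem wirt_sum_gcontr {s : ℂ} {i : Fin 3} {f : Fin 3 → V → Grass} {z : V} (k : Fin 3 → Fin 6)
    (hf : ∀ j, ContDiffAt ℝ ∞ (f j) z) :
    wirt s i (fun w => ∑ j, gcontr (k j) (f j w)) z = ∑ j, gcontr (k j) (wirt s i (f j) z) := by
  have := wirt_sum (s := s) (i := i) Finset.univ (f := fun j w => gcontr (k j) (f j w)) (z := z)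
    fun j => (hf j).linear (gcontrL (k j))
  rw [this]
  exact Finset.sum_congr rfl fun j _ => wirt_gcontr (hf j) _

section Geometry

variable {X : Type*} [TopologicalSpace X] [ChartedSpace V X]

section Operators

variable [IsManifold 𝓘(ℂ, V) ω X]

theorem ginv_sum {ι : Type*} (s : Finset ι) (f : ι → Grass) :
    ginv (∑ i ∈ s, f i) = ∑ i ∈ s, ginv (f i) := map_sum _ _ _

theorem ginv_dbar {a : PV X} {c : atlas V X} {z : V} (hz : z ∈ c.1.target) (s : ℂ) (j : Fin 3) :
    wirt s j ((parityInv a).1 c) z = ginv (wirt s j (a.1 c) z) :=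
  wirt_linear (PV.contDiffAt a.2 hz) ginv

theorem dbarL_parityInv (a : PV X) : dbarL (parityInv a) = -parityInv (dbarL a) :=
  PV.ext fun c z hz => by
    change dbar (parityInv a).1 c z = -ginv (dbar a.1 c z)
    rw [dbar_apply hz, dbar_apply hz, ginv_sum, ← Finset.sum_neg_distrib]
    refine Finset.sum_congr rfl fun j _ => ?_
    rw [ginv_gext, neg_neg, dzbar_eq_wirt, ginv_dbar hz]

theorem dbarL_mul (a b : PV X) : dbarL (a * b) = dbarL a * b + parityInv a * dbarL b :=
  PV.ext fun c z hz => by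
    change dbar (a * b).1 c z = gmul (dbar a.1 c z) (b.1 c z) + gmul (ginv (a.1 c z)) (dbar b.1 c z)
    rw [dbar_apply hz, dbar_apply hz, dbar_apply hz, sum_gmul, gmul_sum, ← Finset.sum_add_distrib]
    refine Finset.sum_congr rfl fun j _ => ?_
    rw [dzbar_eq_wirt, gmul_gext_left, gmul_gext_right, ginv_ginv, ← gext_add]
    exact congrArg _ (wirt_gmul (PV.contDiffAt a.2 hz) (PV.contDiffAt b.2 hz))

theorem dbarL_dbarL (a : PV X) : dbarL (dbarL a) = 0 := PV.ext fun c z hz => by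
  change dbar (dbar a.1) c z = 0
  have ha := PV.contDiffAt a.2 hz
  rw [dbar_apply hz]
  simp only [dzbar_eq_wirt, wirt_congr (dbar_eventuallyEq hz), wirt_sum_gext _ fun j => ha.wirt _ j,
    gext_sum]
  refine IsCoordChange.sum_antisymm _ fun i j => ?_
  rw [gext_gext, wirt_comm ha]

theorem contDiffAt_coeff (Ω : HolVolForm X) (a : PV X) {c : atlas V X} {z : V}
    (hz : z ∈ c.1.target) : ContDiffAt ℝ ∞ (fun w => Ω.coeff c w • a.1 c w) z :=
  (Ω.holomorphic c z hz).contDiffAt_real.fsmul (PV.contDiffAt a.2 hz)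

/-- `∂` is the conjugate by `Ω` of `∑ i, ι_{dz_i} ∂/∂z_i`. -/
theorem coeff_smul_div (Ω : HolVolForm X) (a : Sec X) {c : atlas V X} {z : V}
    (hz : z ∈ c.1.target) : (fun w => Ω.coeff c w • div Ω a c w) =ᶠ[𝓝 z]
      fun z => ∑ i, gcontr (xi i) (wirt (-Complex.I) i (fun w => Ω.coeff c w • a c w) z) := by
  filter_upwards [c.1.open_target.mem_nhds hz] with w hw
  rw [div_apply hw, ← Finset.smul_sum, smul_smul, mul_inv_cancel₀ (Ω.ne_zero c w hw), one_smul]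
  simp only [dz_eq_wirt]

theorem divL_divL (Ω : HolVolForm X) (a : PV X) : divL Ω (divL Ω a) = 0 :=
  PV.ext fun c z hz => by
    change div Ω (div Ω a.1) c z = 0
    have ha := contDiffAt_coeff Ω a hz
    rw [div_apply hz, ← Finset.smul_sum]
    simp only [dz_eq_wirt, wirt_congr (coeff_smul_div Ω a.1 hz), wirt_sum_gcontr _ fun j => ha.wirt _ j,
      gcontr_sum]
    rw [IsCoordChange.sum_antisymm, smul_zero]
    intro i j
    rw [gcontr_gcontr, wirt_comm ha]

theorem divL_parityInv (Ω : HolVolForm X) (a : PV X) :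
    divL Ω (parityInv a) = -parityInv (divL Ω a) :=
  PV.ext fun c z hz => by
    change div Ω (parityInv a).1 c z = -ginv (div Ω a.1 c z)
    rw [div_apply hz, div_apply hz, ginv_sum, ← Finset.sum_neg_distrib]
    refine Finset.sum_congr rfl fun j _ => ?_
    rw [map_smul, ginv_gcontr, smul_neg, neg_neg, dz_eq_wirt]
    have := wirt_linear (s := -Complex.I) (i := j) (contDiffAt_coeff Ω a hz) ginv
    rw [← this]
    simp only [map_smul, parityInv_coe]

theorem dbarL_divL (Ω : HolVolForm X) (a : PV X) : dbarL (divL Ω a) = -divL Ω (dbarL a) :=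
  PV.ext fun c z hz => by
    change dbar (div Ω a.1) c z = -div Ω (dbar a.1) c z
    have ha := PV.contDiffAt a.2 hz
    have hρ := Ω.holomorphic c z hz
    have hρi : AnalyticAt ℂ (fun w => (Ω.coeff c w)⁻¹) z := hρ.inv (Ω.ne_zero c z hz)
    have hb := contDiffAt_coeff Ω a hz
    have h1 : ContDiffAt ℝ ∞ (fun w => ∑ i, gcontr (xi i)
        (wirt (-Complex.I) i (fun w => Ω.coeff c w • a.1 c w) w)) z :=
      ContDiffAt.sum fun i _ => (hb.wirt _ i).linear (gcontrL (xi i))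
    have h2 : div Ω a.1 c =ᶠ[𝓝 z] fun w => (Ω.coeff c w)⁻¹ • ∑ i, gcontr (xi i)
        (wirt (-Complex.I) i (fun w => Ω.coeff c w • a.1 c w) w) := by
      filter_upwards [div_eventuallyEq hz] with w hw
      rw [hw, Finset.smul_sum]
      simp only [dz_eq_wirt]
    have h3 : ∀ j, wirt Complex.I j (div Ω a.1 c) z = (Ω.coeff c z)⁻¹ • ∑ i, gcontr (xi i)
        (wirt Complex.I j (wirt (-Complex.I) i (fun w => Ω.coeff c w • a.1 c w)) z) := by
      intro j
      rw [wirt_congr h2, wirt_fsmul hρi.contDiffAt_real h1, wirtS_dzbar_eq_zero hρi, zero_smul,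
        zero_add, wirt_sum_gcontr _ fun i => hb.wirt _ i]
    have h4 : (fun w => Ω.coeff c w • dbar a.1 c w) =ᶠ[𝓝 z]
        fun w => ∑ j, gext (eta j) (wirt Complex.I j (fun w => Ω.coeff c w • a.1 c w) w) := by
      filter_upwards [c.1.open_target.mem_nhds hz] with w hw
      have hρw := Ω.holomorphic c w hw
      rw [dbar_apply hw, Finset.smul_sum]
      refine Finset.sum_congr rfl fun j _ => ?_
      rw [wirt_fsmul hρw.contDiffAt_real (PV.contDiffAt a.2 hw), wirtS_dzbar_eq_zero hρw, zero_smul,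
        zero_add, gext_smul, dzbar_eq_wirt]
    have h5 : ∀ i, wirt (-Complex.I) i (fun w => ∑ j, gext (eta j)
        (wirt Complex.I j (fun w => Ω.coeff c w • a.1 c w) w)) z = ∑ j, gext (eta j)
        (wirt (-Complex.I) i (wirt Complex.I j (fun w => Ω.coeff c w • a.1 c w)) z) := fun i =>
      wirt_sum_gext _ fun j => hb.wirt _ j
    rw [dbar_apply hz, div_apply hz, ← Finset.smul_sum]
    simp only [dz_eq_wirt, dzbar_eq_wirt, h3, wirt_congr h4, h5, gcontr_sum, gext_smul, gext_sum]
    rw [← Finset.smul_sum, ← smul_neg, Finset.sum_comm, ← Finset.sum_neg_distrib]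
    congr 1
    refine Finset.sum_congr rfl fun i _ => ?_
    rw [← Finset.sum_neg_distrib]
    refine Finset.sum_congr rfl fun j _ => ?_
    have hij : xi i ≠ eta j := by
      intro h
      have := congrArg Fin.val h
      simp [xi, eta] at this
      omega
    rw [gcontr_gext, if_neg hij, zero_sub, neg_neg, wirt_comm hb]

/-- The bracket of polyvector fields that measures the failure of `∂` to be a derivation:
`br a b = ∂(ab) - (∂a) b - (-1)^{|a|} a ∂b`. -/
def br (Ω : HolVolForm X) (a b : PV X) : PV X :=
  divL Ω (a * b) - divL Ω a * b - parityInv a * divL Ω b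

/-- The bracket is the contraction of first derivatives. -/
theorem br_apply (Ω : HolVolForm X) (a b : PV X) {c : atlas V X} {z : V} (hz : z ∈ c.1.target) :
    (br Ω a b).1 c z = ∑ i, (gmul (ginv (dz i (a.1 c) z)) (gcontr (xi i) (b.1 c z)) +
      gmul (gcontr (xi i) (a.1 c z)) (dz i (b.1 c) z)) := by
  change div Ω (a * b).1 c z - gmul (div Ω a.1 c z) (b.1 c z) -
    gmul (ginv (a.1 c z)) (div Ω b.1 c z) = _
  have ha := PV.contDiffAt a.2 hz
  have hb := PV.contDiffAt b.2 hz
  have hρ := (Ω.holomorphic c z hz).contDiffAt_real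
  rw [div_apply hz, div_apply hz, div_apply hz, sum_gmul, gmul_sum, ← Finset.sum_sub_distrib,
    ← Finset.sum_sub_distrib]
  refine Finset.sum_congr rfl fun i _ => ?_
  have h1 : wirt (-Complex.I) i ((a * b).1 c) z =
      gmul (wirt (-Complex.I) i (a.1 c) z) (b.1 c z) +
        gmul (a.1 c z) (wirt (-Complex.I) i (b.1 c) z) := wirt_gmul ha hb
  have h2 : (a * b).1 c z = gmul (a.1 c z) (b.1 c z) := rfl
  rw [dz_eq_wirt, wirt_fsmul hρ (PV.contDiffAt (a * b).2 hz), wirt_fsmul hρ ha, wirt_fsmul hρ hb,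
    h1, h2]
  have hne := Ω.ne_zero c z hz
  simp only [gcontr_add, gcontr_smul, gcontr_gmul, add_gmul, gmul_add, smul_gmul, gmul_smul]
  match_scalars <;> field_simp <;> ring

/-- `γ^p`, for the parity involution `γ`. -/
def parityPow (p : ZMod 2) (a : PV X) : PV X := if p = 0 then a else parityInv a

theorem PV.mul_comm_of_parity (p : ZMod 2) (a b : PV X) (ha : parityInv a = psign p • a) :
    a * b = parityPow p b * a := PV.ext fun c z hz => by
  have h1 := gmul_comm_of_parity p (a.1 c z) (b.1 c z)
    (congrFun (congrFun (congrArg Subtype.val ha) c) z)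
  refine h1.trans ?_
  rcases zmod_two_cases p with rfl | rfl <;> rfl

theorem wirt_parity {a : PV X} {p : ZMod 2} (ha : parityInv a = psign p • a) {c : atlas V X} {z : V}
    (hz : z ∈ c.1.target) (s : ℂ) (i : Fin 3) :
    ginv (wirt s i (a.1 c) z) = psign p • wirt s i (a.1 c) z := by
  rw [← ginv_dbar hz, ← wirt_smul (PV.contDiffAt a.2 hz), ha]
  rfl

/-- The bracket with a polyvector field of parity `p` is a derivation of parity `p + 1`. -/
theorem br_mul (Ω : HolVolForm X) (p : ZMod 2) (a b c : PV X) (ha : parityInv a = psign p • a) :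
    br Ω a (b * c) = br Ω a b * c + parityPow (p + 1) b * br Ω a c := PV.ext fun x z hz => by
  change (br Ω a (b * c)).1 x z = gmul ((br Ω a b).1 x z) (c.1 x z) +
    gmul ((parityPow (p + 1) b).1 x z) ((br Ω a c).1 x z)
  have hbz : (parityPow (p + 1) b).1 x z = gpow (p + 1) (b.1 x z) := by
    rcases zmod_two_cases p with rfl | rfl <;> rfl
  rw [br_apply Ω _ _ hz, br_apply Ω _ _ hz, br_apply Ω _ _ hz, sum_gmul, gmul_sum,
    ← Finset.sum_add_distrib, hbz]
  refine Finset.sum_congr rfl fun i _ => ?_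
  have h1 : wirt (-Complex.I) i ((b * c).1 x) z =
      gmul (wirt (-Complex.I) i (b.1 x) z) (c.1 x z) +
        gmul (b.1 x z) (wirt (-Complex.I) i (c.1 x) z) :=
    wirt_gmul (PV.contDiffAt b.2 hz) (PV.contDiffAt c.2 hz)
  have h2 : (b * c).1 x z = gmul (b.1 x z) (c.1 x z) := rfl
  have haz : ginv (a.1 x z) = psign p • a.1 x z := congrFun (congrFun (congrArg Subtype.val ha) x) z
  have h3 := wirt_parity ha hz (-Complex.I) i
  have h4 : ginv (gcontr (xi i) (a.1 x z)) = psign (p + 1) • gcontr (xi i) (a.1 x z) := by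
    rw [ginv_gcontr, haz, gcontr_smul, ← neg_smul, psign_add, psign_one, mul_neg_one]
  have h5 : gmul (ginv (wirt (-Complex.I) i (a.1 x) z)) (ginv (b.1 x z)) =
      gmul (gpow (p + 1) (b.1 x z)) (ginv (wirt (-Complex.I) i (a.1 x) z)) := by
    rw [h3, smul_gmul, gmul_comm_of_parity p _ _ h3, gmul_smul]
    rcases zmod_two_cases p with rfl | rfl
    · rfl
    · simp [gpow, show (1 : ZMod 2) + 1 = 0 from rfl, ginv_ginv]
  rw [dz_eq_wirt, h1, h2]
  simp only [gcontr_gmul, gmul_add, add_gmul, ← gmul_assoc]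
  rw [h5, gmul_comm_of_parity (p + 1) _ (b.1 x z) h4]
  abel

end Operators

end Geometry


/-! ### Degrees, supports and the inverse of the volume form -/

theorem dzzz_eq : dzzz = gext (xi 0) (gext (xi 1) (gext (xi 2) gone)) := by
  have h : gone = (Pi.single ∅ 1 : Grass) := rfl
  rw [h, gext_single _ _ (by simp), gext_single _ _ (by decide), gext_single _ _ (by decide), dzzz]
  have h1 : (insert (xi 0) (insert (xi 1) (insert (xi 2) (∅ : Finset (Fin 6))))) = {0, 1, 2} := by
    decide
  have h2 : gsign (xi 2) ∅ = 1 := by simp [gsign]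
  have h3 : gsign (xi 1) {xi 2} = 1 := by
    rw [gsign, show ({xi 2} : Finset (Fin 6)).filter (· < xi 1) = ∅ by decide]; simp
  have h4 : gsign (xi 0) {xi 1, xi 2} = 1 := by
    rw [gsign, show ({xi 1, xi 2} : Finset (Fin 6)).filter (· < xi 0) = ∅ by decide]; simp
  simp only [insert_empty_eq] at h1 ⊢
  rw [h2, h3, h4, h1, one_mul, one_mul, one_mul]

theorem gsubst_dzzz (A D : Matrix (Fin 3) (Fin 3) ℂ) : gsubst (blk A D) dzzz = A.det • dzzz := by
  have h0 : ∀ k, gext k 0 = 0 := fun k => map_zero (gextL k)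
  have h10 := gext_gext (xi 1) (xi 0)
  have h20 := gext_gext (xi 2) (xi 0)
  have h21 := gext_gext (xi 2) (xi 1)
  rw [dzzz_eq]
  simp only [gsubst_gext, sum_generators, blk_xi_xi, blk_eta_xi, zero_smul,
    Finset.sum_const_zero, add_zero, gsubst_gone, Fin.sum_univ_three, gext_add, gext_smul,
    gext_self, h0, h10, h20, h21, gext_neg, smul_zero, zero_add, Matrix.det_fin_three, smul_neg,
    neg_zero]
  module

theorem ginv_dzzz : ginv dzzz = -dzzz := by
  rw [dzzz_eq, ginv_gext, ginv_gext, ginv_gext, ginv_gone]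
  simp only [gext_neg, neg_neg]

theorem dzzz_mem_gdeg : dzzz ∈ gdeg 3 := by
  intro K h
  have : K = {0, 1, 2} := by
    by_contra h0
    exact h (by simp [dzzz, h0])
  subst this
  decide

section Geometry

variable {X : Type*} [TopologicalSpace X] [ChartedSpace V X]

variable (X) in
/-- The polyvector fields in `PV^{i,•}`. -/
def PV.deg (i : ℕ) : Submodule ℂ (PV X) where
  carrier := {a | ∀ c z, a.1 c z ∈ gdeg i}
  zero_mem' := fun _ _ => (gdeg i).zero_mem
  add_mem' := fun ha hb c z => (gdeg i).add_mem (ha c z) (hb c z)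
  smul_mem' := fun s _ ha c z => (gdeg i).smul_mem s (ha c z)

variable (X) in
/-- The polyvector fields with compact support. -/
def PV.compact : Submodule ℂ (PV X) where
  carrier := {a | ∃ S : Set X, IsCompact S ∧
    ∀ c : atlas V X, ∀ z ∈ c.1.target, c.1.symm z ∉ S → a.1 c z = 0}
  zero_mem' := ⟨∅, isCompact_empty, fun _ _ _ _ => rfl⟩
  add_mem' := by
    rintro a b ⟨S, hS, haS⟩ ⟨T, hT, hbT⟩
    refine ⟨S ∪ T, hS.union hT, fun c z hz h => ?_⟩
    simp only [Set.mem_union, not_or] at h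
    simp [haS c z hz h.1, hbT c z hz h.2]
  smul_mem' := by
    rintro s a ⟨S, hS, haS⟩
    exact ⟨S, hS, fun c z hz h => by simp [haS c z hz h]⟩

theorem mem_PVc_iff {i : ℕ} {a : Sec X} :
    a ∈ PVc X i ↔ ∃ h : a ∈ PV X, (⟨a, h⟩ : PV X) ∈ PV.deg X i ∧ (⟨a, h⟩ : PV X) ∈ PV.compact X :=
  ⟨fun h => ⟨⟨h.smooth, h.off_target, h.transform⟩, h.degree, h.compact_support⟩,
    fun ⟨h, hd, hc⟩ => ⟨h.1, h.2.1, h.2.2, hd, hc⟩⟩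

/-- The inclusion of the compactly supported elements of `PV^{i,•}` into all polyvector fields. -/
def toPV {i : ℕ} : PVc X i →ₗ[ℂ] PV X :=
  Submodule.inclusion fun _ h => (mem_PVc_iff.mp h).1

theorem toPV_coe {i : ℕ} (a : PVc X i) : (toPV a).1 = a.1 := rfl

theorem toPV_mem_deg {i : ℕ} (a : PVc X i) : toPV a ∈ PV.deg X i := (mem_PVc_iff.mp a.2).2.1

theorem toPV_mem_compact {i : ℕ} (a : PVc X i) : toPV a ∈ PV.compact X :=
  (mem_PVc_iff.mp a.2).2.2

theorem coe_mem_PVc {i : ℕ} {a : PV X} (hd : a ∈ PV.deg X i) (hc : a ∈ PV.compact X) :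
    a.1 ∈ PVc X i := mem_PVc_iff.mpr ⟨a.2, hd, hc⟩

theorem PV.mul_mem_deg {i j : ℕ} {a b : PV X} (ha : a ∈ PV.deg X i) (hb : b ∈ PV.deg X j) :
    a * b ∈ PV.deg X (i + j) := fun c z => gmul_mem_gdeg (ha c z) (hb c z)

theorem PV.one_mem_deg : (1 : PV X) ∈ PV.deg X 0 := fun c z => by
  classical
  rw [PV.coe_one, oneSec]
  split_ifs
  · exact gone_mem_gdeg
  · exact (gdeg 0).zero_mem

theorem PV.eq_zero_of_mem_deg {i : ℕ} (hi : 4 ≤ i) {a : PV X} (ha : a ∈ PV.deg X i) : a = 0 :=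
  PV.ext fun c z _ => eq_zero_of_mem_gdeg hi (ha c z)

theorem parityInv_mem_deg {i : ℕ} {a : PV X} (ha : a ∈ PV.deg X i) : parityInv a ∈ PV.deg X i :=
  fun c z => ginv_mem_gdeg (ha c z)

theorem PV.mul_mem_compact_left {a : PV X} (ha : a ∈ PV.compact X) (b : PV X) :
    a * b ∈ PV.compact X := by
  obtain ⟨S, hS, h⟩ := ha
  refine ⟨S, hS, fun c z hz hzS => ?_⟩
  change gmul (a.1 c z) (b.1 c z) = 0
  rw [h c z hz hzS, zero_gmul]

theorem PV.mul_mem_compact_right (a : PV X) {b : PV X} (hb : b ∈ PV.compact X) :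
    a * b ∈ PV.compact X := by
  obtain ⟨S, hS, h⟩ := hb
  refine ⟨S, hS, fun c z hz hzS => ?_⟩
  change gmul (a.1 c z) (b.1 c z) = 0
  rw [h c z hz hzS, gmul_zero]

theorem parityInv_mem_compact {a : PV X} (ha : a ∈ PV.compact X) : parityInv a ∈ PV.compact X := by
  obtain ⟨S, hS, h⟩ := ha
  refine ⟨S, hS, fun c z hz hzS => ?_⟩
  rw [parityInv_coe, h c z hz hzS, map_zero]

theorem wirt_eq_zero_of_eventually {s : ℂ} {i : Fin 3} {f : V → Grass} {z : V}
    (h : f =ᶠ[𝓝 z] fun _ => 0) : wirt s i f z = 0 := by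
  rw [wirt_congr h]
  simp [wirt]

theorem eventually_eq_zero [T2Space X] {a : Sec X} {S : Set X} (hS : IsCompact S)
    (h : ∀ c : atlas V X, ∀ z ∈ c.1.target, c.1.symm z ∉ S → a c z = 0) {c : atlas V X} {z : V}
    (hz : z ∈ c.1.target) (hzS : c.1.symm z ∉ S) : a c =ᶠ[𝓝 z] fun _ => 0 := by
  filter_upwards [c.1.open_target.mem_nhds hz,
    (c.1.continuousAt_symm hz).eventually (hS.isClosed.isOpen_compl.mem_nhds hzS)] with w hw hw'
  exact h c w hw hw'

variable [IsManifold 𝓘(ℂ, V) ω X]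

theorem dbarL_mem_deg {i : ℕ} {a : PV X} (ha : a ∈ PV.deg X i) : dbarL a ∈ PV.deg X i := by
  intro c z
  rw [dbarL_coe, dbar]
  split_ifs
  · exact (gdeg i).sum_mem fun j _ => gext_eta_mem_gdeg (wirt_mem_gdeg (ha c) _ j z) j
  · exact (gdeg i).zero_mem

theorem divL_mem_deg (Ω : HolVolForm X) {i : ℕ} {a : PV X} (ha : a ∈ PV.deg X (i + 1)) :
    divL Ω a ∈ PV.deg X i := by
  intro c z
  rw [divL_coe, div]
  split_ifs
  · refine (gdeg i).sum_mem fun j _ => (gdeg i).smul_mem _ (gcontr_xi_mem_gdeg ?_ j)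
    rw [dz_eq_wirt]
    exact wirt_mem_gdeg (fun w => (gdeg (i + 1)).smul_mem _ (ha c w)) _ j z
  · exact (gdeg i).zero_mem

theorem divL_of_mem_deg_zero (Ω : HolVolForm X) {a : PV X} (ha : a ∈ PV.deg X 0) :
    divL Ω a = 0 := PV.ext fun c z hz => by
  rw [divL_coe, div_apply hz]
  refine Finset.sum_eq_zero fun j _ => ?_
  rw [gcontr_xi_of_mem_gdeg_zero, smul_zero]
  rw [dz_eq_wirt]
  exact wirt_mem_gdeg (fun w => (gdeg 0).smul_mem _ (ha c w)) _ j z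

theorem dbarL_mem_compact [T2Space X] {a : PV X} (ha : a ∈ PV.compact X) :
    dbarL a ∈ PV.compact X := by
  obtain ⟨S, hS, h⟩ := ha
  refine ⟨S, hS, fun c z hz hzS => ?_⟩
  rw [dbarL_coe, dbar_apply hz]
  refine Finset.sum_eq_zero fun j _ => ?_
  rw [dzbar_eq_wirt, wirt_eq_zero_of_eventually (eventually_eq_zero hS h hz hzS)]
  exact map_zero (gextL (eta j))

theorem divL_mem_compact [T2Space X] (Ω : HolVolForm X) {a : PV X} (ha : a ∈ PV.compact X) :
    divL Ω a ∈ PV.compact X := by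
  obtain ⟨S, hS, h⟩ := ha
  refine ⟨S, hS, fun c z hz hzS => ?_⟩
  rw [divL_coe, div_apply hz]
  refine Finset.sum_eq_zero fun j _ => ?_
  rw [dz_eq_wirt, wirt_eq_zero_of_eventually]
  · exact (congrArg _ (map_zero (gcontrL (xi j)))).trans (smul_zero _)
  · filter_upwards [eventually_eq_zero hS h hz hzS] with w hw
    rw [hw, smul_zero]

theorem dbar_mem_PVc [T2Space X] {i : ℕ} {a : Sec X} (ha : a ∈ PVc X i) : dbar a ∈ PVc X i := by
  obtain ⟨h, hd, hc⟩ := mem_PVc_iff.mp ha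
  exact coe_mem_PVc (dbarL_mem_deg hd) (dbarL_mem_compact hc)

theorem div_mem_PVc [T2Space X] (Ω : HolVolForm X) {i : ℕ} {a : Sec X} (ha : a ∈ PVc X (i + 1)) :
    div Ω a ∈ PVc X i := by
  obtain ⟨h, hd, hc⟩ := mem_PVc_iff.mp ha
  exact coe_mem_PVc (divL_mem_deg Ω hd) (divL_mem_compact Ω hc)

open Classical in
/-- The polyvector field `W = ρ⁻¹ ∂_{z₁} ∂_{z₂} ∂_{z₃}` inverse to the volume form. -/
def invVol (Ω : HolVolForm X) : PV X :=
  ⟨fun c z => if z ∈ c.1.target then (Ω.coeff c z)⁻¹ • dzzz else 0, by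
    refine ⟨fun c => ?_, fun c z hz => if_neg hz, fun c c' z hz hz' => ?_⟩
    · refine ContDiffOn.congr (f := fun z => (Ω.coeff c z)⁻¹ • dzzz) ?_ fun z hz => if_pos hz
      exact fun z hz => (((Ω.holomorphic c z hz).inv
        (Ω.ne_zero c z hz)).contDiffAt_real.fsmul contDiffAt_const).contDiffWithinAt
    · simp only [if_pos hz, if_pos (transition_mem hz')]
      have hd := (isCoordChange hz hz').det_jac_ne_zero
      have hr := Ω.ne_zero c' _ (transition_mem hz')
      rw [frameChange_eq_blk, gsubst_smul, gsubst_dzzz, Ω.transform c c' z hz hz', smul_smul]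
      congr 1
      field_simp⟩

theorem invVol_apply (Ω : HolVolForm X) {c : atlas V X} {z : V} (hz : z ∈ c.1.target) :
    (invVol Ω).1 c z = (Ω.coeff c z)⁻¹ • dzzz := if_pos hz

theorem parityInv_invVol (Ω : HolVolForm X) : parityInv (invVol Ω) = -invVol Ω :=
  PV.ext fun c z hz => by
    change ginv ((invVol Ω).1 c z) = -((invVol Ω).1 c z)
    rw [invVol_apply Ω hz, map_smul, ginv_dzzz, smul_neg]

theorem invVol_mem_deg (Ω : HolVolForm X) : invVol Ω ∈ PV.deg X 3 := fun c z => by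
  by_cases hz : z ∈ c.1.target
  · rw [invVol_apply Ω hz]
    exact (gdeg 3).smul_mem _ dzzz_mem_gdeg
  · rw [(invVol Ω).2.2.1 c z hz]
    exact (gdeg 3).zero_mem

theorem divL_invVol (Ω : HolVolForm X) : divL Ω (invVol Ω) = 0 := PV.ext fun c z hz => by
  rw [divL_coe, div_apply hz]
  refine Finset.sum_eq_zero fun j _ => ?_
  have : (fun w => Ω.coeff c w • (invVol Ω).1 c w) =ᶠ[𝓝 z] fun _ => dzzz := by
    filter_upwards [c.1.open_target.mem_nhds hz] with w hw
    rw [invVol_apply Ω hw, smul_smul, mul_inv_cancel₀ (Ω.ne_zero c w hw), one_smul]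
  rw [dz_eq_wirt, wirt_congr this]
  have h0 : wirt (-Complex.I) j (fun _ => dzzz) z = 0 := by simp [wirt]
  rw [h0]
  exact (congrArg _ (map_zero (gcontrL (xi j)))).trans (smul_zero _)

theorem dbarL_invVol (Ω : HolVolForm X) : dbarL (invVol Ω) = 0 := PV.ext fun c z hz => by
  rw [dbarL_coe, dbar_apply hz]
  refine Finset.sum_eq_zero fun j _ => ?_
  have h1 : (invVol Ω).1 c =ᶠ[𝓝 z] fun w => (Ω.coeff c w)⁻¹ • dzzz := by
    filter_upwards [c.1.open_target.mem_nhds hz] with w hw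
    exact invVol_apply Ω hw
  have hρ : AnalyticAt ℂ (fun w => (Ω.coeff c w)⁻¹) z :=
    (Ω.holomorphic c z hz).inv (Ω.ne_zero c z hz)
  have h0 : wirt Complex.I j (fun _ => dzzz) z = 0 := by simp [wirt]
  rw [dzbar_eq_wirt, wirt_congr h1, wirt_fsmul hρ.contDiffAt_real contDiffAt_const,
    wirtS_dzbar_eq_zero hρ, h0, zero_smul, smul_zero, add_zero]
  exact map_zero (gextL (eta j))

end Geometry


/-! ### The volume measure -/

open MeasureTheory

theorem det_restrictScalars_eq (L : V →L[ℂ] V) :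
    (L.restrictScalars ℝ).det = ‖LinearMap.det (L : V →ₗ[ℂ] V)‖ ^ 2 := by
  have h := LinearMap.det_restrictScalars (R := ℝ) (f := (L : V →ₗ[ℂ] V))
  rw [Algebra.norm_complex_eq] at h
  refine h.trans ?_
  exact Complex.normSq_eq_norm_sq _

theorem det_jac_eq (τ : V → V) (z : V) :
    (jac τ z).det = LinearMap.det (fderiv ℂ τ z : V →ₗ[ℂ] V) := by
  rw [← LinearMap.det_toMatrix']
  rfl

section Geometry

variable {X : Type*} [TopologicalSpace X] [ChartedSpace V X] [MeasurableSpace X] [BorelSpace X]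

/-- The volume measure of a chart. -/
def chartMeasure (Ω : HolVolForm X) (c : atlas V X) : Measure X :=
  Measure.map c.1.symm
    ((volume.restrict c.1.target).withDensity fun z => ENNReal.ofReal (‖Ω.coeff c z‖ ^ 2))

theorem aemeasurable_chart_symm (c : atlas V X) :
    AEMeasurable c.1.symm (volume.restrict c.1.target) :=
  c.1.continuousOn_symm.aemeasurable c.1.open_target.measurableSet

theorem aemeasurable_chart_symm' (Ω : HolVolForm X) (c : atlas V X) :
    AEMeasurable c.1.symm
      ((volume.restrict c.1.target).withDensity fun z => ENNReal.ofReal (‖Ω.coeff c z‖ ^ 2)) :=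
  (aemeasurable_chart_symm c).mono_ac (withDensity_absolutelyContinuous _ _)

theorem measurableSet_chart_preimage (c : atlas V X) {E : Set X} (hE : MeasurableSet E) :
    MeasurableSet (c.1.target ∩ c.1.symm ⁻¹' E) := by
  classical
  rcases isEmpty_or_nonempty X with h | ⟨⟨x⟩⟩
  · convert MeasurableSet.empty
    rw [Set.eq_empty_iff_forall_notMem]
    exact fun z _ => h.elim (c.1.symm z)
  · have h1 : Measurable (c.1.target.piecewise c.1.symm fun _ => x) :=
      c.1.continuousOn_symm.measurable_piecewise continuousOn_const c.1.open_target.measurableSet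
    have h2 : c.1.target ∩ c.1.symm ⁻¹' E =
        c.1.target ∩ (c.1.target.piecewise c.1.symm fun _ => x) ⁻¹' E := by
      ext z
      simp only [Set.mem_inter_iff, Set.mem_preimage, and_congr_right_iff]
      intro hz
      rw [Set.piecewise_eq_of_mem _ _ _ hz]
    rw [h2]
    exact c.1.open_target.measurableSet.inter (h1 hE)

theorem chartMeasure_apply (Ω : HolVolForm X) (c : atlas V X) {E : Set X} (hE : MeasurableSet E) :
    chartMeasure Ω c E =
      ∫⁻ z in c.1.target ∩ c.1.symm ⁻¹' E, ENNReal.ofReal (‖Ω.coeff c z‖ ^ 2) := by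
  rw [chartMeasure, Measure.map_apply_of_aemeasurable (aemeasurable_chart_symm' Ω c) hE,
    withDensity_apply', Measure.restrict_restrict' c.1.open_target.measurableSet, Set.inter_comm]

theorem chartMeasure_compl_source (Ω : HolVolForm X) (c : atlas V X) :
    chartMeasure Ω c (c.1.sourceᶜ) = 0 := by
  rw [chartMeasure_apply Ω c c.1.open_source.measurableSet.compl]
  have : c.1.target ∩ c.1.symm ⁻¹' c.1.sourceᶜ = ∅ := by
    rw [Set.eq_empty_iff_forall_notMem]
    exact fun z hz => hz.2 (c.1.map_target hz.1)
  rw [this, Measure.restrict_empty, lintegral_zero_measure]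

variable [IsManifold 𝓘(ℂ, V) ω X]

/-- Change of variables: the volume measures of two charts agree on the overlap. -/
theorem chartMeasure_inter (Ω : HolVolForm X) (c c' : atlas V X) {E : Set X}
    (hE : MeasurableSet E) :
    chartMeasure Ω c' (E ∩ c.1.source) = chartMeasure Ω c (E ∩ c'.1.source) := by
  have hs := c.1.open_source.measurableSet
  have hs' := c'.1.open_source.measurableSet
  rw [chartMeasure_apply Ω c' (hE.inter hs), chartMeasure_apply Ω c (hE.inter hs')]
  set U := c.1.target ∩ c.1.symm ⁻¹' (E ∩ c'.1.source) with hU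
  have himg : transition c c' '' U = c'.1.target ∩ c'.1.symm ⁻¹' (E ∩ c.1.source) := by
    ext w
    constructor
    · rintro ⟨z, ⟨hz, hzE, hz'⟩, rfl⟩
      refine ⟨transition_mem hz', ?_⟩
      rw [Set.mem_preimage, symm_transition hz']
      exact ⟨hzE, c.1.map_target hz⟩
    · rintro ⟨hw, hwE, hw'⟩
      refine ⟨transition c' c w, ⟨transition_mem hw', ?_⟩, ?_⟩
      · rw [Set.mem_preimage, symm_transition hw']
        exact ⟨hwE, c'.1.map_target hw⟩
      · rw [transition, symm_transition hw']
        exact c'.1.right_inv hw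
  have hinj : Set.InjOn (transition c c') U := by
    intro z hz w hw h
    have h1 := congrArg c'.1.symm h
    rw [symm_transition hz.2.2, symm_transition hw.2.2] at h1
    have h2 := congrArg c.1 h1
    rwa [c.1.right_inv hz.1, c.1.right_inv hw.1] at h2
  have hU' : MeasurableSet U := measurableSet_chart_preimage c (hE.inter hs')
  rw [← himg, lintegral_image_eq_lintegral_abs_det_fderiv_mul volume hU'
    (f' := fun z => (fderiv ℂ (transition c c') z).restrictScalars ℝ) ?_ hinj]
  · refine setLIntegral_congr_fun hU' fun z hz => ?_
    have hz' := Ω.transform c c' z hz.1 hz.2.2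
    rw [det_restrictScalars_eq, ← det_jac_eq, hz', ← ENNReal.ofReal_mul (abs_nonneg _),
      abs_of_nonneg (by positivity), norm_mul]
    congr 1
    ring
  · intro z hz
    exact ((analyticAt_transition hz.1 hz.2.2).differentiableAt.hasFDerivAt.restrictScalars
      ℝ).hasFDerivWithinAt

/-- On the domain of a chart, the volume measure is the volume measure of the chart. -/
theorem volMeasure_restrict (Ω : HolVolForm X) (c : atlas V X) :
    (volMeasure Ω).restrict c.1.source = chartMeasure Ω c := by
  have hs := c.1.open_source.measurableSet
  have hc : (chartMeasure Ω c).restrict c.1.source = chartMeasure Ω c :=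
    Measure.restrict_eq_self_of_ae_mem (by
      rw [ae_iff]
      exact chartMeasure_compl_source Ω c)
  have hle : ∀ c', chartMeasure Ω c' ≤ volMeasure Ω := fun c' =>
    le_iSup (fun c : atlas V X => chartMeasure Ω c) c'
  refine le_antisymm ?_ ?_
  · have h1 : volMeasure Ω ≤ chartMeasure Ω c + (volMeasure Ω).restrict c.1.sourceᶜ := by
      refine iSup_le fun c' => ?_
      change chartMeasure Ω c' ≤ _
      rw [← Measure.restrict_add_restrict_compl (μ := chartMeasure Ω c') hs]
      refine add_le_add ?_ (Measure.restrict_mono_measure (hle c') _)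
      rw [Measure.le_iff]
      intro E hE
      rw [Measure.restrict_apply hE, chartMeasure_inter Ω c c' hE]
      exact measure_mono Set.inter_subset_left
    refine (Measure.restrict_mono_measure h1 _).trans ?_
    rw [Measure.restrict_add, hc, Measure.restrict_restrict hs, Set.inter_compl_self,
      Measure.restrict_empty, add_zero]
  · rw [← hc]
    exact Measure.restrict_mono_measure (hle c) _

end Geometry


/-! ### Integration of polyvector fields -/

open MeasureTheory

theorem gsubst_univ (M : Matrix (Fin 6) (Fin 6) ℂ) (a : Grass) :
    gsubst M a Finset.univ = M.det * a Finset.univ := by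
  rw [gsubst, Finset.sum_eq_single Finset.univ]
  · congr 1
    rw [gminor, dif_pos rfl]
    have hb : Function.Bijective
        ((Finset.univ : Finset (Fin 6)).orderEmbOfFin (rfl : Finset.univ.card = Finset.univ.card)) := by
      refine ⟨(Finset.orderEmbOfFin _ _).injective, fun i => ?_⟩
      have := Finset.range_orderEmbOfFin (Finset.univ : Finset (Fin 6)) rfl
      rw [Finset.coe_univ] at this
      rw [← Set.mem_range, this]
      trivial
    exact Matrix.det_submatrix_equiv_self (Equiv.ofBijective _ hb) M
  · intro I _ hI
    rw [gminor_of_card_ne, zero_mul]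
    intro h
    exact hI ((Finset.card_eq_iff_eq_univ I).mp (by rw [h]; rfl))
  · exact fun h => absurd (Finset.mem_univ _) h

theorem det_blk (A D : Matrix (Fin 3) (Fin 3) ℂ) : (blk A D).det = A.det * D.det := by
  rw [blk, Matrix.det_reindex_self, Matrix.det_fromBlocks_zero₂₁]

section Geometry

variable {X : Type*} [TopologicalSpace X] [ChartedSpace V X]

/-- The top coefficient of the form `(a ∨ Ω) ∧ Ω`, up to sign. -/
def topCoeff (Ω : HolVolForm X) (a : PV X) (c : atlas V X) (z : V) : ℂ :=
  Ω.coeff c z ^ 2 * a.1 c z Finset.univ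

/-- The density of `(a ∨ Ω) ∧ Ω` with respect to the volume measure, up to a constant. -/
def density (Ω : HolVolForm X) (a : PV X) (p : X) : ℂ :=
  topCoeff Ω a ⟨chartAt V p, chart_mem_atlas V p⟩ (chartAt V p p) /
    ((‖Ω.coeff ⟨chartAt V p, chart_mem_atlas V p⟩ (chartAt V p p)‖ ^ 2 : ℝ) : ℂ)

/-- The density may be computed in any chart. -/
theorem density_eq [IsManifold 𝓘(ℂ, V) ω X] (Ω : HolVolForm X) (a : PV X) (c : atlas V X) {p : X}
    (hp : p ∈ c.1.source) :
    density Ω a p = topCoeff Ω a c (c.1 p) / ((‖Ω.coeff c (c.1 p)‖ ^ 2 : ℝ) : ℂ) := by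
  set c₀ : atlas V X := ⟨chartAt V p, chart_mem_atlas V p⟩ with hc₀
  set z₀ := chartAt V p p with hz₀
  have hz : z₀ ∈ c₀.1.target := c₀.1.map_source (mem_chart_source V p)
  have hsymm : c₀.1.symm z₀ = p := c₀.1.left_inv (mem_chart_source V p)
  have hz' : c₀.1.symm z₀ ∈ c.1.source := by rwa [hsymm]
  have hτ : transition c₀ c z₀ = c.1 p := by rw [transition, hsymm]
  have ha := a.2.2.2 c₀ c z₀ hz hz'
  have hρ := Ω.transform c₀ c z₀ hz hz'
  have hcc := isCoordChange hz hz'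
  have hd := hcc.det_jac_ne_zero
  have hinv : (jac (transition c c₀) (transition c₀ c z₀)).det =
      (jac (transition c₀ c) z₀).det⁻¹ := by
    have := congrArg Matrix.det hcc.inv_mul
    rw [Matrix.det_mul, Matrix.det_one] at this
    exact eq_inv_of_mul_eq_one_left this
  have hr := Ω.ne_zero c _ (transition_mem hz')
  change topCoeff Ω a c₀ z₀ / _ = _
  rw [topCoeff, topCoeff, ← hτ, ha, hρ, gsubst_univ, frameChange_eq_blk, det_blk,
    Matrix.det_conjTranspose, hinv]
  push_cast
  simp only [norm_mul, Complex.ofReal_mul, mul_pow, ← Complex.mul_conj', star_inv₀]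
  have hr' : (starRingEnd ℂ) (Ω.coeff c (transition c₀ c z₀)) ≠ 0 := by simpa using hr
  have hd' : (starRingEnd ℂ) (jac (transition c₀ c) z₀).det ≠ 0 := by simpa using hd
  change _ = Ω.coeff c (transition c₀ c z₀) ^ 2 * ((jac (transition c₀ c) z₀).det *
    ((starRingEnd ℂ) (jac (transition c₀ c) z₀).det)⁻¹ * _) / _
  field_simp

theorem contDiff_of_eq_zero {E : Type*} [NormedAddCommGroup E] [NormedSpace ℝ E] {f : V → E}
    {K : Set V} (hK : IsCompact K) (hf : ∀ z ∈ K, ContDiffAt ℝ ∞ f z) (h0 : ∀ z ∉ K, f z = 0) :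
    ContDiff ℝ ∞ f := by
  rw [contDiff_iff_contDiffAt]
  intro z
  by_cases hz : z ∈ K
  · exact hf z hz
  · refine (contDiffAt_const (c := (0 : E))).congr_of_eventuallyEq ?_
    filter_upwards [hK.isClosed.isOpen_compl.mem_nhds hz] with w hw
    exact h0 w hw

/-- Sections with compact support in the domain of the chart `c`. -/
def SupportedIn (c : atlas V X) (a : PV X) : Prop :=
  ∃ S : Set X, IsCompact S ∧ S ⊆ c.1.source ∧
    ∀ c' : atlas V X, ∀ z ∈ c'.1.target, c'.1.symm z ∉ S → a.1 c' z = 0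

theorem SupportedIn.mem_compact {c : atlas V X} {a : PV X} (h : SupportedIn c a) :
    a ∈ PV.compact X := by
  obtain ⟨S, hS, -, h⟩ := h
  exact ⟨S, hS, h⟩

theorem SupportedIn.exists_compact {c : atlas V X} {a : PV X} (h : SupportedIn c a) :
    ∃ K : Set V, IsCompact K ∧ K ⊆ c.1.target ∧ ∀ z ∉ K, a.1 c z = 0 := by
  obtain ⟨S, hS, hSc, h⟩ := h
  refine ⟨c.1 '' S, hS.image_of_continuousOn (c.1.continuousOn.mono hSc), ?_, fun z hz => ?_⟩
  · rintro _ ⟨p, hp, rfl⟩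
    exact c.1.map_source (hSc hp)
  · by_cases hzt : z ∈ c.1.target
    · refine h c z hzt fun hzS => hz ⟨_, hzS, c.1.right_inv hzt⟩
    · exact a.2.2.1 c z hzt

theorem SupportedIn.mul {c : atlas V X} {a : PV X} (h : SupportedIn c a) (b : PV X) :
    SupportedIn c (a * b) := by
  obtain ⟨S, hS, hSc, h⟩ := h
  refine ⟨S, hS, hSc, fun c' z hz hzS => ?_⟩
  change gmul (a.1 c' z) (b.1 c' z) = 0
  rw [h c' z hz hzS, zero_gmul]

theorem SupportedIn.density_eq_zero {c : atlas V X} {a : PV X} (h : SupportedIn c a)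
    (Ω : HolVolForm X) {p : X} (hp : p ∉ c.1.source) : density Ω a p = 0 := by
  obtain ⟨S, hS, hSc, h⟩ := h
  rw [density, topCoeff, h, Pi.zero_apply, mul_zero, zero_div]
  · exact (chartAt V p).map_source (mem_chart_source V p)
  · rw [(chartAt V p).left_inv (mem_chart_source V p)]
    exact fun hpS => hp (hSc hpS)

theorem SupportedIn.contDiff_topCoeff {c : atlas V X} {a : PV X} (h : SupportedIn c a)
    (Ω : HolVolForm X) :
    ContDiff ℝ ∞ (topCoeff Ω a c) ∧ HasCompactSupport (topCoeff Ω a c) := by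
  obtain ⟨K, hK, hKt, h0⟩ := h.exists_compact
  have hz : ∀ z ∉ K, topCoeff Ω a c z = 0 := fun z hz => by
    rw [topCoeff, h0 z hz, Pi.zero_apply, mul_zero]
  refine ⟨contDiff_of_eq_zero hK (fun z hz => ?_) hz, HasCompactSupport.intro hK hz⟩
  have h1 := contDiffAt_pi.mp (PV.contDiffAt a.2 (hKt hz)) Finset.univ
  exact ((Ω.holomorphic c z (hKt hz)).contDiffAt_real.pow 2).mul h1

variable [MeasurableSpace X] [BorelSpace X] [IsManifold 𝓘(ℂ, V) ω X]

/-- The integral of a section supported in a chart is a Lebesgue integral. -/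
theorem SupportedIn.integral_density {c : atlas V X} {a : PV X} (h : SupportedIn c a)
    (Ω : HolVolForm X) : Integrable (density Ω a) (volMeasure Ω) ∧
      ∫ p, density Ω a p ∂volMeasure Ω = ∫ z, topCoeff Ω a c z := by
  have hs := c.1.open_source.measurableSet
  have ht := c.1.open_target.measurableSet
  have h0 : ∀ p ∉ c.1.source, density Ω a p = 0 := fun p hp => h.density_eq_zero Ω hp
  obtain ⟨hsm, hcs⟩ := h.contDiff_topCoeff Ω
  have hcont : ContinuousOn (density Ω a) c.1.source := by
    have h1 : ContinuousOn (fun p => topCoeff Ω a c (c.1 p) /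
        ((‖Ω.coeff c (c.1 p)‖ ^ 2 : ℝ) : ℂ)) c.1.source := by
      have h2 : ContinuousOn (fun z => topCoeff Ω a c z /
          ((‖Ω.coeff c z‖ ^ 2 : ℝ) : ℂ)) c.1.target := by
        refine hsm.continuous.continuousOn.div ?_ fun z hz => ?_
        · have h3 : ContinuousOn (Ω.coeff c) c.1.target := (Ω.holomorphic c).continuousOn
          exact Complex.continuous_ofReal.comp_continuousOn (h3.norm.pow 2)
        · have := Ω.ne_zero c z hz
          simpa using this
      exact h2.comp c.1.continuousOn fun p hp => c.1.map_source hp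
    exact h1.congr fun p hp => density_eq Ω a c hp
  have hm : AEStronglyMeasurable (density Ω a) (chartMeasure Ω c) := by
    rw [← volMeasure_restrict]
    exact hcont.aestronglyMeasurable hs
  have hmap := aemeasurable_chart_symm' Ω c
  have hρm : AEMeasurable (fun z => ENNReal.ofReal (‖Ω.coeff c z‖ ^ 2))
      (volume.restrict c.1.target) := by
    have h3 : ContinuousOn (Ω.coeff c) c.1.target := (Ω.holomorphic c).continuousOn
    exact ((h3.norm.pow 2).aemeasurable ht).ennreal_ofReal
  have hfin : ∀ᵐ z ∂(volume.restrict c.1.target),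
      ENNReal.ofReal (‖Ω.coeff c z‖ ^ 2) < ⊤ := Filter.Eventually.of_forall fun _ =>
    ENNReal.ofReal_lt_top
  have hpt : ∀ z ∈ c.1.target, (ENNReal.ofReal (‖Ω.coeff c z‖ ^ 2)).toReal •
      density Ω a (c.1.symm z) = topCoeff Ω a c z := by
    intro z hz
    rw [density_eq Ω a c (c.1.map_target hz), c.1.right_inv hz,
      ENNReal.toReal_ofReal (by positivity), Complex.real_smul, mul_div_cancel₀]
    have := Ω.ne_zero c z hz
    simpa using this
  have hoff : ∀ z ∉ c.1.target, topCoeff Ω a c z = 0 := fun z hz => by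
    rw [topCoeff, a.2.2.1 c z hz, Pi.zero_apply, mul_zero]
  have hint : Integrable (topCoeff Ω a c) := hsm.continuous.integrable_of_hasCompactSupport hcs
  constructor
  · have h1 : IntegrableOn (density Ω a) c.1.source (volMeasure Ω) := by
      rw [IntegrableOn, volMeasure_restrict]
      change Integrable _ (Measure.map _ _)
      rw [integrable_map_measure hm hmap, integrable_withDensity_iff_integrable_smul₀' hρm hfin]
      refine (hint.restrict (s := c.1.target)).congr ?_
      filter_upwards [ae_restrict_mem ht] with z hz
      exact (hpt z hz).symm
    rwa [integrableOn_iff_integrable_of_support_subset] at h1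
    intro p hp
    by_contra hps
    exact hp (h0 p hps)
  · rw [← setIntegral_eq_integral_of_forall_compl_eq_zero (s := c.1.source) h0,
      volMeasure_restrict]
    change ∫ p, _ ∂(Measure.map _ _) = _
    rw [integral_map hmap hm, integral_withDensity_eq_integral_toReal_smul₀ hρm hfin,
      setIntegral_congr_fun ht hpt, setIntegral_eq_integral_of_forall_compl_eq_zero hoff]

end Geometry


open MeasureTheory

section Geometry

variable {X : Type*} [TopologicalSpace X] [ChartedSpace V X] [T2Space X] [IsManifold 𝓘(ℂ, V) ω X]

open Classical in
/-- A smooth function with compact support in a chart, extended by zero to `X`. -/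
def extendFun (c : atlas V X) (f : V → ℂ) (hf : ContDiff ℝ ∞ f) (K : Set V) (hK : IsCompact K)
    (hKt : K ⊆ c.1.target) (h0 : ∀ z ∉ K, f z = 0) : PV X :=
  ⟨fun c' z => if z ∈ c'.1.target ∧ c'.1.symm z ∈ c.1.source then f (transition c' c z) • gone else 0,
    by
    refine ⟨fun c' z hz => ?_, fun c' z hz => if_neg fun h => hz h.1, fun c' c'' z hz hz' => ?_⟩
    · refine ContDiffAt.contDiffWithinAt ?_
      by_cases hzc : c'.1.symm z ∈ c.1.source
      · have h1 : ContDiffAt ℝ ∞ (fun w => f (transition c' c w) • gone) z := by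
          have h2 : ContDiffAt ℝ ∞ (transition c' c) z :=
            ((analyticAt_transition hz hzc).contDiffAt (n := ∞)).restrict_scalars ℝ
          exact (hf.contDiffAt.comp z h2).fsmul contDiffAt_const
        refine h1.congr_of_eventuallyEq ?_
        filter_upwards [eventually_overlap hz hzc] with w hw
        exact if_pos hw
      · have hS : IsCompact (c.1.symm '' K) := hK.image_of_continuousOn
          (c.1.continuousOn_symm.mono hKt)
        have hzS : c'.1.symm z ∉ c.1.symm '' K := by
          rintro ⟨w, hw, h⟩
          exact hzc (h ▸ c.1.map_target (hKt hw))
        refine (contDiffAt_const (c := (0 : Grass))).congr_of_eventuallyEq ?_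
        filter_upwards [c'.1.open_target.mem_nhds hz,
          (c'.1.continuousAt_symm hz).eventually (hS.isClosed.isOpen_compl.mem_nhds hzS)]
          with w hw hw'
        split_ifs with h
        · rw [h0, zero_smul]
          exact fun hK' => hw' ⟨_, hK', c.1.left_inv h.2⟩
        · rfl
    · have e : (transition c' c'' z ∈ c''.1.target ∧
          c''.1.symm (transition c' c'' z) ∈ c.1.source) ↔
          (z ∈ c'.1.target ∧ c'.1.symm z ∈ c.1.source) := by
        rw [symm_transition hz']
        exact ⟨fun h => ⟨hz, h.2⟩, fun h => ⟨transition_mem hz', h.2⟩⟩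
      simp only [e]
      split_ifs
      · rw [gsubst_smul, gsubst_gone, transition, symm_transition hz', ← transition]
      · funext K
        simp [gsubst]⟩

theorem extendFun_apply {c : atlas V X} {f : V → ℂ} {hf : ContDiff ℝ ∞ f} {K : Set V}
    {hK : IsCompact K} {hKt : K ⊆ c.1.target} {h0 : ∀ z ∉ K, f z = 0} {c' : atlas V X} {z : V}
    (hz : z ∈ c'.1.target) (hzc : c'.1.symm z ∈ c.1.source) :
    (extendFun c f hf K hK hKt h0).1 c' z = f (transition c' c z) • gone := if_pos ⟨hz, hzc⟩

theorem extendFun_supportedIn {c : atlas V X} {f : V → ℂ} {hf : ContDiff ℝ ∞ f} {K : Set V}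
    {hK : IsCompact K} {hKt : K ⊆ c.1.target} {h0 : ∀ z ∉ K, f z = 0} :
    SupportedIn c (extendFun c f hf K hK hKt h0) := by
  classical
  refine ⟨c.1.symm '' K, hK.image_of_continuousOn (c.1.continuousOn_symm.mono hKt), ?_,
    fun c' z hz hzS => ?_⟩
  · rintro _ ⟨z, hz, rfl⟩
    exact c.1.map_target (hKt hz)
  · change (if _ then _ else _) = _
    split_ifs with h
    · rw [h0, zero_smul]
      exact fun hK' => hzS ⟨_, hK', c.1.left_inv h.2⟩
    · rfl

/-- Around every point there is a smooth function with compact support in a chart which is `1` near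
the point. -/
theorem exists_bump (p : X) : ∃ (c : atlas V X) (χ : PV X) (U : Set X), SupportedIn c χ ∧
    IsOpen U ∧ p ∈ U ∧ ∀ c' : atlas V X, ∀ z ∈ c'.1.target, c'.1.symm z ∈ U → χ.1 c' z = gone := by
  set c : atlas V X := ⟨chartAt V p, chart_mem_atlas V p⟩ with hc
  have hp : p ∈ c.1.source := mem_chart_source V p
  obtain ⟨r, hr, hball⟩ := Metric.isOpen_iff.mp c.1.open_target (c.1 p) (c.1.map_source hp)
  let B : ContDiffBump (c.1 p) := ⟨r / 4, r / 2, by positivity, by linarith⟩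
  have hB : ∀ z ∉ Metric.closedBall (c.1 p) (r / 2), ((B z : ℝ) : ℂ) = 0 := by
    intro z hz
    rw [B.zero_of_le_dist (by simpa using (not_le.mp hz).le)]
    rfl
  have hBs : ContDiff ℝ ∞ fun z => ((B z : ℝ) : ℂ) := Complex.ofRealCLM.contDiff.comp B.contDiff
  refine ⟨c, extendFun c (fun z => ((B z : ℝ) : ℂ)) hBs _ (isCompact_closedBall (c.1 p) (r / 2))
    ((Metric.closedBall_subset_ball (by linarith)).trans hball) hB,
    c.1.source ∩ c.1 ⁻¹' Metric.ball (c.1 p) (r / 4), extendFun_supportedIn,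
    c.1.isOpen_inter_preimage Metric.isOpen_ball,
    ⟨hp, Metric.mem_ball_self (by positivity)⟩, ?_⟩
  rintro c' z hz ⟨hzc, hzB⟩
  rw [extendFun_apply hz hzc]
  change ((B (c.1 (c'.1.symm z)) : ℝ) : ℂ) • gone = gone
  rw [B.one_of_mem_closedBall (Metric.ball_subset_closedBall hzB)]
  simp

/-- Localization: an additive property of compactly supported sections that holds for sections
supported in a chart holds for all. -/
theorem compact_induction (N : AddSubgroup (PV X))
    (hN : ∀ (c : atlas V X) (a : PV X), SupportedIn c a → a ∈ N) {a : PV X}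
    (ha : a ∈ PV.compact X) : a ∈ N := by
  classical
  choose c χ U hχ hU hpU hone using exists_bump (X := X)
  -- peel off the bump functions one by one
  have key : ∀ (t : Finset X) (a : PV X) (S : Set X), IsCompact S → S ⊆ ⋃ p ∈ t, U p →
      (∀ c' : atlas V X, ∀ z ∈ c'.1.target, c'.1.symm z ∉ S → a.1 c' z = 0) → a ∈ N := by
    intro t
    induction t using Finset.induction_on with
    | empty =>
      intro a S _ hSt h
      have : a = 0 := PV.ext fun c' z hz => h c' z hz fun hzS => by simpa using hSt hzS
      rw [this]
      exact N.zero_mem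
    | insert p t _ ih =>
      intro a S hS hSt h
      have e : a = χ p * a + (a - χ p * a) := by abel
      rw [e]
      refine N.add_mem (hN (c p) _ ((hχ p).mul a)) (ih _ (S \ U p) (hS.diff (hU p)) ?_ ?_)
      · rintro x ⟨hxS, hxU⟩
        have := hSt hxS
        simp only [Finset.mem_insert, Set.iUnion_iUnion_eq_or_left, Set.mem_union] at this
        exact this.resolve_left hxU
      · intro c' z hz hzS
        change a.1 c' z - gmul ((χ p).1 c' z) (a.1 c' z) = 0
        by_cases hzU : c'.1.symm z ∈ U p
        · rw [hone p c' z hz hzU, gone_gmul, sub_self]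
        · rw [h c' z hz fun hzS' => hzS ⟨hzS', hzU⟩, gmul_zero, sub_self]
  obtain ⟨S, hS, h⟩ := ha
  obtain ⟨t, ht⟩ := hS.elim_finite_subcover U hU fun x _ => Set.mem_iUnion.mpr ⟨x, hpU x⟩
  exact key t a S hS ht h

theorem wirtS_integral_eq_zero {f : V → ℂ} (hf : ContDiff ℝ ∞ f) (hc : HasCompactSupport f) (s : ℂ)
    (i : Fin 3) : ∫ z, wirtS s i f z = 0 := by
  have h1 : ∀ v, Integrable (fun z => fderiv ℝ f z v) := by
    intro v
    have hcont : Continuous fun z => fderiv ℝ f z v :=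
      (hf.continuous_fderiv (by simp)).clm_apply continuous_const
    refine hcont.integrable_of_hasCompactSupport ?_
    exact hc.fderiv_apply (𝕜 := ℝ) v
  have h2 : ∀ v, ∫ z, fderiv ℝ f z v = 0 := by
    intro v
    have := integral_smul_fderiv_eq_neg_fderiv_smul_of_integrable (μ := (volume : Measure V))
      (f := fun _ => (1 : ℝ)) (g := f) (v := v) (by simp) (by simpa using h1 v)
      (by simpa using hf.continuous.integrable_of_hasCompactSupport hc)
      (fun _ _ => differentiableAt_const _) (fun z _ => hf.contDiffAt.differentiable)
    simpa using this
  simp only [wirtS]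
  rw [integral_const_mul, integral_add (h1 _) ((h1 _).const_mul s), integral_const_mul, h2, h2]
  simp

theorem wirt_apply {s : ℂ} {i : Fin 3} {f : V → Grass} {z : V} (hf : ContDiffAt ℝ ∞ f z)
    (K : Finset (Fin 6)) : wirt s i f z K = wirtS s i (fun w => f w K) z := by
  have h := fderiv_apply (𝕜 := ℝ) hf.differentiable K
  simp only [wirt, wirtS, h]
  simp

end Geometry


/-! ### Stokes' theorem -/

open MeasureTheory

theorem wirt_integral_eq_zero {K : Set V} (hK : IsCompact K) {F : V → Grass}
    (hF : ∀ z ∈ K, ContDiffAt ℝ ∞ F z) (h0 : ∀ z ∉ K, F z = 0) (s : ℂ) (i : Fin 3)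
    (L : Finset (Fin 6)) :
    Integrable (fun z => wirt s i F z L) ∧ ∫ z, wirt s i F z L = 0 := by
  have hs := contDiff_of_eq_zero hK hF h0
  have hsL : ContDiff ℝ ∞ fun z => F z L := contDiff_pi.mp hs L
  have hc : HasCompactSupport fun z => F z L :=
    HasCompactSupport.intro hK fun z hz => by rw [h0 z hz, Pi.zero_apply]
  have e : (fun z => wirt s i F z L) = fun z => wirtS s i (fun w => F w L) z :=
    funext fun z => wirt_apply hs.contDiffAt L
  constructor
  · have hcont : Continuous fun z => wirt s i F z L := by
      have : ContDiff ℝ ∞ (wirt s i F) :=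
        contDiff_iff_contDiffAt.mpr fun z => hs.contDiffAt.wirt s i
      exact (continuous_apply L).comp this.continuous
    refine hcont.integrable_of_hasCompactSupport (HasCompactSupport.intro hK fun z hz => ?_)
    rw [wirt_eq_zero_of_eventually, Pi.zero_apply]
    filter_upwards [hK.isClosed.isOpen_compl.mem_nhds hz] with w hw
    exact h0 w hw
  · rw [e]
    exact wirtS_integral_eq_zero hsL hc s i

theorem sum_wirt_integral_eq_zero {K : Set V} (hK : IsCompact K) {F : Fin 3 → V → Grass}
    (hF : ∀ i, ∀ z ∈ K, ContDiffAt ℝ ∞ (F i) z) (h0 : ∀ i, ∀ z ∉ K, F i z = 0) (s : ℂ)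
    (L : Finset (Fin 6)) : ∫ z, ∑ i, wirt s i (F i) z L = 0 := by
  rw [integral_finset_sum _ fun i _ => (wirt_integral_eq_zero hK (hF i) (h0 i) s i L).1]
  exact Finset.sum_eq_zero fun i _ => (wirt_integral_eq_zero hK (hF i) (h0 i) s i L).2

theorem gcontr_univ (k : Fin 6) (a : Grass) : gcontr k a Finset.univ = 0 :=
  if_pos (Finset.mem_univ k)

theorem ginv_univ (a : Grass) : ginv a Finset.univ = a Finset.univ := by
  rw [ginv_apply, show (Finset.univ : Finset (Fin 6)).card = 6 from rfl]
  norm_num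

section Geometry

variable {X : Type*} [TopologicalSpace X] [ChartedSpace V X] [T2Space X] [IsManifold 𝓘(ℂ, V) ω X]

theorem SupportedIn.dbarL {c : atlas V X} {a : PV X} (h : SupportedIn c a) :
    SupportedIn c (dbarL a) := by
  obtain ⟨S, hS, hSc, h⟩ := h
  refine ⟨S, hS, hSc, fun c' z hz hzS => ?_⟩
  rw [dbarL_coe, dbar_apply hz]
  refine Finset.sum_eq_zero fun j _ => ?_
  rw [dzbar_eq_wirt, wirt_eq_zero_of_eventually (eventually_eq_zero hS h hz hzS)]
  exact map_zero (gextL (eta j))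

theorem topCoeff_dbarL (Ω : HolVolForm X) (a : PV X) {c : atlas V X} {z : V}
    (hz : z ∈ c.1.target) : topCoeff Ω (BCOV.dbarL a) c z = ∑ j, wirt Complex.I j
      (fun w => Ω.coeff c w ^ 2 • gext (eta j) (a.1 c w)) z Finset.univ := by
  have hρ : AnalyticAt ℂ (fun w => Ω.coeff c w ^ 2) z := (Ω.holomorphic c z hz).pow 2
  have ha := PV.contDiffAt a.2 hz
  rw [topCoeff, dbarL_coe, dbar_apply hz, Finset.sum_apply, Finset.mul_sum]
  refine Finset.sum_congr rfl fun j _ => ?_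
  have hg : ContDiffAt ℝ ∞ (fun w => gext (eta j) (a.1 c w)) z := ha.linear (gextL (eta j))
  rw [wirt_fsmul hρ.contDiffAt_real hg, wirtS_dzbar_eq_zero hρ, zero_smul,
    zero_add, Pi.smul_apply, smul_eq_mul]
  exact congrArg _ (congrFun (wirt_gext ha _).symm _)

theorem integral_topCoeff_dbarL {c : atlas V X} {a : PV X} (h : SupportedIn c a)
    (Ω : HolVolForm X) : ∫ z, topCoeff Ω (BCOV.dbarL a) c z = 0 := by
  obtain ⟨K, hK, hKt, h0⟩ := h.exists_compact
  have h1 : ∀ j : Fin 3, ∀ z ∉ K, Ω.coeff c z ^ 2 • gext (eta j) (a.1 c z) = 0 := fun j z hz => by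
    rw [h0 z hz]
    exact (congrArg _ (map_zero (gextL (eta j)))).trans (smul_zero _)
  rw [← sum_wirt_integral_eq_zero hK (F := fun j w => Ω.coeff c w ^ 2 • gext (eta j) (a.1 c w))
    (fun j z hz => ((Ω.holomorphic c z (hKt hz)).pow 2).contDiffAt_real.fsmul
      ((PV.contDiffAt a.2 (hKt hz)).linear (gextL (eta j)))) h1 Complex.I Finset.univ]
  congr 1
  funext z
  by_cases hz : z ∈ c.1.target
  · exact topCoeff_dbarL Ω a hz
  · rw [topCoeff, (BCOV.dbarL a).2.2.1 c z hz, Pi.zero_apply, mul_zero]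
    refine (Finset.sum_eq_zero fun j _ => ?_).symm
    rw [wirt_eq_zero_of_eventually, Pi.zero_apply]
    filter_upwards [hK.isClosed.isOpen_compl.mem_nhds fun hzK => hz (hKt hzK)] with w hw
    exact h1 j w hw

/-- The local form of the self-adjointness of `∂`: the difference is a total derivative, because
contractions have no top coefficient. -/
theorem topCoeff_divL (Ω : HolVolForm X) (a b : PV X) {c : atlas V X} {z : V}
    (hz : z ∈ c.1.target) :
    topCoeff Ω (parityInv a * divL Ω b) c z - topCoeff Ω (divL Ω a * b) c z =
      ∑ i, wirt (-Complex.I) i (fun w => gmul (ginv (Ω.coeff c w • a.1 c w))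
        (gcontr (xi i) (Ω.coeff c w • b.1 c w))) z Finset.univ := by
  have hA := contDiffAt_coeff Ω a hz
  have hB := contDiffAt_coeff Ω b hz
  have hne := Ω.ne_zero c z hz
  change Ω.coeff c z ^ 2 * gmul (ginv (a.1 c z)) (div Ω b.1 c z) Finset.univ -
    Ω.coeff c z ^ 2 * gmul (div Ω a.1 c z) (b.1 c z) Finset.univ = _
  rw [div_apply hz, div_apply hz, gmul_sum, sum_gmul, Finset.sum_apply, Finset.sum_apply,
    Finset.mul_sum, Finset.mul_sum, ← Finset.sum_sub_distrib]
  refine Finset.sum_congr rfl fun i _ => ?_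
  have hg : ContDiffAt ℝ ∞ (fun w => gcontr (xi i) (Ω.coeff c w • b.1 c w)) z :=
    hB.linear (gcontrL (xi i))
  rw [wirt_gmul (hA.linear ginv) hg, wirt_linear hA ginv, wirt_gcontr hB, dz_eq_wirt]
  set A' := wirt (-Complex.I) i (fun w => Ω.coeff c w • a.1 c w) z
  set B' := wirt (-Complex.I) i (fun w => Ω.coeff c w • b.1 c w) z
  have h2 := congrFun (gcontr_gmul (xi i) A' (b.1 c z)) Finset.univ
  rw [gcontr_univ, Pi.add_apply] at h2
  change _ = (gmul (ginv A') (gcontr (xi i) (Ω.coeff c z • b.1 c z)) +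
    gmul (ginv (Ω.coeff c z • a.1 c z)) (gcontr (xi i) B')) Finset.univ
  simp only [gcontr_smul, map_smul, gmul_smul, smul_gmul, Pi.add_apply, Pi.smul_apply, smul_eq_mul]
  field_simp
  linear_combination h2

theorem integral_topCoeff_divL {c : atlas V X} (a b : PV X) {K : Set V} (hK : IsCompact K)
    (hKt : K ⊆ c.1.target) (h0 : (∀ z ∉ K, a.1 c z = 0) ∨ ∀ z ∉ K, b.1 c z = 0)
    (Ω : HolVolForm X) :
    ∫ z, (topCoeff Ω (parityInv a * divL Ω b) c z - topCoeff Ω (divL Ω a * b) c z) = 0 := by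
  have h1 : ∀ i : Fin 3, ∀ z ∉ K, gmul (ginv (Ω.coeff c z • a.1 c z))
      (gcontr (xi i) (Ω.coeff c z • b.1 c z)) = 0 := fun i z hz => by
    rcases h0 with h0 | h0
    · rw [h0 z hz, smul_zero, map_zero, zero_gmul]
    · have : gcontr (xi i) (Ω.coeff c z • b.1 c z) = 0 := by
        rw [h0 z hz, smul_zero]
        exact map_zero (gcontrL (xi i))
      rw [this, gmul_zero]
  rw [← sum_wirt_integral_eq_zero hK (F := fun i w => gmul (ginv (Ω.coeff c w • a.1 c w))
      (gcontr (xi i) (Ω.coeff c w • b.1 c w)))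
    (fun i z hz => ((contDiffAt_coeff Ω a (hKt hz)).linear ginv).gmul
      ((contDiffAt_coeff Ω b (hKt hz)).linear (gcontrL (xi i)))) h1 (-Complex.I) Finset.univ]
  congr 1
  funext z
  by_cases hz : z ∈ c.1.target
  · exact topCoeff_divL Ω a b hz
  · rw [topCoeff, topCoeff, (parityInv a * divL Ω b).2.2.1 c z hz,
      (divL Ω a * b).2.2.1 c z hz, Pi.zero_apply, mul_zero, sub_zero]
    refine (Finset.sum_eq_zero fun j _ => ?_).symm
    rw [wirt_eq_zero_of_eventually, Pi.zero_apply]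
    filter_upwards [hK.isClosed.isOpen_compl.mem_nhds fun hzK => hz (hKt hzK)] with w hw
    exact h1 j w hw

variable [MeasurableSpace X] [BorelSpace X]

theorem density_add (Ω : HolVolForm X) (a b : PV X) :
    density Ω (a + b) = fun p => density Ω a p + density Ω b p := by
  funext p
  change _ * (a.1 _ _ Finset.univ + b.1 _ _ Finset.univ) / _ = _
  rw [mul_add, add_div]
  rfl

theorem density_smul (Ω : HolVolForm X) (s : ℂ) (a : PV X) :
    density Ω (s • a) = fun p => s * density Ω a p := by
  funext p
  change _ * (s * a.1 _ _ Finset.univ) / _ = s * (_ * a.1 _ _ Finset.univ / _)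
  ring

theorem integrable_density (Ω : HolVolForm X) {a : PV X} (ha : a ∈ PV.compact X) :
    Integrable (density Ω a) (volMeasure Ω) := by
  refine compact_induction (N :=
    { carrier := {a | Integrable (density Ω a) (volMeasure Ω)}
      add_mem' := fun {a b} ha hb => ?_
      zero_mem' := ?_
      neg_mem' := fun {a} ha => ?_ }) (fun c a h => (h.integral_density Ω).1) ha
  · change Integrable _ _
    rw [density_add]
    exact Integrable.add ha hb
  · have : density Ω (0 : PV X) = fun _ => 0 := by
      funext p
      change _ * (0 : ℂ) / _ = 0
      rw [mul_zero, zero_div]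
    change Integrable _ _
    rw [this]
    exact integrable_zero _ _ _
  · change Integrable _ _
    rw [← neg_one_smul ℂ, density_smul]
    exact Integrable.const_mul ha _

/-- The trace on compactly supported polyvector fields.  The constant is that of `integral`, with the
sign that relates `density` to `(a ∨ Ω) ∧ Ω`. -/
def traceC (Ω : HolVolForm X) : PV.compact X →ₗ[ℂ] ℂ where
  toFun a := 8 * Complex.I * ∫ p, density Ω a.1 p ∂volMeasure Ω
  map_add' a b := by
    rw [Submodule.coe_add, density_add, integral_add (integrable_density Ω a.2)
      (integrable_density Ω b.2), mul_add]
  map_smul' s a := by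
    rw [Submodule.coe_smul, density_smul, integral_const_mul, RingHom.id_apply, smul_eq_mul]
    ring

/-- An arbitrary linear extension of the trace to all polyvector fields.  It is used only on
compactly supported ones. -/
def traceL (Ω : HolVolForm X) : PV X →ₗ[ℂ] ℂ := (LinearMap.exists_extend (traceC Ω)).choose

theorem traceL_eq (Ω : HolVolForm X) {a : PV X} (ha : a ∈ PV.compact X) :
    traceL Ω a = 8 * Complex.I * ∫ p, density Ω a p ∂volMeasure Ω :=
  congrArg (fun f => f ⟨a, ha⟩) (LinearMap.exists_extend (traceC Ω)).choose_spec

theorem traceL_parityInv (Ω : HolVolForm X) {a : PV X} (ha : a ∈ PV.compact X) :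
    traceL Ω (parityInv a) = traceL Ω a := by
  rw [traceL_eq Ω ha, traceL_eq Ω (parityInv_mem_compact ha)]
  congr 2
  funext p
  rw [density, density, topCoeff, topCoeff, parityInv_coe, ginv_univ]

/-- Stokes' theorem for `∂̄`. -/
theorem traceL_dbarL (Ω : HolVolForm X) {a : PV X} (ha : a ∈ PV.compact X) :
    traceL Ω (dbarL a) = 0 := by
  refine compact_induction (N := (LinearMap.ker (traceL Ω ∘ₗ dbarL)).toAddSubgroup)
    (fun c a h => ?_) ha
  change traceL Ω (dbarL a) = 0
  rw [traceL_eq Ω h.dbarL.mem_compact, (h.dbarL.integral_density Ω).2,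
    integral_topCoeff_dbarL h, mul_zero]

theorem SupportedIn.divL {c : atlas V X} {a : PV X} (h : SupportedIn c a) (Ω : HolVolForm X) :
    SupportedIn c (divL Ω a) := by
  obtain ⟨S, hS, hSc, h⟩ := h
  refine ⟨S, hS, hSc, fun c' z hz hzS => ?_⟩
  rw [divL_coe, div_apply hz]
  refine Finset.sum_eq_zero fun j _ => ?_
  rw [dz_eq_wirt, wirt_eq_zero_of_eventually]
  · exact (congrArg _ (map_zero (gcontrL (xi j)))).trans (smul_zero _)
  · filter_upwards [eventually_eq_zero hS h hz hzS] with w hw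
    rw [hw, smul_zero]

theorem SupportedIn.parityInv {c : atlas V X} {a : PV X} (h : SupportedIn c a) :
    SupportedIn c (parityInv a) := by
  obtain ⟨S, hS, hSc, h⟩ := h
  refine ⟨S, hS, hSc, fun c' z hz hzS => ?_⟩
  rw [parityInv_coe, h c' z hz hzS, map_zero]

theorem SupportedIn.mul_left {c : atlas V X} {a : PV X} (h : SupportedIn c a) (b : PV X) :
    SupportedIn c (b * a) := by
  obtain ⟨S, hS, hSc, h⟩ := h
  refine ⟨S, hS, hSc, fun c' z hz hzS => ?_⟩
  change gmul (b.1 c' z) (a.1 c' z) = 0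
  rw [h c' z hz hzS, gmul_zero]

theorem traceL_divL_of_supportedIn (Ω : HolVolForm X) (a b : PV X) {c : atlas V X}
    (h : SupportedIn c a ∨ SupportedIn c b) :
    traceL Ω (divL Ω a * b) = traceL Ω (parityInv a * divL Ω b) := by
  have h1 : SupportedIn c (BCOV.divL Ω a * b) := by
    rcases h with h | h
    · exact (h.divL Ω).mul b
    · exact h.mul_left _
  have h2 : SupportedIn c (BCOV.parityInv a * BCOV.divL Ω b) := by
    rcases h with h | h
    · exact h.parityInv.mul _
    · exact (h.divL Ω).mul_left _
  obtain ⟨K, hK, hKt, h0⟩ : ∃ K : Set V, IsCompact K ∧ K ⊆ c.1.target ∧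
      ((∀ z ∉ K, a.1 c z = 0) ∨ ∀ z ∉ K, b.1 c z = 0) := by
    rcases h with h | h <;> obtain ⟨K, hK, hKt, h0⟩ := h.exists_compact
    · exact ⟨K, hK, hKt, Or.inl h0⟩
    · exact ⟨K, hK, hKt, Or.inr h0⟩
  rw [traceL_eq Ω h1.mem_compact, (h1.integral_density Ω).2, traceL_eq Ω h2.mem_compact,
    (h2.integral_density Ω).2]
  have e := integral_topCoeff_divL a b hK hKt h0 Ω
  obtain ⟨s1, c1⟩ := h1.contDiff_topCoeff Ω
  obtain ⟨s2, c2⟩ := h2.contDiff_topCoeff Ω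
  rw [integral_sub (s2.continuous.integrable_of_hasCompactSupport c2)
    (s1.continuous.integrable_of_hasCompactSupport c1), sub_eq_zero] at e
  rw [e]

/-- `∂` is self-adjoint up to sign with respect to the trace. -/
theorem traceL_divL_mul (Ω : HolVolForm X) {a b : PV X}
    (h : a ∈ PV.compact X ∨ b ∈ PV.compact X) :
    traceL Ω (divL Ω a * b) = traceL Ω (parityInv a * divL Ω b) := by
  rcases h with h | h
  · have := compact_induction (N := (LinearMap.ker (traceL Ω ∘ₗ
        ((LinearMap.mulRight ℂ b) ∘ₗ divL Ω - (LinearMap.mulRight ℂ (divL Ω b)) ∘ₗ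
          parityInv))).toAddSubgroup) (fun c a h => ?_) h
    · exact sub_eq_zero.mp ((map_sub _ _ _).symm.trans this)
    · exact (map_sub _ _ _).trans (sub_eq_zero.mpr (traceL_divL_of_supportedIn Ω a b (Or.inl h)))
  · have := compact_induction (N := (LinearMap.ker (traceL Ω ∘ₗ
        ((LinearMap.mulLeft ℂ (divL Ω a)) - (LinearMap.mulLeft ℂ (parityInv a)) ∘ₗ
          divL Ω))).toAddSubgroup) (fun c b h => ?_) h
    · exact sub_eq_zero.mp ((map_sub _ _ _).symm.trans this)
    · exact (map_sub _ _ _).trans (sub_eq_zero.mpr (traceL_divL_of_supportedIn Ω a b (Or.inr h)))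

/-! ### The pairings in terms of the trace -/

theorem gmul_dzzz_univ (a : Grass) (s : ℂ) : gmul a (s • dzzz) Finset.univ = -(s * a {3, 4, 5}) := by
  rw [gmul, Finset.sum_eq_single {3, 4, 5}]
  · have h1 : (Finset.univ : Finset (Fin 6)) \ {3, 4, 5} = {0, 1, 2} := by decide
    have h2 : monoSign {3, 4, 5} {0, 1, 2} = -1 := by
      rw [monoSign, show ((({3, 4, 5} : Finset (Fin 6)) ×ˢ ({0, 1, 2} : Finset (Fin 6))).filter
        (fun p => p.2 < p.1)).card = 9 by decide]
      norm_num
    rw [h1, h2, Pi.smul_apply, dzzz, Pi.single_eq_same, smul_eq_mul]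
    ring
  · intro I _ hI
    have : Finset.univ \ I ≠ ({0, 1, 2} : Finset (Fin 6)) := by
      intro h
      apply hI
      have h1 := congrArg (fun J => Finset.univ \ J) h
      simp only [sdiff_sdiff_right_self, Finset.inf_eq_inter, Finset.univ_inter] at h1
      rw [h1]
      decide
    rw [Pi.smul_apply, dzzz, Pi.single_eq_of_ne this, smul_zero, mul_zero]
  · exact fun h => absurd (Finset.mem_powerset.mpr (Finset.subset_univ _)) h

theorem dzzz_gmul_univ (a : Grass) : gmul dzzz a Finset.univ = a {3, 4, 5} := by
  rw [gmul, Finset.sum_eq_single {0, 1, 2}]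
  · have h1 : (Finset.univ : Finset (Fin 6)) \ {0, 1, 2} = {3, 4, 5} := by decide
    have h2 : monoSign {0, 1, 2} {3, 4, 5} = 1 := by
      rw [monoSign, show ((({0, 1, 2} : Finset (Fin 6)) ×ˢ ({3, 4, 5} : Finset (Fin 6))).filter
        (fun p => p.2 < p.1)).card = 0 by decide]
      norm_num
    rw [h1, h2, dzzz, Pi.single_eq_same]
    ring
  · intro I _ hI
    rw [dzzz, Pi.single_eq_of_ne hI]
    ring
  · exact fun h => absurd (Finset.mem_powerset.mpr (Finset.subset_univ _)) h

/-- The coefficient of `dz̄₁ dz̄₂ dz̄₃` in a contraction sees only the top coefficient. -/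
theorem gcontract_apply (ρ : ℂ) (a : Grass) :
    gcontract ρ a {3, 4, 5} = ρ * a Finset.univ := by
  set op : Fin 6 → Grass → Grass := fun k f => if (k : ℕ) < 3 then gcontr k f else gext k f with hop
  have key : ∀ (l : List (Fin 6)) (S : Finset (Fin 6)), l.Nodup →
      (l.foldr op (ρ • dzzz)) S ≠ 0 → ∀ j : Fin 6, ((j ∈ S) ↔ (j ∉ l)) ↔ (j : ℕ) < 3 := by
    intro l
    induction l with
    | nil =>
      intro S _ h j
      have : S = {0, 1, 2} := by
        by_contra hS
        exact h (by simp [dzzz, hS])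
      subst this
      simp only [List.not_mem_nil, not_false_eq_true, iff_true]
      revert j
      decide
    | cons k l ih =>
      intro S hl h j
      rw [List.nodup_cons] at hl
      rw [List.foldr_cons, hop] at h
      dsimp only at h
      split_ifs at h with hk
      all_goals
        first | rw [gcontr] at h | rw [gext] at h
        split_ifs at h with hkS
      · exact absurd rfl h
      on_goal 3 => exact absurd rfl h
      all_goals
        rw [← ih _ hl.2 (fun h0 => h (by rw [h0, mul_zero])) j]
        by_cases hjk : j = k
        · subst hjk
          simp [hkS, hl.1]
        · simp [hjk]
  rw [gcontract, Finset.sum_apply, Finset.sum_eq_single Finset.univ]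
  · have hs : (Finset.univ : Finset (Fin 6)).sort = [0, 1, 2, 3, 4, 5] := by
      rw [Fin.sort_univ]
      decide
    have h0 : ∀ k, gext k 0 = 0 := fun k => map_zero (gextL k)
    have hc0 : ∀ k, gcontr k 0 = 0 := fun k => map_zero (gcontrL k)
    have h1 : gext 3 (gext 4 (gext 5 gone)) = (Pi.single {3, 4, 5} 1 : Grass) := by
      have h : gone = (Pi.single ∅ 1 : Grass) := rfl
      rw [h, gext_single _ _ (by simp), gext_single _ _ (by decide), gext_single _ _ (by decide)]
      have h2 : gsign 5 ∅ = 1 := by simp [gsign]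
      have h3 : gsign 4 {5} = 1 := by
        rw [gsign, show ({5} : Finset (Fin 6)).filter (· < 4) = ∅ by decide]; simp
      have h4 : gsign 3 {4, 5} = 1 := by
        rw [gsign, show ({4, 5} : Finset (Fin 6)).filter (· < 3) = ∅ by decide]; simp
      simp only [insert_empty_eq] at *
      rw [h2, h3, h4, one_mul, one_mul, one_mul]
    rw [hs, Pi.smul_apply, smul_eq_mul, dzzz_eq, show xi 0 = 0 from rfl, show xi 1 = 1 from rfl,
      show xi 2 = 2 from rfl]
    have h2 : List.foldr op (ρ • gext 0 (gext 1 (gext 2 gone))) [0, 1, 2, 3, 4, 5] =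
        gcontr 0 (gcontr 1 (gcontr 2 (gext 3 (gext 4 (gext 5
          (ρ • gext 0 (gext 1 (gext 2 gone)))))))) := rfl
    rw [h2]
    have hg : ∀ k, gcontr k gone = 0 := gcontr_gone
    simp [gcontr_gext, gext_smul, gcontr_smul, h0, hc0, hg, gext_neg, gcontr_neg, h1]
    ring
  · intro K _ hK
    rw [Pi.smul_apply]
    by_contra h
    have h1 := key K.sort {3, 4, 5} (Finset.sort_nodup _ _) fun h0 => h (by
      change a K • (List.foldr op (ρ • dzzz) K.sort) {3, 4, 5} = 0
      rw [h0, smul_zero])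
    refine hK (Finset.eq_univ_iff_forall.mpr fun j => ?_)
    have h2 := h1 j
    rw [Finset.mem_sort] at h2
    have h3 : (j ∈ ({3, 4, 5} : Finset (Fin 6))) ↔ ¬ (j : ℕ) < 3 := by
      clear h2
      revert j
      decide
    tauto
  · exact fun h => absurd (Finset.mem_univ _) h

theorem tr_eq (Ω : HolVolForm X) {a : PV X} (ha : a ∈ PV.compact X) : tr Ω a.1 = traceL Ω a := by
  rw [traceL_eq Ω ha, tr, integral]
  have : ∀ p : X, (wedge (contract Ω a.1) Ω.form) ⟨chartAt V p, chart_mem_atlas V p⟩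
      (chartAt V p p) Finset.univ /
      ((‖Ω.coeff ⟨chartAt V p, chart_mem_atlas V p⟩ (chartAt V p p)‖ ^ 2 : ℝ) : ℂ) =
      -density Ω a p := by
    intro p
    rw [wedge, HolVolForm.form, gmul_dzzz_univ, contract, gcontract_apply, density, topCoeff]
    ring
  simp only [this, integral_neg]
  ring

theorem intOmega_eq (Ω : HolVolForm X) {a : PV X} (ha : a ∈ PV.compact X) :
    intOmega Ω a.1 = traceL Ω (invVol Ω * a) := by
  rw [traceL_eq Ω (PV.mul_mem_compact_right _ ha), intOmega, integral]
  have : ∀ p : X, (wedge a.1 Ω.form) ⟨chartAt V p, chart_mem_atlas V p⟩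
      (chartAt V p p) Finset.univ /
      ((‖Ω.coeff ⟨chartAt V p, chart_mem_atlas V p⟩ (chartAt V p p)‖ ^ 2 : ℝ) : ℂ) =
      -density Ω (invVol Ω * a) p := by
    intro p
    have hz : chartAt V p p ∈ (chartAt V p).target :=
      (chartAt V p).map_source (mem_chart_source V p)
    have hne := Ω.ne_zero ⟨chartAt V p, chart_mem_atlas V p⟩ _ hz
    have h1 : (invVol Ω * a).1 ⟨chartAt V p, chart_mem_atlas V p⟩ (chartAt V p p) =
        gmul ((Ω.coeff ⟨chartAt V p, chart_mem_atlas V p⟩ (chartAt V p p))⁻¹ • dzzz)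
          (a.1 ⟨chartAt V p, chart_mem_atlas V p⟩ (chartAt V p p)) :=
      congrArg (fun x => gmul x _) (invVol_apply Ω hz)
    rw [wedge, HolVolForm.form, gmul_dzzz_univ, density, topCoeff, h1, smul_gmul, Pi.smul_apply,
      dzzz_gmul_univ, smul_eq_mul]
    field_simp
  simp only [this, integral_neg]
  ring

end Geometry


/-! ### Calculus of functionals -/

section Functionals

variable {X : Type*} [TopologicalSpace X] [ChartedSpace V X] {M N P : Type*}

/-- A finite family of homogeneous fields with a new first entry. -/
abbrev fcons {n : ℕ} (h : HomField X) (e : Fin n → HomField X) : Fin (n + 1) → HomField X :=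
  Fin.cons (α := fun _ => HomField X) h e

variable (X) in
/-- Taylor components with values in `M`. -/
abbrev Fn (M : Type*) : Type _ := ∀ n : ℕ, (Fin n → HomField X) → M

/-- The insertion of the field `h` as the first argument. -/
def ins (h : HomField X) (F : Fn X M) : Fn X M := fun n e => F (n + 1) (fcons h e)

theorem ins_apply (h : HomField X) (F : Fn X M) (n : ℕ) (e : Fin n → HomField X) :
    ins h F n e = F (n + 1) (fcons h e) := rfl

theorem exists_fcons {n : ℕ} (e : Fin (n + 1) → HomField X) : ∃ h e', e = fcons h e' :=
  ⟨e 0, Fin.tail e, (Fin.cons_self_tail e).symm⟩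

/-- The total parity of a family of fields. -/
def tpar : Fn X (ZMod 2) := fun _ e => ∑ i, (e i).par

theorem tpar_zero (e : Fin 0 → HomField X) : tpar 0 e = 0 := rfl

theorem tpar_fcons {n : ℕ} (h : HomField X) (e : Fin n → HomField X) :
    tpar (n + 1) (fcons h e) = h.par + tpar n e := by
  simp [tpar, Fin.sum_univ_succ]

theorem psign_sum {ι : Type*} (s : Finset ι) (p : ι → ZMod 2) :
    psign (∑ i ∈ s, p i) = ∏ i ∈ s, psign (p i) := by
  classical
  induction s using Finset.induction_on with
  | empty => rfl
  | insert i s hi ih => rw [Finset.sum_insert hi, Finset.prod_insert hi, psign_add, ih]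

theorem sum_finset_succ {n : ℕ} [AddCommMonoid M] (f : Finset (Fin (n + 1)) → M) :
    ∑ S, f S = ∑ S : Finset (Fin n), f (insert 0 (S.map (Fin.succEmb n))) +
      ∑ S : Finset (Fin n), f (S.map (Fin.succEmb n)) := by
  have h0 : (0 : Fin (n + 1)) ∉ (Finset.univ : Finset (Fin n)).map (Fin.succEmb n) := by
    simp [Fin.succ_ne_zero]
  have hu : (Finset.univ : Finset (Fin (n + 1))) =
      insert 0 ((Finset.univ : Finset (Fin n)).map (Fin.succEmb n)) := by
    rw [Fin.univ_succ, Finset.cons_eq_insert]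
    rfl
  have key : ∀ g : Finset (Fin (n + 1)) → M,
      ∑ S ∈ ((Finset.univ : Finset (Fin n)).map (Fin.succEmb n)).powerset, g S =
        ∑ S : Finset (Fin n), g (S.map (Fin.succEmb n)) := by
    intro g
    symm
    refine Finset.sum_nbij (fun S => S.map (Fin.succEmb n)) ?_ ?_ ?_ fun _ _ => rfl
    · intro S _
      exact Finset.mem_powerset.mpr (Finset.map_subset_map.mpr (Finset.subset_univ S))
    · intro S _ T _ h
      exact Finset.map_injective _ h
    · intro S hS
      obtain ⟨u, -, rfl⟩ := Finset.subset_map_iff.mp (Finset.mem_powerset.mp hS)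
      exact ⟨u, Finset.mem_coe.mpr (Finset.mem_univ u), rfl⟩
  have hp : (Finset.univ : Finset (Finset (Fin (n + 1)))) =
      (insert 0 ((Finset.univ : Finset (Fin n)).map (Fin.succEmb n))).powerset := by
    rw [← hu, Finset.powerset_univ]
  rw [hp, Finset.sum_powerset_insert h0, key, key, add_comm]

theorem subfamily_eq (F : Fn X M) {n m : ℕ} (S : Finset (Fin n)) (e : Fin n → HomField X)
    (g : Fin m → Fin n) (hg : StrictMono g) (hS : ∀ i, g i ∈ S) (hc : S.card = m) :
    F S.card (subfamily S e) = F m (e ∘ g) := by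
  subst hc
  congr 1
  funext i
  rw [subfamily, Function.comp_apply, Finset.orderEmbOfFin_unique rfl hS hg]

theorem subfamily_of_isEmpty (F : Fn X M) (S : Finset (Fin 0)) (e : Fin 0 → HomField X) :
    F _ (subfamily S e) = F 0 e :=
  subfamily_eq F S e id strictMono_id (fun i => i.elim0) (by
    rw [Finset.card_eq_zero]
    exact Finset.eq_empty_of_isEmpty S)

theorem subfamily_map_succ (F : Fn X M) {n : ℕ} (S : Finset (Fin n)) (h : HomField X)
    (e : Fin n → HomField X) :
    F _ (subfamily (S.map (Fin.succEmb n)) (fcons h e)) = F _ (subfamily S e) := by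
  rw [subfamily_eq F (S.map (Fin.succEmb n)) (fcons h e) (fun i => (S.orderEmbOfFin rfl i).succ)]
  · rfl
  · exact fun i j hij => Fin.succ_lt_succ_iff.mpr ((S.orderEmbOfFin rfl).strictMono hij)
  · intro i
    exact Finset.mem_map.mpr ⟨_, Finset.orderEmbOfFin_mem S rfl i, rfl⟩
  · exact Finset.card_map _

theorem subfamily_insert_zero (F : Fn X M) {n : ℕ} (S : Finset (Fin n)) (h : HomField X)
    (e : Fin n → HomField X) :
    F _ (subfamily (insert 0 (S.map (Fin.succEmb n))) (fcons h e)) =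
      F _ (fcons h (subfamily S e)) := by
  rw [subfamily_eq F (insert 0 (S.map (Fin.succEmb n))) (fcons h e)
    (Fin.cons (α := fun _ => Fin (n + 1)) 0 fun i => (S.orderEmbOfFin rfl i).succ)]
  · congr 1
    funext i
    refine Fin.cases ?_ (fun i => ?_) i <;> rfl
  · intro i j hij
    induction j using Fin.cases with
    | zero => exact absurd hij (Fin.not_lt_zero i)
    | succ j =>
      induction i using Fin.cases with
      | zero => exact Fin.succ_pos _
      | succ i =>
        exact Fin.succ_lt_succ_iff.mpr
          ((S.orderEmbOfFin rfl).strictMono (Fin.succ_lt_succ_iff.mp hij))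
  · intro i
    induction i using Fin.cases with
    | zero => exact Finset.mem_insert_self _ _
    | succ i =>
      exact Finset.mem_insert_of_mem
        (Finset.mem_map.mpr ⟨_, Finset.orderEmbOfFin_mem S rfl i, rfl⟩)
  · rw [Finset.card_insert_of_notMem, Finset.card_map]
    simp [Fin.succ_ne_zero]

theorem compl_map_succ {n : ℕ} (S : Finset (Fin n)) :
    (S.map (Fin.succEmb n))ᶜ = insert 0 (Sᶜ.map (Fin.succEmb n)) := by
  ext i
  induction i using Fin.cases with
  | zero => simp [Fin.succ_ne_zero]
  | succ i => simp [Fin.succ_ne_zero]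

theorem compl_insert_zero {n : ℕ} (S : Finset (Fin n)) :
    (insert 0 (S.map (Fin.succEmb n)))ᶜ = Sᶜ.map (Fin.succEmb n) := by
  rw [← compl_compl S, ← compl_map_succ, compl_compl, compl_compl]

theorem shuffleSign_eq {n : ℕ} (S : Finset (Fin n)) (e : Fin n → HomField X) :
    shuffleSign S e = ∏ i, ∏ j, if i ∉ S ∧ j ∈ S ∧ i < j then psign ((e i).par * (e j).par) else 1 := by
  rw [shuffleSign, Finset.prod_filter, ← Finset.univ_product_univ, Finset.prod_product]

theorem shuffleSign_insert_zero {n : ℕ} (S : Finset (Fin n)) (h : HomField X)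
    (e : Fin n → HomField X) :
    shuffleSign (insert 0 (S.map (Fin.succEmb n))) (fcons h e) = shuffleSign S e := by
  rw [shuffleSign_eq, shuffleSign_eq, Fin.prod_univ_succ]
  simp [Fin.prod_univ_succ, Fin.succ_ne_zero]

theorem tpar_subfamily {n : ℕ} (S : Finset (Fin n)) (e : Fin n → HomField X) :
    tpar _ (subfamily S e) = ∑ i ∈ S, (e i).par := by
  rw [tpar, ← Finset.sum_coe_sort S]
  exact Fintype.sum_equiv (S.orderIsoOfFin rfl).toEquiv _ _ fun i => rfl

theorem shuffleSign_map_succ {n : ℕ} (S : Finset (Fin n)) (h : HomField X)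
    (e : Fin n → HomField X) :
    shuffleSign (S.map (Fin.succEmb n)) (fcons h e) =
      psign (h.par * tpar _ (subfamily S e)) * shuffleSign S e := by
  rw [shuffleSign_eq, shuffleSign_eq, Fin.prod_univ_succ, tpar_subfamily, Finset.mul_sum, psign_sum]
  simp [Fin.prod_univ_succ, Fin.succ_ne_zero]

/-- The shuffle product of two families of Taylor components, with respect to a pairing that may
depend on the parities of the two groups of arguments. -/
def shuffle [AddCommMonoid P] [Module ℂ P] (B : ZMod 2 → ZMod 2 → M → N → P) (F : Fn X M)
    (G : Fn X N) : Fn X P := fun _ e => ∑ S : Finset _, shuffleSign S e •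
      B (tpar _ (subfamily S e)) (tpar _ (subfamily Sᶜ e)) (F _ (subfamily S e))
        (G _ (subfamily Sᶜ e))

variable [AddCommMonoid P] [Module ℂ P]

theorem shuffle_zero (B : ZMod 2 → ZMod 2 → M → N → P) (F : Fn X M) (G : Fn X N)
    (e : Fin 0 → HomField X) : shuffle B F G 0 e = B 0 0 (F 0 e) (G 0 e) := by
  rw [shuffle, Fintype.sum_unique]
  have h1 : shuffleSign (default : Finset (Fin 0)) e = 1 := rfl
  rw [h1, one_smul, subfamily_of_isEmpty tpar, subfamily_of_isEmpty tpar,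
    subfamily_of_isEmpty F, subfamily_of_isEmpty G]
  rfl

/-- Insertion of a field into a shuffle product. -/
theorem ins_shuffle (B : ZMod 2 → ZMod 2 → M → N → P) (F : Fn X M) (G : Fn X N) (h : HomField X) :
    ins h (shuffle B F G) = fun n e => shuffle (fun s t => B (h.par + s) t) (ins h F) G n e +
      shuffle (fun s t x y => psign (h.par * s) • B s (h.par + t) x y) F (ins h G) n e := by
  funext n e
  rw [ins_apply, shuffle, sum_finset_succ]
  congr 1
  · refine Finset.sum_congr rfl fun S _ => ?_
    rw [shuffleSign_insert_zero, subfamily_insert_zero tpar, subfamily_insert_zero F,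
      compl_insert_zero, subfamily_map_succ tpar, subfamily_map_succ G, tpar_fcons]
    rfl
  · refine Finset.sum_congr rfl fun S _ => ?_
    rw [shuffleSign_map_succ, subfamily_map_succ tpar, subfamily_map_succ F,
      compl_map_succ, subfamily_insert_zero tpar, subfamily_insert_zero G, tpar_fcons, mul_comm,
      mul_smul]
    rfl

/-! ### Graded symmetrization -/

/-- The permutation with `σ j = 0` that induces `τ` on the other indices. -/
def permIns {n : ℕ} (j : Fin (n + 1)) (τ : Equiv.Perm (Fin n)) : Equiv.Perm (Fin (n + 1)) :=
  Equiv.Perm.decomposeFin.symm (0, τ) * Fin.cycleRange j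

theorem permIns_self {n : ℕ} (j : Fin (n + 1)) (τ : Equiv.Perm (Fin n)) : permIns j τ j = 0 := by
  rw [permIns, Equiv.Perm.mul_apply, Fin.cycleRange_self, Equiv.Perm.decomposeFin_symm_apply_zero]

theorem permIns_succAbove {n : ℕ} (j : Fin (n + 1)) (τ : Equiv.Perm (Fin n)) (i : Fin n) :
    permIns j τ (j.succAbove i) = (τ i).succ := by
  rw [permIns, Equiv.Perm.mul_apply, Fin.cycleRange_succAbove,
    Equiv.Perm.decomposeFin_symm_apply_succ, Equiv.swap_self, Equiv.refl_apply]

theorem permIns_bijective (n : ℕ) :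
    Function.Bijective fun p : Fin (n + 1) × Equiv.Perm (Fin n) => permIns p.1 p.2 := by
  rw [Fintype.bijective_iff_injective_and_card]
  constructor
  · rintro ⟨j, τ⟩ ⟨j', τ'⟩ h
    dsimp only at h
    have hj : j = j' := by
      apply (permIns j' τ').injective
      rw [permIns_self, ← h, permIns_self]
    subst hj
    congr 1
    ext i
    have h1 := congrArg (fun σ => σ (j.succAbove i)) h
    simp only [permIns_succAbove] at h1
    rw [Fin.succ_injective _ h1]
  · simp [Fintype.card_perm, Nat.factorial_succ]

theorem fcons_comp_permIns {n : ℕ} (h : HomField X) (e : Fin n → HomField X) (j : Fin (n + 1))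
    (τ : Equiv.Perm (Fin n)) :
    fcons h e ∘ permIns j τ = j.insertNth (α := fun _ => HomField X) h (e ∘ τ) := by
  funext i
  rw [Function.comp_apply]
  induction i using Fin.succAboveCases j with
  | x => rw [permIns_self, Fin.insertNth_apply_same]; rfl
  | p i => rw [permIns_succAbove, Fin.insertNth_apply_succAbove]; rfl

/-- The sign of moving a field of parity `p` past the first `j` fields of a family. -/
def moveSign {n : ℕ} (p : ZMod 2) (j : Fin (n + 1)) (e : Fin n → HomField X) : ℂ :=
  ∏ i : Fin n, if i.castSucc < j then psign (p * (e i).par) else 1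

theorem koszul_permIns {n : ℕ} (h : HomField X) (e : Fin n → HomField X) (j : Fin (n + 1))
    (τ : Equiv.Perm (Fin n)) :
    koszul (permIns j τ) (fcons h e) = moveSign h.par j (e ∘ τ) * koszul τ e := by
  have e1 : ∀ {m : ℕ} (σ : Equiv.Perm (Fin m)) (f : Fin m → HomField X), koszul σ f =
      ∏ i, ∏ k, if i < k ∧ σ k < σ i then psign ((f (σ i)).par * (f (σ k)).par) else 1 := by
    intro m σ f
    rw [koszul, Finset.prod_filter, ← Finset.univ_product_univ, Finset.prod_product]
  rw [e1, e1, Fin.prod_univ_succAbove _ j]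
  have h1 : ∀ k, (if j < k ∧ permIns j τ k < permIns j τ j then
      psign ((fcons h e (permIns j τ j)).par * (fcons h e (permIns j τ k)).par) else 1) = 1 := by
    intro k
    rw [if_neg]
    rw [permIns_self]
    exact fun h => Fin.not_lt_zero _ h.2
  rw [Finset.prod_congr rfl fun k _ => h1 k, Finset.prod_const_one, one_mul, moveSign,
    ← Finset.prod_mul_distrib]
  refine Finset.prod_congr rfl fun i _ => ?_
  rw [Fin.prod_univ_succAbove _ j]
  congr 1
  · rw [permIns_self, permIns_succAbove]
    simp only [Fin.succ_pos, and_true, Fin.succAbove_lt_iff_castSucc_lt]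
    rw [mul_comm]
    rfl
  · refine Finset.prod_congr rfl fun k _ => ?_
    rw [permIns_succAbove, permIns_succAbove]
    simp only [Fin.succ_lt_succ_iff, (Fin.strictMono_succAbove j).lt_iff_lt]
    rfl

/-- The graded symmetrization of a sequence of multilinear expressions with values in `M`. -/
def gradedSym [AddCommMonoid M] [Module ℂ M] (T : Fn X M) : Fn X M := fun _ e =>
  ∑ σ, koszul σ e • T _ (e ∘ σ)

/-- Insertion of a field at all possible positions of an expression. -/
def insAll [AddCommMonoid M] [Module ℂ M] (h : HomField X) (T : Fn X M) : Fn X M := fun n e =>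
  ∑ j : Fin (n + 1), moveSign h.par j e • T (n + 1) (j.insertNth (α := fun _ => HomField X) h e)

theorem ins_gradedSym [AddCommMonoid M] [Module ℂ M] (h : HomField X) (T : Fn X M) :
    ins h (gradedSym T) = gradedSym (insAll h T) := by
  funext n e
  rw [ins_apply, gradedSym, ← Fintype.sum_bijective _ (permIns_bijective n) _ _ fun _ => rfl,
    Fintype.sum_prod_type, Finset.sum_comm, gradedSym]
  refine Finset.sum_congr rfl fun τ _ => ?_
  rw [insAll, Finset.smul_sum]
  refine Finset.sum_congr rfl fun j _ => ?_
  rw [koszul_permIns, fcons_comp_permIns, mul_comm, mul_smul]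

theorem gradedSym_zero [AddCommMonoid M] [Module ℂ M] (T : Fn X M) (e : Fin 0 → HomField X) :
    gradedSym T 0 e = T 0 e := by
  rw [gradedSym, Fintype.sum_unique]
  have h1 : koszul (default : Equiv.Perm (Fin 0)) e = 1 := rfl
  rw [h1, one_smul]
  rfl

/-- An expression whose first factor `α` sees only the first field. -/
def leftMul (B : M → N → P) (α : HomField X → M) (U : Fn X N) : Fn X P
  | 0, _ => 0
  | n + 1, e => B (α (e 0)) (U n (Fin.tail e))

theorem moveSign_zero {n : ℕ} (p : ZMod 2) (e : Fin n → HomField X) : moveSign p 0 e = 1 :=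
  Finset.prod_eq_one fun i _ => if_neg (Fin.not_lt_zero _)

theorem moveSign_succ {n : ℕ} (p : ZMod 2) (j : Fin (n + 1)) (k : HomField X)
    (e : Fin n → HomField X) :
    moveSign p j.succ (fcons k e) = psign (p * k.par) * moveSign p j e := by
  rw [moveSign, Fin.prod_univ_succ, moveSign]
  congr 1
  refine Finset.prod_congr rfl fun i _ => ?_
  rw [← Fin.succ_castSucc]
  simp only [Fin.succ_lt_succ_iff]
  rfl

theorem insertNth_zero_eq {n : ℕ} (h : HomField X) (e : Fin n → HomField X) :
    (0 : Fin (n + 1)).insertNth (α := fun _ => HomField X) h e = fcons h e := by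
  rw [Fin.insertNth_zero']

theorem insertNth_succ_eq {n : ℕ} (h k : HomField X) (j : Fin (n + 1)) (e : Fin n → HomField X) :
    j.succ.insertNth (α := fun _ => HomField X) h (fcons k e) =
      fcons k (j.insertNth (α := fun _ => HomField X) h e) := by
  funext i
  induction i using Fin.cases with
  | zero =>
    have : (0 : Fin (n + 2)) = j.succ.succAbove 0 := by simp
    rw [this, Fin.insertNth_apply_succAbove, ← this]
    rfl
  | succ i =>
    change _ = j.insertNth (α := fun _ => HomField X) h e i
    induction i using Fin.succAboveCases j with
    | x => rw [Fin.insertNth_apply_same, Fin.insertNth_apply_same]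
    | p i =>
      rw [← Fin.succ_succAbove_succ, Fin.insertNth_apply_succAbove, Fin.insertNth_apply_succAbove]
      rfl

theorem insAll_leftMul [AddCommMonoid M] [AddCommMonoid N] [Module ℂ M] [Module ℂ N]
    (B : M →ₗ[ℂ] N →ₗ[ℂ] P) (α : HomField X → M) (U : Fn X N) (h : HomField X) :
    insAll h (leftMul (fun x y => B x y) α U) = fun n e => B (α h) (U n e) +
      leftMul (fun x y => B x y) (fun k => psign (h.par * k.par) • α k) (insAll h U) n e := by
  funext n e
  rw [insAll, Fin.sum_univ_succ, moveSign_zero, one_smul, insertNth_zero_eq]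
  congr 1
  cases n with
  | zero => rw [Fin.sum_univ_zero]; rfl
  | succ n =>
    obtain ⟨k, e, rfl⟩ := exists_fcons e
    change _ = B (psign (h.par * k.par) • α k) (insAll h U n e)
    rw [insAll, map_sum]
    refine Finset.sum_congr rfl fun j _ => ?_
    rw [moveSign_succ, insertNth_succ_eq, map_smul, map_smul, LinearMap.smul_apply, smul_smul,
      mul_comm]
    rfl

/-- The Taylor components of a linear functional. -/
def linFn [Zero M] (α : HomField X → M) : Fn X M
  | 1, e => α (e 0)
  | _, _ => 0

/-- The shuffle product with respect to a bilinear map, without further signs. -/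
abbrev bshuffle [AddCommMonoid M] [AddCommMonoid N] [Module ℂ M] [Module ℂ N]
    (B : M →ₗ[ℂ] N →ₗ[ℂ] P) (F : Fn X M) (G : Fn X N) : Fn X P :=
  shuffle (fun _ _ x y => B x y) F G

theorem shuffle_const_left [Zero M] (B : ZMod 2 → ZMod 2 → M → N → P)
    (hB : ∀ s t y, B s t 0 y = 0) (F : Fn X M) (hF : ∀ h, ins h F = fun _ _ => 0) (G : Fn X N)
    (n : ℕ) (e : Fin n → HomField X) :
    shuffle B F G n e = B 0 (tpar n e) (F 0 Fin.elim0) (G n e) := by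
  have hF' : ∀ (m : ℕ) (e : Fin m → HomField X), 0 < m → F m e = 0 := by
    intro m e hm
    obtain ⟨m, rfl⟩ := Nat.exists_eq_succ_of_ne_zero hm.ne'
    obtain ⟨h, e, rfl⟩ := exists_fcons e
    exact congrFun (congrFun (hF h) m) e
  rw [shuffle, Finset.sum_eq_single ∅]
  · have h1 : shuffleSign (∅ : Finset (Fin n)) e = 1 := by simp [shuffleSign]
    rw [h1, one_smul, subfamily_eq tpar (∅ᶜ) e id strictMono_id (by simp) (by simp),
      subfamily_eq G (∅ᶜ) e id strictMono_id (by simp) (by simp), Function.comp_id]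
    have h2 : F (∅ : Finset (Fin n)).card (subfamily ∅ e) = F 0 Fin.elim0 :=
      congrArg (F 0) (Subsingleton.elim _ _)
    rw [h2]
    rfl
  · intro S _ hS
    rw [hF' _ _ (Finset.card_pos.mpr (Finset.nonempty_iff_ne_empty.mpr hS)), hB, smul_zero]
  · exact fun h => absurd (Finset.mem_univ _) h

theorem gradedSym_leftMul [AddCommMonoid M] [AddCommMonoid N] [Module ℂ M] [Module ℂ N]
    (B : M →ₗ[ℂ] N →ₗ[ℂ] P) (n : ℕ) : ∀ (α : HomField X → M) (U : Fn X N)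
    (e : Fin n → HomField X), gradedSym (leftMul (fun x y => B x y) α U) n e =
      bshuffle B (linFn α) (gradedSym U) n e := by
  induction n with
  | zero =>
    intro α U e
    rw [gradedSym_zero, bshuffle, shuffle_zero]
    change 0 = B 0 _
    rw [map_zero, LinearMap.zero_apply]
  | succ n ih =>
    intro α U e
    obtain ⟨h, e, rfl⟩ := exists_fcons e
    change ins h (gradedSym _) n e = ins h (bshuffle B _ _) n e
    rw [ins_gradedSym, insAll_leftMul, ins_shuffle]
    have h1 : gradedSym (fun n e => B (α h) (U n e) + leftMul (fun x y => B x y)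
        (fun k => psign (h.par * k.par) • α k) (insAll h U) n e) n e =
        B (α h) (gradedSym U n e) + gradedSym (leftMul (fun x y => B x y)
          (fun k => psign (h.par * k.par) • α k) (insAll h U)) n e := by
      simp only [gradedSym, smul_add, Finset.sum_add_distrib, map_sum, map_smul]
    rw [h1, ih]
    congr 1
    · rw [shuffle_const_left _ (fun _ _ y => by rw [map_zero, LinearMap.zero_apply])]
      · rfl
      · intro k
        rfl
    · rw [ins_gradedSym]
      refine Finset.sum_congr rfl fun S _ => congrArg _ ?_
      have h2 : linFn (fun k => psign (h.par * k.par) • α k) _ (subfamily S e) =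
          psign (h.par * tpar _ (subfamily S e)) • linFn α _ (subfamily S e) := by
        generalize subfamily S e = f
        generalize S.card = m at f
        rcases m with _ | _ | m
        · exact (smul_zero _).symm
        · simp [linFn, tpar]
        · exact (smul_zero _).symm
      simp only [h2, map_smul, LinearMap.smul_apply]

end Functionals


/-! ### The algebra of functionals with values in polyvector fields -/

section Functionals

variable {X : Type*} [TopologicalSpace X] [ChartedSpace V X]

variable (X) in
/-- Taylor components with values in polyvector fields. -/
@[ext]
structure FunR where
  toFun : Fn X (PV X)

instance : CoeFun (FunR X) fun _ => ∀ n : ℕ, (Fin n → HomField X) → PV X := ⟨FunR.toFun⟩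

/-- The underlying family of Taylor components. -/
def FunR.equivFn : FunR X ≃ Fn X (PV X) := ⟨FunR.toFun, FunR.mk, fun _ => rfl, fun _ => rfl⟩

instance : AddCommGroup (FunR X) := FunR.equivFn.addCommGroup

instance : Module ℂ (FunR X) := FunR.equivFn.module ℂ

namespace FunR

variable (Φ Ψ Χ : FunR X) (n : ℕ) (e : Fin n → HomField X)

theorem add_apply : (Φ + Ψ) n e = Φ n e + Ψ n e := rfl

theorem sub_apply : (Φ - Ψ) n e = Φ n e - Ψ n e := rfl

theorem neg_apply : (-Φ) n e = -Φ n e := rfl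

theorem smul_apply (s : ℂ) : (s • Φ) n e = s • Φ n e := rfl

variable {Φ Ψ} in
theorem ext' (h : ∀ n e, Φ n e = Ψ n e) : Φ = Ψ := FunR.ext (funext fun n => funext fun e => h n e)

/-- The insertion of a field as the first argument. -/
def ins (h : HomField X) : FunR X →ₗ[ℂ] FunR X where
  toFun Φ := ⟨fun n e => Φ (n + 1) (fcons h e)⟩
  map_add' _ _ := rfl
  map_smul' _ _ := rfl

theorem succ_apply (h : HomField X) : Φ (n + 1) (fcons h e) = ins h Φ n e := rfl

/-- A linear operator on polyvector fields, applied to the values of a functional. -/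
def lift (L : PV X →ₗ[ℂ] PV X) : FunR X →ₗ[ℂ] FunR X where
  toFun Φ := ⟨fun n e => L (Φ n e)⟩
  map_add' Φ Ψ := ext' fun n e => map_add L _ _
  map_smul' s Φ := ext' fun n e => map_smul L s _

/-- The parity involution: the sign of the total parity of a functional, which is the parity of its
value plus the parity of its arguments. -/
def G : FunR X →ₗ[ℂ] FunR X where
  toFun Φ := ⟨fun n e => psign (tpar n e) • parityInv (Φ n e)⟩
  map_add' Φ Ψ := ext' fun n e => by
    change psign _ • parityInv (Φ n e + Ψ n e) = _
    rw [map_add, smul_add]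
    rfl
  map_smul' s Φ := ext' fun n e => by
    change psign _ • parityInv (s • Φ n e) = _
    rw [map_smul, smul_comm]
    rfl

theorem G_apply : G Φ n e = psign (tpar n e) • parityInv (Φ n e) := rfl

theorem G_G : G (G Φ) = Φ := ext' fun n e => by
  rw [G_apply, G_apply, map_smul, parityInv_parityInv, smul_smul, psign_mul_self, one_smul]

theorem ins_G (h : HomField X) : ins h (G Φ) = psign h.par • G (ins h Φ) := ext' fun n e => by
  rw [← succ_apply, G_apply, smul_apply, G_apply, ← succ_apply, smul_smul, ← psign_add, tpar_fcons]

/-- The power of the parity involution. -/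
def Gp (p : ZMod 2) : FunR X →ₗ[ℂ] FunR X := if p = 0 then LinearMap.id else G

theorem Gp_zero : Gp 0 Φ = Φ := rfl

theorem Gp_one : Gp 1 Φ = G Φ := rfl

theorem parityPow_add (p q : ZMod 2) (a : PV X) :
    parityPow (p + q) a = parityPow p (parityPow q a) := by
  rcases zmod_two_cases p with rfl | rfl <;> rcases zmod_two_cases q with rfl | rfl
  exacts [rfl, rfl, rfl, (parityInv_parityInv a).symm]

theorem Gp_apply (p : ZMod 2) : Gp p Φ n e = psign (p * tpar n e) • parityPow p (Φ n e) := by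
  rcases zmod_two_cases p with rfl | rfl
  · rw [Gp_zero, zero_mul, psign_zero, one_smul]
    rfl
  · rw [Gp_one, G_apply, one_mul]
    rfl

theorem Gp_Gp (p q : ZMod 2) : Gp p (Gp q Φ) = Gp (p + q) Φ := by
  rcases zmod_two_cases p with rfl | rfl <;> rcases zmod_two_cases q with rfl | rfl
  exacts [rfl, rfl, rfl, G_G Φ]

theorem ins_Gp (p : ZMod 2) (h : HomField X) :
    ins h (Gp p Φ) = psign (h.par * p) • Gp p (ins h Φ) := by
  rcases zmod_two_cases p with rfl | rfl
  · rw [mul_zero, psign_zero, one_smul]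
    rfl
  · rw [mul_one]
    exact ins_G Φ h

theorem parityPow_linear (p : ZMod 2) :
    ∃ L : PV X →ₗ[ℂ] PV X, ∀ a, parityPow p a = L a := by
  rcases zmod_two_cases p with rfl | rfl
  · exact ⟨LinearMap.id, fun _ => rfl⟩
  · exact ⟨parityInv, fun _ => rfl⟩

theorem parityPow_smul (p : ZMod 2) (s : ℂ) (a : PV X) :
    parityPow p (s • a) = s • parityPow p a := by
  obtain ⟨L, hL⟩ := parityPow_linear (X := X) p
  rw [hL, hL, map_smul]

theorem parityPow_add_arg (p : ZMod 2) (a b : PV X) :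
    parityPow p (a + b) = parityPow p a + parityPow p b := by
  obtain ⟨L, hL⟩ := parityPow_linear (X := X) p
  rw [hL, hL, hL, map_add]

/-- The Koszul-signed product of functionals with values in polyvector fields: the arguments of the
left factor are moved past the right factor. -/
instance : Mul (FunR X) :=
  ⟨fun Φ Ψ => ⟨shuffle (fun s t x y => x * (psign (s * t) • parityPow s y)) Φ.toFun Ψ.toFun⟩⟩

theorem mul_apply : (Φ * Ψ) n e = ∑ S : Finset (Fin n), shuffleSign S e •
    (Φ _ (subfamily S e) * (psign (tpar _ (subfamily S e) * tpar _ (subfamily Sᶜ e)) •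
      parityPow (tpar _ (subfamily S e)) (Ψ _ (subfamily Sᶜ e)))) := rfl

theorem mul_zero_apply (e : Fin 0 → HomField X) : (Φ * Ψ) 0 e = Φ 0 e * Ψ 0 e := by
  refine (shuffle_zero (fun s t x y => x * (psign (s * t) • parityPow s y)) Φ.toFun Ψ.toFun e).trans ?_
  rw [mul_zero, psign_zero, one_smul]
  rfl

theorem ins_mul (h : HomField X) : ins h (Φ * Ψ) = ins h Φ * Gp h.par Ψ + Φ * ins h Ψ := by
  refine ext' fun n e => (congrFun (congrFun (ins_shuffle
    (fun s t x y => x * (psign (s * t) • parityPow s y)) Φ.toFun Ψ.toFun h) n) e).trans ?_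
  refine congrArg₂ (· + ·) ?_ ?_
  · refine Finset.sum_congr rfl fun S _ => congrArg _ (congrArg _ ?_)
    rw [Gp_apply, parityPow_smul, ← parityPow_add, smul_smul, ← psign_add, ← add_mul,
      add_comm (tpar _ _)]
  · refine Finset.sum_congr rfl fun S _ => congrArg _ ?_
    dsimp only
    rw [mul_smul_comm, mul_smul_comm, smul_smul, ← psign_add]
    refine congrArg₂ (· • ·) (congrArg psign ?_) rfl
    generalize tpar _ (subfamily S e) = s
    rcases zmod_two_cases s with rfl | rfl <;> rcases zmod_two_cases h.par with h0 | h0 <;>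
      rw [h0] <;> simp [← add_assoc, show (1 : ZMod 2) + 1 = 0 from rfl]

theorem add_mul' : (Φ + Ψ) * Χ = Φ * Χ + Ψ * Χ := ext' fun n e => by
  simp only [mul_apply, add_apply, add_mul, smul_add, Finset.sum_add_distrib]

theorem mul_add' : Χ * (Φ + Ψ) = Χ * Φ + Χ * Ψ := ext' fun n e => by
  simp only [mul_apply, add_apply, parityPow_add_arg, mul_add, smul_add, Finset.sum_add_distrib]

theorem smul_mul' (s : ℂ) : (s • Φ) * Ψ = s • (Φ * Ψ) := ext' fun n e => by
  simp only [mul_apply, smul_apply, smul_mul_assoc, Finset.smul_sum]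
  exact Finset.sum_congr rfl fun S _ => smul_comm _ _ _

theorem mul_smul' (s : ℂ) : Φ * (s • Ψ) = s • (Φ * Ψ) := ext' fun n e => by
  simp only [mul_apply, smul_apply, parityPow_smul, mul_smul_comm, Finset.smul_sum]
  refine Finset.sum_congr rfl fun S _ => ?_
  rw [smul_comm _ s, smul_comm _ s]

theorem G_mul : G (Φ * Ψ) = G Φ * G Ψ := by
  refine ext' fun n e => ?_
  induction n generalizing Φ Ψ with
  | zero =>
    rw [mul_zero_apply, G_apply, G_apply, G_apply, mul_zero_apply, tpar_zero, psign_zero,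
      one_smul, one_smul, one_smul, parityInv_mul]
  | succ n ih =>
    obtain ⟨h, e, rfl⟩ := exists_fcons e
    have h1 : G (Gp h.par Ψ) = Gp h.par (G Ψ) := by
      rcases zmod_two_cases h.par with h0 | h0 <;> rw [h0] <;> rfl
    rw [succ_apply, succ_apply, ins_G, ins_mul, ins_mul, ins_G, ins_G, map_add, smul_apply,
      add_apply, add_apply, ih, ih, smul_mul', mul_smul', smul_apply, smul_apply, h1, smul_add]

theorem Gp_mul (p : ZMod 2) : Gp p (Φ * Ψ) = Gp p Φ * Gp p Ψ := by
  rcases zmod_two_cases p with rfl | rfl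
  · rfl
  · exact G_mul Φ Ψ

theorem mul_assoc' : Φ * Ψ * Χ = Φ * (Ψ * Χ) := by
  refine ext' fun n e => ?_
  induction n generalizing Φ Ψ Χ with
  | zero =>
    rw [mul_zero_apply, mul_zero_apply, mul_zero_apply, mul_zero_apply, mul_assoc]
  | succ n ih =>
    obtain ⟨h, e, rfl⟩ := exists_fcons e
    rw [succ_apply, succ_apply, ins_mul, ins_mul, ins_mul, ins_mul, Gp_mul, add_mul', mul_add']
    simp only [add_apply, ih, add_assoc]

/-- The constant functional. -/
def const (a : PV X) : FunR X where
  toFun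
    | 0, _ => a
    | _ + 1, _ => 0

theorem ins_const (h : HomField X) (a : PV X) : ins h (const a) = 0 := rfl

theorem G_const (a : PV X) : G (const a) = const (parityInv a) := ext' fun n e => by
  rw [G_apply]
  cases n with
  | zero =>
    rw [tpar_zero, psign_zero, one_smul]
    rfl
  | succ n =>
    change _ • parityInv (0 : PV X) = 0
    rw [map_zero, smul_zero]

theorem const_mul_apply (a : PV X) : (const a * Φ) n e = a * Φ n e := by
  refine (shuffle_const_left
    (fun s t x y => x * (psign (s * t) • parityPow s y)) (fun s t y => zero_mul _) (const a).toFun (fun h => rfl) Φ.toFun n e).trans ?_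
  rw [zero_mul, psign_zero, one_smul]
  rfl

theorem mul_const_one : Φ * const 1 = Φ := by
  refine ext' fun n e => ?_
  induction n generalizing Φ with
  | zero =>
    rw [mul_zero_apply]
    exact mul_one _
  | succ n ih =>
    obtain ⟨h, e, rfl⟩ := exists_fcons e
    have h1 : Gp h.par (const (1 : PV X)) = const 1 := by
      rcases zmod_two_cases h.par with h0 | h0 <;> rw [h0]
      · rfl
      · rw [Gp_one, G_const, parityInv_one]
    have h2 : Φ * (0 : FunR X) = 0 := by
      have := mul_smul' Φ (0 : FunR X) 0
      rwa [smul_zero, zero_smul] at this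
    rw [succ_apply, succ_apply, ins_mul, h1, ins_const, h2, add_zero, ih]

instance : Ring (FunR X) :=
  { (inferInstance : AddCommGroup (FunR X)) with
    mul := (· * ·)
    one := const 1
    mul_assoc := mul_assoc'
    one_mul := fun Φ => ext' fun n e => (const_mul_apply Φ n e 1).trans (one_mul _)
    mul_one := mul_const_one
    left_distrib := fun Χ Φ Ψ => mul_add' Φ Ψ Χ
    right_distrib := fun Φ Ψ Χ => add_mul' Φ Ψ Χ
    zero_mul := fun Φ => by
      have := smul_mul' (0 : FunR X) Φ 0
      rwa [smul_zero, zero_smul] at this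
    mul_zero := fun Φ => by
      have := mul_smul' Φ (0 : FunR X) 0
      rwa [smul_zero, zero_smul] at this }

instance : Algebra ℂ (FunR X) :=
  Algebra.ofModule (fun s Φ Ψ => smul_mul' Φ Ψ s) (fun s Φ Ψ => mul_smul' Φ Ψ s)

theorem one_def : (1 : FunR X) = const 1 := rfl

theorem G_one : G (1 : FunR X) = 1 := by rw [one_def, G_const, parityInv_one]

theorem ins_one (h : HomField X) : ins h (1 : FunR X) = 0 := rfl

/-- The functionals of total parity `p`. -/
def HasPar (p : ZMod 2) (Φ : FunR X) : Prop := G Φ = psign p • Φ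

variable {Φ Ψ}

theorem HasPar.ins {p : ZMod 2} (hΦ : HasPar p Φ) (h : HomField X) :
    HasPar (p + h.par) (ins h Φ) := by
  have h1 := ins_G Φ h
  rw [show G Φ = _ from hΦ, map_smul] at h1
  rw [HasPar, psign_add, mul_comm, mul_smul, h1, smul_smul, psign_mul_self, one_smul]

theorem HasPar.mul {p q : ZMod 2} (hΦ : HasPar p Φ) (hΨ : HasPar q Ψ) : HasPar (p + q) (Φ * Ψ) := by
  rw [HasPar, G_mul, hΦ, hΨ, smul_mul_smul_comm, psign_add]

theorem HasPar.add {p : ZMod 2} (hΦ : HasPar p Φ) (hΨ : HasPar p Ψ) : HasPar p (Φ + Ψ) := by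
  rw [HasPar, map_add, hΦ, hΨ, smul_add]

theorem HasPar.smul {p : ZMod 2} (hΦ : HasPar p Φ) (s : ℂ) : HasPar p (s • Φ) := by
  rw [HasPar, map_smul, hΦ, smul_comm]

theorem HasPar.sub {p : ZMod 2} (hΦ : HasPar p Φ) (hΨ : HasPar p Ψ) : HasPar p (Φ - Ψ) := by
  rw [HasPar, map_sub, hΦ, hΨ, smul_sub]

theorem hasPar_one : HasPar 0 (1 : FunR X) := by rw [HasPar, G_one, psign_zero, one_smul]

theorem HasPar.apply {p : ZMod 2} (hΦ : HasPar p Φ) (n : ℕ) (e : Fin n → HomField X) :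
    parityInv (Φ n e) = psign (p + tpar n e) • Φ n e := by
  have h1 : psign (tpar n e) • parityInv (Φ n e) = psign p • Φ n e :=
    congrArg (fun Φ : FunR X => Φ n e) hΦ
  rw [psign_add, mul_comm, mul_smul, ← h1, smul_smul, psign_mul_self, one_smul]

theorem hasPar_iff {p : ZMod 2} :
    HasPar p Φ ↔ ∀ n e, parityInv (Φ n e) = psign (p + tpar n e) • Φ n e :=
  ⟨fun h => h.apply, fun h => ext' fun n e => by
    rw [G_apply, h, smul_smul, smul_apply, psign_add, mul_comm (psign p), ← mul_assoc,
      psign_mul_self, one_mul]⟩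

/-- Multiplication by an even functional is central, and odd functionals anticommute up to the
parity involution. -/
theorem HasPar.mul_comm {p : ZMod 2} [IsManifold 𝓘(ℂ, V) ω X] (hΦ : HasPar p Φ) (Ψ : FunR X) :
    Φ * Ψ = Gp p Ψ * Φ := by
  refine ext' fun n e => ?_
  induction n generalizing p Φ Ψ with
  | zero =>
    have h1 := hΦ.apply 0 e
    rw [tpar_zero, add_zero] at h1
    rw [mul_zero_apply, mul_zero_apply, Gp_apply, tpar_zero, mul_zero, psign_zero, one_smul,
      PV.mul_comm_of_parity p _ _ h1]
  | succ n ih =>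
    obtain ⟨h, e, rfl⟩ := exists_fcons e
    rw [succ_apply, succ_apply, ins_mul, ins_mul, add_apply, ih (hΦ.ins h), ih hΦ,
      add_apply, add_comm]
    congr 2
    · rcases zmod_two_cases h.par with h0 | h0 <;> rcases zmod_two_cases p with rfl | rfl <;>
        simp only [h0, Gp_zero, Gp_one, ins_G, psign_zero, psign_one, one_smul]
      · have h1 : G Φ = Φ := by rw [hΦ, psign_zero, one_smul]
        rw [h1]
      · have h1 : G Φ = -Φ := by rw [hΦ, psign_one, neg_one_smul]
        rw [h1, neg_one_smul, neg_mul_neg]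
    · rcases zmod_two_cases h.par with h0 | h0 <;> rcases zmod_two_cases p with rfl | rfl <;>
        simp only [h0, Gp_zero, Gp_one, add_zero, zero_add, G_G,
          show (1 : ZMod 2) + 1 = 0 from rfl]

theorem HasPar.commute [IsManifold 𝓘(ℂ, V) ω X] (hΦ : HasPar 0 Φ) (Ψ : FunR X) : Φ * Ψ = Ψ * Φ :=
  hΦ.mul_comm Ψ

theorem HasPar.anticommute [IsManifold 𝓘(ℂ, V) ω X] (hΦ : HasPar 1 Φ) (hΨ : HasPar 1 Ψ) :
    Φ * Ψ = -(Ψ * Φ) := by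
  rw [hΦ.mul_comm Ψ, Gp_one, hΨ, psign_one, neg_one_smul, neg_mul]

/-- The functionals with values in `PV^{i,•}`. -/
def HasDeg (i : ℕ) (Φ : FunR X) : Prop := ∀ n e, Φ n e ∈ PV.deg X i

theorem parityPow_mem_deg {i : ℕ} {a : PV X} (ha : a ∈ PV.deg X i) (p : ZMod 2) :
    parityPow p a ∈ PV.deg X i := by
  rcases zmod_two_cases p with rfl | rfl
  · exact ha
  · exact parityInv_mem_deg ha

theorem HasDeg.mul {i j : ℕ} (hΦ : HasDeg i Φ) (hΨ : HasDeg j Ψ) : HasDeg (i + j) (Φ * Ψ) :=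
  fun _ _ => Submodule.sum_mem _ fun _ _ => Submodule.smul_mem _ _ <| PV.mul_mem_deg (hΦ _ _) <|
    Submodule.smul_mem _ _ (parityPow_mem_deg (hΨ _ _) _)

theorem HasDeg.add {i : ℕ} (hΦ : HasDeg i Φ) (hΨ : HasDeg i Ψ) : HasDeg i (Φ + Ψ) :=
  fun n e => Submodule.add_mem _ (hΦ n e) (hΨ n e)

theorem HasDeg.sub {i : ℕ} (hΦ : HasDeg i Φ) (hΨ : HasDeg i Ψ) : HasDeg i (Φ - Ψ) :=
  fun n e => Submodule.sub_mem _ (hΦ n e) (hΨ n e)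

theorem HasDeg.smul {i : ℕ} (hΦ : HasDeg i Φ) (s : ℂ) : HasDeg i (s • Φ) :=
  fun n e => Submodule.smul_mem _ s (hΦ n e)

theorem HasDeg.eq_zero {i : ℕ} (hΦ : HasDeg i Φ) (hi : 4 ≤ i) : Φ = 0 :=
  FunR.ext' fun n e => PV.eq_zero_of_mem_deg hi (hΦ n e)

/-- The functionals whose values have compact support. -/
def HasCpt (Φ : FunR X) : Prop := ∀ n e, Φ n e ∈ PV.compact X

theorem HasCpt.mul_right (hΦ : HasCpt Φ) (Ψ : FunR X) : HasCpt (Φ * Ψ) :=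
  fun _ _ => Submodule.sum_mem _ fun _ _ => Submodule.smul_mem _ _
    (PV.mul_mem_compact_left (hΦ _ _) _)

theorem parityPow_mem_compact {a : PV X} (ha : a ∈ PV.compact X) (p : ZMod 2) :
    parityPow p a ∈ PV.compact X := by
  rcases zmod_two_cases p with rfl | rfl
  · exact ha
  · exact parityInv_mem_compact ha

theorem HasCpt.mul_left (hΨ : HasCpt Ψ) (Φ : FunR X) : HasCpt (Φ * Ψ) :=
  fun _ _ => Submodule.sum_mem _ fun _ _ => Submodule.smul_mem _ _ <|
    PV.mul_mem_compact_right _ (Submodule.smul_mem _ _ (parityPow_mem_compact (hΨ _ _) _))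

theorem HasCpt.add (hΦ : HasCpt Φ) (hΨ : HasCpt Ψ) : HasCpt (Φ + Ψ) :=
  fun n e => Submodule.add_mem _ (hΦ n e) (hΨ n e)

theorem HasCpt.sub (hΦ : HasCpt Φ) (hΨ : HasCpt Ψ) : HasCpt (Φ - Ψ) :=
  fun n e => Submodule.sub_mem _ (hΦ n e) (hΨ n e)

theorem HasCpt.smul (hΦ : HasCpt Φ) (s : ℂ) : HasCpt (s • Φ) :=
  fun n e => Submodule.smul_mem _ s (hΦ n e)

theorem HasCpt.G (hΦ : HasCpt Φ) : HasCpt (G Φ) :=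
  fun n e => Submodule.smul_mem _ _ (parityInv_mem_compact (hΦ n e))

theorem HasCpt.ins (hΦ : HasCpt Φ) (h : HomField X) : HasCpt (ins h Φ) :=
  fun n e => hΦ (n + 1) (fcons h e)

/-! ### Differential operators on functionals -/

section Operators

variable [IsManifold 𝓘(ℂ, V) ω X] (Ω : HolVolForm X)

/-- The divergence operator on the values of functionals. -/
def del : FunR X →ₗ[ℂ] FunR X := lift (divL Ω)

/-- The operator `∂̄` on the values of functionals. -/
def delbar : FunR X →ₗ[ℂ] FunR X := lift dbarL

theorem del_apply (Φ : FunR X) (n : ℕ) (e : Fin n → HomField X) :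
    del Ω Φ n e = divL Ω (Φ n e) := rfl

theorem del_del (Φ : FunR X) : del Ω (del Ω Φ) = 0 := ext' fun _ _ => divL_divL Ω _

theorem del_G (Φ : FunR X) : del Ω (G Φ) = -G (del Ω Φ) := ext' fun n e => by
  rw [del_apply, G_apply, map_smul, divL_parityInv, neg_apply, G_apply, smul_neg, del_apply]

theorem delbar_G (Φ : FunR X) : delbar (G Φ) = -G (delbar Φ) := ext' fun n e => by
  change dbarL (psign _ • parityInv _) = -(psign _ • parityInv (dbarL _))
  rw [map_smul, dbarL_parityInv, smul_neg]

theorem delbar_del (Φ : FunR X) : delbar (del Ω Φ) = -del Ω (delbar Φ) :=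
  ext' fun _ _ => dbarL_divL Ω _

variable {Ω} in
theorem HasPar.del {p : ZMod 2} (hΦ : HasPar p Φ) : HasPar (p + 1) (del Ω Φ) := by
  have := del_G Ω Φ
  rw [show G Φ = _ from hΦ, map_smul] at this
  rw [HasPar, psign_add, psign_one, mul_neg_one, neg_smul, this, neg_neg]

variable {Ω} in
theorem HasDeg.del {i : ℕ} (hΦ : HasDeg (i + 1) Φ) : HasDeg i (del Ω Φ) :=
  fun n e => divL_mem_deg Ω (hΦ n e)

variable {Ω} in
theorem HasDeg.del_eq_zero (hΦ : HasDeg 0 Φ) : FunR.del Ω Φ = 0 :=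
  FunR.ext' fun n e => divL_of_mem_deg_zero Ω (hΦ n e)

variable {Ω} in
theorem HasCpt.del [T2Space X] (hΦ : HasCpt Φ) : HasCpt (del Ω Φ) :=
  fun n e => divL_mem_compact Ω (hΦ n e)

theorem ins_del (Φ : FunR X) (h : HomField X) : ins h (del Ω Φ) = del Ω (ins h Φ) := rfl

theorem ins_delbar (Φ : FunR X) (h : HomField X) : ins h (delbar Φ) = delbar (ins h Φ) := rfl

theorem delbar_mul (Φ Ψ : FunR X) : delbar (Φ * Ψ) = delbar Φ * Ψ + G Φ * delbar Ψ := by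
  refine ext' fun n e => ?_
  induction n generalizing Φ Ψ with
  | zero =>
    rw [add_apply, mul_zero_apply, mul_zero_apply, G_apply, tpar_zero, psign_zero, one_smul]
    change dbarL ((Φ * Ψ) 0 e) = dbarL _ * _ + _ * dbarL _
    rw [mul_zero_apply, dbarL_mul]
  | succ n ih =>
    obtain ⟨h, e, rfl⟩ := exists_fcons e
    rw [succ_apply, succ_apply, ins_delbar, ins_mul, map_add, map_add, ins_mul, ins_mul,
      ins_delbar, ins_delbar, ins_G, add_apply, ih, ih, ← add_apply]
    refine congrArg (fun Φ : FunR X => Φ n e) ?_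
    rcases zmod_two_cases h.par with h0 | h0 <;> rw [h0]
    · simp only [Gp_zero, psign_zero, one_smul]
      abel
    · simp only [Gp_one, psign_one, neg_one_smul, delbar_G, mul_neg, neg_mul]
      abel

/-- The bracket of functionals that measures the failure of `∂` to be a derivation. -/
def br (Φ Ψ : FunR X) : FunR X := del Ω (Φ * Ψ) - del Ω Φ * Ψ - G Φ * del Ω Ψ

theorem del_mul (Φ Ψ : FunR X) : del Ω (Φ * Ψ) = br Ω Φ Ψ + del Ω Φ * Ψ + G Φ * del Ω Ψ := by
  rw [br]
  abel

theorem br_add (Φ Ψ Χ : FunR X) : br Ω Φ (Ψ + Χ) = br Ω Φ Ψ + br Ω Φ Χ := by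
  simp only [br, mul_add, map_add]
  abel

theorem br_smul (s : ℂ) (Φ Ψ : FunR X) : br Ω Φ (s • Ψ) = s • br Ω Φ Ψ := by
  simp only [br, mul_smul_comm, map_smul, smul_sub]

theorem smul_br (s : ℂ) (Φ Ψ : FunR X) : br Ω (s • Φ) Ψ = s • br Ω Φ Ψ := by
  simp only [br, smul_mul_assoc, map_smul, smul_sub]

theorem ins_br (Φ Ψ : FunR X) (h : HomField X) :
    ins h (br Ω Φ Ψ) = br Ω (ins h Φ) (Gp h.par Ψ) + br Ω Φ (ins h Ψ) := by
  rw [br, br, br, map_sub, map_sub, ins_del, ins_mul, ins_mul, ins_mul, ins_del, ins_del, ins_G,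
    map_add]
  rcases zmod_two_cases h.par with h0 | h0 <;> rw [h0]
  · simp only [Gp_zero, psign_zero, one_smul]
    abel
  · simp only [Gp_one, psign_one, neg_one_smul, del_G, mul_neg, neg_mul]
    abel

theorem G_br (Φ Ψ : FunR X) : G (br Ω Φ Ψ) = -br Ω (G Φ) (G Ψ) := by
  simp only [br, map_sub, ← G_mul, del_G, neg_mul, mul_neg]
  rw [G_mul, G_mul]
  abel

theorem HasPar.Gp_br {p : ZMod 2} (hΦ : HasPar p Φ) (q : ZMod 2) (Ψ : FunR X) :
    Gp q (br Ω Φ Ψ) = psign (q * (p + 1)) • br Ω Φ (Gp q Ψ) := by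
  rcases zmod_two_cases q with rfl | rfl
  · rw [zero_mul, psign_zero, one_smul]
    rfl
  · rw [Gp_one, G_br, hΦ, smul_br, one_mul, psign_add, psign_one, mul_neg_one, neg_smul]
    rfl

/-- The bracket with a functional of parity `p` is a derivation of parity `p + 1`. -/
theorem HasPar.br_mul {p : ZMod 2} (hΦ : HasPar p Φ) (Ψ Χ : FunR X) :
    br Ω Φ (Ψ * Χ) = br Ω Φ Ψ * Χ + Gp (p + 1) Ψ * br Ω Φ Χ := by
  refine ext' fun n e => ?_
  induction n generalizing p Φ Ψ Χ with
  | zero =>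
    have h1 := hΦ.apply 0 e
    rw [tpar_zero, add_zero] at h1
    have h2 : ∀ Ψ : FunR X, br Ω Φ Ψ 0 e = BCOV.br Ω (Φ 0 e) (Ψ 0 e) := by
      intro Ψ
      rw [br, sub_apply, sub_apply, del_apply, mul_zero_apply, mul_zero_apply, mul_zero_apply,
        G_apply, tpar_zero, psign_zero, one_smul]
      rfl
    rw [add_apply, mul_zero_apply, mul_zero_apply, h2, h2, h2, mul_zero_apply, Gp_apply,
      tpar_zero, mul_zero, psign_zero, one_smul, BCOV.br_mul Ω p _ _ _ h1]
  | succ n ih =>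
    obtain ⟨h, e, rfl⟩ := exists_fcons e
    rw [succ_apply, succ_apply, ins_br, ins_mul, map_add, br_add, ins_mul, ins_mul, ins_br,
      ins_br, Gp_mul, add_apply, add_apply, ih (hΦ.ins h), ih hΦ,
      ih hΦ, ← add_apply, ← add_apply]
    refine congrArg (fun Φ : FunR X => Φ n e) ?_
    have h1 : Gp (p + h.par + 1) (Gp h.par Ψ) = Gp (p + 1) Ψ := by
      rw [Gp_Gp]
      congr 2
      rw [show p + h.par + 1 + h.par = p + 1 + (h.par + h.par) by ring,
        CharTwo.add_self_eq_zero, add_zero]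
    rw [h1, ins_Gp, hΦ.Gp_br, smul_mul_smul_comm, psign_mul_self, one_smul, add_mul, mul_add]
    abel

end Operators

end FunR

end Functionals


/-! ### Graded symmetric families of Taylor components -/

section Symmetric

variable {X : Type*} [TopologicalSpace X] [ChartedSpace V X] {M N P : Type*}
  [AddCommGroup M] [Module ℂ M] [AddCommGroup N] [Module ℂ N] [AddCommGroup P] [Module ℂ P]

theorem ins_add (h : HomField X) (F G : Fn X M) : ins h (F + G) = ins h F + ins h G := rfl

theorem ins_smul (h : HomField X) (s : ℂ) (F : Fn X M) : ins h (s • F) = s • ins h F := rfl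

/-- The first two arguments can be exchanged, with the Koszul sign. -/
def SwapInv (F : Fn X M) : Prop :=
  ∀ h k, ins h (ins k F) = psign (h.par * k.par) • ins k (ins h F)

/-- Graded symmetry with respect to the exchanges of neighbours among the first `n + 1`
arguments. -/
def GradedSymmUpTo : ℕ → Fn X M → Prop
  | 0, _ => True
  | n + 1, F => SwapInv F ∧ ∀ h, GradedSymmUpTo n (ins h F)

/-- Graded symmetry, expressed through neighbours. -/
def GradedSymm (F : Fn X M) : Prop := ∀ n, GradedSymmUpTo n F

theorem GradedSymm.swap {F : Fn X M} (hF : GradedSymm F) : SwapInv F := (hF 1).1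

theorem GradedSymm.ins {F : Fn X M} (hF : GradedSymm F) (h : HomField X) :
    GradedSymm (ins h F) := fun n => (hF (n + 1)).2 h

theorem SwapInv.add {F G : Fn X M} (hF : SwapInv F) (hG : SwapInv G) : SwapInv (F + G) :=
  fun h k => by rw [ins_add, ins_add, ins_add, ins_add, hF, hG, smul_add]

theorem SwapInv.smul {F : Fn X M} (hF : SwapInv F) (s : ℂ) : SwapInv (s • F) :=
  fun h k => by rw [ins_smul, ins_smul, ins_smul, ins_smul, hF, smul_comm]

theorem GradedSymmUpTo.add {n : ℕ} : ∀ {F G : Fn X M}, GradedSymmUpTo n F → GradedSymmUpTo n G →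
    GradedSymmUpTo n (F + G) := by
  induction n with
  | zero => exact fun _ _ => trivial
  | succ n ih => exact fun hF hG => ⟨hF.1.add hG.1, fun h => ih (hF.2 h) (hG.2 h)⟩

theorem GradedSymmUpTo.smul {n : ℕ} (s : ℂ) : ∀ {F : Fn X M}, GradedSymmUpTo n F →
    GradedSymmUpTo n (s • F) := by
  induction n with
  | zero => exact fun _ => trivial
  | succ n ih => exact fun hF => ⟨hF.1.smul s, fun h => ih (hF.2 h)⟩

theorem GradedSymmUpTo.of_succ {n : ℕ} : ∀ {F : Fn X M}, GradedSymmUpTo (n + 1) F →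
    GradedSymmUpTo n F := by
  induction n with
  | zero => exact fun _ => trivial
  | succ n ih => exact fun hF => ⟨hF.1, fun h => ih (hF.2 h)⟩

theorem gradedSymmUpTo_zero (n : ℕ) : GradedSymmUpTo n (0 : Fn X M) := by
  induction n with
  | zero => trivial
  | succ n ih => exact ⟨fun h k => (smul_zero _).symm, fun h => ih⟩

/-- A linear functional of the values preserves graded symmetry. -/
theorem GradedSymmUpTo.map (L : M →ₗ[ℂ] N) {n : ℕ} : ∀ {F : Fn X M}, GradedSymmUpTo n F →
    GradedSymmUpTo n (fun m e => L (F m e)) := by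
  induction n with
  | zero => exact fun _ => trivial
  | succ n ih =>
    refine fun hF => ⟨fun h k => ?_, fun h => ih (hF.2 h)⟩
    funext m e
    have := congrFun (congrFun (hF.1 h k) m) e
    change L _ = psign _ • L _
    rw [← map_smul]
    exact congrArg L this

/-- The sign of the parity of the arguments. -/
def argSign (p : ZMod 2) (F : Fn X M) : Fn X M := fun n e => psign (p * tpar n e) • F n e

theorem ins_argSign (p : ZMod 2) (F : Fn X M) (h : HomField X) :
    ins h (argSign p F) = psign (p * h.par) • argSign p (ins h F) := by
  funext n e
  change psign (p * tpar (n + 1) (fcons h e)) • F _ _ = psign _ • psign _ • F _ _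
  rw [smul_smul, ← psign_add, ← mul_add, tpar_fcons]

theorem moveSign_last {n : ℕ} (p : ZMod 2) (e : Fin n → HomField X) :
    moveSign p (Fin.last n) e = psign (p * tpar n e) := by
  rw [tpar, Finset.mul_sum, psign_sum, moveSign]
  exact Finset.prod_congr rfl fun i _ => if_pos (Fin.castSucc_lt_last i)

/-- Moving an argument to the front. -/
theorem GradedSymm.insertNth {n : ℕ} : ∀ {F : Fn X M}, GradedSymm F → ∀ (j : Fin (n + 1))
    (h : HomField X) (e : Fin n → HomField X),
    F (n + 1) (j.insertNth (α := fun _ => HomField X) h e) =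
      moveSign h.par j e • F (n + 1) (fcons h e) := by
  induction n with
  | zero =>
    intro F hF j h e
    rw [Fin.eq_zero j, insertNth_zero_eq, moveSign_zero, one_smul]
  | succ n ih =>
    intro F hF j h e
    induction j using Fin.cases with
    | zero => rw [insertNth_zero_eq, moveSign_zero, one_smul]
    | succ j =>
      obtain ⟨k, e, rfl⟩ := exists_fcons e
      rw [insertNth_succ_eq, moveSign_succ]
      have h1 := congrFun (congrFun (hF.swap h k) n) e
      change BCOV.ins k F _ _ = _ • BCOV.ins k (BCOV.ins h F) n e
      rw [ih (hF.ins k), mul_comm, mul_smul]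
      exact congrArg _ h1

theorem GradedSymm.snoc {n : ℕ} {F : Fn X M} (hF : GradedSymm F) (h : HomField X)
    (e : Fin n → HomField X) : F (n + 1) (Fin.snoc (α := fun _ => HomField X) e h) =
      psign (h.par * tpar n e) • F (n + 1) (fcons h e) := by
  have h1 := hF.insertNth (Fin.last n) h e
  rwa [Fin.insertNth_last', moveSign_last] at h1

theorem koszul_one {n : ℕ} (e : Fin n → HomField X) : koszul 1 e = 1 := by
  refine Finset.prod_eq_one fun q hq => ?_
  have := (Finset.mem_filter.mp hq).2
  exact absurd this.1 this.2.le.not_gt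

theorem gradedSymm_of_comp_perm {F : Fn X M}
    (hF : ∀ (n : ℕ) (e : Fin n → HomField X) (σ : Equiv.Perm (Fin n)),
      F n (e ∘ σ) = koszul σ e • F n e) : GradedSymm F := by
  intro n
  induction n generalizing F with
  | zero => trivial
  | succ n ih =>
    refine ⟨fun h k => ?_, fun h => ih fun n e σ => ?_⟩
    · funext n e
      have h1 := hF (n + 2) (fcons h (fcons k e)) (permIns (Fin.succ 0) 1)
      rw [fcons_comp_permIns, koszul_permIns, Equiv.Perm.coe_one, Function.comp_id, moveSign_succ,
        koszul_one, moveSign_zero] at h1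
      rw [insertNth_succ_eq, insertNth_zero_eq, mul_one, mul_one] at h1
      change F (n + 2) (fcons k (fcons h e)) = psign _ • F (n + 2) (fcons h (fcons k e))
      rw [h1]
    · have h1 := hF (n + 1) (fcons h e) (permIns 0 σ)
      rwa [fcons_comp_permIns, koszul_permIns, moveSign_zero, insertNth_zero_eq, one_mul] at h1

theorem GradedSymm.comp_perm {n : ℕ} : ∀ {F : Fn X M}, GradedSymm F → ∀ (e : Fin n → HomField X)
    (σ : Equiv.Perm (Fin n)), F n (e ∘ σ) = koszul σ e • F n e := by
  induction n with
  | zero =>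
    intro F hF e σ
    rw [Subsingleton.elim σ 1, koszul_one, one_smul]
    rfl
  | succ n ih =>
    intro F hF e σ
    obtain ⟨⟨j, τ⟩, rfl⟩ := (permIns_bijective n).2 σ
    obtain ⟨h, e, rfl⟩ := exists_fcons e
    dsimp only
    rw [fcons_comp_permIns, hF.insertNth, koszul_permIns, mul_smul]
    exact congrArg _ (ih (hF.ins h) e τ)

/-! ### Shuffle products without further signs -/

theorem bshuffle_apply (B : M →ₗ[ℂ] N →ₗ[ℂ] P) (F : Fn X M) (G : Fn X N) (n : ℕ)
    (e : Fin n → HomField X) : bshuffle B F G n e = ∑ S : Finset (Fin n), shuffleSign S e •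
      B (F _ (subfamily S e)) (G _ (subfamily Sᶜ e)) := rfl

theorem bshuffle_add_left (B : M →ₗ[ℂ] N →ₗ[ℂ] P) (F F' : Fn X M) (G : Fn X N) :
    bshuffle B (F + F') G = bshuffle B F G + bshuffle B F' G := by
  funext n e
  simp only [bshuffle_apply, Pi.add_apply, map_add, LinearMap.add_apply, smul_add,
    Finset.sum_add_distrib]

theorem bshuffle_add_right (B : M →ₗ[ℂ] N →ₗ[ℂ] P) (F : Fn X M) (G G' : Fn X N) :
    bshuffle B F (G + G') = bshuffle B F G + bshuffle B F G' := by
  funext n e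
  simp only [bshuffle_apply, Pi.add_apply, map_add, smul_add, Finset.sum_add_distrib]

theorem bshuffle_smul_left (B : M →ₗ[ℂ] N →ₗ[ℂ] P) (F : Fn X M) (G : Fn X N) (s : ℂ) :
    bshuffle B (s • F) G = s • bshuffle B F G := by
  funext n e
  simp only [bshuffle_apply, Pi.smul_apply, map_smul, LinearMap.smul_apply, Finset.smul_sum]
  exact Finset.sum_congr rfl fun S _ => smul_comm _ _ _

theorem bshuffle_smul_right (B : M →ₗ[ℂ] N →ₗ[ℂ] P) (F : Fn X M) (G : Fn X N) (s : ℂ) :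
    bshuffle B F (s • G) = s • bshuffle B F G := by
  funext n e
  simp only [bshuffle_apply, Pi.smul_apply, map_smul, Finset.smul_sum]
  exact Finset.sum_congr rfl fun S _ => smul_comm _ _ _

theorem bshuffle_zero (B : M →ₗ[ℂ] N →ₗ[ℂ] P) (F : Fn X M) (G : Fn X N)
    (e : Fin 0 → HomField X) : bshuffle B F G 0 e = B (F 0 e) (G 0 e) :=
  shuffle_zero (fun _ _ x y => B x y) F G e

theorem ins_bshuffle (B : M →ₗ[ℂ] N →ₗ[ℂ] P) (F : Fn X M) (G : Fn X N) (h : HomField X) :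
    ins h (bshuffle B F G) = bshuffle B (ins h F) G + bshuffle B (argSign h.par F) (ins h G) := by
  rw [bshuffle, ins_shuffle]
  funext n e
  refine congrArg₂ (· + ·) rfl (Finset.sum_congr rfl fun S _ => congrArg _ ?_)
  dsimp only
  rw [argSign, map_smul, LinearMap.smul_apply]

theorem argSign_bshuffle (p : ZMod 2) (B : M →ₗ[ℂ] N →ₗ[ℂ] P) (F : Fn X M) (G : Fn X N) :
    argSign p (bshuffle B F G) = bshuffle B (argSign p F) (argSign p G) := by
  funext n e
  induction n generalizing F G with
  | zero =>
    rw [bshuffle_zero]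
    change psign _ • bshuffle B F G 0 e = B (psign _ • _) (psign _ • _)
    rw [bshuffle_zero, tpar_zero, mul_zero, psign_zero, one_smul, one_smul, one_smul]
  | succ n ih =>
    obtain ⟨h, e, rfl⟩ := exists_fcons e
    have h1 : argSign h.par (argSign p F) = argSign p (argSign h.par F) := by
      funext n e
      exact smul_comm _ _ _
    have h2 := congrFun (congrFun (ins_argSign p (bshuffle B F G) h) n) e
    have h3 := congrFun (congrFun (ins_bshuffle B (argSign p F) (argSign p G) h) n) e
    refine h2.trans (Eq.trans ?_ h3.symm)
    rw [ins_argSign, ins_argSign, h1, bshuffle_smul_left,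
      bshuffle_smul_right, ← smul_add]
    change psign _ • argSign p (ins h (bshuffle B F G)) n e = psign _ • (_ + _)
    rw [← ih, ← ih, ins_bshuffle]
    exact congrArg _ (smul_add _ _ _)

/-- Associativity of shuffle products. -/
theorem bshuffle_assoc {R S T : Type*} [AddCommGroup R] [Module ℂ R] [AddCommGroup S]
    [Module ℂ S] [AddCommGroup T] [Module ℂ T] (B₁ : M →ₗ[ℂ] S →ₗ[ℂ] T) (B₂ : N →ₗ[ℂ] P →ₗ[ℂ] S)
    (B₃ : R →ₗ[ℂ] P →ₗ[ℂ] T) (B₄ : M →ₗ[ℂ] N →ₗ[ℂ] R)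
    (hB : ∀ x y z, B₁ x (B₂ y z) = B₃ (B₄ x y) z) (F : Fn X M) (G : Fn X N) (H : Fn X P) :
    bshuffle B₁ F (bshuffle B₂ G H) = bshuffle B₃ (bshuffle B₄ F G) H := by
  funext n e
  induction n generalizing F G H with
  | zero =>
    rw [bshuffle_zero, bshuffle_zero, bshuffle_zero, bshuffle_zero, hB]
  | succ n ih =>
    obtain ⟨h, e, rfl⟩ := exists_fcons e
    change ins h (bshuffle B₁ F (bshuffle B₂ G H)) n e =
      ins h (bshuffle B₃ (bshuffle B₄ F G) H) n e
    rw [ins_bshuffle, ins_bshuffle, ins_bshuffle, ins_bshuffle, argSign_bshuffle,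
      bshuffle_add_left, bshuffle_add_right]
    simp only [Pi.add_apply, ih, add_assoc]

end Symmetric


/-! ### Pairings and the Poisson tensor -/

section Pairings

variable {X : Type*} [TopologicalSpace X] [ChartedSpace V X]

theorem toPV_injective {i : ℕ} : Function.Injective (toPV : PVc X i → PV X) :=
  Submodule.inclusion_injective _

/-- A polyvector field of degree `i` with compact support, as an element of `PVc X i`. -/
def PV.toC {i : ℕ} (a : PV X) (hd : a ∈ PV.deg X i) (hc : a ∈ PV.compact X) : PVc X i :=
  ⟨a.1, coe_mem_PVc hd hc⟩

/-- The parity involution of `PVc X i`. -/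
def invC {i : ℕ} : PVc X i →ₗ[ℂ] PVc X i where
  toFun a := PV.toC (parityInv (toPV a)) (parityInv_mem_deg (toPV_mem_deg a))
    (parityInv_mem_compact (toPV_mem_compact a))
  map_add' a b := toPV_injective (map_add (parityInv ∘ₗ toPV) a b)
  map_smul' s a := toPV_injective (map_smul (parityInv ∘ₗ toPV) s a)

theorem toPV_invC {i : ℕ} (a : PVc X i) : toPV (invC a) = parityInv (toPV a) := rfl

theorem HasParity.parityInv_eq {p : ZMod 2} {a : PV X} (h : HasParity p a.1) :
    parityInv a = psign p • a :=
  Subtype.ext (funext fun c => funext fun z => ginv_of_parity (h c z))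

theorem hasParity_of_parityInv {p : ZMod 2} {a : PV X} (h : parityInv a = psign p • a) :
    HasParity p a.1 := fun c z K hK =>
  parity_of_ginv (congrFun (congrFun (congrArg Subtype.val h) c) z) K hK

/-- The component `φ_a` of a field. -/
def Fields.phi (f : Fields X) (a : Fin 2) : PV X := toPV (f.1 a)

/-- The component `μ` of a field. -/
def Fields.mu (f : Fields X) : PV X := toPV f.2.1

/-- The component `ν` of a field. -/
def Fields.nu (f : Fields X) : PV X := toPV f.2.2

theorem HomField.parityInv_phi (h : HomField X) (a : Fin 2) :
    parityInv (Fields.phi h.val a) = psign h.par • Fields.phi h.val a :=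
  HasParity.parityInv_eq (h.phi_parity a)

theorem HomField.parityInv_mu (h : HomField X) :
    parityInv (Fields.mu h.val) = psign h.par • Fields.mu h.val :=
  HasParity.parityInv_eq h.mu_parity

theorem HomField.parityInv_nu (h : HomField X) :
    parityInv (Fields.nu h.val) = psign h.par • Fields.nu h.val :=
  HasParity.parityInv_eq h.nu_parity

/-- A field whose components are eigenvectors of the parity involution. -/
def HomField.mk' (p : ZMod 2) (f : Fields X)
    (h1 : ∀ a, parityInv (Fields.phi f a) = psign p • Fields.phi f a)
    (h2 : parityInv (Fields.mu f) = psign p • Fields.mu f)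
    (h3 : parityInv (Fields.nu f) = psign p • Fields.nu f) : HomField X where
  par := p
  val := f
  phi_parity a := hasParity_of_parityInv (h1 a)
  mu_parity := hasParity_of_parityInv h2
  nu_parity := hasParity_of_parityInv h3

theorem Fields.ext' {f g : Fields X} (h1 : ∀ a, Fields.phi f a = Fields.phi g a)
    (h2 : Fields.mu f = Fields.mu g) (h3 : Fields.nu f = Fields.nu g) : f = g :=
  Prod.ext (funext fun a => toPV_injective (h1 a))
    (Prod.ext (toPV_injective h2) (toPV_injective h3))

theorem parityInv_half (p : ZMod 2) {i : ℕ} (a : PVc X i) :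
    parityInv (toPV ((1 / 2 : ℂ) • (a + psign p • invC a))) =
      psign p • toPV ((1 / 2 : ℂ) • (a + psign p • invC a)) := by
  change parityInv ((1 / 2 : ℂ) • (toPV a + psign p • parityInv (toPV a))) =
    psign p • (1 / 2 : ℂ) • (toPV a + psign p • parityInv (toPV a))
  simp only [map_smul, map_add, parityInv_parityInv]
  rw [smul_comm (psign p), smul_add (psign p), smul_smul (psign p), psign_mul_self, one_smul,
    add_comm]

/-- The projection of a field to its part of parity `p`. -/
def Fields.part (p : ZMod 2) (f : Fields X) : HomField X :=
  HomField.mk' p (fun a => (1 / 2 : ℂ) • (f.1 a + psign p • invC (f.1 a)),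
    (1 / 2 : ℂ) • (f.2.1 + psign p • invC f.2.1), (1 / 2 : ℂ) • (f.2.2 + psign p • invC f.2.2))
    (fun _ => parityInv_half _ _) (parityInv_half _ _) (parityInv_half _ _)

theorem Fields.part_add_part (f : Fields X) :
    (Fields.part 0 f).val + (Fields.part 1 f).val = f := by
  have key : ∀ {i : ℕ} (a : PVc X i), (1 / 2 : ℂ) • (a + psign 0 • invC a) +
      (1 / 2 : ℂ) • (a + psign 1 • invC a) = a := by
    intro i a
    rw [psign_zero, psign_one]
    module
  exact Prod.ext (funext fun a => key _) (Prod.ext (key _) (key _))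

variable [T2Space X] [IsManifold 𝓘(ℂ, V) ω X]

/-- The operator `∂̄` on `PVc X i`. -/
def dbarC {i : ℕ} : PVc X i →ₗ[ℂ] PVc X i where
  toFun a := PV.toC (dbarL (toPV a)) (dbarL_mem_deg (toPV_mem_deg a))
    (dbarL_mem_compact (toPV_mem_compact a))
  map_add' a b := toPV_injective (map_add (dbarL ∘ₗ toPV) a b)
  map_smul' s a := toPV_injective (map_smul (dbarL ∘ₗ toPV) s a)

/-- The divergence operator from `PVc X (i + 1)` to `PVc X i`. -/
def divC (Ω : HolVolForm X) {i : ℕ} : PVc X (i + 1) →ₗ[ℂ] PVc X i where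
  toFun a := PV.toC (divL Ω (toPV a)) (divL_mem_deg Ω (toPV_mem_deg a))
    (divL_mem_compact Ω (toPV_mem_compact a))
  map_add' a b := toPV_injective (map_add (divL Ω ∘ₗ toPV) a b)
  map_smul' s a := toPV_injective (map_smul (divL Ω ∘ₗ toPV) s a)

theorem toPV_dbarC {i : ℕ} (a : PVc X i) : toPV (dbarC a) = dbarL (toPV a) := rfl

theorem toPV_divC (Ω : HolVolForm X) {i : ℕ} (a : PVc X (i + 1)) :
    toPV (divC Ω a) = divL Ω (toPV a) := rfl

theorem toPVc_of_mem {i : ℕ} {a : Sec X} (h : a ∈ PVc X i) : toPVc i a = ⟨a, h⟩ := dif_pos h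

theorem parityInv_divL (Ω : HolVolForm X) {p : ZMod 2} {a : PV X} (h : parityInv a = psign p • a) :
    parityInv (divL Ω a) = psign (p + 1) • divL Ω a := by
  have h1 := divL_parityInv Ω a
  rw [h, map_smul] at h1
  rw [psign_add, psign_one, mul_neg_one, neg_smul, h1, neg_neg]

theorem parityInv_dbarL {p : ZMod 2} {a : PV X} (h : parityInv a = psign p • a) :
    parityInv (dbarL a) = psign (p + 1) • dbarL a := by
  have h1 := dbarL_parityInv a
  rw [h, map_smul] at h1
  rw [psign_add, psign_one, mul_neg_one, neg_smul, h1, neg_neg]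

theorem Q_phi (Ω : HolVolForm X) (e : HomField X) (a : Fin 2) :
    Fields.phi (Q Ω e).val a = dbarL (Fields.phi e.val a) :=
  congrArg toPV (toPVc_of_mem (dbar_mem_PVc (e.val.1 a).2))

theorem Q_mu (Ω : HolVolForm X) (e : HomField X) :
    Fields.mu (Q Ω e).val = dbarL (Fields.mu e.val) :=
  congrArg toPV (toPVc_of_mem (dbar_mem_PVc e.val.2.1.2))

theorem Q_nu (Ω : HolVolForm X) (e : HomField X) :
    Fields.nu (Q Ω e).val = dbarL (Fields.nu e.val) + divL Ω (Fields.mu e.val) := by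
  change toPV (toPVc 0 _ + toPVc 0 _) = _
  rw [map_add]
  exact congrArg₂ (· + ·) (congrArg toPV (toPVc_of_mem (dbar_mem_PVc e.val.2.2.2)))
    (congrArg toPV (toPVc_of_mem (div_mem_PVc Ω e.val.2.1.2)))

theorem Q_Q (Ω : HolVolForm X) (e : HomField X) : (Q Ω (Q Ω e)).val = 0 := by
  refine Fields.ext' (fun a => ?_) ?_ ?_
  · rw [Q_phi, Q_phi, dbarL_dbarL]
    exact (map_zero toPV).symm
  · rw [Q_mu, Q_mu, dbarL_dbarL]
    exact (map_zero toPV).symm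
  · rw [Q_nu, Q_nu, Q_mu, map_add, dbarL_dbarL, dbarL_divL, zero_add, neg_add_cancel]
    exact (map_zero toPV).symm

theorem Q_par (Ω : HolVolForm X) (e : HomField X) : (Q Ω e).par = e.par + 1 := rfl

variable [MeasurableSpace X] [BorelSpace X] (Ω : HolVolForm X)

/-- `∫ η ∧ Ω` as a linear functional.  It is the trace of `Ω⁻¹ η`, so Stokes' theorem for the trace
is inherited. -/
def intL : PV X →ₗ[ℂ] ℂ := traceL Ω ∘ₗ LinearMap.mulLeft ℂ (invVol Ω)

theorem intL_apply (a : PV X) : intL Ω a = traceL Ω (invVol Ω * a) := rfl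

theorem intL_parityInv {a : PV X} (ha : a ∈ PV.compact X) :
    intL Ω (parityInv a) = -intL Ω a := by
  rw [intL_apply, intL_apply, ← traceL_parityInv Ω (PV.mul_mem_compact_right _ ha), parityInv_mul,
    parityInv_invVol, neg_mul, map_neg, neg_neg]

theorem intL_dbarL {a : PV X} (ha : a ∈ PV.compact X) : intL Ω (dbarL a) = 0 := by
  have h := traceL_dbarL Ω (PV.mul_mem_compact_right (invVol Ω) ha)
  rw [dbarL_mul, dbarL_invVol, zero_mul, zero_add, parityInv_invVol, neg_mul, map_neg,
    neg_eq_zero] at h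
  exact h

theorem intL_divL {a : PV X} (ha : a ∈ PV.compact X) : intL Ω (divL Ω a) = 0 := by
  have h := traceL_divL_mul Ω (a := parityInv (invVol Ω)) (Or.inr ha)
  rw [parityInv_parityInv, divL_parityInv, divL_invVol, map_zero, neg_zero, zero_mul,
    map_zero] at h
  exact h.symm

theorem traceL_eq_zero_of_parity {a : PV X} (ha : a ∈ PV.compact X) {p : ZMod 2} (hp : p ≠ 0)
    (h : parityInv a = psign p • a) : traceL Ω a = 0 := by
  have h1 := traceL_parityInv Ω ha
  rcases zmod_two_cases p with rfl | rfl
  · exact absurd rfl hp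
  · rw [h, psign_one, neg_one_smul, map_neg] at h1
    linear_combination (-1 / 2) * h1

theorem intL_eq_zero_of_parity {a : PV X} (ha : a ∈ PV.compact X) {p : ZMod 2} (hp : p ≠ 1)
    (h : parityInv a = psign p • a) : intL Ω a = 0 := by
  have h1 := intL_parityInv Ω ha
  rcases zmod_two_cases p with rfl | rfl
  · rw [h, psign_zero, one_smul] at h1
    linear_combination (1 / 2) * h1
  · exact absurd rfl hp

theorem Fields.phi_mem_compact (f : Fields X) (a : Fin 2) : Fields.phi f a ∈ PV.compact X :=
  toPV_mem_compact _

theorem Fields.mu_mem_compact (f : Fields X) : Fields.mu f ∈ PV.compact X := toPV_mem_compact _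

theorem Fields.nu_mem_compact (f : Fields X) : Fields.nu f ∈ PV.compact X := toPV_mem_compact _

theorem intOmega_wedge {i j : ℕ} (a : PVc X i) (b : PVc X j) :
    intOmega Ω (wedge a.1 b.1) = intL Ω (toPV a * toPV b) :=
  Eq.trans (by rw [PV.coe_mul, toPV_coe, toPV_coe])
    (intOmega_eq Ω (PV.mul_mem_compact_left (toPV_mem_compact a) (toPV b)))

theorem tr_wedge {i j : ℕ} (a : PVc X i) (b : PVc X j) :
    tr Ω (wedge a.1 b.1) = traceL Ω (toPV a * toPV b) :=
  Eq.trans (by rw [PV.coe_mul, toPV_coe, toPV_coe])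
    (tr_eq Ω (PV.mul_mem_compact_left (toPV_mem_compact a) (toPV b)))

theorem pairR_eq (u : DualFields X) (h : Fields X) : pairR Ω u h =
    intL Ω (toPV (u.1 0) * Fields.phi h 0) + intL Ω (toPV (u.1 1) * Fields.phi h 1) +
      traceL Ω (toPV u.2.1 * Fields.mu h) + traceL Ω (toPV u.2.2 * Fields.nu h) := by
  rw [pairR, Fin.sum_univ_two]
  exact congrArg₂ (· + ·) (congrArg₂ (· + ·) (congrArg₂ (· + ·) (intOmega_wedge Ω _ _)
    (intOmega_wedge Ω _ _)) (tr_wedge Ω _ _)) (tr_wedge Ω _ _)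

theorem pairL_eq (h : Fields X) (v : DualFields X) : pairL Ω h v =
    intL Ω (Fields.phi h 0 * toPV (v.1 0)) + intL Ω (Fields.phi h 1 * toPV (v.1 1)) +
      traceL Ω (Fields.mu h * toPV v.2.1) + traceL Ω (Fields.nu h * toPV v.2.2) := by
  rw [pairL, Fin.sum_univ_two]
  exact congrArg₂ (· + ·) (congrArg₂ (· + ·) (congrArg₂ (· + ·) (intOmega_wedge Ω _ _)
    (intOmega_wedge Ω _ _)) (tr_wedge Ω _ _)) (tr_wedge Ω _ _)

theorem omega_inv : omega⁻¹ = !![0, -1; 1, 0] := by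
  apply Matrix.inv_eq_left_inv
  rw [omega, Matrix.mul_fin_two, Matrix.one_fin_two]
  norm_num

theorem poissonTensor_eq (u v : DualFields X) : poissonTensor Ω u v =
    intL Ω (toPV (u.1 1) * toPV (v.1 0)) - intL Ω (toPV (u.1 0) * toPV (v.1 1)) +
      traceL Ω (divL Ω (toPV u.2.1) * toPV v.2.1) := by
  have h : tr Ω (wedge (div Ω (u.2.1 : Sec X)) (v.2.1 : Sec X)) =
      traceL Ω (divL Ω (toPV u.2.1) * toPV v.2.1) := by
    rw [← toPV_divC, ← tr_wedge]
    rfl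
  rw [poissonTensor, h, omega_inv]
  simp only [Fin.sum_univ_two, intOmega_wedge]
  simp
  ring

/-- The Poisson tensor as a bilinear map. -/
def poissonL : DualFields X →ₗ[ℂ] DualFields X →ₗ[ℂ] ℂ :=
by
  refine LinearMap.mk₂ ℂ (poissonTensor Ω) ?_ ?_ ?_ ?_ <;> intros <;> simp only [poissonTensor_eq,
    Prod.fst_add, Prod.snd_add, Prod.smul_fst, Prod.smul_snd, Pi.add_apply, Pi.smul_apply, map_add,
    map_smul, add_mul, mul_add, smul_mul_assoc, mul_smul_comm, smul_eq_mul] <;> ring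

theorem poissonL_apply (u v : DualFields X) : poissonL Ω u v = poissonTensor Ω u v := rfl

/-- The pairing of a field with a dual field as a bilinear map. -/
def pairLL : Fields X →ₗ[ℂ] DualFields X →ₗ[ℂ] ℂ :=
by
  refine LinearMap.mk₂ ℂ (pairL Ω) ?_ ?_ ?_ ?_ <;> intros <;> simp only [pairL_eq, Fields.phi, Fields.mu, Fields.nu,
    Prod.fst_add, Prod.snd_add, Prod.smul_fst, Prod.smul_snd, Pi.add_apply, Pi.smul_apply, map_add,
    map_smul, add_mul, mul_add, smul_mul_assoc, mul_smul_comm, smul_eq_mul] <;> ring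

/-- The pairing of a dual field with a field as a bilinear map. -/
def pairRL : DualFields X →ₗ[ℂ] Fields X →ₗ[ℂ] ℂ :=
by
  refine LinearMap.mk₂ ℂ (pairR Ω) ?_ ?_ ?_ ?_ <;> intros <;> simp only [pairR_eq, Fields.phi, Fields.mu, Fields.nu,
    Prod.fst_add, Prod.snd_add, Prod.smul_fst, Prod.smul_snd, Pi.add_apply, Pi.smul_apply, map_add,
    map_smul, add_mul, mul_add, smul_mul_assoc, mul_smul_comm, smul_eq_mul] <;> ring

theorem pairLL_apply (h : Fields X) (v : DualFields X) : pairLL Ω h v = pairL Ω h v := rfl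

theorem pairRL_apply (u : DualFields X) (h : Fields X) : pairRL Ω u h = pairR Ω u h := rfl

/-- The contraction of the Poisson tensor with a dual field on the right. -/
def sharpR (v : DualFields X) : Fields X :=
  (![-v.1 1, v.1 0], invC (divC Ω v.2.1), 0)

/-- The contraction of the Poisson tensor with a dual field on the left. -/
def sharpL (u : DualFields X) : Fields X :=
  (![u.1 1, -u.1 0], divC Ω u.2.1, 0)

theorem traceL_divL_mul' {a b : PV X} (h : a ∈ PV.compact X) :
    traceL Ω (divL Ω a * b) = traceL Ω (a * parityInv (divL Ω b)) := by
  rw [traceL_divL_mul Ω (Or.inl h), ← traceL_parityInv Ω (PV.mul_mem_compact_left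
    (parityInv_mem_compact h) _), parityInv_mul, parityInv_parityInv]

theorem poissonTensor_eq_pairR (u v : DualFields X) :
    poissonTensor Ω u v = pairR Ω u (sharpR Ω v) := by
  rw [poissonTensor_eq, pairR_eq, traceL_divL_mul' Ω (toPV_mem_compact u.2.1)]
  have h0 : Fields.phi (sharpR Ω v) 0 = -toPV (v.1 1) := map_neg toPV _
  have h1 : Fields.phi (sharpR Ω v) 1 = toPV (v.1 0) := rfl
  have h2 : Fields.mu (sharpR Ω v) = parityInv (divL Ω (toPV v.2.1)) := rfl
  have h3 : Fields.nu (sharpR Ω v) = 0 := map_zero toPV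
  rw [h0, h1, h2, h3, mul_neg, map_neg, mul_zero, map_zero]
  ring

theorem poissonTensor_eq_pairL (u v : DualFields X) :
    poissonTensor Ω u v = pairL Ω (sharpL Ω u) v := by
  rw [poissonTensor_eq, pairL_eq]
  have h0 : Fields.phi (sharpL Ω u) 0 = toPV (u.1 1) := rfl
  have h1 : Fields.phi (sharpL Ω u) 1 = -toPV (u.1 0) := map_neg toPV _
  have h2 : Fields.mu (sharpL Ω u) = divL Ω (toPV u.2.1) := rfl
  have h3 : Fields.nu (sharpL Ω u) = 0 := map_zero toPV
  rw [h0, h1, h2, h3, neg_mul, map_neg, zero_mul, map_zero]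
  ring

/-- The Poisson tensor only depends on the functional that a dual field represents. -/
theorem poissonTensor_congr_right {v v' : DualFields X}
    (h : ∀ k : HomField X, pairL Ω k.val v = pairL Ω k.val v') (u : DualFields X) :
    poissonTensor Ω u v = poissonTensor Ω u v' := by
  rw [poissonTensor_eq_pairL, poissonTensor_eq_pairL, ← Fields.part_add_part (sharpL Ω u),
    ← pairLL_apply, ← pairLL_apply, map_add, LinearMap.add_apply, LinearMap.add_apply]
  exact congrArg₂ (· + ·) (h _) (h _)

/-- The Poisson tensor only depends on the functional that a dual field represents. -/
theorem poissonTensor_congr_left {u u' : DualFields X}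
    (h : ∀ k : HomField X, pairR Ω u k.val = pairR Ω u' k.val) (v : DualFields X) :
    poissonTensor Ω u v = poissonTensor Ω u' v := by
  rw [poissonTensor_eq_pairR, poissonTensor_eq_pairR, ← Fields.part_add_part (sharpR Ω v),
    ← pairRL_apply, ← pairRL_apply, map_add, map_add]
  exact congrArg₂ (· + ·) (h _) (h _)

/-- The dual fields that pair non-trivially only with fields of parity `t`. -/
structure IsHomDual (t : ZMod 2) (v : DualFields X) : Prop where
  phi : ∀ a, parityInv (toPV (v.1 a)) = psign (t + 1) • toPV (v.1 a)
  mu : parityInv (toPV v.2.1) = psign t • toPV v.2.1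
  nu : parityInv (toPV v.2.2) = psign t • toPV v.2.2

/-- The projection of a dual field to the part that pairs only with fields of parity `t`. -/
def dualPart (t : ZMod 2) (v : DualFields X) : DualFields X :=
  (fun a => (1 / 2 : ℂ) • (v.1 a + psign (t + 1) • invC (v.1 a)),
    (1 / 2 : ℂ) • (v.2.1 + psign t • invC v.2.1), (1 / 2 : ℂ) • (v.2.2 + psign t • invC v.2.2))

theorem isHomDual_dualPart (t : ZMod 2) (v : DualFields X) : IsHomDual t (dualPart t v) :=
  ⟨fun _ => parityInv_half _ _, parityInv_half _ _, parityInv_half _ _⟩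

theorem traceL_mul_parityInv {a b : PV X} {s : ZMod 2} (ha : a ∈ PV.compact X)
    (h : parityInv a = psign s • a) : traceL Ω (a * parityInv b) = psign s * traceL Ω (a * b) := by
  rw [← traceL_parityInv Ω (PV.mul_mem_compact_left ha _), parityInv_mul, parityInv_parityInv, h,
    smul_mul_assoc, map_smul, smul_eq_mul]

theorem intL_mul_parityInv {a b : PV X} {s : ZMod 2} (ha : a ∈ PV.compact X)
    (h : parityInv a = psign s • a) : intL Ω (a * parityInv b) = -(psign s * intL Ω (a * b)) := by
  rw [← neg_neg (intL Ω (a * parityInv b)), ← intL_parityInv Ω (PV.mul_mem_compact_left ha _),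
    parityInv_mul, parityInv_parityInv, h, smul_mul_assoc, map_smul, smul_eq_mul]

theorem traceL_parityInv_mul {a b : PV X} {s : ZMod 2} (ha : a ∈ PV.compact X)
    (h : parityInv a = psign s • a) : traceL Ω (parityInv b * a) = psign s * traceL Ω (b * a) := by
  rw [← traceL_parityInv Ω (PV.mul_mem_compact_right _ ha), parityInv_mul, parityInv_parityInv, h,
    mul_smul_comm, map_smul, smul_eq_mul]

theorem intL_parityInv_mul {a b : PV X} {s : ZMod 2} (ha : a ∈ PV.compact X)
    (h : parityInv a = psign s • a) : intL Ω (parityInv b * a) = -(psign s * intL Ω (b * a)) := by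
  rw [← neg_neg (intL Ω (parityInv b * a)), ← intL_parityInv Ω (PV.mul_mem_compact_right _ ha),
    parityInv_mul, parityInv_parityInv, h, mul_smul_comm, map_smul, smul_eq_mul]

theorem pairR_dualPart (t : ZMod 2) (v : DualFields X) (h : HomField X) :
    pairR Ω (dualPart t v) h.val = if h.par = t then pairR Ω v h.val else 0 := by
  have key : pairR Ω (dualPart t v) h.val =
      (1 / 2) * (1 + psign t * psign h.par) * pairR Ω v h.val := by
    rw [pairR_eq, pairR_eq]
    simp only [dualPart, map_smul, map_add, smul_mul_assoc, add_mul, toPV_invC, smul_eq_mul]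
    rw [intL_parityInv_mul Ω (Fields.phi_mem_compact _ _) (h.parityInv_phi 0),
      intL_parityInv_mul Ω (Fields.phi_mem_compact _ _) (h.parityInv_phi 1),
      traceL_parityInv_mul Ω (Fields.mu_mem_compact _) h.parityInv_mu,
      traceL_parityInv_mul Ω (Fields.nu_mem_compact _) h.parityInv_nu, psign_add, psign_one]
    ring
  rw [key]
  rcases zmod_two_cases t with rfl | rfl <;> rcases zmod_two_cases h.par with h0 | h0 <;>
    simp [h0, psign_zero, psign_one] <;> norm_num

theorem pairL_dualPart (t : ZMod 2) (v : DualFields X) (h : HomField X) :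
    pairL Ω h.val (dualPart t v) = if h.par = t then pairL Ω h.val v else 0 := by
  have key : pairL Ω h.val (dualPart t v) =
      (1 / 2) * (1 + psign t * psign h.par) * pairL Ω h.val v := by
    rw [pairL_eq, pairL_eq]
    simp only [dualPart, map_smul, map_add, mul_smul_comm, mul_add, toPV_invC, smul_eq_mul]
    rw [intL_mul_parityInv Ω (Fields.phi_mem_compact _ _) (h.parityInv_phi 0),
      intL_mul_parityInv Ω (Fields.phi_mem_compact _ _) (h.parityInv_phi 1),
      traceL_mul_parityInv Ω (Fields.mu_mem_compact _) h.parityInv_mu,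
      traceL_mul_parityInv Ω (Fields.nu_mem_compact _) h.parityInv_nu, psign_add, psign_one]
    ring
  rw [key]
  rcases zmod_two_cases t with rfl | rfl <;> rcases zmod_two_cases h.par with h0 | h0 <;>
    simp [h0, psign_zero, psign_one] <;> norm_num

/-- The dual field that represents, on the right of a field, the same functional as `v` does on the
left, and vice versa. -/
def flipDual (t : ZMod 2) (v : DualFields X) : DualFields X :=
  (v.1, psign t • v.2.1, psign t • v.2.2)

theorem PV.mul_comm_parity {p q : ZMod 2} {a b : PV X} (ha : parityInv a = psign p • a)
    (hb : parityInv b = psign q • b) : a * b = psign (p * q) • (b * a) := by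
  rw [PV.mul_comm_of_parity p a b ha]
  rcases zmod_two_cases p with rfl | rfl
  · rw [zero_mul, psign_zero, one_smul]
    rfl
  · change parityInv b * a = _
    rw [hb, one_mul, smul_mul_assoc]

theorem traceL_mul_eq_zero {p q : ZMod 2} {a b : PV X} (hc : a ∈ PV.compact X)
    (ha : parityInv a = psign p • a) (hb : parityInv b = psign q • b) (h : p ≠ q) :
    traceL Ω (a * b) = 0 := by
  refine traceL_eq_zero_of_parity Ω (PV.mul_mem_compact_left hc b) (p := p + q)
    (fun h0 => h ((by decide : ∀ p q : ZMod 2, p + q = 0 → p = q) p q h0)) ?_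
  rw [parityInv_mul, ha, hb, smul_mul_smul_comm, psign_add]

theorem intL_mul_eq_zero {p q : ZMod 2} {a b : PV X} (hc : a ∈ PV.compact X)
    (ha : parityInv a = psign p • a) (hb : parityInv b = psign q • b) (h : p = q) :
    intL Ω (a * b) = 0 := by
  subst h
  refine intL_eq_zero_of_parity Ω (PV.mul_mem_compact_left hc b) (p := 0) zero_ne_one ?_
  rw [parityInv_mul, ha, hb, smul_mul_smul_comm, psign_mul_self, psign_zero]

theorem zmod_two_ne {p q : ZMod 2} (h : p ≠ q) : p = q + 1 := by
  revert p q
  decide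

theorem pairL_eq_zero {t : ZMod 2} {v : DualFields X} (hv : IsHomDual t v) {h : HomField X}
    (hh : h.par ≠ t) : pairL Ω h.val v = 0 := by
  have h1 := zmod_two_ne hh
  rw [pairL_eq, intL_mul_eq_zero Ω (Fields.phi_mem_compact _ _) (h.parityInv_phi 0) (hv.phi 0) h1,
    intL_mul_eq_zero Ω (Fields.phi_mem_compact _ _) (h.parityInv_phi 1) (hv.phi 1) h1,
    traceL_mul_eq_zero Ω (Fields.mu_mem_compact _) h.parityInv_mu hv.mu hh,
    traceL_mul_eq_zero Ω (Fields.nu_mem_compact _) h.parityInv_nu hv.nu hh]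
  ring

theorem parityInv_toPV_smul {i : ℕ} {a : PVc X i} {p : ZMod 2}
    (h : parityInv (toPV a) = psign p • toPV a) (s : ℂ) :
    parityInv (toPV (s • a)) = psign p • toPV (s • a) := by
  rw [map_smul, map_smul, h, smul_comm]

theorem isHomDual_flipDual {t : ZMod 2} {v : DualFields X} (hv : IsHomDual t v) :
    IsHomDual t (flipDual t v) :=
  ⟨hv.phi, parityInv_toPV_smul hv.mu _, parityInv_toPV_smul hv.nu _⟩

theorem pairR_flipDual {t : ZMod 2} {v : DualFields X} (hv : IsHomDual t v) (h : HomField X) :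
    pairR Ω (flipDual t v) h.val = pairL Ω h.val v := by
  by_cases hh : h.par = t
  · have e1 : ∀ a, toPV (v.1 a) * Fields.phi h.val a = Fields.phi h.val a * toPV (v.1 a) := by
      intro a
      rw [PV.mul_comm_parity (hv.phi a) (h.parityInv_phi a), hh]
      have : (t + 1) * t = 0 := by rcases zmod_two_cases t with rfl | rfl <;> rfl
      rw [this, psign_zero, one_smul]
    have ht : t * t = t := by rcases zmod_two_cases t with rfl | rfl <;> rfl
    have e2 : toPV (psign t • v.2.1) * Fields.mu h.val = Fields.mu h.val * toPV v.2.1 := by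
      rw [map_smul, smul_mul_assoc, PV.mul_comm_parity hv.mu h.parityInv_mu, hh, smul_smul, ht,
        psign_mul_self, one_smul]
    have e3 : toPV (psign t • v.2.2) * Fields.nu h.val = Fields.nu h.val * toPV v.2.2 := by
      rw [map_smul, smul_mul_assoc, PV.mul_comm_parity hv.nu h.parityInv_nu, hh, smul_smul, ht,
        psign_mul_self, one_smul]
    rw [pairR_eq, pairL_eq, ← e1, ← e1, ← e2, ← e3]
    rfl
  · have hw := isHomDual_flipDual hv
    have h2 := zmod_two_ne hh
    have hne := fun h => hh (Eq.symm h)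
    rw [pairL_eq_zero Ω hv hh, pairR_eq,
      intL_mul_eq_zero Ω (toPV_mem_compact _) (hw.phi 0) (h.parityInv_phi 0) h2.symm,
      intL_mul_eq_zero Ω (toPV_mem_compact _) (hw.phi 1) (h.parityInv_phi 1) h2.symm,
      traceL_mul_eq_zero Ω (toPV_mem_compact _) hw.mu h.parityInv_mu hne,
      traceL_mul_eq_zero Ω (toPV_mem_compact _) hw.nu h.parityInv_nu hne]
    ring

theorem flipDual_flipDual (t : ZMod 2) (v : DualFields X) : flipDual t (flipDual t v) = v := by
  change (v.1, psign t • psign t • v.2.1, psign t • psign t • v.2.2) = v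
  rw [smul_smul, smul_smul, psign_mul_self, one_smul, one_smul]

theorem pairL_flipDual {t : ZMod 2} {v : DualFields X} (hv : IsHomDual t v) (h : HomField X) :
    pairL Ω h.val (flipDual t v) = pairR Ω v h.val := by
  rw [← pairR_flipDual Ω (isHomDual_flipDual hv), flipDual_flipDual]

theorem pairR_eq_zero {t : ZMod 2} {v : DualFields X} (hv : IsHomDual t v) {h : HomField X}
    (hh : h.par ≠ t) : pairR Ω v h.val = 0 := by
  rw [← pairL_flipDual Ω hv, pairL_eq_zero Ω (isHomDual_flipDual hv) hh]

/-- The Hamiltonian field of a homogeneous dual field. -/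
def hamField (t : ZMod 2) (v : DualFields X) (hv : IsHomDual t v) : HomField X :=
  HomField.mk' (t + 1) (sharpR Ω v)
    (fun a => by
      fin_cases a
      · change parityInv (toPV (-v.1 1)) = _ • toPV (-v.1 1)
        rw [map_neg, map_neg, hv.phi, smul_neg]
      · exact hv.phi 0)
    (by
      change parityInv (parityInv (divL Ω (toPV v.2.1))) = _ • parityInv (divL Ω (toPV v.2.1))
      rw [parityInv_divL Ω hv.mu, map_smul, parityInv_divL Ω hv.mu])
    (by
      change parityInv (toPV 0) = _ • toPV 0
      rw [map_zero, map_zero, smul_zero])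

theorem hamField_val (t : ZMod 2) (v : DualFields X) (hv : IsHomDual t v) :
    (hamField Ω t v hv).val = sharpR Ω v := rfl

theorem sharpL_flipDual {t : ZMod 2} {v : DualFields X} (hv : IsHomDual t v) :
    sharpL Ω (flipDual t v) = -sharpR Ω v := by
  refine Fields.ext' (fun a => ?_) ?_ ?_
  · fin_cases a
    · change toPV (v.1 1) = toPV (-(-v.1 1))
      rw [neg_neg]
    · rfl
  · change divL Ω (toPV (psign t • v.2.1)) = -parityInv (divL Ω (toPV v.2.1))
    rw [map_smul, map_smul, ← map_smul, ← hv.mu, divL_parityInv]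
  · change toPV 0 = toPV (-0)
    rw [neg_zero]

theorem poissonTensor_eq_zero {s t : ZMod 2} {u v : DualFields X} (hu : IsHomDual s u)
    (hv : IsHomDual t v) (h : s ≠ t + 1) : poissonTensor Ω u v = 0 := by
  rw [poissonTensor_eq_pairR, ← hamField_val Ω t v hv]
  exact pairR_eq_zero Ω hu fun h0 => h h0.symm

theorem IsHomDual.smul {t : ZMod 2} {v : DualFields X} (hv : IsHomDual t v) (s : ℂ) :
    IsHomDual t (s • v) := ⟨fun a => parityInv_toPV_smul (hv.phi a) s,
  parityInv_toPV_smul hv.mu s, parityInv_toPV_smul hv.nu s⟩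

end Pairings


/-! ### The Poisson bracket of functionals -/

section Bracket

variable {X : Type*} [TopologicalSpace X] [ChartedSpace V X] [T2Space X] [IsManifold 𝓘(ℂ, V) ω X]
  [MeasurableSpace X] [BorelSpace X] (Ω : HolVolForm X)

/-- Functionals of parity `p`, with left derivatives instead of right derivatives, and with graded
symmetry expressed through neighbours. -/
structure IsFun (p : ZMod 2) (F : PreFunctional X) : Prop where
  symm : GradedSymm F
  parity : ∀ n e, F n e ≠ 0 → tpar n e = p
  deriv : ∀ n e, ∃ v : DualFields X, ∀ h : HomField X, ins h F n e = pairL Ω h.val v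

variable {Ω} {p q r : ZMod 2} {F F' G G' H : PreFunctional X}

theorem zmod_two_add_eq {a b c : ZMod 2} : a + b = c ↔ a = c + b := by
  constructor
  · rintro rfl
    rw [add_assoc, CharTwo.add_self_eq_zero, add_zero]
  · rintro rfl
    rw [add_assoc, CharTwo.add_self_eq_zero, add_zero]

theorem IsFun.exists_homDual (hF : IsFun Ω p F) (n : ℕ)
    (e : Fin n → HomField X) : ∃ v : DualFields X, IsHomDual (p + tpar n e) v ∧
      ∀ h : HomField X, ins h F n e = pairL Ω h.val v := by
  obtain ⟨v, hv⟩ := hF.deriv n e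
  refine ⟨dualPart (p + tpar n e) v, isHomDual_dualPart _ v, fun h => ?_⟩
  rw [pairL_dualPart, ← hv]
  split_ifs with h0
  · rfl
  · by_contra h1
    have h2 := hF.parity _ _ h1
    rw [tpar_fcons] at h2
    exact h0 (zmod_two_add_eq.mp h2)

/-- The homogeneous dual field that represents the left derivative. -/
def IsFun.dual (hF : IsFun Ω p F) : Fn X (DualFields X) :=
  fun n e => (hF.exists_homDual n e).choose

theorem IsFun.isHomDual (hF : IsFun Ω p F) (n : ℕ)
    (e : Fin n → HomField X) : IsHomDual (p + tpar n e) (hF.dual n e) :=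
  (hF.exists_homDual n e).choose_spec.1

theorem IsFun.ins_eq (hF : IsFun Ω p F) (h : HomField X) (n : ℕ)
    (e : Fin n → HomField X) : BCOV.ins h F n e = pairL Ω h.val (hF.dual n e) :=
  (hF.exists_homDual n e).choose_spec.2 h

/-- The homogeneous dual field that represents the right derivative. -/
def IsFun.dualR (hF : IsFun Ω p F) : Fn X (DualFields X) :=
  fun n e => psign ((p + tpar n e) * tpar n e) • flipDual (p + tpar n e) (hF.dual n e)

theorem IsFun.isHomDual_dualR (hF : IsFun Ω p F) (n : ℕ)
    (e : Fin n → HomField X) : IsHomDual (p + tpar n e) (hF.dualR n e) :=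
  (isHomDual_flipDual (hF.isHomDual n e)).smul _

theorem IsFun.snoc_eq (hF : IsFun Ω p F) (h : HomField X) (n : ℕ)
    (e : Fin n → HomField X) : F (n + 1) (Fin.snoc (α := fun _ => HomField X) e h) =
      pairR Ω (hF.dualR n e) h.val := by
  rw [IsFun.dualR, ← pairRL_apply, map_smul, LinearMap.smul_apply, pairRL_apply,
    pairR_flipDual Ω (hF.isHomDual n e), hF.symm.snoc, ← hF.ins_eq, ins_apply]
  by_cases h0 : F (n + 1) (fcons h e) = 0
  · rw [h0, smul_zero, smul_zero]
  · have h2 := hF.parity _ _ h0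
    rw [tpar_fcons, zmod_two_add_eq] at h2
    rw [h2]

theorem IsFun.isFunctional (hF : IsFun Ω p F) :
    IsFunctional Ω p F where
  multilinear n e i s a b c ha hb hc := by
    cases n with
    | zero => exact i.elim0
    | succ n =>
      have h1 : ∀ x : HomField X, F (n + 1) (Function.update e i x) =
          moveSign x.par i (i.removeNth e) * pairL Ω x.val (hF.dual n (i.removeNth e)) := by
        intro x
        rw [← Fin.insertNth_removeNth, hF.symm.insertNth, ← hF.ins_eq]
        rfl
      rw [h1, h1, h1, ha, hb, hc, ← pairLL_apply, ← pairLL_apply, ← pairLL_apply, map_add,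
        map_smul, LinearMap.add_apply, LinearMap.smul_apply, smul_eq_mul]
      ring
  symmetric n e σ := hF.symm.comp_perm e σ
  parity := hF.parity
  smooth_derivative n e := ⟨hF.dualR n e, fun h => hF.snoc_eq h n e⟩

theorem IsFunctional.isFun (hF : IsFunctional Ω p F) :
    IsFun Ω p F where
  symm := gradedSymm_of_comp_perm hF.symmetric
  parity := hF.parity
  deriv n e := by
    obtain ⟨u, hu⟩ := hF.smooth_derivative n e
    refine ⟨psign ((p + tpar n e) * tpar n e) • flipDual (p + tpar n e) (dualPart (p + tpar n e) u),
      fun h => ?_⟩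
    have hs : F (n + 1) (fcons h e) = psign (h.par * tpar n e) •
        F (n + 1) (Fin.snoc (α := fun _ => HomField X) e h) := by
      rw [(gradedSymm_of_comp_perm hF.symmetric).snoc, smul_smul, psign_mul_self, one_smul]
    rw [← pairLL_apply, map_smul, pairLL_apply, pairL_flipDual Ω (isHomDual_dualPart _ u),
      pairR_dualPart, ← hu, ins_apply]
    split_ifs with h0
    · rw [hs, h0]
    · rw [smul_zero]
      by_contra h1
      have h2 := hF.parity _ _ h1
      change tpar _ _ = _ at h2
      rw [tpar_fcons] at h2
      exact h0 (zmod_two_add_eq.mp h2)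

theorem isFun_iff : IsFun Ω p F ↔ IsFunctional Ω p F :=
  ⟨IsFun.isFunctional, IsFunctional.isFun⟩

theorem IsFun.add (hF : IsFun Ω p F) (hG : IsFun Ω p G) :
    IsFun Ω p (F + G) where
  symm n := (hF.symm n).add (hG.symm n)
  parity n e h := by
    by_contra h0
    refine h ?_
    have h1 : F n e = 0 := by_contra fun h => h0 (hF.parity n e h)
    have h2 : G n e = 0 := by_contra fun h => h0 (hG.parity n e h)
    change F n e + G n e = 0
    rw [h1, h2, add_zero]
  deriv n e := ⟨hF.dual n e + hG.dual n e, fun h => by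
    rw [← pairLL_apply, map_add, pairLL_apply, pairLL_apply, ← hF.ins_eq, ← hG.ins_eq]
    rfl⟩

theorem IsFun.smul (hF : IsFun Ω p F) (s : ℂ) :
    IsFun Ω p (s • F) where
  symm n := (hF.symm n).smul s
  parity n e h := hF.parity n e fun h0 => h (by
    change s • F n e = 0
    rw [h0, smul_zero])
  deriv n e := ⟨s • hF.dual n e, fun h => by
    rw [← pairLL_apply, map_smul, pairLL_apply, ← hF.ins_eq]
    rfl⟩

theorem IsFun.zero (p : ZMod 2) : IsFun Ω p (0 : PreFunctional X) where
  symm n := gradedSymmUpTo_zero n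
  parity n e h := absurd rfl h
  deriv n e := ⟨0, fun h => by
    rw [← pairLL_apply, map_zero]
    rfl⟩

theorem IsFun.ins_ins_eq (hF : IsFun Ω p F) (h k : HomField X) (n : ℕ) (e : Fin n → HomField X) :
    BCOV.ins k (BCOV.ins h F) n e = pairL Ω k.val
      (psign (h.par * (p + h.par + tpar n e)) • hF.dual (n + 1) (fcons h e)) := by
  rw [← pairLL_apply, map_smul, pairLL_apply, ← hF.ins_eq]
  refine (congrFun (congrFun (hF.symm.swap k h) n) e).trans ?_
  change psign _ • F (n + 2) (fcons k (fcons h e)) = psign _ • F (n + 2) (fcons k (fcons h e))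
  by_cases h0 : F (n + 2) (fcons k (fcons h e)) = 0
  · rw [h0, smul_zero, smul_zero]
  · have h3 := hF.parity _ _ h0
    rw [tpar_fcons, tpar_fcons] at h3
    have h4 : p + h.par + tpar n e = k.par := by
      rw [← h3]
      linear_combination (h.par + tpar n e) * (CharTwo.two_eq_zero : (2 : ZMod 2) = 0)
    rw [h4, mul_comm]

theorem IsFun.ins (hF : IsFun Ω p F) (h : HomField X) : IsFun Ω (p + h.par) (ins h F) where
  symm := hF.symm.ins h
  parity n e h0 := by
    have := hF.parity (n + 1) (fcons h e) h0
    rwa [tpar_fcons, add_comm, zmod_two_add_eq] at this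
  deriv n e := ⟨_, fun k => hF.ins_ins_eq h k n e⟩

/-- The Poisson bracket can be computed from any dual fields that represent the derivatives. -/
theorem bracket_eq (U V : Fn X (DualFields X))
    (hU : ∀ n e h, F (n + 1) (Fin.snoc (α := fun _ => HomField X) e h) =
      pairR Ω (U n e) (HomField.val h))
    (hV : ∀ n e h, BCOV.ins h G n e = pairL Ω (HomField.val h) (V n e)) :
    bracket Ω F G = bshuffle (poissonL Ω) U V := by
  have h1 : ∀ n e h, pairR Ω (rightDeriv (m := n) Ω F e) (HomField.val h) =
      pairR Ω (U n e) h.val := by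
    intro n e h
    have H : ∃ u : DualFields X, ∀ h : HomField X,
      F (n + 1) (Fin.snoc (α := fun _ => HomField X) e h) = pairR Ω u h.val := ⟨U n e, hU n e⟩
    rw [rightDeriv, dif_pos H, ← hU, ← H.choose_spec]
  have h2 : ∀ n e h, pairL Ω (HomField.val h) (leftDeriv (m := n) Ω G e) =
      pairL Ω h.val (V n e) := by
    intro n e h
    have H : ∃ v : DualFields X, ∀ h : HomField X,
      G (n + 1) (Fin.cons (α := fun _ => HomField X) h e) = pairL Ω h.val v := ⟨V n e, hV n e⟩
    rw [leftDeriv, dif_pos H, ← hV, ← H.choose_spec]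
    rfl
  funext n e
  refine Finset.sum_congr rfl fun S _ => ?_
  rw [poissonTensor_congr_left Ω (h1 _ _), poissonTensor_congr_right Ω (h2 _ _)]
  rfl

theorem IsFun.bracket_eq (hF : IsFun Ω p F)
    (hG : IsFun Ω q G) : bracket Ω F G = bshuffle (poissonL Ω) hF.dualR hG.dual :=
  BCOV.bracket_eq _ _ (fun n e h => hF.snoc_eq h n e) fun n e h => hG.ins_eq h n e

theorem bracket_add_left (hF : IsFun Ω p F)
    (hF' : IsFun Ω p F') (hG : IsFun Ω q G) :
    bracket Ω (F + F') G = bracket Ω F G + bracket Ω F' G := by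
  rw [hF.bracket_eq hG, hF'.bracket_eq hG, ← bshuffle_add_left]
  refine BCOV.bracket_eq _ _ (fun n e h => ?_) fun n e h => hG.ins_eq h n e
  change F _ _ + F' _ _ = pairR Ω (hF.dualR n e + hF'.dualR n e) h.val
  rw [hF.snoc_eq, hF'.snoc_eq]
  exact (LinearMap.map_add₂ (pairRL Ω) _ _ _).symm

theorem bracket_smul_left (hF : IsFun Ω p F)
    (hG : IsFun Ω q G) (s : ℂ) : bracket Ω (s • F) G = s • bracket Ω F G := by
  rw [hF.bracket_eq hG, ← bshuffle_smul_left]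
  refine BCOV.bracket_eq _ _ (fun n e h => ?_) fun n e h => hG.ins_eq h n e
  change s • F _ _ = pairR Ω (s • hF.dualR n e) h.val
  rw [hF.snoc_eq]
  exact (LinearMap.map_smul₂ (pairRL Ω) _ _ _).symm

theorem bracket_add_right (hF : IsFun Ω p F)
    (hG : IsFun Ω q G) (hG' : IsFun Ω q G') :
    bracket Ω F (G + G') = bracket Ω F G + bracket Ω F G' := by
  rw [hF.bracket_eq hG, hF.bracket_eq hG', ← bshuffle_add_right]
  refine BCOV.bracket_eq _ _ (fun n e h => hF.snoc_eq h n e) fun n e h => ?_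
  change BCOV.ins h G n e + BCOV.ins h G' n e = pairL Ω h.val (hG.dual n e + hG'.dual n e)
  rw [hG.ins_eq, hG'.ins_eq]
  exact (map_add (pairLL Ω h.val) _ _).symm

theorem bracket_smul_right (hF : IsFun Ω p F)
    (hG : IsFun Ω q G) (s : ℂ) : bracket Ω F (s • G) = s • bracket Ω F G := by
  rw [hF.bracket_eq hG, ← bshuffle_smul_right]
  refine BCOV.bracket_eq _ _ (fun n e h => hF.snoc_eq h n e) fun n e h => ?_
  change s • BCOV.ins h G n e = pairL Ω h.val (s • hG.dual n e)
  rw [hG.ins_eq]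
  exact (map_smul (pairLL Ω h.val) _ _).symm

/-- The insertion of a field is a derivation of the Poisson bracket. -/
theorem ins_bracket (hF : IsFun Ω p F) (hG : IsFun Ω q G)
    (h : HomField X) : ins h (bracket Ω F G) =
      bracket Ω (ins h F) G + psign (h.par * (p + 1)) • bracket Ω F (ins h G) := by
  have h1 : bracket Ω (BCOV.ins h F) G = bshuffle (poissonL Ω) (BCOV.ins h hF.dualR) hG.dual := by
    refine BCOV.bracket_eq _ _ (fun n e k => ?_) fun n e k => hG.ins_eq k n e
    change F (n + 2) (Fin.cons (α := fun _ => HomField X) h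
      (Fin.snoc (α := fun _ => HomField X) e k)) = pairR Ω (hF.dualR (n + 1) (fcons h e)) k.val
    rw [Fin.cons_snoc_eq_snoc_cons, hF.snoc_eq]
  have h2 : bracket Ω F (BCOV.ins h G) = bshuffle (poissonL Ω) hF.dualR
      (fun n e => psign (h.par * (q + h.par + tpar n e)) • BCOV.ins h hG.dual n e) :=
    BCOV.bracket_eq _ _ (fun n e k => hF.snoc_eq k n e) fun n e k => hG.ins_ins_eq h k n e
  rw [hF.bracket_eq hG, ins_bshuffle, h1, h2]
  refine congrArg₂ (· + ·) rfl (funext fun n => funext fun e => ?_)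
  rw [Pi.smul_apply, Pi.smul_apply, bshuffle_apply, bshuffle_apply, Finset.smul_sum]
  refine Finset.sum_congr rfl fun S _ => ?_
  rw [smul_comm _ (shuffleSign S e)]
  refine congrArg _ ?_
  generalize subfamily S e = f
  generalize subfamily Sᶜ e = f'
  change poissonL Ω (psign (h.par * tpar _ f) • hF.dualR _ f) (hG.dual _ (fcons h f')) =
    psign _ • poissonL Ω (hF.dualR _ f) (psign _ • hG.dual _ (fcons h f'))
  rw [map_smul, LinearMap.smul_apply, map_smul, smul_smul, poissonL_apply]
  by_cases h0 : p + tpar _ f = q + tpar _ (fcons h f') + 1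
  · rw [← psign_add]
    congr 2
    rw [tpar_fcons] at h0
    linear_combination h.par * h0 - (h.par * p) * (CharTwo.two_eq_zero : (2 : ZMod 2) = 0)
  · rw [poissonTensor_eq_zero Ω (hF.isHomDual_dualR _ _) (hG.isHomDual _ _) h0, smul_zero, smul_zero]

/-- The Hamiltonian field of the first Taylor component. -/
def IsFun.ham (hF : IsFun Ω p F) : HomField X :=
  hamField Ω (p + tpar 0 Fin.elim0) (hF.dual 0 Fin.elim0) (hF.isHomDual 0 Fin.elim0)

theorem IsFun.ham_par (hF : IsFun Ω p F) :
    hF.ham.par = p + 1 := by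
  change p + 0 + 1 = p + 1
  rw [add_zero]

theorem bracket_zero_right (hF : IsFun Ω p F)
    (hG : IsFun Ω q G) (e : Fin 0 → HomField X) :
    bracket Ω G F 0 e = ins hF.ham G 0 e := by
  obtain rfl : e = Fin.elim0 := Subsingleton.elim _ _
  rw [hG.bracket_eq hF, bshuffle_zero, poissonL_apply, poissonTensor_eq_pairR]
  change pairR Ω _ hF.ham.val = _
  rw [← hG.snoc_eq]
  exact congrArg (G 1) (funext fun i => by rw [Fin.fin_one_eq_zero i]; rfl)

theorem bracket_zero_left (hF : IsFun Ω p F)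
    (hG : IsFun Ω q G) (e : Fin 0 → HomField X) :
    bracket Ω F G 0 e = -ins hF.ham G 0 e := by
  obtain rfl : e = Fin.elim0 := Subsingleton.elim _ _
  rw [hF.bracket_eq hG, bshuffle_zero, poissonL_apply, hG.ins_eq, IsFun.dualR]
  change poissonTensor Ω (psign ((p + 0) * 0) • _) _ = _
  rw [mul_zero, psign_zero, one_smul, poissonTensor_eq_pairL, sharpL_flipDual Ω (hF.isHomDual 0 _),
    ← pairLL_apply, map_neg]
  rfl

end Bracket


/-! ### The dg Lie algebra of functionals -/

section DGLie

variable {X : Type*} [TopologicalSpace X] [ChartedSpace V X] [T2Space X] [IsManifold 𝓘(ℂ, V) ω X]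
  [MeasurableSpace X] [BorelSpace X] {Ω : HolVolForm X} {p q r : ZMod 2}
  {F G H : PreFunctional X}

theorem psign_smul_pairL {t : ZMod 2} {v : DualFields X} (hv : IsHomDual t v) (c : ZMod 2)
    (h : HomField X) :
    psign (c * h.par) * pairL Ω h.val v = pairL Ω h.val (psign (c * t) • v) := by
  rw [← pairLL_apply, ← pairLL_apply, map_smul, smul_eq_mul, pairLL_apply]
  by_cases hh : h.par = t
  · rw [hh]
  · rw [pairL_eq_zero Ω hv hh, mul_zero, mul_zero]

variable (Ω) in
/-- The conditions on the components of order at most one of a functional of parity `p`. -/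
def IsFunBase (p : ZMod 2) (F : PreFunctional X) : Prop :=
  (∀ e, F 0 e ≠ 0 → p = 0) ∧
    ∀ e, ∃ v : DualFields X, ∀ h : HomField X, ins h F 0 e = pairL Ω h.val v

variable (Ω) in
/-- The conditions on a functional of parity `p`, imposed on the components of order at most one,
and on the exchange of the first two arguments, after the insertion of up to `n` fields. -/
def IsFunUpTo : ℕ → ZMod 2 → PreFunctional X → Prop
  | 0, p, F => IsFunBase Ω p F
  | n + 1, p, F => IsFunBase Ω p F ∧ SwapInv F ∧ ∀ h, IsFunUpTo n (p + h.par) (ins h F)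

theorem IsFunUpTo.add {n : ℕ} : ∀ {p : ZMod 2} {F G : PreFunctional X}, IsFunUpTo Ω n p F →
    IsFunUpTo Ω n p G → IsFunUpTo Ω n p (F + G) := by
  have key : ∀ {p : ZMod 2} {F G : PreFunctional X}, IsFunBase Ω p F →
      IsFunBase Ω p G → IsFunBase Ω p (F + G) := by
    intro p F G hF hG
    refine ⟨fun e h => ?_, fun e => ?_⟩
    · by_contra h0
      refine h ?_
      change F 0 e + G 0 e = 0
      rw [by_contra fun h => h0 (hF.1 e h), by_contra fun h => h0 (hG.1 e h), add_zero]
    · obtain ⟨v, hv⟩ := hF.2 e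
      obtain ⟨w, hw⟩ := hG.2 e
      refine ⟨v + w, fun h => ?_⟩
      rw [← pairLL_apply, map_add, pairLL_apply, pairLL_apply, ← hv, ← hw]
      rfl
  induction n with
  | zero => exact key
  | succ n ih => exact fun hF hG => ⟨key hF.1 hG.1, hF.2.1.add hG.2.1, fun h =>
      ih (hF.2.2 h) (hG.2.2 h)⟩

theorem IsFunUpTo.smul {n : ℕ} (s : ℂ) : ∀ {p : ZMod 2} {F : PreFunctional X}, IsFunUpTo Ω n p F →
    IsFunUpTo Ω n p (s • F) := by
  have key : ∀ {p : ZMod 2} {F : PreFunctional X}, IsFunBase Ω p F →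
      IsFunBase Ω p (s • F) := by
    intro p F hF
    refine ⟨fun e h => hF.1 e fun h0 => h ?_, fun e => ?_⟩
    · change s * F 0 e = 0
      rw [h0, mul_zero]
    · obtain ⟨v, hv⟩ := hF.2 e
      refine ⟨s • v, fun h => ?_⟩
      rw [← pairLL_apply, map_smul, pairLL_apply, ← hv]
      rfl
  induction n with
  | zero => exact key
  | succ n ih => exact fun hF => ⟨key hF.1, hF.2.1.smul s, fun h => ih (hF.2.2 h)⟩

theorem IsFun.upTo {n : ℕ} : ∀ {p : ZMod 2} {F : PreFunctional X}, IsFun Ω p F →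
    IsFunUpTo Ω n p F := by
  have key : ∀ {p : ZMod 2} {F : PreFunctional X}, IsFun Ω p F → IsFunBase Ω p F :=
    fun hF => ⟨fun e h => (hF.parity 0 e h).symm, fun e => hF.deriv 0 e⟩
  induction n with
  | zero => exact key
  | succ n ih => exact fun hF => ⟨key hF, hF.symm.swap, fun h => ih (hF.ins h)⟩

theorem isFun_of_upTo (hF : ∀ n, IsFunUpTo Ω n p F) :
    IsFun Ω p F := by
  have h1 : ∀ n p (F : PreFunctional X), IsFunUpTo Ω n p F → GradedSymmUpTo n F := by
    intro n
    induction n with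
    | zero => exact fun _ _ _ => trivial
    | succ n ih => exact fun p F hF => ⟨hF.2.1, fun h => ih _ _ (hF.2.2 h)⟩
  have h2 : ∀ n p (F : PreFunctional X), IsFunUpTo Ω n p F → ∀ e, F n e ≠ 0 → tpar n e = p := by
    intro n
    induction n with
    | zero => exact fun p F hF e h => (hF.1 e h).symm
    | succ n ih =>
      intro p F hF e h
      obtain ⟨k, e, rfl⟩ := exists_fcons e
      rw [tpar_fcons, add_comm, zmod_two_add_eq]
      exact ih _ _ (hF.2.2 k) e h
  have h3 : ∀ n p (F : PreFunctional X), (∀ n, IsFunUpTo Ω n p F) → ∀ e, ∃ v : DualFields X,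
      ∀ h : HomField X, ins h F n e = pairL Ω h.val v := by
    intro n
    induction n with
    | zero => exact fun p F hF e => (hF 0).2 e
    | succ n ih =>
      intro p F hF e
      obtain ⟨k, e, rfl⟩ := exists_fcons e
      obtain ⟨v, hv⟩ := ih (p + k.par) (ins k F) (fun n => (hF (n + 1)).2.2 k) e
      set t := p + k.par + tpar n e with ht
      refine ⟨psign (k.par * t) • dualPart t v, fun h => ?_⟩
      rw [← psign_smul_pairL (isHomDual_dualPart t v), pairL_dualPart, ← hv]
      have h4 : ins h F (n + 1) (fcons k e) = psign (k.par * h.par) * ins h (ins k F) n e :=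
        congrFun (congrFun ((hF 1).2.1 k h) n) e
      rw [h4]
      split_ifs with hh
      · rfl
      · refine congrArg _ (by_contra fun h5 => hh ?_)
        have h6 := h2 (n + 1) _ _ ((hF (n + 2)).2.2 k) (fcons h e) h5
        rw [tpar_fcons, zmod_two_add_eq] at h6
        exact h6
  exact ⟨fun n => h1 n p F (hF n), fun n => h2 n p F (hF n), fun n => h3 n p F hF⟩

theorem psign_mul_add (a b c : ZMod 2) : psign (a * (b + c)) = psign (a * b) * psign (a * c) := by
  rw [mul_add, psign_add]

theorem psign_add_mul (a b c : ZMod 2) : psign ((a + b) * c) = psign (a * c) * psign (b * c) := by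
  rw [add_mul, psign_add]

theorem IsFun.congr {p q : ZMod 2} {F : PreFunctional X} (hF : IsFun Ω p F) (h : p = q) :
    IsFun Ω q F := h ▸ hF

/-- The Poisson bracket of functionals is a functional. -/
theorem IsFun.bracket (hF : IsFun Ω p F)
    (hG : IsFun Ω q G) : IsFun Ω (p + q + 1) (bracket Ω F G) := by
  have h0 : ∀ (p q : ZMod 2) (F G : PreFunctional X), IsFun Ω p F → IsFun Ω q G →
      IsFunBase Ω (p + q + 1) (BCOV.bracket Ω F G) := by
    intro p q F G hF hG
    refine ⟨fun e h => ?_, fun e => ?_⟩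
    · rw [bracket_zero_right hG hF] at h
      have h1 := hF.parity _ _ h
      rw [tpar_fcons, tpar_zero, hG.ham_par] at h1
      rw [← h1]
      linear_combination (q + 1) * (CharTwo.two_eq_zero : (2 : ZMod 2) = 0)
    · refine ⟨psign (hG.ham.par * (p + hG.ham.par + tpar 0 e)) • (hF.ins hG.ham).dual 0 e -
        psign ((hF.ham.par + p + 1) * (q + hF.ham.par + tpar 0 e)) • (hG.ins hF.ham).dual 0 e,
        fun h => ?_⟩
      rw [← pairLL_apply, map_sub, pairLL_apply, pairLL_apply,
        ← psign_smul_pairL ((hF.ins hG.ham).isHomDual 0 e),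
        ← psign_smul_pairL ((hG.ins hF.ham).isHomDual 0 e), ← (hF.ins hG.ham).ins_eq,
        ← (hG.ins hF.ham).ins_eq, ins_bracket hF hG]
      change BCOV.bracket Ω (BCOV.ins h F) G 0 e + psign _ * BCOV.bracket Ω F (BCOV.ins h G) 0 e = _
      rw [bracket_zero_right hG (hF.ins h), bracket_zero_left hF (hG.ins h), hF.symm.swap hG.ham h,
        hG.symm.swap hF.ham h, Pi.smul_apply, Pi.smul_apply, Pi.smul_apply, Pi.smul_apply,
        smul_eq_mul, smul_eq_mul, add_assoc hF.ham.par, psign_add_mul, mul_comm h.par]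
      ring
  have hs : ∀ (p q : ZMod 2) (F G : PreFunctional X), IsFun Ω p F → IsFun Ω q G →
      SwapInv (BCOV.bracket Ω F G) := by
    intro p q F G hF hG h k
    rw [ins_bracket hF hG, ins_bracket hF hG, ins_add, ins_add, ins_smul, ins_smul,
      ins_bracket (hF.ins k) hG, ins_bracket (hF.ins h) hG, ins_bracket hF (hG.ins k),
      ins_bracket hF (hG.ins h), hF.symm.swap h k, hG.symm.swap h k,
      bracket_smul_left ((hF.ins h).ins k) hG, bracket_smul_right hF ((hG.ins h).ins k)]
    funext n e
    simp only [Pi.add_apply, Pi.smul_apply, smul_eq_mul]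
    rw [add_right_comm p k.par 1, add_right_comm p h.par 1, psign_mul_add h.par (p + 1) k.par,
      psign_mul_add k.par (p + 1) h.par, mul_comm k.par h.par]
    have := psign_mul_self (h.par * k.par)
    linear_combination (-psign (k.par * (p + 1)) *
      BCOV.bracket Ω (BCOV.ins h F) (BCOV.ins k G) n e) * this
  refine isFun_of_upTo fun n => ?_
  induction n generalizing p q F G with
  | zero => exact h0 p q F G hF hG
  | succ n ih =>
    refine ⟨h0 p q F G hF hG, hs p q F G hF hG, fun h => ?_⟩
    rw [ins_bracket hF hG]
    refine IsFunUpTo.add ?_ (IsFunUpTo.smul _ ?_)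
    · rw [show p + q + 1 + h.par = p + h.par + q + 1 by ring]
      exact ih (hF.ins h) hG
    · rw [show p + q + 1 + h.par = p + (q + h.par) + 1 by ring]
      exact ih hF (hG.ins h)

theorem bracket_skew (hF : IsFun Ω p F) (hG : IsFun Ω q G) :
    bracket Ω F G = -(psign ((p + 1) * (q + 1)) • bracket Ω G F) := by
  funext n e
  change bracket Ω F G n e = -(psign ((p + 1) * (q + 1)) * bracket Ω G F n e)
  induction n generalizing p q F G with
  | zero =>
    rw [bracket_zero_left hF hG, bracket_zero_right hF hG]
    by_cases h0 : ins hF.ham G 0 e = 0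
    · rw [h0, mul_zero]
    · have h1 := hG.parity _ _ h0
      rw [tpar_fcons, tpar_zero, hF.ham_par, add_zero] at h1
      rw [h1]
      rcases zmod_two_cases q with rfl | rfl
      · rw [zero_mul, psign_zero, one_mul]
      · rw [show (1 : ZMod 2) * (1 + 1) = 0 from rfl, psign_zero, one_mul]
  | succ n ih =>
    obtain ⟨h, e, rfl⟩ := exists_fcons e
    change ins h (bracket Ω F G) n e = -(_ * ins h (bracket Ω G F) n e)
    rw [ins_bracket hF hG, ins_bracket hG hF]
    simp only [Pi.add_apply, Pi.smul_apply, smul_eq_mul]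
    rw [ih (hF.ins h) hG, ih hF (hG.ins h), add_right_comm p, add_right_comm q,
      psign_add_mul, psign_mul_add _ (q + 1), mul_comm h.par (p + 1)]
    have := psign_mul_self ((p + 1) * h.par)
    linear_combination (-psign ((p + 1) * (q + 1)) * bracket Ω (ins h G) F n e) * this

/-- The Jacobi identity.  Insertions of fields reduce it to the Taylor components of order zero,
where it is the graded symmetry of the second derivatives. -/
theorem bracket_jacobi (hF : IsFun Ω p F)
    (hG : IsFun Ω q G) (hH : IsFun Ω r H) : bracket Ω F (bracket Ω G H) =
      bracket Ω (bracket Ω F G) H + psign ((p + 1) * (q + 1)) • bracket Ω G (bracket Ω F H) := by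
  funext n e
  change bracket Ω F (bracket Ω G H) n e = bracket Ω (bracket Ω F G) H n e +
    psign ((p + 1) * (q + 1)) * bracket Ω G (bracket Ω F H) n e
  induction n generalizing p q r F G H with
  | zero =>
    rw [bracket_zero_left hF (hG.bracket hH), bracket_zero_right hH (hF.bracket hG),
      bracket_zero_left hG (hF.bracket hH), ins_bracket hG hH, ins_bracket hF hG,
      ins_bracket hF hH]
    simp only [Pi.add_apply, Pi.smul_apply, smul_eq_mul]
    rw [bracket_zero_right hH (hG.ins _), bracket_zero_left hG (hH.ins _),
      bracket_zero_right hG (hF.ins _), bracket_zero_left hF (hG.ins _),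
      bracket_zero_right hH (hF.ins _), bracket_zero_left hF (hH.ins _),
      hF.symm.swap hG.ham hH.ham, hG.symm.swap hF.ham hH.ham, hH.symm.swap hF.ham hG.ham]
    simp only [Pi.smul_apply, smul_eq_mul, hF.ham_par, hG.ham_par, hH.ham_par]
    rw [mul_comm (r + 1) (p + 1), mul_comm (q + 1) (p + 1)]
    have h1 := psign_mul_self ((p + 1) * (r + 1))
    have h2 := psign_mul_self ((p + 1) * (q + 1))
    have h3 : psign ((q + 1) * (r + 1)) * ins hH.ham (ins hG.ham F) 0 e =
        psign ((p + 1) * (q + 1)) * ins hH.ham (ins hG.ham F) 0 e := by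
      by_cases h0 : ins hH.ham (ins hG.ham F) 0 e = 0
      · rw [h0, mul_zero, mul_zero]
      · have h1 := hF.parity _ _ h0
        rw [tpar_fcons, tpar_fcons, tpar_zero, hG.ham_par, hH.ham_par] at h1
        congr 2
        rw [← h1]
        rcases zmod_two_cases q with rfl | rfl <;> rcases zmod_two_cases r with rfl | rfl <;> rfl
    linear_combination -h3 + ins hH.ham (ins hF.ham G) 0 e * h1 -
      psign ((p + 1) * (q + 1)) * ins hG.ham (ins hF.ham H) 0 e * h2
  | succ n ih =>
    obtain ⟨h, e, rfl⟩ := exists_fcons e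
    change ins h (bracket Ω F (bracket Ω G H)) n e = ins h (bracket Ω (bracket Ω F G) H) n e +
      _ * ins h (bracket Ω G (bracket Ω F H)) n e
    rw [ins_bracket hF (hG.bracket hH),
      ins_bracket (hF.bracket hG) hH, ins_bracket hG (hF.bracket hH), ins_bracket hG hH,
      ins_bracket hF hG, ins_bracket hF hH]
    rw [bracket_add_right hF ((hG.ins h).bracket hH)
        (((hG.bracket (hH.ins h)).smul _).congr (by ring)),
      bracket_add_left ((hF.ins h).bracket hG)
        (((hF.bracket (hG.ins h)).smul _).congr (by ring)) hH,
      bracket_add_right hG ((hF.ins h).bracket hH)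
        (((hF.bracket (hH.ins h)).smul _).congr (by ring)),
      bracket_smul_right hF (hG.bracket (hH.ins h)),
      bracket_smul_left (hF.bracket (hG.ins h)) hH,
      bracket_smul_right hG (hF.bracket (hH.ins h))]
    simp only [Pi.add_apply, Pi.smul_apply, smul_eq_mul]
    rw [ih (hF.ins h) hG hH, ih hF (hG.ins h) hH,
      ih hF hG (hH.ins h), add_right_comm p, add_right_comm q,
      psign_add_mul (p + 1) h.par, psign_mul_add (p + 1) (q + 1) h.par, mul_comm (p + 1) h.par,
      show p + q + 1 + 1 = (p + 1) + (q + 1) by ring, psign_mul_add h.par (p + 1) (q + 1)]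
    have := psign_mul_self (h.par * (p + 1))
    linear_combination (psign ((p + 1) * (q + 1)) *
      bracket Ω (ins h G) (bracket Ω F H) n e) * this

end DGLie


/-! ### The dual action of the differential -/

section Differential

variable {X : Type*} [TopologicalSpace X] [ChartedSpace V X] (Ω : HolVolForm X) {M : Type*}
  [AddCommGroup M] [Module ℂ M]

/-- The dual action of `Q` on families of Taylor components with values in `M`. -/
def qdual (F : Fn X M) : Fn X M := fun n e =>
  -∑ i : Fin n, psign (∑ j ∈ Finset.univ.filter (· < i), (e j).par) •
    F n (Function.update e i (Q Ω (e i)))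

theorem Qdual_eq (F : PreFunctional X) : Qdual Ω F = qdual Ω F := rfl

theorem qdual_zero (F : Fn X M) (e : Fin 0 → HomField X) : qdual Ω F 0 e = 0 := neg_zero

theorem ins_qdual (F : Fn X M) (h : HomField X) :
    ins h (qdual Ω F) = psign h.par • qdual Ω (ins h F) - ins (Q Ω h) F := by
  funext n e
  change -∑ i : Fin (n + 1), psign _ • F (n + 1) (Function.update (fcons h e) i _) =
    psign h.par • -∑ i : Fin n, psign _ • F (n + 1) (fcons h (Function.update e i _)) -
      F (n + 1) (fcons (Q Ω h) e)
  rw [Fin.sum_univ_succ, neg_add_rev, smul_neg, sub_eq_add_neg, Finset.smul_sum]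
  refine congrArg₂ (· + ·) (congrArg _ (Finset.sum_congr rfl fun i _ => ?_)) (congrArg _ ?_)
  · rw [smul_smul, ← psign_add]
    refine congrArg₂ (· • ·) (congrArg psign ?_) (congrArg (F (n + 1))
      (Fin.cons_update (α := fun _ => HomField X) _ _ _ _).symm)
    rw [Finset.sum_filter, Fin.sum_univ_succ, if_pos (Fin.succ_pos i), Finset.sum_filter]
    simp only [Fin.succ_lt_succ_iff]
    rfl
  · rw [Finset.filter_false_of_mem fun j _ => Fin.not_lt_zero j, Finset.sum_empty, psign_zero,
      one_smul]
    exact congrArg (F (n + 1)) (Fin.update_cons_zero (α := fun _ => HomField X) _ _ _)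

theorem qdual_add (F G : Fn X M) : qdual Ω (F + G) = qdual Ω F + qdual Ω G := by
  funext n e
  simp only [qdual, Pi.add_apply, smul_add, Finset.sum_add_distrib, neg_add]

theorem qdual_smul (s : ℂ) (F : Fn X M) : qdual Ω (s • F) = s • qdual Ω F := by
  funext n e
  simp only [qdual, Pi.smul_apply, smul_neg, Finset.smul_sum]
  exact congrArg _ (Finset.sum_congr rfl fun i _ => smul_comm _ _ _)

variable {Ω} [T2Space X] [IsManifold 𝓘(ℂ, V) ω X] [MeasurableSpace X] [BorelSpace X]
  {p q : ZMod 2} {F G : PreFunctional X}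

/-- Integration by parts: the transpose of `Q`. -/
theorem exists_transpose (v : DualFields X) : ∃ w : DualFields X, ∀ h : HomField X,
    -pairL Ω (Q Ω h).val v = pairL Ω h.val w := by
  have e1 : ∀ a b : PV X, a ∈ PV.compact X →
      traceL Ω (dbarL a * b) = -traceL Ω (a * parityInv (dbarL b)) := by
    intro a b ha
    have h1 := traceL_dbarL Ω (PV.mul_mem_compact_left ha b)
    rw [dbarL_mul, map_add] at h1
    have h2 := traceL_parityInv Ω (PV.mul_mem_compact_left (parityInv_mem_compact ha) (dbarL b))
    rw [parityInv_mul, parityInv_parityInv] at h2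
    linear_combination h1 + h2
  have e2 : ∀ a b : PV X, a ∈ PV.compact X →
      intL Ω (dbarL a * b) = intL Ω (a * parityInv (dbarL b)) := by
    intro a b ha
    have h1 := intL_dbarL Ω (PV.mul_mem_compact_left ha b)
    rw [dbarL_mul, map_add] at h1
    have h2 := intL_parityInv Ω (PV.mul_mem_compact_left (parityInv_mem_compact ha) (dbarL b))
    rw [parityInv_mul, parityInv_parityInv] at h2
    linear_combination h1 - h2
  refine ⟨(fun a => -invC (dbarC (v.1 a)), invC (dbarC v.2.1) - invC (divC Ω v.2.2),
    invC (dbarC v.2.2)), fun h => ?_⟩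
  rw [pairL_eq, pairL_eq, Q_phi, Q_phi, Q_mu, Q_nu, add_mul, map_add,
    e2 _ _ (Fields.phi_mem_compact _ _), e2 _ _ (Fields.phi_mem_compact _ _),
    e1 _ _ (Fields.mu_mem_compact _), e1 _ _ (Fields.nu_mem_compact _),
    traceL_divL_mul' Ω (Fields.mu_mem_compact _)]
  simp only [map_neg, map_sub, mul_neg, mul_sub, toPV_invC, toPV_dbarC, toPV_divC]
  ring

/-- The Poisson tensor is compatible with `Q`. -/
theorem pairL_Q_hamField {p : ZMod 2} {v w : DualFields X} (hv : IsHomDual p v)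
    (hw : IsHomDual p w) : pairL Ω (Q Ω (hamField Ω p w hw)).val v =
      psign (p + 1) * pairL Ω (Q Ω (hamField Ω p v hv)).val w := by
  have key : ∀ {v w : DualFields X} (hw : IsHomDual p w),
      pairL Ω (Q Ω (hamField Ω p w hw)).val v =
        intL Ω (dbarL (toPV (w.1 0)) * toPV (v.1 1)) - intL Ω (dbarL (toPV (w.1 1)) * toPV (v.1 0)) +
        psign (p + 1) * traceL Ω (dbarL (divL Ω (toPV w.2.1)) * toPV v.2.1) := by
    intro v w hw
    have h0 : Fields.phi (hamField Ω p w hw).val 0 = -toPV (w.1 1) := map_neg toPV _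
    have h1 : Fields.phi (hamField Ω p w hw).val 1 = toPV (w.1 0) := rfl
    have h2 : Fields.mu (hamField Ω p w hw).val = psign (p + 1) • divL Ω (toPV w.2.1) :=
      parityInv_divL Ω hw.mu
    have h3 : Fields.nu (hamField Ω p w hw).val = 0 := map_zero toPV
    rw [pairL_eq, Q_phi, Q_phi, Q_mu, Q_nu, h0, h1, h2, h3]
    simp only [map_neg, neg_mul, map_smul, smul_mul_assoc, map_zero, divL_divL, smul_zero, zero_add,
      zero_mul, smul_eq_mul]
    ring
  have ei : ∀ a b, intL Ω (dbarL (toPV (w.1 a)) * toPV (v.1 b)) =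
      -(psign (p + 1) * intL Ω (dbarL (toPV (v.1 b)) * toPV (w.1 a))) := by
    intro a b
    have h1 := intL_dbarL Ω (PV.mul_mem_compact_left (toPV_mem_compact (w.1 a)) (toPV (v.1 b)))
    have h3 : (p + 1) * (p + 1 + 1) = 0 := by rcases zmod_two_cases p with rfl | rfl <;> rfl
    rw [dbarL_mul, map_add, hw.phi, smul_mul_assoc, PV.mul_comm_parity (hw.phi a) (parityInv_dbarL (hv.phi b)), h3,
      psign_zero, one_smul, map_smul, smul_eq_mul] at h1
    linear_combination h1
  have et : traceL Ω (dbarL (divL Ω (toPV w.2.1)) * toPV v.2.1) =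
      psign (p + 1) * traceL Ω (dbarL (divL Ω (toPV v.2.1)) * toPV w.2.1) := by
    have hc := toPV_mem_compact w.2.1
    have h1 := traceL_dbarL Ω (PV.mul_mem_compact_left (divL_mem_compact Ω hc) (toPV v.2.1))
    have h2 := traceL_divL_mul Ω (b := dbarL (toPV v.2.1)) (Or.inl hc)
    rw [dbarL_mul, map_add, parityInv_divL Ω hw.mu, smul_mul_assoc, map_smul, smul_eq_mul, h2, hw.mu, smul_mul_assoc,
      map_smul, smul_eq_mul, ← neg_neg (divL Ω (dbarL _)), ← dbarL_divL, mul_neg, map_neg,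
      PV.mul_comm_parity hw.mu (parityInv_dbarL (parityInv_divL Ω hv.mu)), map_smul, smul_eq_mul, psign_add, psign_one] at h1
    have h3 : p * (p + 1 + 1) = p := by rcases zmod_two_cases p with rfl | rfl <;> rfl
    rw [h3] at h1
    rw [psign_add, psign_one]
    have := psign_mul_self p
    linear_combination h1 - (psign p * traceL Ω (dbarL (divL Ω (toPV v.2.1)) * toPV w.2.1)) * this
  rw [key, key, ei, ei, et]
  ring

theorem IsFun.qdual (hF : IsFun Ω p F) :
    IsFun Ω (p + 1) (qdual Ω F) := by
  have h0 : ∀ (p : ZMod 2) (F : PreFunctional X), IsFun Ω p F →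
      IsFunBase Ω (p + 1) (BCOV.qdual Ω F) := by
    intro p F hF
    refine ⟨fun e h => absurd (qdual_zero Ω F e) h, fun e => ?_⟩
    obtain ⟨w, hw⟩ := exists_transpose (Ω := Ω) (hF.dual 0 e)
    refine ⟨w, fun h => ?_⟩
    rw [← hw, ← hF.ins_eq, ins_qdual, Pi.sub_apply, Pi.sub_apply, Pi.smul_apply, Pi.smul_apply,
      qdual_zero, smul_zero, zero_sub]
  refine isFun_of_upTo fun n => ?_
  induction n generalizing p F with
  | zero => exact h0 p F hF
  | succ n ih =>
    refine ⟨h0 p F hF, fun h k => ?_, fun h => ?_⟩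
    · have e1 : ∀ (h k : HomField X), BCOV.ins h (BCOV.qdual Ω (BCOV.ins k F)) =
          psign h.par • BCOV.qdual Ω (BCOV.ins h (BCOV.ins k F)) -
            BCOV.ins (Q Ω h) (BCOV.ins k F) := fun h k => ins_qdual Ω _ h
      have e2 : ∀ (h k : HomField X), BCOV.ins h (BCOV.ins k (BCOV.qdual Ω F)) =
          psign k.par • (psign h.par • BCOV.qdual Ω (BCOV.ins h (BCOV.ins k F)) -
            BCOV.ins (Q Ω h) (BCOV.ins k F)) - BCOV.ins h (BCOV.ins (Q Ω k) F) := by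
        intro h k
        rw [← e1, ins_qdual]
        rfl
      rw [e2, e2, hF.symm.swap h k, qdual_smul, hF.symm.swap (Q Ω h) k, hF.symm.swap h (Q Ω k),
        Q_par, Q_par]
      funext n e
      simp only [Pi.sub_apply, Pi.smul_apply, smul_eq_mul]
      rw [psign_mul_add h.par, psign_add_mul h.par, mul_one, one_mul]
      have := psign_mul_self h.par
      have := psign_mul_self k.par
      linear_combination (-psign (h.par * k.par) * BCOV.ins k (BCOV.ins (Q Ω h) F) n e) * this
    · rw [ins_qdual, sub_eq_add_neg, ← neg_one_smul ℂ (BCOV.ins (Q Ω h) F)]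
      refine IsFunUpTo.add (IsFunUpTo.smul _ ?_) (IsFunUpTo.smul _ 
        ((hF.ins (Q Ω h)).congr (by rw [Q_par]; ring)).upTo)
      · rw [add_right_comm]
        exact ih (hF.ins h)

theorem qdual_qdual (hF : IsFun Ω p F) :
    qdual Ω (qdual Ω F) = 0 := by
  funext n e
  induction n generalizing p F with
  | zero => exact qdual_zero Ω _ e
  | succ n ih =>
    obtain ⟨h, e, rfl⟩ := exists_fcons e
    change ins h (qdual Ω (qdual Ω F)) n e = 0
    have h1 : qdual Ω (psign h.par • qdual Ω (ins h F) - ins (Q Ω h) F) =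
        psign h.par • qdual Ω (qdual Ω (ins h F)) - qdual Ω (ins (Q Ω h) F) := by
      rw [sub_eq_add_neg, ← neg_one_smul ℂ (ins (Q Ω h) F), qdual_add, qdual_smul, qdual_smul,
        neg_one_smul, ← sub_eq_add_neg]
    rw [ins_qdual, ins_qdual, ins_qdual, h1, Q_par]
    simp only [Pi.sub_apply, Pi.smul_apply, smul_eq_mul]
    rw [ih (hF.ins h), Pi.zero_apply, Pi.zero_apply, hF.ins_eq, Q_Q, ← pairLL_apply, map_zero, LinearMap.zero_apply,
      psign_add, psign_one]
    ring

/-- `Q` is a derivation of the Poisson bracket. -/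
theorem qdual_bracket (hF : IsFun Ω p F)
    (hG : IsFun Ω q G) : qdual Ω (bracket Ω F G) =
      bracket Ω (qdual Ω F) G + psign (p + 1) • bracket Ω F (qdual Ω G) := by
  funext n e
  change qdual Ω (bracket Ω F G) n e =
    bracket Ω (qdual Ω F) G n e + psign (p + 1) * bracket Ω F (qdual Ω G) n e
  induction n generalizing p q F G with
  | zero =>
    rw [qdual_zero, bracket_zero_right hG hF.qdual, bracket_zero_left hF hG.qdual, ins_qdual,
      ins_qdual]
    simp only [Pi.sub_apply, Pi.smul_apply, qdual_zero, smul_zero, zero_sub]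
    obtain rfl : e = Fin.elim0 := Subsingleton.elim _ _
    rw [hF.ins_eq, hG.ins_eq]
    have t0 : tpar (X := X) 0 Fin.elim0 = 0 := rfl
    -- in order zero, both sides pair the Hamiltonian fields with `Q`; they vanish unless `p = q`
    by_cases hpq : p = q
    · subst hpq
      have := pairL_Q_hamField (Ω := Ω) (hF.isHomDual 0 Fin.elim0) (hG.isHomDual 0 Fin.elim0)
      change pairL Ω (Q Ω hG.ham).val _ = psign (p + 0 + 1) * pairL Ω (Q Ω hF.ham).val _ at this
      rw [add_zero] at this
      linear_combination this
    · have h1 : (Q Ω hG.ham).par ≠ p + tpar (X := X) 0 Fin.elim0 := by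
        rw [Q_par, hG.ham_par, t0, add_zero, add_assoc, CharTwo.add_self_eq_zero, add_zero]
        exact fun h => hpq h.symm
      have h2 : (Q Ω hF.ham).par ≠ q + tpar (X := X) 0 Fin.elim0 := by
        rw [Q_par, hF.ham_par, t0, add_zero, add_assoc, CharTwo.add_self_eq_zero, add_zero]
        exact hpq
      rw [pairL_eq_zero Ω (hF.isHomDual 0 _) h1, pairL_eq_zero Ω (hG.isHomDual 0 _) h2]
      ring
  | succ n ih =>
    obtain ⟨h, e, rfl⟩ := exists_fcons e
    change ins h (qdual Ω (bracket Ω F G)) n e = ins h (bracket Ω (qdual Ω F) G) n e +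
      _ * ins h (bracket Ω F (qdual Ω G)) n e
    have e1 : ∀ {r : ZMod 2} {K : PreFunctional X}, IsFun Ω r K → ins h (qdual Ω K) =
        psign h.par • qdual Ω (ins h K) + (-1 : ℂ) • ins (Q Ω h) K := by
      intro r K hK
      rw [ins_qdual, sub_eq_add_neg, neg_one_smul]
    rw [e1 (hF.bracket hG), ins_bracket hF.qdual hG, ins_bracket hF hG.qdual, e1 hF, e1 hG,
      ins_bracket hF hG, ins_bracket hF hG, qdual_add, qdual_smul]
    rw [bracket_add_left ((hF.ins h).qdual.smul _)
        (((hF.ins (Q Ω h)).smul _).congr (by rw [Q_par]; ring)) hG,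
      bracket_add_right hF ((hG.ins h).qdual.smul _)
        (((hG.ins (Q Ω h)).smul _).congr (by rw [Q_par]; ring)),
      bracket_smul_left (hF.ins h).qdual hG, bracket_smul_left (hF.ins (Q Ω h)) hG,
      bracket_smul_right hF (hG.ins h).qdual, bracket_smul_right hF (hG.ins (Q Ω h))]
    simp only [Pi.add_apply, Pi.smul_apply, smul_eq_mul]
    rw [ih (hF.ins h) hG, ih hF (hG.ins h), Q_par, add_right_comm p h.par,
      psign_add (p + 1) h.par, psign_mul_add h.par (p + 1) 1, psign_add_mul h.par 1 (p + 1),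
      mul_one, one_mul]
    have h1 := psign_mul_self h.par
    linear_combination (psign (p + 1) * bracket Ω (ins h F) (qdual Ω G) n e) * h1

/-- An even functional that satisfies the classical master equation makes the functionals a dg Lie
algebra with the differential `Q + {I, -}`. -/
theorem isDGLie_of_masterEquation (hI : IsFun Ω 0 (action Ω))
    (hCME : (2 : ℂ) • qdual Ω (action Ω) + bracket Ω (action Ω) (action Ω) = 0) :
    IsDGLie (shiftedFunctionals Ω) (bracket Ω) (differential Ω) := by
  have hmem : ∀ {i : ZMod 2} {F : PreFunctional X}, F ∈ shiftedFunctionals Ω i ↔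
      IsFun Ω (i + 1) F := fun {i F} => isFun_iff.symm
  have hd : ∀ {p : ZMod 2} {F : PreFunctional X}, IsFun Ω p F →
      IsFun Ω (p + 1) (bracket Ω (action Ω) F) := fun hF =>
    (hI.bracket hF).congr (by ring)
  have hdef : ∀ F : PreFunctional X, differential Ω F = qdual Ω F + bracket Ω (action Ω) F :=
    fun _ => rfl
  have hcan : ∀ i : ZMod 2, i + 1 + 1 = i := fun i => by
    rw [add_assoc, CharTwo.add_self_eq_zero, add_zero]
  refine ⟨fun i => hmem.mpr (IsFun.zero _), fun i F hF G hG => hmem.mpr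
      ((hmem.mp hF).add (hmem.mp hG)), fun i s F hF => hmem.mpr ((hmem.mp hF).smul s),
    fun i j F hF G hG => hmem.mpr (((hmem.mp hF).bracket (hmem.mp hG)).congr ?_),
    fun i j F hF F' hF' G hG => bracket_add_left (hmem.mp hF) (hmem.mp hF') (hmem.mp hG),
    fun i j s F hF G hG => bracket_smul_left (hmem.mp hF) (hmem.mp hG) s,
    fun i j F hF G hG => ?_, fun i j k F hF G hG H hH => ?_, fun i F hF => ?_,
    fun i F hF G hG => ?_, fun i s F hF => ?_, fun i F hF => ?_, fun i j F hF G hG => ?_⟩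
  · rw [show i + 1 + (j + 1) + 1 = i + j + 1 + 1 + 1 by ring, hcan]
  · have := bracket_skew (hmem.mp hF) (hmem.mp hG)
    rwa [hcan, hcan] at this
  · have := bracket_jacobi (hmem.mp hF) (hmem.mp hG) (hmem.mp hH)
    rwa [hcan, hcan] at this
  · exact hmem.mpr ((hmem.mp hF).qdual.add (hd (hmem.mp hF)))
  · rw [hdef, hdef, hdef, qdual_add, bracket_add_right hI (hmem.mp hF) (hmem.mp hG)]
    abel
  · rw [hdef, hdef, qdual_smul, bracket_smul_right hI (hmem.mp hF), smul_add]
  · have hF' := hmem.mp hF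
    -- the square of the differential is the bracket with `Q I + ½ {I, I}`
    have h1 := bracket_jacobi hI hI hF'
    have h2 := bracket_add_left (hI.qdual.smul 2) ((hI.bracket hI).congr (by ring)) hF'
    have h3 : bracket Ω (0 : PreFunctional X) F = 0 := by
      have := bracket_smul_left (IsFun.zero (Ω := Ω) 0) hF' 0
      rwa [smul_zero, zero_smul] at this
    rw [hCME, h3, bracket_smul_left hI.qdual hF'] at h2
    rw [hdef, hdef, qdual_add, qdual_qdual hF', qdual_bracket hI hF',
      bracket_add_right hI hF'.qdual (hd hF')]
    rw [show ((0 : ZMod 2) + 1) * (0 + 1) = 1 from rfl, psign_one] at h1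
    rw [show (0 : ZMod 2) + 1 = 1 from rfl, psign_one]
    funext n e
    have h1' := congrFun (congrFun h1 n) e
    have h2' := congrFun (congrFun h2 n) e
    simp only [Pi.add_apply, Pi.smul_apply, smul_eq_mul, Pi.zero_apply] at h1' h2' ⊢
    linear_combination (1 / 2) * h1' - (1 / 2) * h2'
  · have hF' := hmem.mp hF
    have hG' := hmem.mp hG
    have h1 := bracket_jacobi hI hF' hG'
    rw [show ((0 : ZMod 2) + 1) * (i + 1 + 1) = i by rw [hcan, zero_add, one_mul]] at h1
    rw [hdef, hdef, hdef, qdual_bracket hF' hG', hcan, bracket_add_left hF'.qdual (hd hF') hG',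
      bracket_add_right hF' hG'.qdual (hd hG'), h1, smul_add]
    abel

end Differential


/-! ### Linear functionals, graded symmetry, and the derivation induced by the differential -/

section FunR

variable {X : Type*} [TopologicalSpace X] [ChartedSpace V X]

namespace FunR

/-- A linear functional with values in polyvector fields. -/
def lin (α : HomField X → PV X) : FunR X := ⟨linFn α⟩

theorem ins_lin (α : HomField X → PV X) (h : HomField X) : ins h (lin α) = const (α h) :=
  ext' fun n e => by
    cases n <;> rfl

theorem lin_apply_one (α : HomField X → PV X) (e : Fin 1 → HomField X) : lin α 1 e = α (e 0) := rfl

theorem lift_lin (L : PV X →ₗ[ℂ] PV X) (α : HomField X → PV X) :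
    lift L (lin α) = lin fun e => L (α e) := ext' fun n e => by
  rcases n with _ | _ | n
  · exact map_zero L
  · rfl
  · exact map_zero L

theorem lift_const (L : PV X →ₗ[ℂ] PV X) (a : PV X) : lift L (const a) = const (L a) :=
  ext' fun n e => by
    cases n
    · rfl
    · exact map_zero L

theorem hasPar_lin {α : HomField X → PV X} (hα : ∀ e, parityInv (α e) = psign e.par • α e) :
    HasPar 0 (lin α) := hasPar_iff.mpr fun n e => by
  rcases n with _ | _ | n
  · change parityInv (0 : PV X) = _ • (0 : PV X)
    rw [map_zero, smul_zero]
  · rw [lin_apply_one, hα, zero_add, tpar, Fin.sum_univ_one]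
  · change parityInv (0 : PV X) = _ • (0 : PV X)
    rw [map_zero, smul_zero]

theorem hasPar_const {p : ZMod 2} {a : PV X} (ha : parityInv a = psign p • a) :
    HasPar p (const a) := by
  rw [HasPar, G_const, ha]
  exact ext' fun n e => by
    cases n
    · rfl
    · exact (smul_zero (psign p) : psign p • (0 : PV X) = 0).symm

theorem hasDeg_lin {i : ℕ} {α : HomField X → PV X} (hα : ∀ e, α e ∈ PV.deg X i) :
    HasDeg i (lin α) := by
  intro n e
  rcases n with _ | _ | n
  · exact Submodule.zero_mem _
  · exact hα _
  · exact Submodule.zero_mem _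

theorem hasDeg_const {i : ℕ} {a : PV X} (ha : a ∈ PV.deg X i) : HasDeg i (const a) := by
  intro n e
  cases n
  · exact ha
  · exact Submodule.zero_mem _

theorem hasCpt_lin {α : HomField X → PV X} (hα : ∀ e, α e ∈ PV.compact X) :
    HasCpt (lin α) := by
  intro n e
  rcases n with _ | _ | n
  · exact Submodule.zero_mem _
  · exact hα _
  · exact Submodule.zero_mem _

theorem hasCpt_const {a : PV X} (ha : a ∈ PV.compact X) : HasCpt (const a) := by
  intro n e
  cases n
  · exact ha
  · exact Submodule.zero_mem _

theorem HasPar.Gp_eq {p : ZMod 2} {Φ : FunR X} (hΦ : HasPar p Φ) (q : ZMod 2) :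
    Gp q Φ = psign (q * p) • Φ := by
  rcases zmod_two_cases q with rfl | rfl
  · rw [zero_mul, psign_zero, one_smul]
    rfl
  · rw [one_mul]
    exact hΦ

/-! ### Graded symmetry of functionals with values in polyvector fields -/

/-- Graded symmetry with respect to the exchanges of neighbours among the first `n + 1`
arguments. -/
abbrev SymmUpTo (n : ℕ) (Φ : FunR X) : Prop := GradedSymmUpTo n Φ.toFun

theorem SymmUpTo.swap {n : ℕ} {Φ : FunR X} (hΦ : SymmUpTo (n + 1) Φ) (h k : HomField X) :
    ins h (ins k Φ) = psign (h.par * k.par) • ins k (ins h Φ) := FunR.ext (hΦ.1 h k)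

theorem SymmUpTo.Gp {n : ℕ} (p : ZMod 2) : ∀ {Φ : FunR X}, SymmUpTo n Φ →
    SymmUpTo n (Gp p Φ) := by
  induction n with
  | zero => exact fun _ => trivial
  | succ n ih =>
    refine fun {Φ} hΦ => ⟨fun h k => ?_, fun h => ?_⟩
    · change (FunR.ins h (FunR.ins k (FunR.Gp p Φ))).toFun =
        (psign (h.par * k.par) • FunR.ins k (FunR.ins h (FunR.Gp p Φ))).toFun
      rw [ins_Gp, map_smul, ins_Gp, ins_Gp, map_smul, ins_Gp, hΦ.swap, map_smul,
        smul_comm (psign (h.par * p)), smul_comm (psign (k.par * p)) (psign (h.par * k.par)),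
        smul_comm (psign (h.par * p))]
    · have h1 := ins_Gp Φ p h
      change SymmUpTo n (FunR.ins h (FunR.Gp p Φ))
      rw [h1]
      exact GradedSymmUpTo.smul _ (ih (hΦ.2 h))

theorem SymmUpTo.mul {n : ℕ} : ∀ {Φ Ψ : FunR X}, SymmUpTo n Φ → SymmUpTo n Ψ →
    SymmUpTo n (Φ * Ψ) := by
  induction n with
  | zero => exact fun _ _ => trivial
  | succ n ih =>
    refine fun {Φ Ψ} hΦ hΨ => ⟨fun h k => ?_, fun h => ?_⟩
    · change (FunR.ins h (FunR.ins k (Φ * Ψ))).toFun =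
        (psign (h.par * k.par) • FunR.ins k (FunR.ins h (Φ * Ψ))).toFun
      rw [ins_mul, ins_mul, map_add, map_add, ins_mul, ins_mul, ins_mul, ins_mul, ins_Gp, ins_Gp,
        Gp_Gp, Gp_Gp, hΦ.swap h k, hΨ.swap h k, add_comm h.par k.par, mul_comm k.par h.par,
        mul_smul_comm, mul_smul_comm, mul_smul_comm, smul_mul_assoc]
      refine congrArg FunR.toFun ?_
      simp only [smul_add, smul_smul, psign_mul_self, one_smul]
      abel
    · change SymmUpTo n (FunR.ins h (Φ * Ψ))
      rw [ins_mul]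
      exact (ih (hΦ.2 h) (SymmUpTo.Gp _ hΨ.of_succ)).add (ih hΦ.of_succ (hΨ.2 h))

theorem symm_const (a : PV X) (n : ℕ) : SymmUpTo n (const a) := by
  cases n with
  | zero => trivial
  | succ n => exact ⟨fun h k => (smul_zero _).symm, fun h => gradedSymmUpTo_zero n⟩

theorem symm_lin (α : HomField X → PV X) (n : ℕ) : SymmUpTo n (lin α) := by
  cases n with
  | zero => trivial
  | succ n =>
    refine ⟨fun h k => ?_, fun h => ?_⟩
    · change (ins h (ins k (lin α))).toFun = (psign _ • ins k (ins h (lin α))).toFun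
      rw [ins_lin, ins_lin, ins_const, ins_const, smul_zero]
    · change SymmUpTo n (ins h (lin α))
      rw [ins_lin]
      exact symm_const _ _

theorem SymmUpTo.lift (L : PV X →ₗ[ℂ] PV X) {n : ℕ} {Φ : FunR X} (hΦ : SymmUpTo n Φ) :
    SymmUpTo n (lift L Φ) := GradedSymmUpTo.map L hΦ

/-! ### The dual action of `Q` on functionals with values in polyvector fields -/

variable (Ω : HolVolForm X)

/-- The dual action of `Q` on functionals with values in polyvector fields. -/
def qd : FunR X →ₗ[ℂ] FunR X where
  toFun Φ := ⟨qdual Ω Φ.toFun⟩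
  map_add' Φ Ψ := FunR.ext (qdual_add Ω _ _)
  map_smul' s Φ := FunR.ext (qdual_smul Ω s _)

theorem qd_zero_apply (Φ : FunR X) (e : Fin 0 → HomField X) : qd Ω Φ 0 e = 0 := qdual_zero Ω _ e

theorem ins_qd (Φ : FunR X) (h : HomField X) :
    ins h (qd Ω Φ) = psign h.par • qd Ω (ins h Φ) - ins (Q Ω h) Φ := FunR.ext (ins_qdual Ω _ h)

theorem qd_lift (L : PV X →ₗ[ℂ] PV X) (Φ : FunR X) : qd Ω (lift L Φ) = lift L (qd Ω Φ) :=
  ext' fun n e => by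
    change -∑ i, psign _ • L _ = L (-∑ i, psign _ • _)
    rw [map_neg, map_sum]
    simp only [map_smul]

theorem qd_const (a : PV X) : qd Ω (const a) = 0 := ext' fun n e => by
  rcases n with _ | n
  · exact qd_zero_apply Ω _ e
  · change -∑ i : Fin (n + 1), psign _ • (0 : PV X) = 0
    simp

theorem qd_lin (α : HomField X → PV X) : qd Ω (lin α) = lin fun e => -α (Q Ω e) :=
  ext' fun n e => by
    rcases n with _ | _ | n
    · exact qd_zero_apply Ω _ e
    · change -∑ i : Fin 1, psign _ • α (Function.update e i (Q Ω (e i)) 0) = -α _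
      rw [Fin.sum_univ_one, Function.update_self]
      have : psign (∑ j ∈ Finset.univ.filter (· < (0 : Fin 1)), (e j).par) = 1 := by simp [psign_zero]
      rw [this, one_smul]
    · change -∑ i : Fin (n + 2), psign _ • (0 : PV X) = 0
      simp

theorem G_qd (Φ : FunR X) : G (qd Ω Φ) = -qd Ω (G Φ) := by
  have hQ : ∀ h : HomField X, (Q Ω h).par = h.par + 1 := fun h => rfl
  refine ext' fun n e => ?_
  induction n generalizing Φ with
  | zero =>
    rw [G_apply, neg_apply, qd_zero_apply, qd_zero_apply, map_zero, smul_zero, neg_zero]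
  | succ n ih =>
    obtain ⟨h, e, rfl⟩ := exists_fcons e
    rw [succ_apply, succ_apply, map_neg, ins_G, ins_qd, ins_qd, ins_G, ins_G, map_sub, map_smul,
      hQ, map_smul, smul_smul, psign_mul_self, one_smul, smul_sub, smul_smul, psign_mul_self,
      one_smul, sub_apply, ih, neg_sub, psign_add, psign_one]
    simp only [neg_apply, sub_apply, smul_apply, mul_neg_one, neg_smul]
    abel

/-- The Leibniz rule for the dual action of `Q`. -/
theorem qd_mul (Φ Ψ : FunR X) : qd Ω (Φ * Ψ) = qd Ω Φ * G Ψ + Φ * qd Ω Ψ := by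
  have hQ : ∀ h : HomField X, (Q Ω h).par = h.par + 1 := fun h => rfl
  refine ext' fun n e => ?_
  induction n generalizing Φ Ψ with
  | zero =>
    rw [add_apply, mul_zero_apply, mul_zero_apply, qd_zero_apply, qd_zero_apply, qd_zero_apply,
      zero_mul, mul_zero, add_zero]
  | succ n ih =>
    obtain ⟨h, e, rfl⟩ := exists_fcons e
    have h1 : psign h.par • qd Ω (Gp h.par Ψ) = Gp h.par (qd Ω Ψ) := by
      rcases zmod_two_cases h.par with h0 | h0 <;> rw [h0]
      · rw [psign_zero, one_smul]
        rfl
      · rw [psign_one, neg_one_smul, Gp_one, Gp_one, G_qd]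
    have h2 : Gp h.par (G Ψ) = Gp (h.par + 1) Ψ := by
      rw [← Gp_one Ψ, Gp_Gp]
    have h3 : G (Gp h.par Ψ) = Gp (h.par + 1) Ψ := by
      rw [← Gp_one, Gp_Gp, add_comm]
    rw [succ_apply, succ_apply, ins_qd, ins_mul, ins_mul, map_add, map_add, ins_mul, ins_mul,
      ins_qd, ins_qd, ins_G, hQ, sub_apply, smul_apply, add_apply, ih, ih, ← h1, h2, h3]
    rw [← add_apply, ← smul_apply, ← sub_apply]
    refine congrArg (fun Φ : FunR X => Φ n e) ?_
    rw [smul_add, smul_add, smul_add, sub_mul, mul_sub, smul_mul_assoc, mul_smul_comm,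
      mul_smul_comm, mul_smul_comm]
    abel

variable [IsManifold 𝓘(ℂ, V) ω X]

/-- The odd derivation that combines the dual action of `Q` with `∂̄` on the values. -/
def totD : FunR X →ₗ[ℂ] FunR X := qd Ω ∘ₗ G + delbar

theorem totD_apply (Φ : FunR X) : totD Ω Φ = qd Ω (G Φ) + delbar Φ := rfl

theorem totD_mul (Φ Ψ : FunR X) : totD Ω (Φ * Ψ) = totD Ω Φ * Ψ + G Φ * totD Ω Ψ := by
  rw [totD_apply, totD_apply, totD_apply, G_mul, qd_mul, G_G, delbar_mul, add_mul, mul_add]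
  abel

theorem totD_del (Φ : FunR X) : totD Ω (del Ω Φ) = -del Ω (totD Ω Φ) := by
  have h1 : G (del Ω Φ) = -del Ω (G Φ) := by rw [del_G, neg_neg]
  have h2 : qd Ω (del Ω (G Φ)) = del Ω (qd Ω (G Φ)) := qd_lift Ω _ _
  rw [totD_apply, totD_apply, h1, map_neg, h2, delbar_del, map_add, neg_add]

theorem totD_const {a : PV X} (ha : dbarL a = 0) : totD Ω (const a) = 0 := by
  have h1 : delbar (const a) = const (dbarL a) := lift_const _ _
  have h2 : const (0 : PV X) = 0 := ext' fun n e => by cases n <;> rfl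
  rw [totD_apply, G_const, qd_const, h1, ha, h2, add_zero]

theorem totD_lin {α : HomField X → PV X} (hα : ∀ e, parityInv (α e) = psign e.par • α e) :
    totD Ω (lin α) = lin fun e => dbarL (α e) - α (Q Ω e) := by
  have h1 : G (lin α) = lin α := by rw [hasPar_lin hα, psign_zero, one_smul]
  have h2 : delbar (lin α) = lin fun e => dbarL (α e) := lift_lin _ _
  rw [totD_apply, h1, h2, qd_lin]
  refine ext' fun n e => ?_
  rcases n with _ | _ | n
  · exact add_zero _
  · exact neg_add_eq_sub _ _
  · exact add_zero _

/-! ### Traces and integrals of functionals -/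

variable [T2Space X] [MeasurableSpace X] [BorelSpace X]

/-- The trace of the values of a functional. -/
def traceF (Φ : FunR X) : PreFunctional X := fun n e => traceL Ω (Φ n e)

/-- The integral of the values of a functional against `Ω`. -/
def intF (Φ : FunR X) : PreFunctional X := fun n e => intL Ω (Φ n e)

variable {Ω} (Φ Ψ : FunR X)

theorem traceF_add : traceF Ω (Φ + Ψ) = traceF Ω Φ + traceF Ω Ψ :=
  funext fun _ => funext fun _ => map_add _ _ _

theorem traceF_sub : traceF Ω (Φ - Ψ) = traceF Ω Φ - traceF Ω Ψ :=
  funext fun _ => funext fun _ => map_sub _ _ _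

theorem traceF_neg : traceF Ω (-Φ) = -traceF Ω Φ := funext fun _ => funext fun _ => map_neg _ _

theorem traceF_smul (s : ℂ) : traceF Ω (s • Φ) = s • traceF Ω Φ :=
  funext fun _ => funext fun _ => (traceL Ω).map_smul s _

theorem traceF_zero : traceF Ω (0 : FunR X) = 0 := funext fun _ => funext fun _ => map_zero _

theorem intF_add : intF Ω (Φ + Ψ) = intF Ω Φ + intF Ω Ψ :=
  funext fun _ => funext fun _ => map_add _ _ _

theorem intF_sub : intF Ω (Φ - Ψ) = intF Ω Φ - intF Ω Ψ :=
  funext fun _ => funext fun _ => map_sub _ _ _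

theorem intF_neg : intF Ω (-Φ) = -intF Ω Φ := funext fun _ => funext fun _ => map_neg _ _

theorem intF_smul (s : ℂ) : intF Ω (s • Φ) = s • intF Ω Φ :=
  funext fun _ => funext fun _ => (intL Ω).map_smul s _

theorem intF_eq : intF Ω Φ = traceF Ω (const (invVol Ω) * Φ) := funext fun n => funext fun e => by
  rw [traceF, const_mul_apply]
  rfl

theorem ins_traceF (h : HomField X) : BCOV.ins h (traceF Ω Φ) = traceF Ω (ins h Φ) := rfl

theorem ins_intF (h : HomField X) : BCOV.ins h (intF Ω Φ) = intF Ω (ins h Φ) := rfl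

theorem qdual_traceF : qdual Ω (traceF Ω Φ) = traceF Ω (qd Ω Φ) := funext fun n => funext fun e => by
  change -∑ i, psign _ • traceL Ω _ = traceL Ω (-∑ i, psign _ • _)
  rw [map_neg, map_sum]
  simp only [map_smul]

variable {Φ Ψ}

/-- The action of `Q` on the trace of a functional, computed by the derivation `totD`. -/
theorem HasPar.qdual_traceF {p : ZMod 2} (hp : HasPar p Φ) (hc : HasCpt Φ) :
    qdual Ω (traceF Ω Φ) = psign p • traceF Ω (totD Ω Φ) := by
  have h1 : traceF Ω (delbar Φ) = 0 :=
    funext fun n => funext fun e => traceL_dbarL Ω (hc n e)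
  rw [FunR.qdual_traceF, totD_apply, traceF_add, h1, add_zero, hp, map_smul, traceF_smul, smul_smul,
    psign_mul_self, one_smul]

theorem traceF_del_mul (hc : HasCpt Φ ∨ HasCpt Ψ) :
    traceF Ω (del Ω Φ * Ψ) = traceF Ω (G Φ * del Ω Ψ) := by
  refine funext fun n => funext fun e => ?_
  induction n generalizing Φ Ψ with
  | zero =>
    rw [traceF, traceF, mul_zero_apply, mul_zero_apply, G_apply, tpar_zero, psign_zero, one_smul]
    exact traceL_divL_mul Ω (hc.imp (fun h => h 0 e) fun h => h 0 e)
  | succ n ih =>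
    obtain ⟨h, e, rfl⟩ := exists_fcons e
    have h1 : del Ω (Gp h.par Ψ) = psign h.par • Gp h.par (del Ω Ψ) := by
      rcases zmod_two_cases h.par with h0 | h0 <;> rw [h0]
      · rw [psign_zero, one_smul]
        rfl
      · rw [psign_one, neg_one_smul, Gp_one, Gp_one, del_G]
    have h2 : HasCpt Ψ → HasCpt (Gp h.par Ψ) := by
      intro hΨ
      rcases zmod_two_cases h.par with h0 | h0 <;> rw [h0]
      · exact hΨ
      · exact hΨ.G
    change BCOV.ins h (traceF Ω _) n e = BCOV.ins h (traceF Ω _) n e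
    rw [ins_traceF, ins_traceF, ins_mul, ins_mul, traceF_add, traceF_add, ins_del, ins_del, ins_G]
    change traceF Ω _ n e + traceF Ω _ n e = traceF Ω _ n e + traceF Ω _ n e
    congr 1
    · rw [ih (hc.imp (fun h' => h'.ins h) h2), h1, mul_smul_comm, smul_mul_assoc]
    · exact ih (hc.imp id fun h' => h'.ins h) e

theorem intF_del (hc : HasCpt Φ) : intF Ω (del Ω Φ) = 0 :=
  funext fun n => funext fun e => intL_divL Ω (hc n e)

theorem HasPar.traceF_parity {p : ZMod 2} (hΦ : HasPar p Φ) (hc : HasCpt Φ) (n : ℕ)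
    (e : Fin n → HomField X) (h : traceF Ω Φ n e ≠ 0) : tpar n e = p := by
  by_contra h0
  refine h (traceL_eq_zero_of_parity Ω (hc n e) (p := p + tpar n e) (fun h1 => h0 ?_)
    (hΦ.apply n e))
  rw [zmod_two_add_eq, zero_add] at h1
  exact h1.symm

theorem HasPar.intF_parity {p : ZMod 2} (hΦ : HasPar p Φ) (hc : HasCpt Φ) (n : ℕ)
    (e : Fin n → HomField X) (h : intF Ω Φ n e ≠ 0) : tpar n e = p + 1 := by
  by_contra h0
  refine h (intL_eq_zero_of_parity Ω (hc n e) (p := p + tpar n e) (fun h1 => h0 ?_)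
    (hΦ.apply n e))
  rw [zmod_two_add_eq] at h1
  rw [h1]
  linear_combination (-1 : ZMod 2) * (CharTwo.two_eq_zero : (2 : ZMod 2) = 0)

end FunR

end FunR


/-! ### Gradients -/

section Gradient

variable {X : Type*} [TopologicalSpace X] [ChartedSpace V X] [T2Space X] [IsManifold 𝓘(ℂ, V) ω X]
  [MeasurableSpace X] [BorelSpace X] (Ω : HolVolForm X)

open FunR

/-- `F` is a functional of parity `q` whose first derivative is given by the functionals `U a`, `A`,
`B` with values in `PV^{0,•}`, `PV^{2,•}`, `PV^{3,•}`, in the directions of the components `φ_a`, `μ`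
and `ν` of the inserted field. -/
structure HasGrad (q : ZMod 2) (F : PreFunctional X) (U : Fin 2 → FunR X) (A B : FunR X) :
    Prop where
  symm : GradedSymm F
  parity : ∀ n e, F n e ≠ 0 → tpar n e = q
  ins_eq : ∀ h, ins h F = intF Ω (const (Fields.phi h.val 0) * Gp h.par (U 0)) +
    intF Ω (const (Fields.phi h.val 1) * Gp h.par (U 1)) +
    traceF Ω (const (Fields.mu h.val) * Gp h.par A) +
    traceF Ω (const (Fields.nu h.val) * Gp h.par B)
  parU : ∀ a, HasPar (q + 1) (U a)
  parA : HasPar q A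
  parB : HasPar q B
  degU : ∀ a, HasDeg 0 (U a)
  degA : HasDeg 2 A
  degB : HasDeg 3 B
  cptU : ∀ a, HasCpt (U a)
  cptA : HasCpt A
  cptB : HasCpt B

variable {Ω} {q : ZMod 2} {F : PreFunctional X} {U : Fin 2 → FunR X} {A B : FunR X}

/-- The dual fields that represent the right derivative. -/
def HasGrad.rep (hF : HasGrad Ω q F U A B) : Fn X (DualFields X) := fun n e =>
  (fun a => PV.toC (U a n e) (hF.degU a n e) (hF.cptU a n e),
    PV.toC (A n e) (hF.degA n e) (hF.cptA n e), PV.toC (B n e) (hF.degB n e) (hF.cptB n e))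

theorem HasGrad.isHomDual (hF : HasGrad Ω q F U A B) (n : ℕ) (e : Fin n → HomField X) :
    IsHomDual (q + tpar n e) (hF.rep n e) where
  phi a := by
    rw [add_right_comm]
    exact (hF.parU a).apply n e
  mu := hF.parA.apply n e
  nu := hF.parB.apply n e

theorem HasGrad.snoc_eq (hF : HasGrad Ω q F U A B) (h : HomField X) (n : ℕ)
    (e : Fin n → HomField X) : F (n + 1) (Fin.snoc (α := fun _ => HomField X) e h) =
      pairR Ω (hF.rep n e) h.val := by
  have key : ∀ (L : PV X →ₗ[ℂ] ℂ) (x : PV X) (Φ : FunR X),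
      parityInv x = psign h.par • x →
      L ((const x * Gp h.par Φ : FunR X) n e) = psign (h.par * tpar n e) * L (Φ n e * x) := by
    intro L x Φ hx
    have h1 : parityPow h.par (parityPow h.par (Φ n e)) = Φ n e := by
      rw [← parityPow_add, CharTwo.add_self_eq_zero]
      rfl
    rw [const_mul_apply, Gp_apply, mul_smul_comm, map_smul, PV.mul_comm_of_parity _ _ _ hx, h1,
      smul_eq_mul]
  have h1 := congrFun (congrFun (hF.ins_eq h) n) e
  change F (n + 1) (fcons h e) = intL Ω _ + intL Ω _ + traceL Ω _ + traceL Ω _ at h1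
  rw [key _ _ _ (h.parityInv_phi 0), key _ _ _ (h.parityInv_phi 1), key _ _ _ h.parityInv_mu,
    key _ _ _ h.parityInv_nu] at h1
  rw [hF.symm.snoc, h1, pairR_eq]
  change _ = intL Ω (U 0 n e * _) + intL Ω (U 1 n e * _) + traceL Ω (A n e * _) +
    traceL Ω (B n e * _)
  rw [smul_eq_mul]
  linear_combination (intL Ω (U 0 n e * Fields.phi h.val 0) +
    intL Ω (U 1 n e * Fields.phi h.val 1) + traceL Ω (A n e * Fields.mu h.val) +
    traceL Ω (B n e * Fields.nu h.val)) * psign_mul_self (h.par * tpar n e)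

/-- The dual fields that represent the left derivative. -/
def HasGrad.repL (hF : HasGrad Ω q F U A B) : Fn X (DualFields X) := fun n e =>
  psign ((q + tpar n e) * tpar n e) • flipDual (q + tpar n e) (hF.rep n e)

theorem HasGrad.cons_eq (hF : HasGrad Ω q F U A B) (h : HomField X) (n : ℕ)
    (e : Fin n → HomField X) : ins h F n e = pairL Ω h.val (hF.repL n e) := by
  have hs : F (n + 1) (fcons h e) = psign (h.par * tpar n e) •
      F (n + 1) (Fin.snoc (α := fun _ => HomField X) e h) := by
    rw [hF.symm.snoc, smul_smul, psign_mul_self, one_smul]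
  rw [HasGrad.repL, ← pairLL_apply, map_smul, pairLL_apply, pairL_flipDual Ω (hF.isHomDual n e),
    ← hF.snoc_eq, ins_apply]
  by_cases h1 : F (n + 1) (fcons h e) = 0
  · rw [h1, hF.symm.snoc, h1, smul_zero, smul_zero]
  · have h2 := hF.parity _ _ h1
    rw [tpar_fcons] at h2
    rw [hs, zmod_two_add_eq.mp h2]

theorem HasGrad.isFun (hF : HasGrad Ω q F U A B) : IsFun Ω q F where
  symm := hF.symm
  parity := hF.parity
  deriv n e := ⟨hF.repL n e, fun h => hF.cons_eq h n e⟩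

theorem mul_eq_bshuffle {r : ZMod 2} {Φ Ψ : FunR X} (hΨ : HasPar r Ψ) :
    (Φ * Ψ).toFun = bshuffle (LinearMap.mul ℂ (PV X)) (argSign r Φ.toFun) Ψ.toFun := by
  funext n e
  rw [bshuffle_apply]
  refine (mul_apply Φ Ψ n e).trans (Finset.sum_congr rfl fun S _ => congrArg _ ?_)
  have h1 : parityPow (tpar _ (subfamily S e)) (Ψ _ (subfamily Sᶜ e)) =
      psign (tpar _ (subfamily S e) * (r + tpar _ (subfamily Sᶜ e))) • Ψ _ (subfamily Sᶜ e) := by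
    rcases zmod_two_cases (tpar _ (subfamily S e)) with h0 | h0 <;> rw [h0]
    · rw [zero_mul, psign_zero, one_smul]
      rfl
    · rw [one_mul]
      exact hΨ.apply _ _
  rw [h1, smul_smul, ← psign_add, ← mul_add, add_left_comm, CharTwo.add_self_eq_zero, add_zero,
    mul_comm _ r]
  exact (mul_smul_comm _ _ _).trans (smul_mul_assoc _ _ _).symm

theorem bshuffle_mul_argSign {r : ZMod 2} {Φ Ψ : FunR X} (hΨ : HasPar r Ψ) :
    bshuffle (LinearMap.mul ℂ (PV X)) Φ.toFun (argSign r Ψ.toFun) = argSign r (Φ * Ψ).toFun := by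
  have h1 : argSign r (argSign r Φ.toFun) = Φ.toFun := by
    funext n e
    change psign _ • psign _ • _ = _
    rw [smul_smul, psign_mul_self, one_smul]
  rw [mul_eq_bshuffle hΨ, argSign_bshuffle, h1]

theorem zmod_two_sq (p : ZMod 2) : p * p = p := by
  rcases zmod_two_cases p with rfl | rfl <;> rfl

/-- The Poisson bracket of two functionals, in terms of their gradients. -/
theorem HasGrad.bracket_eq {q' : ZMod 2} {F' : PreFunctional X} {U' : Fin 2 → FunR X}
    {A' B' : FunR X} (hF : HasGrad Ω q F U A B) (hF' : HasGrad Ω q' F' U' A' B') :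
    bracket Ω F F' = psign ((q + 1) * (q' + 1)) •
      (intF Ω (U 1 * U' 0) - intF Ω (U 0 * U' 1)) +
      psign (q' * (q + 1)) • traceF Ω (del Ω A * A') := by
  have k1 : ∀ (a b : Fin 2) (n : ℕ) (e : Fin n → HomField X),
      intL Ω (bshuffle (LinearMap.mul ℂ (PV X)) (U a).toFun (argSign (q' + 1) (U' b).toFun) n e) =
        psign ((q + 1) * (q' + 1)) * intF Ω (U a * U' b) n e := by
    intro a b n e
    rw [bshuffle_mul_argSign (hF'.parU b), argSign, map_smul, smul_eq_mul]
    change _ * intF Ω (U a * U' b) n e = _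
    by_cases h0 : intF Ω (U a * U' b) n e = 0
    · rw [h0, mul_zero, mul_zero]
    · rw [((hF.parU a).mul (hF'.parU b)).intF_parity ((hF.cptU a).mul_right _) n e h0]
      congr 2
      linear_combination zmod_two_sq (q' + 1) + (q' + 1) * (CharTwo.two_eq_zero : (2 : ZMod 2) = 0)
  have k2 : ∀ (n : ℕ) (e : Fin n → HomField X),
      traceL Ω (bshuffle (LinearMap.mul ℂ (PV X)) (del Ω A).toFun (argSign q' A'.toFun) n e) =
        psign (q' * (q + 1) + q') * traceF Ω (del Ω A * A') n e := by
    intro n e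
    rw [bshuffle_mul_argSign hF'.parA, argSign, map_smul, smul_eq_mul]
    change _ * traceF Ω (del Ω A * A') n e = _
    by_cases h0 : traceF Ω (del Ω A * A') n e = 0
    · rw [h0, mul_zero, mul_zero]
    · rw [(hF.parA.del.mul hF'.parA).traceF_parity (hF.cptA.del.mul_right _) n e h0]
      congr 2
      linear_combination zmod_two_sq q'
  rw [BCOV.bracket_eq _ _ (fun n e h => hF.snoc_eq h n e) fun n e h => hF'.cons_eq h n e]
  funext n e
  have s1 : ∀ {n : ℕ} (e : Fin n → HomField X) (a : Fin 2), toPV ((hF'.repL n e).1 a) =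
      argSign (q' + 1) (U' a).toFun n e := by
    intro n e a
    change psign _ • U' a n e = psign _ • U' a n e
    rw [add_mul, zmod_two_sq, ← add_one_mul]
  have s2 : ∀ {n : ℕ} (e : Fin n → HomField X), toPV (hF'.repL n e).2.1 =
      psign q' • argSign q' A'.toFun n e := by
    intro n e
    change psign _ • psign _ • A' n e = psign q' • psign _ • A' n e
    rw [smul_smul, smul_smul, ← psign_add, ← psign_add]
    congr 2
    linear_combination zmod_two_sq (tpar n e) +
      tpar n e * (CharTwo.two_eq_zero : (2 : ZMod 2) = 0)
  rw [bshuffle_apply]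
  simp only [poissonL_apply, poissonTensor_eq, s1, s2, mul_smul_comm, map_smul]
  simp only [Pi.add_apply, Pi.smul_apply, Pi.sub_apply, smul_eq_mul]
  have k3 := k2 n e
  rw [psign_add] at k3
  have k4 : psign q' * traceL Ω (bshuffle (LinearMap.mul ℂ (PV X)) (del Ω A).toFun
      (argSign q' A'.toFun) n e) = psign (q' * (q + 1)) * traceF Ω (del Ω A * A') n e := by
    rw [k3]
    linear_combination psign (q' * (q + 1)) * traceF Ω (del Ω A * A') n e * psign_mul_self q'
  rw [mul_sub, ← k1, ← k1, ← k4, bshuffle_apply, bshuffle_apply, bshuffle_apply]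
  simp only [map_sum, map_smul, smul_eq_mul, Finset.mul_sum, mul_add, mul_sub,
    Finset.sum_add_distrib, Finset.sum_sub_distrib]
  refine congrArg₂ (· + ·) rfl (Finset.sum_congr rfl fun S _ => ?_)
  rw [mul_left_comm]
  rfl

end Gradient


/-! ### The tautological functionals -/

section Tautological

variable {X : Type*} [TopologicalSpace X] [ChartedSpace V X]

namespace FunR

theorem HasPar.Gp_even {Φ : FunR X} (hΦ : HasPar 0 Φ) (p : ZMod 2) : Gp p Φ = Φ := by
  rw [hΦ.Gp_eq, mul_zero, psign_zero, one_smul]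

theorem HasPar.G_even {Φ : FunR X} (hΦ : HasPar 0 Φ) : G Φ = Φ := hΦ.Gp_even 1

theorem HasPar.G_odd {Φ : FunR X} (hΦ : HasPar 1 Φ) : G Φ = -Φ := by
  rw [hΦ, psign_one, neg_one_smul]

variable (X) in
/-- The component `φ_a` of the field, as a functional with values in polyvector fields. -/
def phiF (a : Fin 2) : FunR X := lin fun e => Fields.phi e.val a

variable (X) in
/-- The component `μ` of the field. -/
def muF : FunR X := lin fun e => Fields.mu e.val

variable (X) in
/-- The component `ν` of the field. -/
def nuF : FunR X := lin fun e => Fields.nu e.val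

theorem hasPar_phiF (a : Fin 2) : HasPar 0 (phiF X a) := hasPar_lin fun e => e.parityInv_phi a

theorem hasPar_muF : HasPar 0 (muF X) := hasPar_lin fun e => e.parityInv_mu

theorem hasPar_nuF : HasPar 0 (nuF X) := hasPar_lin fun e => e.parityInv_nu

theorem hasDeg_phiF (a : Fin 2) : HasDeg 0 (phiF X a) := hasDeg_lin fun _ => toPV_mem_deg _

theorem hasDeg_muF : HasDeg 1 (muF X) := hasDeg_lin fun _ => toPV_mem_deg _

theorem hasCpt_phiF (a : Fin 2) : HasCpt (phiF X a) := hasCpt_lin fun _ => toPV_mem_compact _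

theorem hasCpt_muF : HasCpt (muF X) := hasCpt_lin fun _ => toPV_mem_compact _

/-- The multilinear expressions of `∑ k, ν^k`. -/
def nuProd : Fn X (PV X)
  | 0, _ => 1
  | n + 1, e => Fields.nu (e 0).val * nuProd n (Fin.tail e)

variable (X) in
/-- The functional `∑ k, ν^k = 1 / (1 - ν)`. -/
def geo : FunR X := ⟨gradedSym nuProd⟩

theorem hasDeg_geo : HasDeg 0 (geo X) := by
  have key : ∀ n (e : Fin n → HomField X), nuProd n e ∈ PV.deg X 0 := by
    intro n
    induction n with
    | zero => exact fun e => PV.one_mem_deg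
    | succ n ih => exact fun e => PV.mul_mem_deg (i := 0) (j := 0) (toPV_mem_deg _) (ih _)
  exact fun n e => Submodule.sum_mem _ fun σ _ => Submodule.smul_mem _ _ (key _ _)

theorem hasPar_geo : HasPar 0 (geo X) := hasPar_iff.mpr fun n e => by
  have key : ∀ n (e : Fin n → HomField X), parityInv (nuProd n e) = psign (tpar n e) • nuProd n e := by
    intro n
    induction n with
    | zero => exact fun e => by rw [tpar_zero, psign_zero, one_smul]; exact parityInv_one
    | succ n ih =>
      intro e
      obtain ⟨h, e, rfl⟩ := exists_fcons e
      change parityInv (Fields.nu h.val * nuProd n e) = _ • (Fields.nu h.val * nuProd n e)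
      rw [parityInv_mul, ih, h.parityInv_nu, smul_mul_smul_comm, tpar_fcons, psign_add]
  have h1 : ∀ σ : Equiv.Perm (Fin n), tpar n (e ∘ σ) = tpar n e := fun σ =>
    Equiv.sum_comp σ fun i => (e i).par
  change parityInv (∑ σ : Equiv.Perm (Fin n), koszul σ e • nuProd n (e ∘ σ)) =
    _ • ∑ σ : Equiv.Perm (Fin n), koszul σ e • nuProd n (e ∘ σ)
  rw [map_sum, Finset.smul_sum]
  refine Finset.sum_congr rfl fun σ _ => ?_
  rw [map_smul, key, h1, zero_add, smul_comm]

theorem mul_apply_even {Φ Ψ : FunR X} (hΨ : HasPar 0 Ψ) (n : ℕ) (e : Fin n → HomField X) :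
    (Φ * Ψ) n e = bshuffle (LinearMap.mul ℂ (PV X)) Φ.toFun Ψ.toFun n e := by
  rw [mul_apply, bshuffle_apply]
  refine Finset.sum_congr rfl fun S _ => congrArg _ ?_
  have h1 := hΨ.apply _ (subfamily Sᶜ e)
  rcases zmod_two_cases (tpar _ (subfamily S e)) with h0 | h0 <;> rw [h0]
  · rw [zero_mul, psign_zero, one_smul]
    rfl
  · refine congrArg (Φ _ (subfamily S e) * ·) ?_
    change psign _ • parityInv _ = _
    rw [h1, smul_smul, one_mul, zero_add, psign_mul_self, one_smul]

theorem geo_eq : geo X = 1 + nuF X * geo X := ext' fun n e => by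
  rw [add_apply, mul_apply_even hasPar_geo]
  refine Eq.trans ?_ (congrArg _ (gradedSym_leftMul (LinearMap.mul ℂ (PV X)) n
    (fun e => Fields.nu e.val) nuProd e))
  cases n with
  | zero =>
    change gradedSym nuProd 0 e = 1 + gradedSym _ 0 e
    rw [gradedSym_zero, gradedSym_zero]
    exact (add_zero _).symm
  | succ n => exact (zero_add _).symm

variable [IsManifold 𝓘(ℂ, V) ω X]

theorem geo_mul : geo X * (1 - nuF X) = 1 := by
  rw [mul_sub, mul_one, hasPar_geo.commute, sub_eq_iff_eq_add]
  exact geo_eq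

theorem const_mul_Gp {p : ZMod 2} {a : PV X} (ha : parityInv a = psign p • a) (Φ : FunR X) :
    const a * Gp p Φ = Φ * const a := by
  rw [(hasPar_const ha).mul_comm, Gp_Gp, CharTwo.add_self_eq_zero]
  rfl

theorem ins_geo (h : HomField X) :
    ins h (geo X) = const (Fields.nu h.val) * (geo X * geo X) := by
  have h1 := ins_mul (1 - nuF X) (geo X) h
  rw [← hasPar_geo.commute, geo_mul, ins_one, map_sub, ins_one, zero_sub, nuF, ins_lin,
    hasPar_geo.Gp_even, neg_mul, eq_comm, neg_add_eq_zero] at h1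
  have h2 := congrArg (geo X * ·) h1
  rw [← mul_assoc (geo X) (1 - _), ← nuF, geo_mul, one_mul, hasPar_geo.commute, mul_assoc] at h2
  exact h2.symm

theorem symm_geo (n : ℕ) : SymmUpTo n (geo X) := by
  induction n with
  | zero => trivial
  | succ n ih =>
    refine ⟨fun h k => ?_, fun h => ?_⟩
    · have key : ∀ h k : HomField X, ins h (ins k (geo X)) = (2 : ℂ) •
          (const (Fields.nu k.val) * (const (Fields.nu h.val) * (geo X * geo X * geo X))) := by
        intro h k
        have h1 : Gp h.par (geo X * geo X) = geo X * geo X :=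
          (hasPar_geo.mul hasPar_geo).Gp_even _
        rw [ins_geo, ins_mul, ins_const, zero_mul, zero_add, ins_mul, hasPar_geo.Gp_even, ins_geo,
          hasPar_geo.commute (const _ * _)]
        simp only [mul_assoc, mul_add, two_smul]
      have h2 : const (Fields.nu k.val) * const (Fields.nu h.val) = psign (h.par * k.par) •
          (const (Fields.nu h.val) * const (Fields.nu k.val)) := by
        rw [(hasPar_const k.parityInv_nu).mul_comm, (hasPar_const h.parityInv_nu).Gp_eq,
          smul_mul_assoc, mul_comm]
      change (ins h (ins k (geo X))).toFun = (psign (h.par * k.par) • ins k (ins h (geo X))).toFun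
      rw [key, key, ← mul_assoc (const _), h2, ← mul_assoc (const _) (const _), smul_mul_assoc,
        smul_comm]
    · change SymmUpTo n (ins h (geo X))
      rw [ins_geo]
      exact (symm_const _ _).mul (ih.mul ih)

/-! ### Calculus with even functionals -/

variable (X) in
/-- The centre of the algebra of functionals; it contains the even functionals. -/
def Cen : Type _ := Subalgebra.center ℂ (FunR X)

instance : CommRing (Cen X) := inferInstanceAs (CommRing (Subalgebra.center ℂ (FunR X)))

instance : Algebra ℂ (Cen X) := inferInstanceAs (Algebra ℂ (Subalgebra.center ℂ (FunR X)))

instance : Algebra (Cen X) (FunR X) :=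
  RingHom.toAlgebra' (Subalgebra.val (Subalgebra.center ℂ (FunR X))).toRingHom fun c Φ =>
    (Subalgebra.mem_center_iff.mp c.2 Φ).symm

instance : IsScalarTower ℂ (Cen X) (FunR X) where
  smul_assoc s c Φ := smul_mul_assoc s c.1 Φ

theorem HasPar.exists_cen {Φ : FunR X} (hΦ : HasPar 0 Φ) :
    ∃ c : Cen X, (∀ Ψ, Φ * Ψ = c • Ψ) ∧ ∀ Ψ, Ψ * Φ = c • Ψ :=
  ⟨⟨Φ, Subalgebra.mem_center_iff.mpr fun Ψ => (hΦ.commute Ψ).symm⟩, fun _ => rfl,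
    fun Ψ => (hΦ.commute Ψ).symm⟩

theorem HasPar.mul_self_odd {Φ : FunR X} (hΦ : HasPar 1 Φ) : Φ * Φ = 0 := by
  have h1 := hΦ.anticommute hΦ
  rw [eq_neg_iff_add_eq_zero, ← two_smul ℂ] at h1
  exact (smul_eq_zero.mp h1).resolve_left two_ne_zero

variable {Ω : HolVolForm X} {Φ Ψ : FunR X}

theorem HasPar.br_mul_even {p : ZMod 2} (hΦ : HasPar p Φ) (hΨ : HasPar 0 Ψ) (Χ : FunR X) :
    br Ω Φ (Ψ * Χ) = br Ω Φ Ψ * Χ + Ψ * br Ω Φ Χ := by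
  rw [hΦ.br_mul, hΨ.Gp_even]

theorem HasPar.br_comm (hΦ : HasPar 0 Φ) (hΨ : HasPar 0 Ψ) : br Ω Φ Ψ = br Ω Ψ Φ := by
  rw [br, br, hΦ.G_even, hΨ.G_even, hΦ.commute Ψ, hΨ.commute (FunR.del Ω Φ), hΦ.commute (FunR.del Ω Ψ), sub_right_comm]

theorem HasPar.br {p q : ZMod 2} (hΦ : HasPar p Φ) (hΨ : HasPar q Ψ) :
    HasPar (p + q + 1) (br Ω Φ Ψ) := by
  have h1 := hΦ.del (Ω := Ω) |>.mul hΨ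
  have h2 := (hΦ.smul (psign p)).mul (hΨ.del (Ω := Ω))
  rw [add_right_comm] at h1
  rw [← add_assoc] at h2
  rw [FunR.br, hΦ]
  exact ((hΦ.mul hΨ).del.sub h1).sub h2

theorem br_eq (hΨ : HasDeg 0 Ψ) : FunR.br Ω Φ Ψ = del Ω (Φ * Ψ) - del Ω Φ * Ψ := by
  rw [FunR.br, hΨ.del_eq_zero, mul_zero, sub_zero]

theorem HasDeg.br_zero {i : ℕ} (hΦ : HasDeg (i + 1) Φ) (hΨ : HasDeg 0 Ψ) :
    HasDeg i (FunR.br Ω Φ Ψ) := by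
  rw [br_eq hΨ]
  exact HasDeg.sub (HasDeg.del (hΦ.mul hΨ)) (hΦ.del.mul hΨ)

theorem br_deg_zero (hΦ : HasDeg 0 Φ) (hΨ : HasDeg 0 Ψ) : FunR.br Ω Φ Ψ = 0 := by
  rw [br_eq hΨ, hΦ.del_eq_zero, zero_mul, sub_zero]
  exact (hΦ.mul hΨ).del_eq_zero

variable (Ω) in
/-- The derivation `{μ, -}`. -/
abbrev D : FunR X → FunR X := FunR.br Ω (muF X)

variable (Ω) in
/-- The divergence of `μ`. -/
abbrev divMu : FunR X := del Ω (muF X)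

theorem hasPar_divMu : HasPar 1 (divMu Ω) := hasPar_muF.del

theorem hasDeg_divMu : HasDeg 0 (divMu Ω) := HasDeg.del hasDeg_muF

theorem HasPar.D (hΦ : HasPar 0 Φ) : HasPar 1 (D Ω Φ) := hasPar_muF.br hΦ

theorem HasDeg.D (hΦ : HasDeg 0 Φ) : HasDeg 0 (D Ω Φ) := hasDeg_muF.br_zero hΦ

theorem D_mul (hΦ : HasPar 0 Φ) (Ψ : FunR X) :
    FunR.D Ω (Φ * Ψ) = FunR.D Ω Φ * Ψ + Φ * FunR.D Ω Ψ :=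
  hasPar_muF.br_mul_even hΦ Ψ

theorem del_muF_mul (Φ : FunR X) :
    del Ω (muF X * Φ) = FunR.D Ω Φ + divMu Ω * Φ + muF X * del Ω Φ := by
  rw [del_mul, hasPar_muF.G_even]

variable [T2Space X] [MeasurableSpace X] [BorelSpace X]

theorem totD_phiF (a : Fin 2) : totD Ω (phiF X a) = 0 := by
  rw [phiF, totD_lin Ω (α := fun e => Fields.phi e.val a) fun e => e.parityInv_phi a]
  refine ext' fun n e => ?_
  rcases n with _ | _ | n
  · rfl
  · exact sub_eq_zero.mpr (Q_phi Ω _ a).symm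
  · rfl

theorem totD_muF : totD Ω (muF X) = 0 := by
  rw [muF, totD_lin Ω (α := fun e => Fields.mu e.val) fun e => e.parityInv_mu]
  refine ext' fun n e => ?_
  rcases n with _ | _ | n
  · rfl
  · exact sub_eq_zero.mpr (Q_mu Ω _).symm
  · rfl

theorem totD_nuF : totD Ω (nuF X) = -divMu Ω := by
  rw [nuF, totD_lin Ω (α := fun e => Fields.nu e.val) fun e => e.parityInv_nu, divMu, muF, del, lift_lin]
  refine ext' fun n e => ?_
  rcases n with _ | _ | n
  · exact neg_zero.symm
  · change _ - Fields.nu (Q Ω (e 0)).val = -divL Ω _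
    rw [Q_nu]
    exact sub_add_cancel_left _ _
  · exact neg_zero.symm

theorem totD_geo : totD Ω (geo X) = -(divMu Ω * (geo X * geo X)) := by
  have h0 : totD Ω (1 : FunR X) = 0 := by
    have := totD_mul Ω (1 : FunR X) 1
    rwa [G_one, one_mul, mul_one, one_mul, eq_comm, add_eq_left] at this
  have h1 := totD_mul Ω (1 - nuF X) (geo X)
  rw [← hasPar_geo.commute, geo_mul, h0, map_sub, h0, totD_nuF, zero_sub, neg_neg,
    (hasPar_one.sub hasPar_nuF).G_even, eq_comm, add_comm, add_eq_zero_iff_eq_neg] at h1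
  have h2 := congrArg (geo X * ·) h1
  rw [← mul_assoc, geo_mul, one_mul, mul_neg, hasPar_geo.commute, mul_assoc] at h2
  exact h2

theorem totD_D {Φ : FunR X} (hd : HasDeg 0 Φ) (hΦ : totD Ω Φ = 0) :
    totD Ω (FunR.D Ω Φ) = 0 := by
  have h1 : totD Ω (divMu Ω) = 0 := by rw [totD_del, totD_muF, map_zero, neg_zero]
  rw [FunR.D, br_eq hd, map_sub, totD_del, totD_mul, totD_mul, hΦ, totD_muF, h1]
  simp

end FunR

end Tautological


/-! ### The classical master equation -/

section Master

variable {X : Type*} [TopologicalSpace X] [ChartedSpace V X] [IsManifold 𝓘(ℂ, V) ω X]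

namespace FunR

variable (Ω : HolVolForm X)

/-- The polyvector field `Ω⁻¹`, as a constant functional. -/
abbrev volF : FunR X := const (invVol Ω)

variable {Ω}

theorem hasPar_volF : HasPar 1 (volF Ω) :=
  hasPar_const ((parityInv_invVol Ω).trans (by rw [psign_one, neg_one_smul]))

theorem hasDeg_volF : HasDeg 3 (volF Ω) := hasDeg_const (invVol_mem_deg Ω)

theorem del_volF : del Ω (volF Ω) = 0 := by
  rw [del, lift_const, divL_invVol]
  exact ext' fun n e => by cases n <;> rfl

variable (Ω) in
/-- The derivation `α ↦ ∂ (Ω⁻¹ α)` on functionals with values in `PV^{0,•}`. -/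
abbrev E : FunR X → FunR X := FunR.br Ω (volF Ω)

theorem E_eq {α : FunR X} (hd : HasDeg 0 α) : E Ω α = del Ω (volF Ω * α) := by
  rw [E, br_eq hd, del_volF, zero_mul, sub_zero]

theorem HasPar.E {α : FunR X} (hα : HasPar 0 α) : HasPar 0 (E Ω α) := hasPar_volF.br hα

theorem HasDeg.E {α : FunR X} (hα : HasDeg 0 α) : HasDeg 2 (E Ω α) := hasDeg_volF.br_zero hα

theorem E_mul {α : FunR X} (hα : HasPar 0 α) (β : FunR X) :
    FunR.E Ω (α * β) = FunR.E Ω α * β + α * FunR.E Ω β :=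
  hasPar_volF.br_mul_even hα β

theorem br_zero_right (Φ : FunR X) : FunR.br Ω Φ (0 : FunR X) = 0 := by
  have := br_smul Ω 0 Φ (0 : FunR X)
  rwa [smul_zero, zero_smul] at this

/-- The bracket of `γ` with `E α E β = 0`. -/
theorem br_E_mul_E {α β γ : FunR X} (hα : HasPar 0 α) (hβ : HasPar 0 β) (hγ : HasPar 0 γ)
    (dα : HasDeg 0 α) (dβ : HasDeg 0 β) :
    FunR.br Ω (FunR.E Ω α) γ * FunR.E Ω β + FunR.br Ω (FunR.E Ω β) γ * FunR.E Ω α = 0 := by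
  have h1 : FunR.E Ω α * FunR.E Ω β = 0 := (dα.E.mul dβ.E).eq_zero le_rfl
  have h2 := hγ.br_mul_even (Ω := Ω) (hα.E (Ω := Ω)) (FunR.E Ω β)
  rw [h1, br_zero_right, hγ.br_comm hα.E, hγ.br_comm hβ.E, hα.E.commute] at h2
  exact h2.symm

/-- The divergence of `E (α β)` vanishes. -/
theorem br_E_add {α β : FunR X} (hα : HasPar 0 α) (hβ : HasPar 0 β)
    (dα : HasDeg 0 α) (dβ : HasDeg 0 β) :
    FunR.br Ω (FunR.E Ω α) β + FunR.br Ω (FunR.E Ω β) α = 0 := by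
  have h0 : ∀ {γ : FunR X}, HasDeg 0 γ → del Ω (FunR.E Ω γ) = 0 := fun hγ => by
    rw [E_eq hγ, del_del]
  have h1 := h0 (dα.mul dβ)
  rwa [E_mul hα, map_add, hα.commute, ← sub_zero (del Ω (FunR.E Ω α * β)), ← zero_mul β, ← h0 dα,
    ← br_eq dβ, ← sub_zero (del Ω (FunR.E Ω β * α)), h0 dα, zero_mul, ← zero_mul α, ← h0 dβ,
    ← br_eq dα, h0 dβ, zero_mul] at h1

theorem br_E_self {α : FunR X} (hα : HasPar 0 α) (dα : HasDeg 0 α) :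
    FunR.br Ω (FunR.E Ω α) α = 0 := by
  have h1 := br_E_add (Ω := Ω) hα hα dα dα
  rw [← two_smul ℂ] at h1
  exact (smul_eq_zero.mp h1).resolve_left two_ne_zero

/-- The part of fourth order in `φ` of the master equation: it vanishes before integration, because
products of two elements `E α`, `E β` of `PV^{2,•}` vanish. -/
theorem del_quadratic_mul {α β γ : FunR X} (hα : HasPar 0 α) (hβ : HasPar 0 β) (hγ : HasPar 0 γ)
    (dα : HasDeg 0 α) (dβ : HasDeg 0 β) (dγ : HasDeg 0 γ) :
    del Ω (FunR.E Ω (α * γ) * β - FunR.E Ω (β * γ) * α) *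
      (FunR.E Ω (α * γ) * β - FunR.E Ω (β * γ) * α) = 0 := by
  have e1 : FunR.E Ω (α * γ) * β - FunR.E Ω (β * γ) * α =
      FunR.E Ω α * (β * γ) - FunR.E Ω β * (α * γ) := by
    rw [E_mul hα, E_mul hβ, add_mul, add_mul, hβ.commute (FunR.E Ω γ), mul_assoc (FunR.E Ω γ),
      hα.commute (FunR.E Ω γ), mul_assoc (FunR.E Ω γ), hα.commute β, mul_assoc, mul_assoc,
      hγ.commute, hγ.commute, add_sub_add_right_eq_sub]
  have e2 : ∀ {α β : FunR X}, HasPar 0 α → HasPar 0 β → HasDeg 0 α → HasDeg 0 β →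
      del Ω (FunR.E Ω α * (β * γ)) = γ * FunR.br Ω (FunR.E Ω α) β +
        β * FunR.br Ω (FunR.E Ω α) γ := by
    intro α β hα hβ dα dβ
    rw [hγ.commute, ← hα.E.br_mul_even hβ, br_eq (dβ.mul dγ), E_eq dα, del_del, zero_mul, sub_zero]
  have s1 : ∀ {α β : FunR X}, HasPar 0 α → HasPar 0 β → HasDeg 0 α →
      FunR.br Ω (FunR.E Ω α) β * FunR.E Ω α = 0 := by
    intro α β hα hβ dα
    have h1 := br_E_mul_E (Ω := Ω) hα hα hβ dα dα
    rw [← two_smul ℂ] at h1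
    exact (smul_eq_zero.mp h1).resolve_left two_ne_zero
  have s2 : ∀ {α β : FunR X}, HasPar 0 α → HasPar 0 β → HasDeg 0 α → HasDeg 0 β →
      FunR.br Ω (FunR.E Ω α) β * FunR.E Ω β = 0 := by
    intro α β hα hβ dα dβ
    have h1 := br_E_mul_E (Ω := Ω) hα hβ hβ dα dβ
    rwa [br_E_self hβ dβ, zero_mul, add_zero] at h1
  have p1 := s1 hα hβ dα
  have p2 := s1 hβ hα dβ
  have p3 := s1 hα hγ dα
  have p4 := s1 hβ hγ dβ
  have p5 := s2 hα hβ dα dβ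
  have p6 := s2 hβ hα dβ dα
  have p7 := br_E_mul_E (Ω := Ω) hα hβ hγ dα dβ
  have hN : HasPar 0 (FunR.E Ω α * (β * γ) - FunR.E Ω β * (α * γ)) :=
    (hα.E.mul (hβ.mul hγ)).sub (hβ.E.mul (hα.mul hγ))
  rw [e1, ← hN.commute, map_sub, e2 hα hβ dα dβ, e2 hβ hα dβ dα]
  obtain ⟨a, a1, a2⟩ := (hα.E (Ω := Ω)).exists_cen
  obtain ⟨b, b1, b2⟩ := (hβ.E (Ω := Ω)).exists_cen
  obtain ⟨x, x1, -⟩ := hα.exists_cen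
  obtain ⟨y, y1, -⟩ := hβ.exists_cen
  obtain ⟨z, z1, -⟩ := hγ.exists_cen
  simp only [sub_mul, mul_assoc, smul_mul_assoc, a1, b1, x1, y1, z1]
  rw [a2] at p1 p3 p6
  rw [b2] at p2 p4 p5
  rw [a2, b2] at p7
  linear_combination (norm := module) (y * z * z) • p1 + (x * z * z) • p2 + (y * y * z) • p3 +
    (x * x * z) • p4 - (x * z * z) • p5 - (y * z * z) • p6 - (x * y * z) • p7

/-- The part of the master equation without `φ`, where `μ⁴ = 0` because of its degree. -/
theorem del_cubic_mul :
    (3 : ℂ) • (del Ω (muF X * (muF X * geo X)) * (muF X * (muF X * geo X))) =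
      (4 : ℂ) • (divMu Ω * (muF X * (muF X * (muF X * (geo X * geo X))))) := by
  have hμ := hasPar_muF (X := X)
  have hf := hasPar_geo (X := X)
  have h4 : muF X * (muF X * (muF X * muF X)) = 0 :=
    (hasDeg_muF.mul (hasDeg_muF.mul (hasDeg_muF.mul hasDeg_muF))).eq_zero le_rfl
  have k1 : FunR.br Ω (geo X) (muF X) = FunR.D Ω (geo X) := hf.br_comm hμ
  have h5 := congrArg (FunR.br Ω (geo X)) h4
  rw [hf.br_mul_even hμ, hf.br_mul_even hμ, hf.br_mul_even hμ, k1, br_zero_right] at h5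
  have h6 := congrArg (del Ω) h4
  rw [map_zero] at h6
  have h7 : del Ω (muF X * (muF X * geo X)) = FunR.D Ω (muF X) * geo X +
      muF X * FunR.D Ω (geo X) + divMu Ω * (muF X * geo X) +
      muF X * (FunR.D Ω (geo X) + divMu Ω * geo X) := by
    rw [del_muF_mul, del_muF_mul, D_mul hμ, hasDeg_geo.del_eq_zero, mul_zero, add_zero]
  rw [del_muF_mul, del_muF_mul, del_muF_mul, D_mul hμ, D_mul hμ] at h6
  rw [h7]
  obtain ⟨u, u1, u2⟩ := hμ.exists_cen
  obtain ⟨f, f1, f2⟩ := hf.exists_cen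
  simp only [add_mul, mul_add, u1, u2, f1, f2, smul_mul_assoc, mul_smul_comm] at h5 h6 ⊢
  have h8 : (4 : ℂ) • u • u • u • FunR.D Ω (geo X) = 0 := by
    linear_combination (norm := (match_scalars <;> (try simp only [map_ofNat]) <;> ring))
      h5
  have h9 : (2 : ℂ) • ((3 : ℂ) • u • u • FunR.D Ω (muF X) + (2 : ℂ) • u • u • u • divMu Ω) = 0 := by
    linear_combination (norm := (match_scalars <;> (try simp only [map_ofNat]) <;> ring))
      h6
  replace h8 := (smul_eq_zero.mp h8).resolve_left (by norm_num)
  replace h9 := (smul_eq_zero.mp h9).resolve_left two_ne_zero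
  linear_combination (norm := (match_scalars <;> (try simp only [map_ofNat]) <;> ring))
      (6 * f) • h8 + (f * f) • h9

/-! ### Integration by parts -/

variable [T2Space X] [MeasurableSpace X] [BorelSpace X]

theorem hasCpt_divMu : HasCpt (divMu Ω) := hasCpt_muF.del

theorem HasCpt.D {α : FunR X} (dα : HasDeg 0 α) : HasCpt (FunR.D Ω α) := by
  rw [FunR.D, br_eq dα]
  exact HasCpt.sub (hasCpt_muF.mul_right α).del (hasCpt_divMu.mul_right α)

theorem intF_D {α : FunR X} (dα : HasDeg 0 α) :
    intF Ω (FunR.D Ω α) = -intF Ω (divMu Ω * α) := by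
  have h1 := intF_del (Ω := Ω) (hasCpt_muF.mul_right α)
  rw [del_muF_mul, dα.del_eq_zero, mul_zero, add_zero, intF_add] at h1
  exact eq_neg_of_add_eq_zero_left h1

/-- The part of second order in `φ` of the bracket of the action with itself. -/
theorem traceF_cross {α β : FunR X} (hα : HasPar 0 α) (hβ : HasPar 0 β) (dα : HasDeg 0 α)
    (dβ : HasDeg 0 β) :
    traceF Ω (del Ω (muF X * (muF X * geo X)) * (FunR.E Ω α * β)) =
      (-2 : ℂ) • intF Ω (FunR.D Ω α * (FunR.D Ω β * geo X)) := by
  have hμ := hasPar_muF (X := X)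
  have hf := hasPar_geo (X := X)
  have dD : HasDeg 0 (FunR.D Ω β * geo X) := dβ.D.mul hasDeg_geo
  have h1 : del Ω (del Ω (muF X * (muF X * geo X)) * β) = (-2 : ℂ) •
      (FunR.D Ω (FunR.D Ω β * geo X) + divMu Ω * (FunR.D Ω β * geo X)) := by
    have e1 : FunR.br Ω (muF X * (muF X * geo X)) β =
        (2 : ℂ) • (muF X * (FunR.D Ω β * geo X)) := by
      rw [(hμ.mul (hμ.mul hf)).br_comm hβ, hβ.br_mul_even hμ, hβ.br_mul_even hμ,
        br_deg_zero dβ hasDeg_geo, hβ.br_comm hμ]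
      obtain ⟨u, u1, u2⟩ := hμ.exists_cen
      obtain ⟨f, f1, f2⟩ := hf.exists_cen
      simp only [u1, f2, mul_smul_comm, two_smul]
      module
    have e2 : del Ω (muF X * (muF X * geo X)) * β =
        del Ω (muF X * (muF X * geo X) * β) - (2 : ℂ) • (muF X * (FunR.D Ω β * geo X)) := by
      rw [← e1, br_eq dβ, sub_sub_cancel]
    rw [e2, map_sub, del_del, map_smul, del_muF_mul, dD.del_eq_zero, mul_zero, add_zero]
    module
  have hQ : HasPar 1 (del Ω (muF X * (muF X * geo X)) * β) :=
    (hμ.mul (hμ.mul hf)).del.mul hβ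
  have cQ : HasCpt (del Ω (muF X * (muF X * geo X)) * β) :=
    (hasCpt_muF.mul_right _).del.mul_right _
  have h2 := traceF_del_mul (Ω := Ω) (Ψ := volF Ω * α) (Or.inl cQ)
  rw [hQ.G_odd, neg_mul, traceF_neg, ← E_eq dα, (show HasPar 0 _ from hQ.del).commute, mul_assoc,
    ← intF_eq, h1] at h2
  have h3 := intF_D (Ω := Ω) (dα.mul dD)
  rw [D_mul hα, intF_add] at h3
  rw [mul_smul_comm, mul_add, intF_smul, intF_add, ← mul_assoc α (divMu Ω), hα.commute (divMu Ω),
    mul_assoc (divMu Ω)] at h2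
  rw [← hβ.commute, ← mul_assoc]
  linear_combination (norm := module) h2 + (2 : ℂ) • h3

variable (X Ω) in
/-- The part of the action of second order in `φ` is `-½ ∫ Y / (1 - ν) ∧ Ω`. -/
def quadF : FunR X := phiF X 0 * D Ω (phiF X 1) - phiF X 1 * D Ω (phiF X 0)

variable (X Ω) in
/-- Up to sign and a factor `½`, the derivative of the action with respect to `φ_0` or `φ_1`. -/
def gradF (a : Fin 2) : FunR X :=
  D Ω (phiF X a) * geo X + D Ω (phiF X a * geo X) + divMu Ω * (phiF X a * geo X)

variable (X Ω) in
/-- Up to a factor `½`, the derivative of the part of the action of second order in `φ` with respect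
to `μ`. -/
def crossF : FunR X :=
  E Ω (phiF X 0 * geo X) * phiF X 1 - E Ω (phiF X 1 * geo X) * phiF X 0

theorem hasPar_quadF : HasPar 1 (quadF X Ω) :=
  HasPar.sub ((hasPar_phiF 0).mul (hasPar_phiF 1).D) ((hasPar_phiF 1).mul (hasPar_phiF 0).D)

theorem hasPar_gradF (a : Fin 2) : HasPar 1 (gradF X Ω a) :=
  HasPar.add (HasPar.add ((hasPar_phiF a).D.mul hasPar_geo) ((hasPar_phiF a).mul hasPar_geo).D)
    (hasPar_divMu.mul ((hasPar_phiF a).mul hasPar_geo))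

theorem hasPar_crossF : HasPar 0 (crossF X Ω) :=
  have h := fun a => ((hasPar_phiF (X := X) a).mul hasPar_geo).E (Ω := Ω)
  HasPar.sub ((h 0).mul (hasPar_phiF 1)) ((h 1).mul (hasPar_phiF 0))

theorem hasDeg_phiF_mul_geo (a : Fin 2) : HasDeg 0 (phiF X a * geo X) :=
  (hasDeg_phiF a).mul hasDeg_geo

/-- The part of the bracket of the action with itself that comes from the derivatives in the
directions of `φ`. -/
theorem gradF_mul_gradF : gradF X Ω 0 * gradF X Ω 1 = (2 : ℂ) •
    (D Ω (phiF X 0 * geo X) * (D Ω (phiF X 1) * geo X) -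
      D Ω (phiF X 1 * geo X) * (D Ω (phiF X 0) * geo X)) -
      (2 : ℂ) • (quadF X Ω * (divMu Ω * (geo X * geo X))) := by
  have h0 := (hasPar_phiF (X := X) 0)
  have h1 := (hasPar_phiF (X := X) 1)
  have hf := hasPar_geo (X := X)
  obtain ⟨x, x1, x2⟩ := h0.exists_cen
  obtain ⟨y, y1, y2⟩ := h1.exists_cen
  obtain ⟨f, f1, f2⟩ := hf.exists_cen
  have d0 := h0.D (Ω := Ω)
  have d1 := h1.D (Ω := Ω)
  have df := hf.D (Ω := Ω)
  have dm := hasPar_divMu (Ω := Ω)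
  rw [gradF, gradF, quadF, D_mul h0, D_mul h1]
  simp only [x1, y1, f1, f2, add_mul, mul_add, sub_mul,
    mul_sub, smul_mul_assoc, mul_smul_comm, d1.anticommute d0, dm.anticommute d0,
    dm.anticommute d1, df.anticommute d0, df.anticommute d1, df.anticommute dm, d0.mul_self_odd,
    d1.mul_self_odd, df.mul_self_odd, dm.mul_self_odd]
  match_scalars <;> (try simp only [map_ofNat]) <;> ring

/-- The part of the bracket of the action with itself that comes from the derivative in the direction
of `μ`. -/
theorem traceF_del_add_mul :
    traceF Ω (del Ω (muF X * (muF X * geo X) + crossF X Ω) *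
      (muF X * (muF X * geo X) + crossF X Ω)) =
    (4 / 3 : ℂ) • traceF Ω (divMu Ω * (muF X * (muF X * (muF X * (geo X * geo X))))) -
      (4 : ℂ) • intF Ω (D Ω (phiF X 0 * geo X) * (D Ω (phiF X 1) * geo X) -
      D Ω (phiF X 1 * geo X) * (D Ω (phiF X 0) * geo X)) := by
  have h0 := (hasPar_phiF (X := X) 0)
  have h1 := (hasPar_phiF (X := X) 1)
  have hf := hasPar_geo (X := X)
  have e1 := traceF_cross (Ω := Ω) (h0.mul hf) h1 (hasDeg_phiF_mul_geo 0) (hasDeg_phiF 1)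
  have e2 := traceF_cross (Ω := Ω) (h1.mul hf) h0 (hasDeg_phiF_mul_geo 1) (hasDeg_phiF 0)
  have e3 := congrArg (traceF Ω) (del_cubic_mul (Ω := Ω))
  have e4 := del_quadratic_mul (Ω := Ω) h0 h1 hf (hasDeg_phiF 0) (hasDeg_phiF 1) hasDeg_geo
  have e5 : traceF Ω (del Ω (crossF X Ω) * (muF X * (muF X * geo X))) =
      traceF Ω (del Ω (muF X * (muF X * geo X)) * crossF X Ω) := by
    rw [traceF_del_mul (Or.inr (hasCpt_muF.mul_right _)), hasPar_crossF.G_even,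
      hasPar_crossF.commute]
  have e6 : traceF Ω (del Ω (muF X * (muF X * geo X)) * crossF X Ω) = (-2 : ℂ) •
      intF Ω (D Ω (phiF X 0 * geo X) * (D Ω (phiF X 1) * geo X) -
      D Ω (phiF X 1 * geo X) * (D Ω (phiF X 0) * geo X)) := by
    rw [crossF, mul_sub, traceF_sub, e1, e2, intF_sub, smul_sub]
  change del Ω (crossF X Ω) * crossF X Ω = 0 at e4
  rw [map_add, mul_add, add_mul, add_mul, e4, add_zero, traceF_add, traceF_add, e5, e6]
  rw [traceF_smul, traceF_smul] at e3
  linear_combination (norm := module) (1 / 3 : ℂ) • e3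

end FunR

end Master


/-! ### The gradient of the action -/

section Gradients

variable {X : Type*} [TopologicalSpace X] [ChartedSpace V X] [IsManifold 𝓘(ℂ, V) ω X]
  [T2Space X] [MeasurableSpace X] [BorelSpace X] {Ω : HolVolForm X}

namespace FunR

theorem SymmUpTo.D {n : ℕ} {α : FunR X} (hα : SymmUpTo n α) (dα : HasDeg 0 α) :
    SymmUpTo n (FunR.D Ω α) := by
  have h1 : FunR.D Ω α = del Ω (muF X * α) + (-1 : ℂ) • (divMu Ω * α) := by
    rw [FunR.D, br_eq dα, neg_one_smul, sub_eq_add_neg]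
  rw [h1]
  exact (((symm_lin _ n).mul hα).lift _).add (((symm_lin _ n).lift _).mul hα |>.smul _)

/-- The first variation of `∫ φ_a {μ, φ_b} / (1 - ν) ∧ Ω`. -/
theorem intF_ins_quad (a b : Fin 2) (h : HomField X) :
    intF Ω (ins h (phiF X a * (D Ω (phiF X b) * geo X))) =
      intF Ω (const (Fields.phi h.val a) * Gp h.par (D Ω (phiF X b) * geo X)) -
      intF Ω (const (Fields.phi h.val b) *
        Gp h.par (D Ω (phiF X a * geo X) + divMu Ω * (phiF X a * geo X))) +
      traceF Ω (const (Fields.mu h.val) * Gp h.par (del Ω (volF Ω * (phiF X a * phiF X b * geo X)) -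
        E Ω (phiF X a * geo X) * phiF X b)) +
      traceF Ω (const (Fields.nu h.val) *
        Gp h.par (volF Ω * (phiF X a * (D Ω (phiF X b) * (geo X * geo X))))) := by
  have ha := hasPar_phiF (X := X) a
  have hb := hasPar_phiF (X := X) b
  have hf := hasPar_geo (X := X)
  have e1 : ins h (phiF X a) = const (Fields.phi h.val a) := ins_lin _ h
  have e2 : ins h (phiF X b) = const (Fields.phi h.val b) := ins_lin _ h
  have e3 : ins h (muF X) = const (Fields.mu h.val) := ins_lin _ h
  rw [const_mul_Gp (h.parityInv_phi b), const_mul_Gp h.parityInv_mu, const_mul_Gp h.parityInv_nu,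
    ins_mul, ins_mul, ins_br, hf.Gp_even, hb.Gp_even, ins_geo, e1, e2, e3]
  generalize hx : const (Fields.phi h.val b) = x
  generalize hy : const (Fields.mu h.val) = y
  generalize hz : const (Fields.nu h.val) = z
  have dx : HasDeg 0 x := hx ▸ hasDeg_const (toPV_mem_deg _)
  have cy : HasCpt y := hy ▸ hasCpt_const (toPV_mem_compact _)
  have e4 : ∀ {w : FunR X} (_ : HasPar 0 w) (_ : HasDeg 0 w) {β : FunR X}, HasCpt β →
      intF Ω (w * del Ω β) = -traceF Ω (E Ω w * β) := by
    intro w hw dw β cβ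
    have h1 := traceF_del_mul (Ω := Ω) (Φ := volF Ω * w) (Or.inr cβ)
    have h2 : HasPar 1 (volF Ω * w) := hasPar_volF.mul hw
    rw [h2.G_odd, neg_mul, traceF_neg, mul_assoc, ← intF_eq, ← E_eq dw] at h1
    rw [h1, neg_neg]
  have e5 := intF_D (Ω := Ω) (α := phiF X a * geo X * x) ((hasDeg_phiF_mul_geo a).mul dx)
  rw [D_mul (ha.mul hf), intF_add] at e5
  have e6 := e4 (ha.mul hf) (hasDeg_phiF_mul_geo a) (cy.mul_right (phiF X b))
  have e7 := e4 ((ha.mul hb).mul hf) (((hasDeg_phiF a).mul (hasDeg_phiF b)).mul hasDeg_geo) cy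
  rw [E_eq (((hasDeg_phiF a).mul (hasDeg_phiF b)).mul hasDeg_geo)] at e7
  have e8 : phiF X a * ((FunR.br Ω y (phiF X b) + FunR.br Ω (muF X) x) * geo X +
      FunR.D Ω (phiF X b) * (z * (geo X * geo X))) =
      phiF X a * geo X * del Ω (y * phiF X b) - phiF X a * phiF X b * geo X * del Ω y +
      phiF X a * geo X * FunR.D Ω x + phiF X a * (FunR.D Ω (phiF X b) * (geo X * geo X)) * z := by
    rw [br_eq (Φ := y) (hasDeg_phiF b)]
    obtain ⟨u, u1, u2⟩ := ha.exists_cen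
    obtain ⟨v, v1, v2⟩ := hb.exists_cen
    obtain ⟨f, f1, f2⟩ := hf.exists_cen
    have k1 : ∀ w, phiF X a * geo X * w = u • f • w := fun w => by rw [mul_assoc, u1, f1]
    have k2 : ∀ w, phiF X a * phiF X b * geo X * w = u • v • f • w := fun w => by
      rw [mul_assoc, mul_assoc, u1, v1, f1]
    have k3 : ∀ w, w * (geo X * geo X) = f • f • w := fun w => by rw [← mul_assoc, f2, f2]
    rw [k1, k1, k2, u1, u1, k3, k3, f2, mul_smul_comm, mul_smul_comm, smul_mul_assoc,
      smul_mul_assoc, smul_mul_assoc, v2 (del Ω y)]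
    module
  rw [intF_add, e8, intF_add, intF_add, intF_sub, e6, e7, sub_mul, traceF_sub, add_mul, intF_add,
    mul_assoc (FunR.E Ω _) (phiF X b), hb.commute, mul_assoc (volF Ω) _ z, ← intF_eq,
    mul_assoc (divMu Ω)]
  linear_combination (norm := module) e5

variable (Ω) in
/-- The action `∫ (-½ Y / (1 - ν)) ∧ Ω + Tr (⅙ μ³ / (1 - ν))`, before integration. -/
def actF : FunR X := (-1 / 2 : ℂ) • (volF Ω * (quadF X Ω * geo X)) +
  (1 / 6 : ℂ) • (muF X * (muF X * (muF X * geo X)))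

theorem hasPar_actF : HasPar 0 (actF Ω) :=
  HasPar.add ((hasPar_volF.mul (hasPar_quadF.mul hasPar_geo)).smul _)
    ((hasPar_muF.mul (hasPar_muF.mul (hasPar_muF.mul hasPar_geo))).smul _)

theorem quadF_mul (Φ : FunR X) : quadF X Ω * Φ =
    phiF X 0 * (D Ω (phiF X 1) * Φ) - phiF X 1 * (D Ω (phiF X 0) * Φ) := by
  rw [quadF, sub_mul, mul_assoc, mul_assoc]

theorem hasCpt_quadF : HasCpt (quadF X Ω) :=
  HasCpt.sub ((hasCpt_phiF 0).mul_right _) ((hasCpt_phiF 1).mul_right _)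

theorem hasDeg_quadF : HasDeg 0 (quadF X Ω) :=
  HasDeg.sub ((hasDeg_phiF 0).mul (hasDeg_phiF 1).D) ((hasDeg_phiF 1).mul (hasDeg_phiF 0).D)

theorem hasCpt_actF : HasCpt (actF Ω) :=
  HasCpt.add (((hasCpt_quadF.mul_right _).mul_left _).smul _) ((hasCpt_muF.mul_right _).smul _)

theorem symm_actF (n : ℕ) : SymmUpTo n (actF Ω) := by
  have h1 : ∀ a b, SymmUpTo n (phiF X a * D Ω (phiF X b)) := fun a b =>
    (symm_lin _ n).mul (SymmUpTo.D (symm_lin _ n) (hasDeg_phiF b))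
  have h2 : quadF X Ω = phiF X 0 * D Ω (phiF X 1) + (-1 : ℂ) • (phiF X 1 * D Ω (phiF X 0)) := by
    rw [quadF, neg_one_smul, sub_eq_add_neg]
  have h3 : SymmUpTo n (quadF X Ω) := by
    rw [h2]
    exact (h1 0 1).add ((h1 1 0).smul _)
  exact (((symm_const _ n).mul (h3.mul (symm_geo n))).smul _).add
    (((symm_lin _ n).mul ((symm_lin _ n).mul ((symm_lin _ n).mul (symm_geo n)))).smul _)

end FunR

open FunR

theorem hasGrad_action : HasGrad Ω 0 (traceF Ω (actF Ω))
    ![(-1 / 2 : ℂ) • gradF X Ω 1, (1 / 2 : ℂ) • gradF X Ω 0]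
    ((1 / 2 : ℂ) • (muF X * (muF X * geo X) + crossF X Ω))
    ((-1 / 2 : ℂ) • (volF Ω * (quadF X Ω * (geo X * geo X))) +
      (1 / 6 : ℂ) • (muF X * (muF X * (muF X * (geo X * geo X))))) where
  symm n := (symm_actF n).map (traceL Ω)
  parity n e h := hasPar_actF.traceF_parity hasCpt_actF n e h
  ins_eq h := by
    have hμ := hasPar_muF (X := X)
    have hf := hasPar_geo (X := X)
    have e1 : FunR.ins h (muF X) = const (Fields.mu h.val) := ins_lin _ h
    have e2 : FunR.ins h (muF X * (muF X * (muF X * geo X))) =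
        (3 : ℂ) • (const (Fields.mu h.val) * (muF X * (muF X * geo X))) +
        const (Fields.nu h.val) * (muF X * (muF X * (muF X * (geo X * geo X)))) := by
      rw [FunR.ins_mul, FunR.ins_mul, FunR.ins_mul, (hμ.mul (hμ.mul hf)).Gp_even, (hμ.mul hf).Gp_even,
        hf.Gp_even, ins_geo, e1]
      obtain ⟨u, u1, u2⟩ := hμ.exists_cen
      obtain ⟨f, f1, f2⟩ := hf.exists_cen
      generalize const (Fields.mu h.val) = y
      generalize const (Fields.nu h.val) = z
      simp only [u1, u2, f2, mul_smul_comm, smul_mul_assoc, mul_add, smul_add, ← mul_assoc]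
      match_scalars <;> (try simp only [map_ofNat]) <;> ring
    have hf' := hμ.mul hf
    have hff := hf.mul hf
    have e3 : FunR.ins h (volF Ω * (quadF X Ω * geo X)) = volF Ω * FunR.ins h (quadF X Ω * geo X) := by
      rw [FunR.ins_mul, FunR.ins_const, zero_mul, zero_add]
    have e4 := intF_ins_quad (Ω := Ω) 0 1 h
    have e5 := intF_ins_quad (Ω := Ω) 1 0 h
    rw [(hasPar_phiF (X := X) 1).commute (phiF X 0)] at e5
    rw [FunR.ins_traceF, actF, map_add, map_smul, map_smul, e2, e3, traceF_add, traceF_smul, ← intF_eq,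
      quadF_mul, quadF_mul, map_sub, intF_sub, e4, e5]
    simp only [Matrix.cons_val_zero, Matrix.cons_val_one, gradF, crossF, map_add, map_sub, map_smul,
      mul_add, mul_sub, mul_smul_comm, smul_add, smul_sub, traceF_add, traceF_sub, traceF_smul,
      intF_add, intF_sub, intF_smul, (hμ.mul hf').Gp_even, (hμ.mul (hμ.mul (hμ.mul hff))).Gp_even]
    module
  parU := Fin.forall_fin_two.mpr ⟨(hasPar_gradF 1).smul _, (hasPar_gradF 0).smul _⟩
  parA := ((hasPar_muF.mul (hasPar_muF.mul hasPar_geo)).add hasPar_crossF).smul _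
  parB := ((hasPar_volF.mul (hasPar_quadF.mul (hasPar_geo.mul hasPar_geo))).smul _).add
    ((hasPar_muF.mul (hasPar_muF.mul (hasPar_muF.mul (hasPar_geo.mul hasPar_geo)))).smul _)
  degU := by
    have key : ∀ a, HasDeg 0 (gradF X Ω a) := fun a => HasDeg.add (HasDeg.add
      ((hasDeg_phiF a).D.mul hasDeg_geo) (hasDeg_phiF_mul_geo a).D)
      (hasDeg_divMu.mul (hasDeg_phiF_mul_geo a))
    exact Fin.forall_fin_two.mpr ⟨(key 1).smul _, (key 0).smul _⟩
  degA := (HasDeg.add (hasDeg_muF.mul (hasDeg_muF.mul hasDeg_geo))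
    (HasDeg.sub ((hasDeg_phiF_mul_geo 0).E.mul (hasDeg_phiF 1))
      ((hasDeg_phiF_mul_geo 1).E.mul (hasDeg_phiF 0)))).smul _
  degB := HasDeg.add ((hasDeg_volF.mul (hasDeg_quadF.mul (hasDeg_geo.mul hasDeg_geo))).smul _)
    ((hasDeg_muF.mul (hasDeg_muF.mul (hasDeg_muF.mul (hasDeg_geo.mul hasDeg_geo)))).smul _)
  cptU := by
    have key : ∀ a, HasCpt (gradF X Ω a) := fun a => HasCpt.add (HasCpt.add
      ((HasCpt.D (hasDeg_phiF a)).mul_right _) (HasCpt.D (hasDeg_phiF_mul_geo a)))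
      (hasCpt_divMu.mul_right _)
    exact Fin.forall_fin_two.mpr ⟨(key 1).smul _, (key 0).smul _⟩
  cptA := (HasCpt.add (hasCpt_muF.mul_right _)
    (HasCpt.sub ((hasCpt_phiF 1).mul_left _) ((hasCpt_phiF 0).mul_left _))).smul _
  cptB := HasCpt.add (((hasCpt_quadF.mul_right _).mul_left _).smul _)
    ((hasCpt_muF.mul_right _).smul _)

theorem qdual_action : qdual Ω (traceF Ω (actF Ω)) =
    (1 / 2 : ℂ) • intF Ω (quadF X Ω * (divMu Ω * (geo X * geo X))) -
      (1 / 6 : ℂ) • traceF Ω (divMu Ω * (muF X * (muF X * (muF X * (geo X * geo X))))) := by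
  have hμ := hasPar_muF (X := X)
  have hm := hasPar_divMu (X := X) (Ω := Ω)
  have h1 : totD Ω (quadF X Ω) = 0 := by
    have h : ∀ a, totD Ω (FunR.D Ω (phiF X a)) = 0 := fun a => totD_D (hasDeg_phiF a) (totD_phiF a)
    simp only [quadF, map_sub, totD_mul, totD_phiF, h, zero_mul, mul_zero, add_zero, sub_zero]
  have h2 : totD Ω (volF Ω) = 0 := totD_const Ω (dbarL_invVol Ω)
  have h3 : muF X * (muF X * (muF X * (divMu Ω * (geo X * geo X)))) =
      divMu Ω * (muF X * (muF X * (muF X * (geo X * geo X)))) := by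
    have h : ∀ Ψ, muF X * (divMu Ω * Ψ) = divMu Ω * (muF X * Ψ) := fun Ψ => by
      rw [← mul_assoc, hμ.commute, mul_assoc]
    rw [h, h, h]
  rw [hasPar_actF.qdual_traceF hasCpt_actF, psign_zero, one_smul, actF, map_add, map_smul, map_smul,
    totD_mul, totD_mul, totD_mul, totD_mul, totD_mul, totD_muF, totD_geo, h1, h2, hμ.G_even,
    hasPar_volF.G_odd, hasPar_quadF.G_odd]
  simp only [zero_mul, zero_add, neg_mul, mul_neg, neg_neg, h3, traceF_add, traceF_smul, traceF_neg,
    ← intF_eq]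
  module

/-- The classical master equation. -/
theorem masterEquation : (2 : ℂ) • qdual Ω (traceF Ω (actF Ω)) +
    bracket Ω (traceF Ω (actF Ω)) (traceF Ω (actF Ω)) = 0 := by
  have h1 : psign ((0 + 1) * (0 + 1)) = -1 := by rw [zero_add, mul_one, psign_one]
  have h2 := congrArg (intF Ω) (gradF_mul_gradF (X := X) (Ω := Ω))
  have h3 := traceF_del_add_mul (X := X) (Ω := Ω)
  have h4 : gradF X Ω 1 * gradF X Ω 0 = -(gradF X Ω 0 * gradF X Ω 1) :=
    (hasPar_gradF 1).anticommute (hasPar_gradF 0)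
  rw [intF_sub, intF_smul, intF_smul] at h2
  rw [hasGrad_action.bracket_eq hasGrad_action, qdual_action, h1, zero_mul, psign_zero]
  simp only [Matrix.cons_val_zero, Matrix.cons_val_one, map_smul, smul_mul_assoc, mul_smul_comm, h4,
    traceF_smul, intF_smul, intF_neg, h2, h3]
  module

end Gradients


/-! ### The Hamiltonians of `sl₂` -/

section Hamiltonians

variable {X : Type*} [TopologicalSpace X] [ChartedSpace V X] [IsManifold 𝓘(ℂ, V) ω X]
  [T2Space X] [MeasurableSpace X] [BorelSpace X] {Ω : HolVolForm X}

open FunR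

variable (X) in
/-- The quadratic expression `½ (p φ_0² + 2 q φ_0 φ_1 + r φ_1²)`. -/
def hamF (p q r : ℂ) : FunR X := (p / 2) • (phiF X 0 * phiF X 0) + q • (phiF X 0 * phiF X 1) +
  (r / 2) • (phiF X 1 * phiF X 1)

variable (X) in
/-- The gradient of `hamF X p q r`. -/
def hamGrad (p q r : ℂ) : Fin 2 → FunR X :=
  ![p • phiF X 0 + q • phiF X 1, q • phiF X 0 + r • phiF X 1]

variable (p q r : ℂ)

theorem hasPar_hamF : HasPar 0 (hamF X p q r) :=
  have h := fun a b => (hasPar_phiF (X := X) a).mul (hasPar_phiF b)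
  HasPar.add (HasPar.add ((h 0 0).smul _) ((h 0 1).smul _)) ((h 1 1).smul _)

theorem hasCpt_hamF : HasCpt (hamF X p q r) :=
  have h := fun a b => (hasCpt_phiF (X := X) a).mul_right (phiF X b)
  HasCpt.add (HasCpt.add ((h 0 0).smul _) ((h 0 1).smul _)) ((h 1 1).smul _)

theorem hasGrad_hamF : HasGrad Ω 1 (intF Ω (hamF X p q r)) (hamGrad X p q r) 0 0 where
  symm n := by
    have h : ∀ a b, SymmUpTo n (phiF X a * phiF X b) := fun a b => (symm_lin _ n).mul (symm_lin _ n)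
    exact ((((h 0 0).smul _).add ((h 0 1).smul _)).add ((h 1 1).smul _)).map (intL Ω)
  parity n e h := by
    rw [(hasPar_hamF p q r).intF_parity (hasCpt_hamF p q r) n e h, zero_add]
  ins_eq h := by
    have h1 : ∀ a b, FunR.ins h (phiF X a * phiF X b) =
        const (Fields.phi h.val a) * phiF X b + const (Fields.phi h.val b) * phiF X a := by
      intro a b
      have e : ∀ a, FunR.ins h (phiF X a) = const (Fields.phi h.val a) := fun a => ins_lin _ h
      rw [FunR.ins_mul, (hasPar_phiF b).Gp_even, e, e, (hasPar_phiF a).commute (const _)]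
    have h2 : ∀ a, Gp h.par (phiF X a) = phiF X a := fun a => (hasPar_phiF a).Gp_even _
    rw [ins_intF, hamF]
    simp only [hamGrad, map_add, map_smul, h1, h2,
      Matrix.cons_val_zero, Matrix.cons_val_one, mul_add, mul_smul_comm, intF_add, intF_smul,
      map_zero, mul_zero, traceF_zero, add_zero]
    module
  parU a := by
    have h := fun a => hasPar_phiF (X := X) a
    fin_cases a <;> exact ((h 0).smul _).add ((h 1).smul _)
  parA := (map_zero G).trans (smul_zero _).symm
  parB := (map_zero G).trans (smul_zero _).symm
  degU a := by
    have h := fun a => hasDeg_phiF (X := X) a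
    fin_cases a <;> exact ((h 0).smul _).add ((h 1).smul _)
  degA := fun _ _ => Submodule.zero_mem _
  degB := fun _ _ => Submodule.zero_mem _
  cptU a := by
    have h := fun a => hasCpt_phiF (X := X) a
    fin_cases a <;> exact ((h 0).smul _).add ((h 1).smul _)
  cptA := fun _ _ => Submodule.zero_mem _
  cptB := fun _ _ => Submodule.zero_mem _

theorem qdual_hamF : qdual Ω (intF Ω (hamF X p q r)) = 0 := by
  have h2 : totD Ω (volF Ω) = 0 := totD_const Ω (dbarL_invVol Ω)
  rw [intF_eq, (hasPar_volF.mul (hasPar_hamF p q r)).qdual_traceF ((hasCpt_hamF p q r).mul_left _),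
    totD_mul, h2, hamF]
  simp only [map_add, map_smul, totD_mul, totD_phiF, zero_mul, mul_zero, smul_zero, add_zero,
    traceF_zero]

/-- The variation of the action along `φ_a ↦ φ_b`, symmetrized in `a` and `b`, is a divergence. -/
theorem intF_gradF_mul (a b : Fin 2) :
    intF Ω (gradF X Ω a * phiF X b) + intF Ω (gradF X Ω b * phiF X a) = 0 := by
  have ha := hasPar_phiF (X := X) a
  have hb := hasPar_phiF (X := X) b
  have hf := hasPar_geo (X := X)
  have h1 := intF_D (Ω := Ω) (((hasDeg_phiF a).mul (hasDeg_phiF b)).mul hasDeg_geo)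
  have h2 : gradF X Ω a * phiF X b + gradF X Ω b * phiF X a =
      (2 : ℂ) • (FunR.D Ω (phiF X a * phiF X b * geo X) +
        divMu Ω * (phiF X a * phiF X b * geo X)) := by
    obtain ⟨u, u1, u2⟩ := ha.exists_cen
    obtain ⟨v, v1, v2⟩ := hb.exists_cen
    obtain ⟨f, f1, f2⟩ := hf.exists_cen
    rw [gradF, gradF, D_mul ha, D_mul hb, D_mul (ha.mul hb), D_mul ha]
    simp only [u1, u2, v1, v2, f1, f2, add_mul, mul_add, smul_add, smul_mul_assoc, mul_smul_comm]
    match_scalars <;> (try simp only [map_ofNat]) <;> ring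
  rw [← intF_add, h2, intF_smul, intF_add, h1, neg_add_cancel, smul_zero]

/-- `ω` and `Ĩ` are invariant under `sl₂`: the variation of `Ĩ` along the vector field of a
Hamiltonian is the integral of a divergence. -/
theorem bracket_action_hamF : bracket Ω (traceF Ω (actF Ω)) (intF Ω (hamF X p q r)) = 0 := by
  have h00 := intF_gradF_mul (X := X) (Ω := Ω) 0 0
  have h01 := intF_gradF_mul (X := X) (Ω := Ω) 0 1
  have h11 := intF_gradF_mul (X := X) (Ω := Ω) 1 1
  have h1 : psign ((0 + 1) * (1 + 1)) = 1 := rfl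
  rw [hasGrad_action.bracket_eq (hasGrad_hamF p q r), h1, mul_zero, traceF_zero, smul_zero]
  simp only [hamGrad, Matrix.cons_val_zero, Matrix.cons_val_one, smul_mul_assoc, mul_smul_comm,
    mul_add, smul_add, intF_add, intF_smul]
  linear_combination (norm := module) (p / 4) • h00 + (q / 2) • h01 + (r / 4) • h11

theorem bracket_hamF (p' q' r' : ℂ) :
    bracket Ω (intF Ω (hamF X p q r)) (intF Ω (hamF X p' q' r')) =
      intF Ω (hamF X (2 * (q * p' - p * q')) (r * p' - p * r') (2 * (r * q' - q * r'))) := by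
  have h1 : psign ((1 + 1) * (1 + 1)) = 1 := rfl
  have h2 : phiF X 1 * phiF X 0 = phiF X 0 * phiF X 1 := (hasPar_phiF 1).commute _
  rw [(hasGrad_hamF p q r).bracket_eq (hasGrad_hamF p' q' r'), h1, mul_zero, traceF_zero, smul_zero]
  simp only [hamGrad, hamF, Matrix.cons_val_zero, Matrix.cons_val_one, smul_mul_assoc,
    mul_smul_comm, mul_add, add_mul, smul_add, intF_add, intF_smul, h2]
  module

end Hamiltonians


/-! ### The action and the Hamiltonians as traces -/

section Expressions

variable {X : Type*} [TopologicalSpace X] [ChartedSpace V X]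

/-- The graded symmetrization of multilinear expressions. -/
def FunR.sym : Fn X (PV X) →ₗ[ℂ] FunR X where
  toFun T := ⟨gradedSym T⟩
  map_add' T T' := FunR.ext' fun n e => by
    change gradedSym (T + T') n e = gradedSym T n e + gradedSym T' n e
    simp only [gradedSym, Pi.add_apply, smul_add, Finset.sum_add_distrib]
  map_smul' s T := FunR.ext' fun n e => by
    change gradedSym (s • T) n e = s • gradedSym T n e
    simp only [gradedSym, Pi.smul_apply, Finset.smul_sum, smul_comm s]

open FunR

variable (X) in
/-- The product of an expression `U` with a function `α` of the first field. -/
abbrev mulExpr (α : HomField X → PV X) (U : Fn X (PV X)) : Fn X (PV X) :=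
  leftMul (fun x y => LinearMap.mul ℂ (PV X) x y) α U

theorem sym_toFun (T : Fn X (PV X)) : (sym T).toFun = gradedSym T := rfl

theorem sym_mulExpr {α : HomField X → PV X} {U : Fn X (PV X)} (hU : HasPar 0 (sym U)) :
    sym (mulExpr X α U) = lin α * sym U := FunR.ext' fun n e => by
  rw [mul_apply_even hU, sym_toFun, sym_toFun, gradedSym_leftMul]
  rfl

theorem linFn_psign (α : HomField X → PV X) :
    linFn (fun e : HomField X => psign e.par • α e) = argSign 1 (lin α).toFun := by
  funext n e
  rcases n with _ | _ | n
  · exact (smul_zero _).symm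
  · change _ = psign (1 * ∑ i, (e i).par) • α (e 0)
    rw [Fin.sum_univ_one, one_mul]
    rfl
  · exact (smul_zero _).symm

theorem sym_linFn (α : HomField X → PV X) : sym (linFn α) = lin α := FunR.ext' fun n e => by
  change ∑ σ, koszul σ e • linFn α _ (e ∘ σ) = linFn α n e
  rcases n with _ | _ | n
  · exact Finset.sum_eq_zero fun σ _ => smul_zero _
  · change ∑ σ : Equiv.Perm (Fin 1), koszul σ e • α (e (σ 0)) = α (e 0)
    rw [Fintype.sum_unique]
    have h1 : koszul (default : Equiv.Perm (Fin 1)) e = 1 :=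
      Finset.prod_eq_one fun q hq => by
        have := (Finset.mem_filter.mp hq).2.1
        omega
    rw [h1, one_smul]
    rfl
  · exact Finset.sum_eq_zero fun σ _ => smul_zero _

theorem wedge_wedgeProd {k : ℕ} (a : PV X) (e : Fin k → HomField X) :
    wedge a.1 (wedgeProd fun j => nu (e j).val) = (a * nuProd k e).1 := by
  induction k generalizing a with
  | zero =>
    rw [show nuProd 0 e = 1 from rfl, mul_one]
    exact funext fun c => funext fun z => gmul_gone _
  | succ k ih =>
    change _ = (a * (Fields.nu (e 0).val * nuProd k (Fin.tail e))).1
    rw [← mul_assoc, ← ih]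
    refine funext fun c => funext fun z => ?_
    change gmul _ ((List.ofFn _).foldr gmul gone) = gmul (gmul _ _) ((List.ofFn _).foldr gmul gone)
    rw [List.ofFn_succ, List.foldr_cons, gmul_assoc]
    rfl

variable [IsManifold 𝓘(ℂ, V) ω X] [T2Space X] [MeasurableSpace X] [BorelSpace X]
  (Ω : HolVolForm X)

theorem sym_mulExpr_odd {α : HomField X → PV X} {U : Fn X (PV X)} (hU : HasPar 1 (sym U)) :
    sym (mulExpr X (fun e => psign e.par • α e) U) = lin α * sym U := FunR.ext' fun n e => by
  change (sym _).toFun n e = (lin α * sym U).toFun n e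
  rw [mul_eq_bshuffle hU, ← linFn_psign, sym_toFun, sym_toFun, gradedSym_leftMul]

/-- The bracket of polyvector fields, for a second argument of degree `0`. -/
def brBilin : PV X →ₗ[ℂ] PV X →ₗ[ℂ] PV X :=
  (LinearMap.mul ℂ (PV X)).compr₂ (divL Ω) - (LinearMap.mul ℂ (PV X)).comp (divL Ω)

theorem brBilin_apply (y x : PV X) : brBilin Ω y x = divL Ω (y * x) - divL Ω y * x := rfl

theorem bshuffle_brBilin (b : Fin 2) :
    bshuffle (brBilin Ω) (muF X).toFun (phiF X b).toFun = (D Ω (phiF X b)).toFun := by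
  funext n e
  rw [D, br_eq (hasDeg_phiF b)]
  change _ = divL Ω ((muF X * phiF X b) n e) - (del Ω (muF X) * phiF X b) n e
  rw [mul_apply_even (hasPar_phiF b), mul_apply_even (hasPar_phiF b), bshuffle_apply,
    bshuffle_apply, bshuffle_apply, map_sum, ← Finset.sum_sub_distrib]
  refine Finset.sum_congr rfl fun S _ => ?_
  rw [brBilin_apply, smul_sub, map_smul]
  rfl

/-- The map `(x, u) ↦ (y ↦ {y, x} u)`. -/
def brMul : PV X →ₗ[ℂ] PV X →ₗ[ℂ] PV X →ₗ[ℂ] PV X :=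
  LinearMap.mk₂ ℂ (fun x u => LinearMap.mulRight ℂ u ∘ₗ (brBilin Ω).flip x)
    (fun x x' u => LinearMap.ext fun y => by simp [add_mul])
    (fun s x u => LinearMap.ext fun y => by simp)
    (fun x u u' => LinearMap.ext fun y => by simp [mul_add])
    (fun s x u => LinearMap.ext fun y => by simp)

/-- The expressions of `{μ, φ_b} / (1 - ν)`. -/
def brExpr (b : Fin 2) : Fn X (PV X) :=
  leftMul (fun y g => LinearMap.applyₗ (R := ℂ) (M := PV X) (M₂ := PV X) y g)
    (fun e => Fields.mu e.val) (leftMul (fun x u => brMul Ω x u) (fun e => Fields.phi e.val b) nuProd)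

theorem sym_brExpr (b : Fin 2) : sym (brExpr Ω b) = D Ω (phiF X b) * geo X :=
  FunR.ext' fun n e => by
    have h1 : gradedSym (leftMul (fun x u => brMul Ω x u) (fun e => Fields.phi e.val b) nuProd) =
        bshuffle (brMul Ω) (phiF X b).toFun (geo X).toFun :=
      funext fun n => funext fun e => gradedSym_leftMul _ n _ _ e
    rw [mul_apply_even hasPar_geo, ← bshuffle_brBilin, sym_toFun, brExpr, gradedSym_leftMul, h1,
      bshuffle_assoc _ _ (LinearMap.mul ℂ (PV X)) (brBilin Ω) fun y x u => rfl]
    rfl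

/-- The expressions of `φ_a {μ, φ_b} / (1 - ν)`. -/
def quadExpr (a b : Fin 2) : Fn X (PV X) :=
  mulExpr X (fun e => psign e.par • Fields.phi e.val a) (brExpr Ω b)

theorem sym_quadExpr (a b : Fin 2) :
    sym (quadExpr Ω a b) = phiF X a * (D Ω (phiF X b) * geo X) := by
  have h1 : HasPar 1 (sym (brExpr Ω b)) := by
    rw [sym_brExpr]
    exact (hasPar_phiF b).D.mul hasPar_geo
  rw [quadExpr, sym_mulExpr_odd h1, sym_brExpr]
  rfl

variable (X) in
/-- The expressions of `μ³ / (1 - ν)`. -/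
def cubExpr : Fn X (PV X) := mulExpr X (fun e => Fields.mu e.val)
  (mulExpr X (fun e => Fields.mu e.val) (mulExpr X (fun e => Fields.mu e.val) nuProd))

theorem sym_cubExpr : sym (cubExpr X) = muF X * (muF X * (muF X * geo X)) := by
  have hμ := hasPar_muF (X := X)
  have h0 : sym nuProd = geo X := rfl
  have h1 := sym_mulExpr (α := fun e : HomField X => Fields.mu e.val) (hasPar_geo (X := X))
  have h2 : HasPar 0 (sym (mulExpr X (fun e => Fields.mu e.val) nuProd)) :=
    h1 ▸ hμ.mul hasPar_geo
  have h3 := sym_mulExpr (α := fun e : HomField X => Fields.mu e.val) h2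
  have h4 : HasPar 0 (sym (mulExpr X (fun e => Fields.mu e.val)
      (mulExpr X (fun e => Fields.mu e.val) nuProd))) := h3 ▸ hμ.mul h2
  rw [cubExpr, sym_mulExpr h4, h3, h1]
  rfl

theorem actionExpr_eq (n : ℕ) (e : Fin n → HomField X) : actionExpr Ω n e =
    (-1 / 2) * intL Ω (quadExpr Ω 0 1 n e - quadExpr Ω 1 0 n e) +
      (1 / 6) * traceL Ω (cubExpr X n e) := by
  have hz : ∀ a : PV X, a * 0 = 0 := mul_zero
  -- expressions with fewer than three arguments have a factor that vanishes
  rcases n with _ | _ | _ | k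
  · change 0 = (-1 / 2) * intL Ω (0 - 0) + (1 / 6) * traceL Ω 0
    simp
  · change 0 = (-1 / 2) * intL Ω (_ * (0 : PV X) - _ * (0 : PV X)) + (1 / 6) * traceL Ω (_ * (0 : PV X))
    simp
  · change 0 = (-1 / 2) * intL Ω (_ * (0 : PV X) - _ * (0 : PV X)) +
      (1 / 6) * traceL Ω (_ * (_ * (0 : PV X)))
    simp
  · let ν := nuProd k fun j => e j.succ.succ.succ
    let φ := fun (i : Fin (k + 3)) a => Fields.phi (e i).val a
    let μ := fun (i : Fin (k + 3)) => Fields.mu (e i).val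
    let B := fun b => psign ((e 1).par + 1) • (divL Ω (μ 1 * φ 2 b) - divL Ω (μ 1) * φ 2 b -
      psign (e 1).par • (μ 1 * divL Ω (φ 2 b)))
    have h1 : actionExpr Ω (k + 3) e = (1 / 2) * (psign ((e 0).par + (e 1).par) *
        intOmega Ω (wedge (∑ a : Fin 2, ∑ b : Fin 2, omega a b • (φ 0 a * B b)).1
          (wedgeProd fun j : Fin k => nu (e j.succ.succ.succ).val)) ) +
        (1 / 6) * tr Ω (wedge (μ 0 * μ 1 * μ 2).1
          (wedgeProd fun j : Fin k => nu (e j.succ.succ.succ).val)) := by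
      simp only [Submodule.coe_sum, Submodule.coe_smul]
      rfl
    have h2 : ∀ a b, quadExpr Ω a b (k + 3) e = (psign (e 0).par • φ 0 a) *
        ((divL Ω (μ 1 * φ 2 b) - divL Ω (μ 1) * φ 2 b) * ν) := fun a b => rfl
    have h3 : cubExpr X (k + 3) e = μ 0 * (μ 1 * (μ 2 * ν)) := rfl
    have h4 : ∀ b, B b = psign ((e 1).par + 1) • (divL Ω (μ 1 * φ 2 b) - divL Ω (μ 1) * φ 2 b) := by
      intro b
      have : divL Ω (φ 2 b) = 0 := divL_of_mem_deg_zero Ω (toPV_mem_deg _)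
      change _ • (_ - _ - _ • (_ * divL Ω (φ 2 b))) = _
      rw [this, mul_zero, smul_zero, sub_zero]
    have c1 : (∑ a : Fin 2, ∑ b : Fin 2, omega a b • (φ 0 a * B b)) * ν ∈ PV.compact X :=
      PV.mul_mem_compact_left (Submodule.sum_mem _ fun a _ => Submodule.sum_mem _ fun b _ =>
        Submodule.smul_mem _ _ (PV.mul_mem_compact_left (toPV_mem_compact _) _)) _
    have c2 : μ 0 * μ 1 * μ 2 * ν ∈ PV.compact X := PV.mul_mem_compact_left
      (PV.mul_mem_compact_left (PV.mul_mem_compact_left (toPV_mem_compact _) _) _) _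
    have h5 : (∑ a : Fin 2, ∑ b : Fin 2, omega a b • (φ 0 a * B b)) * ν =
        φ 0 0 * (B 1 * ν) - φ 0 1 * (B 0 * ν) := by
      simp only [Fin.sum_univ_two, omega, Matrix.of_apply, Matrix.cons_val_zero,
        Matrix.cons_val_one, zero_smul, one_smul, neg_smul, zero_add, add_zero, add_mul, neg_mul,
        mul_assoc, sub_eq_add_neg]
    rw [h1, wedge_wedgeProd, wedge_wedgeProd, intOmega_eq Ω c1, tr_eq Ω c2, ← intL_apply, h5, h2,
      h2, h3, h4, h4, mul_assoc (μ 0 * μ 1), mul_assoc (μ 0)]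
    simp only [smul_mul_assoc, mul_smul_comm, map_sub, map_smul, smul_eq_mul, psign_add, psign_one]
    have h6 := psign_mul_self (e 1).par
    generalize intL Ω (φ 0 0 * _) = s
    generalize intL Ω (φ 0 1 * _) = t
    linear_combination (-1 / 2) * psign (e 0).par * (s - t) * h6

theorem action_eq : action Ω = traceF Ω (actF Ω) := by
  funext n e
  have h1 : quadF X Ω * geo X = sym (quadExpr Ω 0 1 - quadExpr Ω 1 0) := by
    rw [quadF_mul, map_sub, sym_quadExpr, sym_quadExpr]
  rw [actF, traceF_add, traceF_smul, traceF_smul, ← intF_eq, h1, ← sym_cubExpr]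
  change ∑ σ, _ = (-1 / 2 : ℂ) * intL Ω (∑ σ, _) + (1 / 6 : ℂ) * traceL Ω (∑ σ, _)
  rw [map_sum, map_sum, Finset.mul_sum, Finset.mul_sum, ← Finset.sum_add_distrib]
  refine Finset.sum_congr rfl fun σ _ => ?_
  rw [actionExpr_eq, map_smul, map_smul, smul_eq_mul, smul_eq_mul]
  change _ = _ * (_ * intL Ω (quadExpr Ω 0 1 n (e ∘ σ) - quadExpr Ω 1 0 n (e ∘ σ))) + _
  ring

/-- The expressions of `φ_a φ_b`. -/
def phiExpr (a b : Fin 2) : Fn X (PV X) :=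
  mulExpr X (fun e => Fields.phi e.val a) (linFn fun e => Fields.phi e.val b)

theorem sym_phiExpr (a b : Fin 2) : sym (phiExpr a b) = phiF X a * phiF X b := by
  have h1 := sym_linFn fun e : HomField X => Fields.phi e.val b
  rw [phiExpr, sym_mulExpr (h1 ▸ hasPar_phiF b), h1]
  rfl

theorem hamiltonianExpr_eq (x : sl2) (n : ℕ) (e : Fin n → HomField X) : hamiltonianExpr Ω x n e =
    intL Ω ((x.1 1 0 / 2) • phiExpr 0 0 n e + (x.1 1 1 / 2) • phiExpr 0 1 n e -
      (x.1 0 0 / 2) • phiExpr 1 0 n e - (x.1 0 1 / 2) • phiExpr 1 1 n e) := by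
  have h0 : ∀ a b c d : ℂ, (0 : ℂ) =
      intL Ω (a • (0 : PV X) + b • (0 : PV X) - c • (0 : PV X) - d • (0 : PV X)) := by simp
  have h1 : ∀ (a b c d : ℂ) (s t : PV X), (0 : ℂ) =
      intL Ω (a • (s * 0) + b • (s * 0) - c • (t * 0) - d • (t * 0)) := by simp
  rcases n with _ | _ | _ | n
  · exact h0 _ _ _ _
  · exact h1 _ _ _ _ _ _
  · let φ := fun (i : Fin 2) a => Fields.phi (e i).val a
    have h2 : hamiltonianExpr Ω x 2 e = (1 / 2) * intOmega Ω (∑ a : Fin 2, ∑ b : Fin 2,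
        omega a b • (φ 0 a * ∑ c : Fin 2, x.1 b c • φ 1 c)).1 := by
      simp only [Submodule.coe_sum, Submodule.coe_smul, PV.coe_mul]
      rfl
    have h3 : ∀ a b, phiExpr a b 2 e = φ 0 a * φ 1 b := fun a b => rfl
    have c1 : ∑ a : Fin 2, ∑ b : Fin 2, omega a b • (φ 0 a * ∑ c : Fin 2, x.1 b c • φ 1 c) ∈
        PV.compact X := Submodule.sum_mem _ fun a _ => Submodule.sum_mem _ fun b _ =>
      Submodule.smul_mem _ _ (PV.mul_mem_compact_left (toPV_mem_compact _) _)
    rw [h2, intOmega_eq Ω c1, ← intL_apply, h3, h3, h3, h3]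
    simp only [Fin.sum_univ_two, omega, Matrix.of_apply, Matrix.cons_val_zero,
      Matrix.cons_val_one, zero_smul, one_smul, neg_smul, zero_add, add_zero, mul_add,
      mul_smul_comm, map_add, map_sub, map_neg, map_smul, smul_eq_mul]
    ring
  · exact h1 _ _ _ _ _ _

theorem sl2_apply_zero (x : sl2) : x.1 0 0 = -x.1 1 1 := by
  have h : Matrix.trace x.1 = 0 := LinearMap.mem_ker.mp x.2
  rw [Matrix.trace_fin_two] at h
  linear_combination h

theorem J_eq (x : sl2) : J Ω x = intF Ω (hamF X (x.1 1 0) (x.1 1 1) (-x.1 0 1)) := by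
  have h1 : hamF X (x.1 1 0) (x.1 1 1) (-x.1 0 1) = sym ((x.1 1 0 / 2) • phiExpr 0 0 +
      (x.1 1 1 / 2) • phiExpr 0 1 - (x.1 0 0 / 2) • phiExpr 1 0 - (x.1 0 1 / 2) • phiExpr 1 1) := by
    simp only [map_add, map_sub, map_smul, sym_phiExpr, (hasPar_phiF (X := X) 1).commute (phiF X 0),
      hamF, sl2_apply_zero]
    module
  rw [h1]
  funext n e
  change ∑ σ, _ = intL Ω (∑ σ, _)
  rw [map_sum]
  refine Finset.sum_congr rfl fun σ _ => ?_
  rw [hamiltonianExpr_eq, map_smul]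
  rfl

variable {Ω}

theorem isFun_action : IsFun Ω 0 (action Ω) := action_eq Ω ▸ hasGrad_action.isFun

theorem bracket_action_J (x : sl2) : bracket Ω (action Ω) (J Ω x) = 0 := by
  rw [action_eq, J_eq, bracket_action_hamF]

theorem J_smul_add (s : ℂ) (x y : sl2) : J Ω (s • x + y) = s • J Ω x + J Ω y := by
  have h1 : (s • x + y).1 = s • x.1 + y.1 := rfl
  rw [J_eq, J_eq, J_eq, ← intF_smul, ← intF_add, h1]
  congr 1
  simp only [hamF, Matrix.add_apply, Matrix.smul_apply, smul_eq_mul]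
  module

theorem isDGLieHom_J :
    IsDGLieHom (shiftedFunctionals Ω) (bracket Ω) (differential Ω) (J Ω) where
  map_mem x := by
    have h := (hasGrad_hamF (Ω := Ω) (x.1 1 0) (x.1 1 1) (-x.1 0 1)).isFun
    rw [← J_eq] at h
    exact isFun_iff.mp h
  map_add x y := by simpa using J_smul_add (Ω := Ω) 1 x y
  map_smul s x := by
    have h0 : J Ω 0 = 0 := by simpa using J_smul_add (Ω := Ω) (-1) 0 0
    simpa [h0] using J_smul_add (Ω := Ω) s x 0
  map_d x := by
    rw [differential, bracket_action_J, add_zero, Qdual_eq, J_eq, qdual_hamF]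
  map_lie x y := by
    have h1 : ⁅x, y⁆.1 = x.1 * y.1 - y.1 * x.1 := rfl
    rw [J_eq, J_eq, J_eq, bracket_hamF, h1]
    simp only [Matrix.sub_apply, Matrix.mul_apply, Fin.sum_univ_two, sl2_apply_zero]
    congr 2 <;> ring

end Expressions

end BCOV

end

theorem mainTheorem6 {X : Type*} [TopologicalSpace X] [T2Space X] [SecondCountableTopology X]
    [ChartedSpace BCOV.V X] [IsManifold 𝓘(ℂ, BCOV.V) ω X] [MeasurableSpace X] [BorelSpace X]
    (Ω : BCOV.HolVolForm X) :
    (∀ i, ∀ a ∈ BCOV.PVc X i, BCOV.dbar a ∈ BCOV.PVc X i) ∧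
    (∀ i, ∀ a ∈ BCOV.PVc X (i + 1), BCOV.div Ω a ∈ BCOV.PVc X i) ∧
    BCOV.IsDGLie (BCOV.shiftedFunctionals Ω) (BCOV.bracket Ω) (BCOV.differential Ω) ∧
    BCOV.IsDGLieHom (BCOV.shiftedFunctionals Ω) (BCOV.bracket Ω) (BCOV.differential Ω)
      (BCOV.J Ω) ∧
    ∀ x : BCOV.sl2, BCOV.bracket Ω (BCOV.action Ω) (BCOV.J Ω x) = 0 :=
  ⟨fun _ _ ha => BCOV.dbar_mem_PVc ha, fun _ _ ha => BCOV.div_mem_PVc Ω ha,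
    BCOV.isDGLie_of_masterEquation BCOV.isFun_action (BCOV.action_eq Ω ▸ BCOV.masterEquation),
    BCOV.isDGLieHom_J, BCOV.bracket_action_J⟩
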